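/- **Setting.** Let $n\ge 2$. An oriented hyperplane through the origin of $\mathbb R^{n+1}$ is $H=\nu_H^\perp$ with a chosen unit normal $\nu_H$; let $\Sigma_H=H\cap\mathbb S^n$ be its equatorial sphere, with the surface measure $\mathcal H^{n-1}$. For $\sigma>0$ and $0<r_1<r_2$ let $\mathcal X_\sigma(\Sigma_H,r_1,r_2)$ be the set of all $u\in C^1(\Sigma_H\times(r_1,r_2))$ such that, with $u_r=u(\cdot,r)$, $$\|u_r\|_{C^1(\Sigma_H)}=\max_{\Sigma_H}|u_r|+\max_{\Sigma_H}|\nabla^{\Sigma_H}u_r|<\sigma\quad\text{for all } r\in(r_1,r_2),\qquad |r\,\partial_r u|\le\sigma\quad\text{on }\Sigma_H\times(r_1,r_2).$$ The spherical graph of $u$ over $\Sigma_H\times(a,b)$ is $$\Sigma_H(u,a,b)=\Big\{r\,\frac{\omega+u(\omega,r)\,\nu_H}{\sqrt{1+u(\omega,r)^2}}:\ \omega\in\Sigma_H,\ r\in(a,b)\Big\}.$$ Let $A_{r_1}^{r_2}=\{x\in\mathbb R^{n+1}:r_1<|x|<r_2\}$. A $C^1$ hypersurface $M$ has mean curvature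 bounded by $\Lambda$ in $A_{r_1}^{r_2}$ if there is a Borel vector field $h:\mathbb R^{n+1}\to\mathbb R^{n+1}$ with $|h|\le\Lambda$ such that $\int_M \mathrm{div}^M X\,d\mathcal H^n=\int_M X\cdot h\,d\mathcal H^n$ for all $X\in C^1_c(A_{r_1}^{r_2};\mathbb R^{n+1})$. A Jacobi field of $\Sigma_H$ is a solution $\varphi$ of $\Delta^{\Sigma_H}\varphi+(n-1)\varphi=0$ on $\Sigma_H$, and $E^0_{\Sigma_H}$ is the orthogonal projection of $L^2(\Sigma_H)$ onto the span of the Jacobi fields. Given $\eta_0>\eta>0$, the intervals $(r_1,r_2)$ and $(r_3,r_4)$ are $(\eta,\eta_0)$-related if, for some $r_0$, $$r_2=r_0(1+\eta_0),\quad r_1=r_0(1-\eta_0),\quad r_4=r_0(1+\eta),\quad r_3=r_0(1-\eta).$$ **Theorem (energy estimates for spherical graphs).** For every $n\ge2$ there is a constant $C=C(n)>0$, and for all $\eta_0>\eta>0$ there are positive constants $\sigma_0=\sigma_0(n,\eta_0,\eta)$ and $C_0=C_0(n,\eta_0,\eta)$, with the following property. Let $H$ be an oriented hyperplane through the origin,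 $\Lambda\ge0$, $\sigma>0$, $0<r_1<r_2$, let $(r_1,r_2)$ and $(r_3,r_4)$ be $(\eta,\eta_0)$-related, and let $u\in\mathcal X_\sigma(\Sigma_H,r_1,r_2)$ be such that $\max\{1,\Lambda r_2\}\,\sigma\le\sigma_0$ and $\Sigma_H(u,r_1,r_2)$ has mean curvature bounded by $\Lambda$ in $A_{r_1}^{r_2}$. Then $$\Big|\mathcal H^n(\Sigma_H(u,r_3,r_4))-\mathcal H^n(\Sigma_H(0,r_3,r_4))\Big|\le C_0\int_{\Sigma_H\times(r_1,r_2)}r^{n-1}\big(u^2+\Lambda\,r\,|u|\big).$$ Moreover, if there is $r\in(r_1,r_2)$ with $E^0_{\Sigma_H}u_r=0$, then $$\int_{\Sigma_H\times(r_3,r_4)}r^{n-1}u^2\le C(n)\,\Lambda\,r_2\,(r_2^n-r_1^n)+C_0\int_{\Sigma_H\times(r_1,r_2)}r^{n-1}(r\,\partial_r u)^2.$$ -/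

import Mathlib

open MeasureTheory Set
open scoped InnerProductSpace

noncomputable section

namespace SphericalGraph

/-- The ambient Euclidean space `ℝ^(n+1)`. -/
abbrev Amb (n : ℕ) : Type := EuclideanSpace ℝ (Fin (n + 1))

/-- An oriented hyperplane through the origin of `ℝ^(n+1)`: it is given by its unit normal `ν`. -/
structure OrientedHyperplane (n : ℕ) where
  /-- The unit normal `ν_H`. -/
  normal : Amb n
  norm_normal : ‖normal‖ = 1

variable {n : ℕ}

/-- The hyperplane `H = ν_H^⊥` as a linear subspace. -/
def OrientedHyperplane.toSubmodule (H : OrientedHyperplane n) : Submodule ℝ (Amb n) :=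
  (Submodule.span ℝ {H.normal})ᗮ

/-- The equatorial sphere `Σ_H = H ∩ 𝕊^n`. -/
def equator (H : OrientedHyperplane n) : Set (Amb n) :=
  {ω | ω ∈ H.toSubmodule ∧ ‖ω‖ = 1}

/-- The retraction `x ↦ p_H x / |p_H x|` of `{x : p_H x ≠ 0}` onto `Σ_H`, where `p_H` is the
orthogonal projection onto `H`. -/
def toEquator (H : OrientedHyperplane n) (x : Amb n) : Amb n :=
  ‖H.toSubmodule.starProjection x‖⁻¹ • H.toSubmodule.starProjection x

/-- The extension of a function on `Σ_H` to `{x : p_H x ≠ 0}` that is constant along the fibres of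
the retraction onto `Σ_H`. On `Σ_H` its Euclidean gradient is the tangential gradient and its
Euclidean Laplacian is the Laplace-Beltrami operator of `Σ_H`. -/
def equatorExt (H : OrientedHyperplane n) (v : Amb n → ℝ) (x : Amb n) : ℝ :=
  v (toEquator H x)

/-- The tangential gradient `∇^{Σ_H} v (ω)`, for `ω ∈ Σ_H`. -/
def sphGrad (H : OrientedHyperplane n) (v : Amb n → ℝ) (ω : Amb n) : Amb n :=
  gradient (equatorExt H v) ω

/-- The Laplace-Beltrami operator `Δ^{Σ_H} v (ω)`, for `ω ∈ Σ_H`. -/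
def sphLaplacian (H : OrientedHyperplane n) (v : Amb n → ℝ) (ω : Amb n) : ℝ :=
  Laplacian.laplacian (equatorExt H v) ω

/-- The norm `‖v‖_{C^1(Σ_H)} = max |v| + max |∇^{Σ_H} v|` of `v ∈ C^1(Σ_H)`. -/
def normC1 (H : OrientedHyperplane n) (v : Amb n → ℝ) : ℝ :=
  (⨆ ω : equator H, |v ω|) + ⨆ ω : equator H, ‖sphGrad H v ω‖

/-- The class `𝒳_σ(Σ_H)` of the `v ∈ C^1(Σ_H)` with `‖v‖_{C^1(Σ_H)} < σ`. Only the values of `v`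
on `Σ_H` matter. -/
def SmallC1 (H : OrientedHyperplane n) (σ : ℝ) (v : Amb n → ℝ) : Prop :=
  ContDiffOn ℝ 1 v (equator H) ∧ normC1 H v < σ

/-- The radial derivative `∂_r u (ω, r)`. -/
def radialDeriv (u : Amb n → ℝ → ℝ) (ω : Amb n) (r : ℝ) : ℝ :=
  deriv (fun s => u ω s) r

/-- The class `𝒳_σ(Σ_H, r₁, r₂)` of the `u ∈ C^1(Σ_H × (r₁, r₂))` such that every slice
`u_r = u(·, r)` lies in `𝒳_σ(Σ_H)`, and `|r ∂_r u| ≤ σ`. Only the values of `u` on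
`Σ_H × (r₁, r₂)` matter. -/
def SmallC1Annulus (H : OrientedHyperplane n) (σ r₁ r₂ : ℝ) (u : Amb n → ℝ → ℝ) : Prop :=
  ContDiffOn ℝ 1 (fun p : Amb n × ℝ => u p.1 p.2) (equator H ×ˢ Ioo r₁ r₂) ∧
  (∀ r ∈ Ioo r₁ r₂, SmallC1 H σ (fun ω => u ω r)) ∧
  ∀ ω ∈ equator H, ∀ r ∈ Ioo r₁ r₂, |r * radialDeriv u ω r| ≤ σ

/-- The spherical graph `Σ_H(u, r₁, r₂)` of `u` over `Σ_H × (r₁, r₂)`. -/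
def graph (H : OrientedHyperplane n) (u : Amb n → ℝ → ℝ) (r₁ r₂ : ℝ) : Set (Amb n) :=
  {x | ∃ ω ∈ equator H, ∃ r ∈ Ioo r₁ r₂,
    x = (r / Real.sqrt (1 + u ω r ^ 2)) • (ω + u ω r • H.normal)}

/-- The open annulus `{x : r₁ < |x| < r₂}`. -/
def annulus (n : ℕ) (r₁ r₂ : ℝ) : Set (Amb n) :=
  {x | r₁ < ‖x‖ ∧ ‖x‖ < r₂}

/-- The tangent space `T_x M`. -/
def tangentSpaceAt (M : Set (Amb n)) (x : Amb n) : Submodule ℝ (Amb n) :=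
  Submodule.span ℝ (tangentConeAt ℝ M x)

/-- The tangential divergence `div^M X (x)`: the trace of `P ∘ DX(x)`, with `P` the orthogonal
projection onto `T_x M`. -/
def tangentialDiv (M : Set (Amb n)) (X : Amb n → Amb n) (x : Amb n) : ℝ :=
  LinearMap.trace ℝ (Amb n)
    ((tangentSpaceAt M x).starProjection ∘L fderiv ℝ X x : Amb n →L[ℝ] Amb n).toLinearMap

/-- The `C^1` hypersurface `M` has (distributional) mean curvature bounded by `Λ` in the open set
`U`: there is a Borel vector field `h` with `|h| ≤ Λ` and `∫_M div^M X dℋ^n = ∫_M X · h dℋ^n` for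
all `X ∈ C^1_c(U; ℝ^(n+1))`. Here `ℋ^n` is `μHE[n]`, the Hausdorff measure normalized so as to
coincide with Lebesgue measure on `ℝ^n`. -/
def HasMeanCurvatureBoundedBy (M U : Set (Amb n)) (Λ : ℝ) : Prop :=
  ∃ h : Amb n → Amb n, Measurable h ∧ (∀ x, ‖h x‖ ≤ Λ) ∧
    ∀ X : Amb n → Amb n, ContDiff ℝ 1 X → HasCompactSupport X → tsupport X ⊆ U →
      ∫ x in M, tangentialDiv M X x ∂(μHE[n]) = ∫ x in M, ⟪X x, h x⟫_ℝ ∂(μHE[n])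

/-- The area `ℋ^n(M)`. -/
def area (M : Set (Amb n)) : ℝ :=
  (μHE[n] M).toReal

/-- The surface measure `ℋ^(n-1) ⌞ Σ_H` on the equatorial sphere. -/
def sphMeasure (H : OrientedHyperplane n) : Measure (Amb n) :=
  (μHE[n - 1] : Measure (Amb n)).restrict (equator H)

/-- The integral `∫_{Σ_H × (a, b)} f`, with respect to the product of the surface measure and of
the Lebesgue measure. -/
def annulusIntegral (H : OrientedHyperplane n) (a b : ℝ) (f : Amb n → ℝ → ℝ) : ℝ :=
  ∫ p : Amb n × ℝ, f p.1 p.2 ∂((sphMeasure H).prod (volume.restrict (Ioo a b)))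

/-- `φ` is a Jacobi field of `Σ_H`: `Δ^{Σ_H} φ + (n - 1) φ = 0` on `Σ_H`. -/
def IsJacobiField (H : OrientedHyperplane n) (φ : Amb n → ℝ) : Prop :=
  ContDiffOn ℝ 2 φ (equator H) ∧
    ∀ ω ∈ equator H, sphLaplacian H φ ω + ((n : ℝ) - 1) * φ ω = 0

/-- The closed subspace of `L²(Σ_H)` spanned by the Jacobi fields. (The span is finite dimensional,
so that taking the closure adds nothing.) -/
def jacobiSpace (H : OrientedHyperplane n) : Submodule ℝ (Lp ℝ 2 (sphMeasure H)) :=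
  (Submodule.span ℝ {f : Lp ℝ 2 (sphMeasure H) |
    ∃ φ, IsJacobiField H φ ∧ f =ᵐ[sphMeasure H] φ}).topologicalClosure

instance (H : OrientedHyperplane n) : CompleteSpace (jacobiSpace H) :=
  (Submodule.isClosed_topologicalClosure _).completeSpace_coe

/-- The orthogonal projection `E⁰_{Σ_H}` of `L²(Σ_H)` onto the span of the Jacobi fields. -/
def jacobiProj (H : OrientedHyperplane n) :
    Lp ℝ 2 (sphMeasure H) →L[ℝ] Lp ℝ 2 (sphMeasure H) :=
  (jacobiSpace H).starProjection

/-- `v ∈ L²(Σ_H)` and `E⁰_{Σ_H} v = 0`. -/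
def JacobiProjEqZero (H : OrientedHyperplane n) (v : Amb n → ℝ) : Prop :=
  ∃ hv : MemLp v 2 (sphMeasure H), jacobiProj H (hv.toLp v) = 0

/-- The intervals `(r₁, r₂)` and `(r₃, r₄)` are `(η, η₀)`-related. -/
def Related (η η₀ r₁ r₂ r₃ r₄ : ℝ) : Prop :=
  ∃ r₀ : ℝ, r₂ = r₀ * (1 + η₀) ∧ r₁ = r₀ * (1 - η₀) ∧ r₄ = r₀ * (1 + η) ∧ r₃ = r₀ * (1 - η)

end SphericalGraph

end

set_option linter.unusedSectionVars false

namespace SphericalGraph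

/-! ### Area formula for injective C¹ immersions -/

section AreaFormula

open Filter Topology
open scoped NNReal ENNReal

/-! Put V = u / √(1 + u²), the sine of the angle to the hyperplane. The graph is then the image of a
flat annulus of ℝⁿ under Φ(y) = √(1 - V²) ι y + |y| V ν (`graphMap`), with |Φ(y)| = |y| and ⟪Φ(y),
ν⟫ = |y| V =: w. The pulled back metric differs from the flat one by O(e), where e = V² + |y|²|DV|²,
so the two areas differ by at most C ∫ e (`abs_area_sub_le`). The first variation identity tested
with f ν turns the curvature bound into a weak Laplace equation for w, with a relative error O(σ²)
and a right-hand side of size Λ (`abs_integral_fderiv_gradient_le`). Testing with ζ(|y|)² w gives a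
Caccioppoli inequality (`integral_energyDensity_le`) that bounds ∫ e by ∫ (V² + Λ |y| |V|). This is
the first estimate.

For the second estimate, Δw = 0 reads (r∂_r)²V + n r∂_r V + Δ_S V + (n - 1) V = 0 on spheres. If
radial derivatives are given, V has to be controlled by the form of -Δ_S - (n - 1). This form equals
-(n - 1) on constants, 0 on linear functions (the Jacobi fields), and is at least n + 1 on the
orthogonal complement of both. The test function ζ² (w - 2 |y| m), with m the spherical mean of V,
reverses the sign on constants, so that only degree one escapes. Up to a total derivative the
derivative of the cutoff meets only V · r∂_r V (`integral_fderiv_radialTest`), and is paid for by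
the radial energy. The degree one modes of u vanish at one radius; those of V are small there
because u - V is cubic, and the radial energy carries this to all other radii (`firstModes_le`). The
remaining errors carry a factor σ² but live on the larger annulus; they are absorbed because the L²
norm there is controlled by the one on the smaller annulus and the radial energy
(`wint_slice_sq_le`).

Two general facts support this. The area formula follows from the comparison of a C¹ immersion with
its derivative at small scale. The spectral gap (`exists_spectral_gap`) is algebraic: rotation
fields are skew with respect to the sphere measure, half the sum of their squares acts on
polynomials of degree k as -k (k + n - 2) modulo lower degrees, and polynomials are dense. -/

theorem euclideanHausdorffMeasure_image_le_of_dist_le {X Y Z : Type*}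
    [MetricSpace Y] [MeasurableSpace Y] [BorelSpace Y]
    [MetricSpace Z] [MeasurableSpace Z] [BorelSpace Z] {d : ℕ} {K : ℝ≥0} {f : X → Y} {g : X → Z}
    {s : Set X} (h : ∀ x ∈ s, ∀ y ∈ s, dist (f x) (f y) ≤ K * dist (g x) (g y)) :
    (μHE[d] : Measure Y) (f '' s) ≤ (K : ℝ≥0∞) ^ d * (μHE[d] : Measure Z) (g '' s) := by
  rcases s.eq_empty_or_nonempty with rfl | ⟨x₀, hx₀⟩
  · simp
  have : Nonempty X := ⟨x₀⟩
  -- The hypothesis says that f is a K-Lipschitz function of g, even where g is not injective: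
  -- points with the same g-value have the same f-value. The map `k` is that function, defined
  -- through chosen preimages.
  set k : Z → Y := fun z => f (Function.invFunOn g s z) with hk
  have hinv : ∀ z ∈ g '' s, Function.invFunOn g s z ∈ s ∧ g (Function.invFunOn g s z) = z :=
    fun z hz => Function.invFunOn_pos hz
  have hL : LipschitzOnWith K k (g '' s) := by
    refine LipschitzOnWith.of_dist_le_mul fun z hz z' hz' => ?_
    have h1 := hinv z hz
    have h2 := hinv z' hz'
    have := h _ h1.1 _ h2.1
    rwa [h1.2, h2.2] at this
  have himg : k '' (g '' s) = f '' s := by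
    rw [image_image]
    refine image_congr fun x hx => ?_
    have h1 := hinv (g x) (mem_image_of_mem g hx)
    have := h _ h1.1 _ hx
    rw [h1.2, dist_self, mul_zero] at this
    exact dist_le_zero.1 this
  have := hL.hausdorffMeasure_image_le (d := (d : ℝ)) (by positivity)
  rw [himg, ENNReal.rpow_natCast] at this
  simp only [Measure.euclideanHausdorffMeasure_def, Measure.smul_apply, ENNReal.smul_def,
    smul_eq_mul]
  calc _ ≤ _ := mul_le_mul_right this _
    _ = _ := by ring

/-- A local inequality between measures on a second countable space is global. -/
theorem measure_le_of_locally_le {X : Type*} [TopologicalSpace X] [SecondCountableTopology X]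
    [MeasurableSpace X] [BorelSpace X] {μ ν : Measure X}
    (h : ∀ x, ∃ N ∈ 𝓝 x, ∀ B ⊆ N, MeasurableSet B → μ B ≤ ν B) : μ ≤ ν := by
  choose N hN hB using h
  obtain ⟨t, htc, ht⟩ := TopologicalSpace.countable_cover_nhds
    (f := fun x => interior (N x)) (fun x => interior_mem_nhds.2 (hN x))
  refine Measure.le_iff.2 fun s hs => ?_
  rcases isEmpty_or_nonempty X with hX | hX
  · simp [Set.eq_empty_of_isEmpty s]
  obtain ⟨e, he⟩ := htc.exists_eq_range (by
    by_contra hne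
    rw [not_nonempty_iff_eq_empty] at hne
    simp [hne] at ht
    exact hX.elim fun x => by simpa using (ht ▸ mem_univ x : x ∈ (∅ : Set X)))
  set U : ℕ → Set X := fun k => interior (N (e k)) with hU
  have hcov : ⋃ k, disjointed U k = univ := by
    rw [iUnion_disjointed, ← ht, he, biUnion_range]
  have hm : ∀ k, MeasurableSet (disjointed U k) :=
    fun k => MeasurableSet.disjointed (fun i => isOpen_interior.measurableSet) k
  have key : ∀ ρ : Measure X, ρ s = ∑' k, ρ (s ∩ disjointed U k) := by
    intro ρ
    rw [← measure_iUnion (fun i j hij => ((disjoint_disjointed U hij).mono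
      inter_subset_right inter_subset_right)) (fun k => hs.inter (hm k)), ← inter_iUnion, hcov,
      inter_univ]
  rw [key μ, key ν]
  refine ENNReal.tsum_le_tsum fun k => hB (e k) _ ?_ (hs.inter (hm k))
  exact inter_subset_right.trans ((disjointed_subset U k).trans interior_subset)

/-- Upgrades a comparison up to every factor c > 1 to an inequality. Letting c tend to 1 is also
legitimate for b = ∞, because the limit of the factor is not zero. -/
theorem ennreal_le_of_forall_one_lt_mul {a b : ℝ≥0∞} (h : ∀ c : ℝ≥0, 1 < c → a ≤ c * b) :
    a ≤ b := by
  have h1 : Tendsto (fun c : ℝ≥0 => (c : ℝ≥0∞) * b) (𝓝[>] 1) (𝓝 (((1 : ℝ≥0) : ℝ≥0∞) * b)) := by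
    refine ENNReal.Tendsto.mul_const ?_ (Or.inl (by simp))
    exact (ENNReal.continuous_coe.tendsto 1).mono_left nhdsWithin_le_nhds
  have := ge_of_tendsto h1 (by filter_upwards [self_mem_nhdsWithin] with c hc using h c hc)
  simpa using this

variable {E F : Type*} [NormedAddCommGroup E] [InnerProductSpace ℝ E] [FiniteDimensional ℝ E]
  [MeasurableSpace E] [BorelSpace E]
  [NormedAddCommGroup F] [InnerProductSpace ℝ F] [FiniteDimensional ℝ F]
  [MeasurableSpace F] [BorelSpace F]

/-- The Jacobian `√det (Lᵀ L)` of a linear map. -/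
noncomputable def jac (L : E →L[ℝ] F) : ℝ := (L : E →ₗ[ℝ] F).normDet

theorem jac_nonneg (L : E →L[ℝ] F) : 0 ≤ jac L := LinearMap.normDet_nonneg _

/-- The Gram expression √det(L†L) is a continuous function of L. -/
theorem continuous_jac : Continuous (jac : (E →L[ℝ] F) → ℝ) := by
  have h : (jac : (E →L[ℝ] F) → ℝ) =
      fun L => Real.sqrt ((ContinuousLinearMap.adjoint L).comp L).det := by
    funext L
    have := ContinuousLinearMap.normDet_sq (𝕜 := ℝ) L
    rw [jac, ← this]
    exact (Real.sqrt_sq (LinearMap.normDet_nonneg _)).symm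
  rw [h]
  refine Real.continuous_sqrt.comp (ContinuousLinearMap.continuous_det.comp ?_)
  exact (ContinuousLinearMap.adjoint.continuous).clm_comp continuous_id

theorem jac_pos {L : E →L[ℝ] F} (hL : Function.Injective L) : 0 < jac L := by
  refine lt_of_le_of_ne (jac_nonneg L) (Ne.symm ?_)
  exact ((LinearMap.normDet_ne_zero_tfae (L : E →ₗ[ℝ] F)).out 0 4).2 hL

theorem measure_image_eq_jac_mul (L : E →L[ℝ] F) (s : Set E) :
    (μHE[Module.finrank ℝ E] : Measure F) (L '' s) = ENNReal.ofReal (jac L) * volume s :=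
  LinearMap.euclideanHausdorffMeasure_image_eq_normDet_mul_volume (L : E →ₗ[ℝ] F) s

/-- Near a point of strict differentiability, an immersion is almost isometric to its derivative. -/
theorem exists_nhds_dist_le_of_hasStrictFDerivAt {f : E → F} {L : E →L[ℝ] F} {x : E}
    (hf : HasStrictFDerivAt f L x) (hL : Function.Injective L) {c : ℝ≥0} (hc : 1 < c) :
    ∃ N ∈ 𝓝 x, ∀ y ∈ N, ∀ z ∈ N, dist (f y) (f z) ≤ c * dist (L y) (L z) ∧
      dist (L y) (L z) ≤ c * dist (f y) (f z) := by
  obtain ⟨K, hK, hanti⟩ := LinearMap.exists_antilipschitzWith (L : E →ₗ[ℝ] F)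
    (LinearMap.ker_eq_bot.2 hL)
  have hKr : (0 : ℝ) < K := hK
  have hc' : (1 : ℝ) < c := hc
  -- The linearization error is at most δ K ‖L (y - z)‖. The condition K δ c ≤ c - 1 gives both 1 +
  -- K δ ≤ c and 1 ≤ c (1 - K δ), one for each inequality.
  obtain ⟨δ, hδ0, hδ⟩ : ∃ δ : ℝ≥0, 0 < δ ∧ (K : ℝ) * δ * c ≤ c - 1 := by
    refine ⟨⟨(c - 1) / (K * c), by have : (0:ℝ) ≤ c - 1 := by linarith
                                   positivity⟩, ?_, ?_⟩
    · show (0 : ℝ) < (c - 1) / (K * c)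
      have : (0:ℝ) < c - 1 := by linarith
      positivity
    · show (K : ℝ) * ((c - 1) / (K * c)) * c ≤ c - 1
      have : (c : ℝ) ≠ 0 := by positivity
      apply le_of_eq
      field_simp
  obtain ⟨N, hN, happ⟩ := hf.approximates_deriv_on_nhds (Or.inr hδ0)
  refine ⟨N, hN, fun y hy z hz => ?_⟩
  have h1 : ‖f y - f z - L (y - z)‖ ≤ δ * ‖y - z‖ := happ y hy z hz
  have h2 : ‖y - z‖ ≤ K * ‖L (y - z)‖ := by
    have := hanti.le_mul_dist y z
    simpa [dist_eq_norm, map_sub] using this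
  rw [dist_eq_norm, dist_eq_norm, ← map_sub]
  have h3 : ‖f y - f z‖ ≤ ‖f y - f z - L (y - z)‖ + ‖L (y - z)‖ := by
    simpa using norm_add_le (f y - f z - L (y - z)) (L (y - z))
  have h4 : ‖L (y - z)‖ ≤ ‖f y - f z - L (y - z)‖ + ‖f y - f z‖ := by
    have := norm_sub_le (f y - f z) (f y - f z - L (y - z))
    simp only [sub_sub_cancel] at this
    linarith
  have hδr : (0 : ℝ) ≤ δ := δ.2
  set l := ‖L (y - z)‖
  have hl : 0 ≤ l := norm_nonneg _
  have h5 : δ * ‖y - z‖ ≤ δ * (K * l) := by gcongr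
  have h6 : (K : ℝ) * δ * c * l ≤ (c - 1) * l := by gcongr
  have h7 : (K : ℝ) * δ * l ≤ K * δ * c * l := by
    have : 0 ≤ (K : ℝ) * δ * l := by positivity
    nlinarith
  constructor
  · nlinarith
  · have hcn : (0 : ℝ) ≤ c := by linarith
    have h8 : l ≤ K * δ * l + ‖f y - f z‖ := by nlinarith
    have h9 : c * l ≤ c * (K * δ * l + ‖f y - f z‖) := by gcongr
    nlinarith

/-- Near x the map is bi-Lipschitz equivalent, with constant b close to 1, to its derivative at x,
and a linear map multiplies volume by its Jacobian. On a smaller neighbourhood the Jacobian itself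
varies by a factor at most b. -/
theorem exists_nhds_measure_image_comparable {D : Set E} (hD : IsOpen D) {f : E → F}
    (hf : ContDiffOn ℝ 1 f D) (hL : ∀ x ∈ D, Function.Injective (fderiv ℝ f x))
    {x : E} (hx : x ∈ D) {c : ℝ≥0} (hc : 1 < c) :
    ∃ N ∈ 𝓝 x, N ⊆ D ∧ ∀ B ⊆ N, MeasurableSet B →
      (μHE[Module.finrank ℝ E] : Measure F) (f '' B) ≤
        c * ∫⁻ y in B, ENNReal.ofReal (jac (fderiv ℝ f y)) ∧
      ∫⁻ y in B, ENNReal.ofReal (jac (fderiv ℝ f y)) ≤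
        c * (μHE[Module.finrank ℝ E] : Measure F) (f '' B) := by
  set d := Module.finrank ℝ E
  -- The Lipschitz comparison in dimension d costs b ^ d and the oscillation of the Jacobian one
  -- more factor b.
  obtain ⟨b, hb1, hbc⟩ : ∃ b : ℝ≥0, 1 < b ∧ b ^ (d + 1) ≤ c := by
    have ht : Tendsto (fun b : ℝ≥0 => b ^ (d + 1)) (𝓝[>] 1) (𝓝 1) := by
      have := ((continuous_pow (M := ℝ≥0) (d + 1)).tendsto 1).mono_left
        (nhdsWithin_le_nhds (s := Ioi 1))
      simpa using this
    obtain ⟨b, hb1, hb2⟩ := ((ht.eventually (eventually_le_nhds hc)).and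
      self_mem_nhdsWithin).exists
    exact ⟨b, hb2, hb1⟩
  have hcd : ContDiffAt ℝ 1 f x := hf.contDiffAt (hD.mem_nhds hx)
  have hstrict : HasStrictFDerivAt f (fderiv ℝ f x) x := hcd.hasStrictFDerivAt one_ne_zero
  obtain ⟨N₁, hN₁, hd⟩ := exists_nhds_dist_le_of_hasStrictFDerivAt hstrict (hL x hx) hb1
  have hJ : ContinuousAt (fun y => jac (fderiv ℝ f y)) x :=
    (continuous_jac.continuousAt).comp (hcd.fderiv_right (m := 0) (by simp)).continuousAt
  set J₀ := jac (fderiv ℝ f x) with hJ₀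
  have hJpos : 0 < J₀ := jac_pos (hL x hx)
  have hb1' : (1 : ℝ) < b := hb1
  have hb0 : (0 : ℝ) < b := by linarith
  have hup : ∀ᶠ y in 𝓝 x, jac (fderiv ℝ f y) < b * J₀ :=
    hJ.eventually_lt continuousAt_const (by nlinarith)
  have hlow : ∀ᶠ y in 𝓝 x, J₀ < b * jac (fderiv ℝ f y) :=
    continuousAt_const.eventually_lt (continuousAt_const.mul hJ) (by
      show J₀ < b * J₀
      nlinarith)
  refine ⟨N₁ ∩ D ∩ {y | jac (fderiv ℝ f y) < b * J₀ ∧ J₀ < b * jac (fderiv ℝ f y)},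
    inter_mem (inter_mem hN₁ (hD.mem_nhds hx)) (hup.and hlow),
    inter_subset_left.trans inter_subset_right, fun B hB hBm => ?_⟩
  have hlin := measure_image_eq_jac_mul (fderiv ℝ f x) B
  have h1 : (μHE[d] : Measure F) (f '' B) ≤ (b : ℝ≥0∞) ^ d * (ENNReal.ofReal J₀ * volume B) := by
    rw [← hlin]
    exact euclideanHausdorffMeasure_image_le_of_dist_le
      fun y hy z hz => (hd y (hB hy).1.1 z (hB hz).1.1).1
  have h2 : ENNReal.ofReal J₀ * volume B ≤ (b : ℝ≥0∞) ^ d * (μHE[d] : Measure F) (f '' B) := by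
    rw [← hlin]
    exact euclideanHausdorffMeasure_image_le_of_dist_le
      fun y hy z hz => (hd y (hB hy).1.1 z (hB hz).1.1).2
  have hbE : (b : ℝ≥0∞) = ENNReal.ofReal b := by simp
  have h3 : ENNReal.ofReal J₀ * volume B ≤ b * ∫⁻ y in B, ENNReal.ofReal (jac (fderiv ℝ f y)) := by
    rw [← setLIntegral_const, ← lintegral_const_mul' _ _ ENNReal.coe_ne_top]
    refine setLIntegral_mono' hBm fun y hy => ?_
    rw [hbE, ← ENNReal.ofReal_mul hb0.le]
    exact ENNReal.ofReal_le_ofReal (hB hy).2.2.le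
  have h4 : ∫⁻ y in B, ENNReal.ofReal (jac (fderiv ℝ f y)) ≤ b * (ENNReal.ofReal J₀ * volume B) := by
    rw [← setLIntegral_const, ← lintegral_const_mul' _ _ ENNReal.coe_ne_top]
    refine setLIntegral_mono' hBm fun y hy => ?_
    rw [hbE, ← ENNReal.ofReal_mul hb0.le]
    exact ENNReal.ofReal_le_ofReal (hB hy).2.1.le
  have hbc' : (b : ℝ≥0∞) ^ d * b ≤ c := by
    rw [← pow_succ]; exact_mod_cast hbc
  constructor
  · calc _ ≤ _ := h1
      _ ≤ (b : ℝ≥0∞) ^ d * (b * ∫⁻ y in B, ENNReal.ofReal (jac (fderiv ℝ f y))) := by gcongr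
      _ ≤ _ := by rw [← mul_assoc]; gcongr
  · calc _ ≤ _ := h4
      _ ≤ b * ((b : ℝ≥0∞) ^ d * (μHE[d] : Measure F) (f '' B)) := by gcongr
      _ ≤ _ := by rw [← mul_assoc, mul_comm (b : ℝ≥0∞)]; gcongr

/-- The area formula for an injective `C^1` immersion of an open set, as an identity of measures. -/
theorem comap_euclideanHausdorffMeasure_eq {D : Set E} (hD : IsOpen D) {f : E → F}
    (hf : ContDiffOn ℝ 1 f D) (hinj : InjOn f D)
    (hL : ∀ x ∈ D, Function.Injective (fderiv ℝ f x)) :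
    Measure.comap (D.domRestrict f) (μHE[Module.finrank ℝ E] : Measure F) =
      Measure.comap ((↑) : D → E)
        (volume.withDensity fun y => ENNReal.ofReal (jac (fderiv ℝ f y))) := by
  have hemb : MeasurableEmbedding (D.domRestrict f) :=
    hf.continuousOn.measurableEmbedding hD.measurableSet hinj
  have hemb' : MeasurableEmbedding ((↑) : D → E) := MeasurableEmbedding.subtype_coe hD.measurableSet
  have hl : ∀ B : Set D, MeasurableSet B → Measure.comap ((↑) : D → E)
        (volume.withDensity fun y => ENNReal.ofReal (jac (fderiv ℝ f y))) B =
      ∫⁻ y in ((↑) '' B : Set E), ENNReal.ofReal (jac (fderiv ℝ f y)) := fun B hB => by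
    rw [hemb'.comap_apply, withDensity_apply _ (hemb'.measurableSet_image.2 hB)]
  have hr : ∀ B : Set D, Measure.comap (D.domRestrict f) (μHE[Module.finrank ℝ E] : Measure F) B =
      (μHE[Module.finrank ℝ E] : Measure F) (f '' ((↑) '' B : Set E)) := fun B => by
    rw [hemb.comap_apply, image_image]; rfl
  -- On the subtype `D` the two measures are comparable near each point with any constant c > 1,
  -- hence globally with the same constant; then c tends to 1.
  have key : ∀ c : ℝ≥0, 1 < c →
      Measure.comap (D.domRestrict f) (μHE[Module.finrank ℝ E] : Measure F) ≤
        (c : ℝ≥0∞) • Measure.comap ((↑) : D → E)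
        (volume.withDensity fun y => ENNReal.ofReal (jac (fderiv ℝ f y))) ∧
      Measure.comap ((↑) : D → E)
        (volume.withDensity fun y => ENNReal.ofReal (jac (fderiv ℝ f y))) ≤
        (c : ℝ≥0∞) • Measure.comap (D.domRestrict f) (μHE[Module.finrank ℝ E] : Measure F) := by
    intro c hc
    constructor <;> refine measure_le_of_locally_le fun x => ?_ <;>
      obtain ⟨N, hN, -, hB⟩ := exists_nhds_measure_image_comparable hD hf hL x.2 hc <;>
      refine ⟨((↑) : D → E) ⁻¹' N, continuous_subtype_val.continuousAt.preimage_mem_nhds hN, fun B hBN hBm => ?_⟩ <;>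
      have := hB ((↑) '' B) (image_subset_iff.2 hBN) (hemb'.measurableSet_image.2 hBm) <;>
      rw [Measure.smul_apply, smul_eq_mul, hl B hBm, hr B]
    exacts [this.1, this.2]
  refine le_antisymm ?_ ?_ <;> refine Measure.le_iff.2 fun s _ =>
    ennreal_le_of_forall_one_lt_mul fun c hc => ?_
  · exact (key c hc).1 s
  · exact (key c hc).2 s

/-- The area formula: change of variables. -/
theorem setIntegral_image_eq_setIntegral_jac {D : Set E} (hD : IsOpen D) {f : E → F}
    (hf : ContDiffOn ℝ 1 f D) (hinj : InjOn f D)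
    (hL : ∀ x ∈ D, Function.Injective (fderiv ℝ f x)) (g : F → ℝ) :
    ∫ x in f '' D, g x ∂(μHE[Module.finrank ℝ E] : Measure F) =
      ∫ y in D, jac (fderiv ℝ f y) * g (f y) := by
  have hemb : MeasurableEmbedding (D.domRestrict f) :=
    hf.continuousOn.measurableEmbedding hD.measurableSet hinj
  have h := comap_euclideanHausdorffMeasure_eq hD hf hinj hL
  have h1 : ∫ x in f '' D, g x ∂(μHE[Module.finrank ℝ E] : Measure F) =
      ∫ y : D, g (D.domRestrict f y) ∂(Measure.comap (D.domRestrict f)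
        (μHE[Module.finrank ℝ E] : Measure F)) := by
    rw [← hemb.integral_map, hemb.map_comap, range_domRestrict]
  rw [h1, h]
  have h2 := integral_subtype_comap (μ := volume.withDensity fun y => ENNReal.ofReal
    (jac (fderiv ℝ f y))) hD.measurableSet (fun y => g (f y))
  refine Eq.trans h2 ?_
  rw [restrict_withDensity hD.measurableSet]
  have hcont : ContinuousOn (fun y => jac (fderiv ℝ f y)) D :=
    continuous_jac.comp_continuousOn (hf.continuousOn_fderiv_of_isOpen hD le_rfl)
  have hmeas : AEMeasurable (fun y => (jac (fderiv ℝ f y)).toNNReal) (volume.restrict D) :=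
    (continuous_real_toNNReal.comp_continuousOn hcont).aemeasurable hD.measurableSet
  have := integral_withDensity_eq_integral_smul₀ hmeas (fun y => g (f y))
  refine Eq.trans this ?_
  refine integral_congr_ae (Eventually.of_forall fun y => ?_)
  show ((jac (fderiv ℝ f y)).toNNReal : ℝ) • g (f y) = _
  rw [Real.coe_toNNReal _ (jac_nonneg _), smul_eq_mul]

theorem measure_image_eq_setLIntegral_jac {D : Set E} (hD : IsOpen D) {f : E → F}
    (hf : ContDiffOn ℝ 1 f D) (hinj : InjOn f D)
    (hL : ∀ x ∈ D, Function.Injective (fderiv ℝ f x)) :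
    (μHE[Module.finrank ℝ E] : Measure F) (f '' D) =
      ∫⁻ y in D, ENNReal.ofReal (jac (fderiv ℝ f y)) := by
  have hemb : MeasurableEmbedding (D.domRestrict f) :=
    hf.continuousOn.measurableEmbedding hD.measurableSet hinj
  have h := congrArg (fun m => m univ) (comap_euclideanHausdorffMeasure_eq hD hf hinj hL)

  rw [hemb.comap_apply, (MeasurableEmbedding.subtype_coe hD.measurableSet).comap_apply,
    image_univ, image_univ, range_domRestrict, Subtype.range_coe,
    withDensity_apply _ hD.measurableSet] at h
  exact h

/-- The Jacobian is the volume ratio of the image of the unit ball, and a c-Lipschitz map raises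
d-dimensional measure by at most c ^ d. No singular values are needed. -/
theorem jac_le_pow {L : E →L[ℝ] F} {c : ℝ≥0} (h : ∀ v, ‖L v‖ ≤ c * ‖v‖) :
    jac L ≤ c ^ Module.finrank ℝ E := by
  have h1 := euclideanHausdorffMeasure_image_le_of_dist_le (d := Module.finrank ℝ E) (K := c)
    (f := L) (g := id) (s := Metric.ball (0 : E) 1)
    (fun x _ y _ => by simpa [dist_eq_norm, ← map_sub] using h (x - y))
  rw [measure_image_eq_jac_mul, image_id, InnerProductSpace.euclideanHausdorffMeasure_eq_volume,
    ENNReal.mul_le_mul_iff_left (Metric.measure_ball_pos _ _ one_pos).ne'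
      measure_ball_lt_top.ne] at h1
  rw [← ENNReal.ofReal_le_ofReal_iff (by positivity)]
  simpa [ENNReal.ofReal_pow] using h1

/-- The same comparison on the unit ball, with the identity viewed as a c-Lipschitz function of `L`.
-/
theorem one_le_pow_mul_jac {L : E →L[ℝ] F} {c : ℝ≥0} (h : ∀ v, ‖v‖ ≤ c * ‖L v‖) :
    1 ≤ c ^ Module.finrank ℝ E * jac L := by
  have h1 := euclideanHausdorffMeasure_image_le_of_dist_le (d := Module.finrank ℝ E) (K := c)
    (f := id) (g := L) (s := Metric.ball (0 : E) 1)
    (fun x _ y _ => by simpa [dist_eq_norm, ← map_sub] using h (x - y))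
  rw [measure_image_eq_jac_mul, image_id, InnerProductSpace.euclideanHausdorffMeasure_eq_volume,
    ← mul_assoc] at h1
  nth_rewrite 1 [← one_mul (volume _)] at h1
  rw [ENNReal.mul_le_mul_iff_left (Metric.measure_ball_pos _ _ one_pos).ne'
      measure_ball_lt_top.ne] at h1
  rw [← ENNReal.ofReal_le_ofReal_iff (mul_nonneg (by positivity) (jac_nonneg _)),
    ENNReal.ofReal_mul (by positivity)]
  simpa [ENNReal.ofReal_pow] using h1

end AreaFormula

/-! ### Hausdorff measure and cone measure on the unit sphere -/

section SphereMeasure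

open Filter Topology Metric
open scoped NNReal ENNReal Pointwise

/-- Two finite measures on a compact metric space for which the measure of a ball depends on its
radius only are proportional. -/
theorem eq_smul_of_measure_ball_eq {X : Type*} [MetricSpace X] [CompactSpace X]
    [SecondCountableTopology X] [MeasurableSpace X]
    [BorelSpace X] (μ ν : Measure X) [IsFiniteMeasure μ] [IsFiniteMeasure ν]
    [ν.IsOpenPosMeasure] (hμ : ∀ x y r, μ (ball x r) = μ (ball y r))
    (hν : ∀ x y r, ν (ball x r) = ν (ball y r)) :
    μ = (μ univ / ν univ) • ν := by
  rcases isEmpty_or_nonempty X with hX | ⟨⟨x₀⟩⟩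
  · exact Measure.ext fun s _ => by simp [Set.eq_empty_of_isEmpty s]
  have hνpos : 0 < ν.real univ := by
    rw [measureReal_def]
    exact ENNReal.toReal_pos (isOpen_univ.measure_ne_zero ν ⟨x₀, trivial⟩) (measure_ne_top _ _)
  set c : ℝ≥0∞ := μ univ / ν univ with hc
  have hν0 : ν univ ≠ 0 := isOpen_univ.measure_ne_zero ν ⟨x₀, trivial⟩
  have hctop : c ≠ ∞ := ENNReal.div_ne_top (measure_ne_top _ _) hν0
  have hcr : c.toReal = μ.real univ / ν.real univ := by
    rw [hc, ENNReal.toReal_div]; rfl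
  have hfin : IsFiniteMeasure (c • ν) := Measure.smul_finite ν hctop
  refine ext_of_forall_integral_eq_of_IsFiniteMeasure fun f => ?_
  rw [integral_smul_measure, hcr, smul_eq_mul]
  set h : ℝ → ℝ := fun r => ν.real (ball x₀ r) with hh
  set g : ℝ → ℝ := fun r => μ.real (ball x₀ r) with hg
  have hhpos : ∀ r, 0 < r → 0 < h r := fun r hr =>
    ENNReal.toReal_pos (isOpen_ball.measure_ne_zero ν ⟨x₀, mem_ball_self hr⟩)
      (measure_ne_top _ _)
  have hset : ∀ r, MeasurableSet {p : X × X | dist p.1 p.2 < r} := fun r =>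
    (isOpen_lt (continuous_fst.dist continuous_snd) continuous_const).measurableSet
  have hintg : ∀ (k : X → ℝ) (r : ℝ), Continuous k → Integrable
      (fun p : X × X => {p : X × X | dist p.1 p.2 < r}.indicator (fun p => k p.2) p)
      (μ.prod ν) := fun k r hk => by
    refine Integrable.indicator ?_ (hset r)
    obtain ⟨B, hB⟩ := (isCompact_univ (X := X)).exists_bound_of_continuousOn hk.continuousOn
    exact Integrable.of_bound (hk.comp continuous_snd).aestronglyMeasurable B
      (Eventually.of_forall fun p => hB _ trivial)
  -- Fubini on the set dist x y < r: after exchanging the integrals, the inner one is the μ-measure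
  -- of a ball around y, which is `g r` for every y.
  have hfub : ∀ (k : X → ℝ) (r : ℝ), Continuous k →
      ∫ x, ∫ y in ball x r, k y ∂ν ∂μ = g r * ∫ y, k y ∂ν := by
    intro k r hk
    have h1 : ∀ x, ∫ y in ball x r, k y ∂ν =
        ∫ y, {p : X × X | dist p.1 p.2 < r}.indicator (fun p => k p.2) (x, y) ∂ν := fun x => by
      rw [← integral_indicator measurableSet_ball]
      refine integral_congr_ae (Eventually.of_forall fun y => ?_)
      simp only [indicator, mem_ball, mem_ofPred_eq, dist_comm y x]
    simp_rw [h1]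
    rw [integral_integral_swap (hintg k r hk), ← integral_const_mul]
    refine integral_congr_ae (Eventually.of_forall fun y => ?_)
    have h2 : ∀ x, {p : X × X | dist p.1 p.2 < r}.indicator (fun p => k p.2) (x, y) =
        (ball y r).indicator (fun _ => k y) x := fun x => by
      simp only [indicator, mem_ball, mem_ofPred_eq]
    simp only [h2]
    rw [integral_indicator measurableSet_ball, setIntegral_const, smul_eq_mul, measureReal_def,
      hμ y x₀ r]
    rfl
  -- The case k = 1 shows that the ratio of the μ- and ν-measure of balls does not depend on the
  -- radius.
  have hone : ∀ r, g r * ν.real univ = h r * μ.real univ := fun r => by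
    have h1 := hfub (fun _ => 1) r continuous_const
    simp only [integral_const, smul_eq_mul, mul_one] at h1
    rw [← h1]
    have h2 : ∀ x, (ν.restrict (ball x r)).real univ = h r := fun x => by
      rw [measureReal_restrict_apply_univ, measureReal_def, hν x x₀ r]; rfl
    simp only [h2, integral_const, smul_eq_mul]
    ring
  have hfc : UniformContinuous f := CompactSpace.uniformContinuous_of_continuous f.continuous
  obtain ⟨B, hB⟩ := (isCompact_univ (X := X)).exists_bound_of_continuousOn f.continuous.continuousOn
  have hfi : ∀ (m : Measure X) [IsFiniteMeasure m], Integrable (fun x => f x) m := fun m _ =>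
    Integrable.of_bound f.continuous.aestronglyMeasurable B
      (Eventually.of_forall fun p => hB _ trivial)
  -- By uniform continuity f(x) is within ε of its ν-average over a small ball around x. Integrating
  -- this in μ and using `hfub` replaces the μ-integral by a multiple of the ν-integral.
  have key : ∀ ε > 0, |∫ x, f x ∂μ - μ.real univ / ν.real univ * ∫ x, f x ∂ν| ≤
      ε * μ.real univ := by
    intro ε hε
    obtain ⟨r, hr, hru⟩ := Metric.uniformContinuous_iff.1 hfc ε hε
    have hhr := hhpos r hr
    have hratio : μ.real univ / ν.real univ = g r / h r := by
      rw [div_eq_div_iff hνpos.ne' hhr.ne']; linarith [hone r]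
    have h3 : ∀ x, |h r * f x - ∫ y in ball x r, f y ∂ν| ≤ ε * h r := fun x => by
      have hx : ν.real (ball x r) = h r := by rw [measureReal_def, hν x x₀ r]; rfl
      have h4 : h r * f x = ∫ y in ball x r, f x ∂ν := by
        rw [setIntegral_const, hx, smul_eq_mul]
      rw [h4, ← integral_sub (μ := ν.restrict (ball x r)) (integrable_const _) (hfi _), ← hx]
      have h5 : ∀ y ∈ ball x r, ‖f x - f y‖ ≤ ε := fun y hy => by
        have := hru (a := y) (b := x) hy
        rw [dist_comm, Real.dist_eq] at this
        exact this.le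
      exact norm_setIntegral_le_of_norm_le_const (measure_lt_top ν (ball x r)) h5
    have hmeas : Integrable (fun x => ∫ y in ball x r, f y ∂ν) μ := by
      have := (hintg (fun x => f x) r f.continuous).integral_prod_left
      refine this.congr (Eventually.of_forall fun x => ?_)
      simp only
      rw [← integral_indicator measurableSet_ball]
      refine integral_congr_ae (Eventually.of_forall fun y => ?_)
      simp only [indicator, mem_ball, mem_ofPred_eq, dist_comm y x]
    have h5 : |∫ x, (h r * f x - ∫ y in ball x r, f y ∂ν) ∂μ| ≤ (ε * h r) * μ.real univ := by
      have := norm_integral_le_of_norm_le_const (μ := μ) (C := ε * h r)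
        (f := fun x => h r * f x - ∫ y in ball x r, f y ∂ν) (Eventually.of_forall h3)
      exact this
    rw [integral_sub ((hfi μ).const_mul _) hmeas, hfub _ _ f.continuous, integral_const_mul] at h5
    rw [hratio]
    have h6 : ∫ x, f x ∂μ - g r / h r * ∫ x, f x ∂ν =
        (h r * ∫ x, f x ∂μ - g r * ∫ x, f x ∂ν) / h r := by field_simp
    rw [h6, abs_div, abs_of_pos hhr, div_le_iff₀ hhr]
    linarith
  have h7 : |∫ x, f x ∂μ - μ.real univ / ν.real univ * ∫ x, f x ∂ν| ≤ 0 := by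
    refine le_of_forall_pos_le_add fun ε hε => ?_
    have hm : 0 ≤ μ.real univ := measureReal_nonneg
    have h8 := key (ε / (μ.real univ + 1)) (by positivity)
    have h9 : ε / (μ.real univ + 1) * μ.real univ ≤ ε := by
      rw [div_mul_eq_mul_div, div_le_iff₀ (by positivity)]
      nlinarith
    linarith
  exact sub_eq_zero.1 (abs_nonpos_iff.1 h7)

variable {E : Type*} [NormedAddCommGroup E] [InnerProductSpace ℝ E] [FiniteDimensional ℝ E]
  [MeasurableSpace E] [BorelSpace E]

/-- A linear isometry acts isometrically on the unit sphere. -/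
def sphereIsometry (e : E ≃ₗᵢ[ℝ] E) : sphere (0 : E) 1 ≃ᵢ sphere (0 : E) 1 where
  toFun ω := ⟨e ω, by simp⟩
  invFun ω := ⟨e.symm ω, by simp⟩
  left_inv ω := by simp
  right_inv ω := by simp
  isometry_toFun := fun x y => e.isometry x y

/-- The cone over the image of a set is the image of its cone, and a linear isometry preserves
Lebesgue measure. -/
theorem measurePreserving_sphereIsometry (e : E ≃ₗᵢ[ℝ] E) :
    MeasurePreserving (sphereIsometry e) (volume : Measure E).toSphere
      (volume : Measure E).toSphere := by
  have hm : Measurable (sphereIsometry e) := (sphereIsometry e).continuous.measurable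
  refine ⟨hm, Measure.ext fun s hs => ?_⟩
  rw [Measure.map_apply hm hs, Measure.toSphere_apply' _ hs, Measure.toSphere_apply' _ (hm hs)]
  congr 1
  have himg : Ioo (0 : ℝ) 1 • (((↑) : sphere (0 : E) 1 → E) '' s) =
      e '' (Ioo (0 : ℝ) 1 • (((↑) : sphere (0 : E) 1 → E) '' (sphereIsometry e ⁻¹' s))) := by
    ext x
    simp only [Set.mem_smul, mem_image, mem_preimage]
    constructor
    · rintro ⟨t, ht, _, ⟨ω, hω, rfl⟩, rfl⟩
      refine ⟨t • e.symm ω, ⟨t, ht, _, ⟨(sphereIsometry e).symm ω, by simpa using hω, rfl⟩, ?_⟩, ?_⟩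
      · rfl
      · simp
    · rintro ⟨_, ⟨t, ht, _, ⟨ω, hω, rfl⟩, rfl⟩, rfl⟩
      exact ⟨t, ht, _, ⟨_, hω, rfl⟩, (map_smul e t (ω : E)).symm⟩
  rw [himg]
  have := e.measurePreserving.measure_preimage_equiv (f := e.toHomeomorph.toMeasurableEquiv)
    (e '' (Ioo (0 : ℝ) 1 • (((↑) : sphere (0 : E) 1 → E) '' (sphereIsometry e ⁻¹' s))))
  rw [← this]
  congr 1
  exact (preimage_image_eq _ e.injective).symm

/-- The reflection in the hyperplane orthogonal to x - y exchanges the two unit vectors. -/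
theorem exists_sphereIsometry_eq (x y : sphere (0 : E) 1) :
    ∃ e : E ≃ₗᵢ[ℝ] E, sphereIsometry e x = y :=
  ⟨(ℝ ∙ ((x : E) - y))ᗮ.reflection, Subtype.ext
    (Submodule.reflection_sub (by simp))⟩

theorem measure_ball_eq_of_invariant {μ : Measure (sphere (0 : E) 1)}
    (h : ∀ e : E ≃ₗᵢ[ℝ] E, MeasurePreserving (sphereIsometry e) μ μ)
    (x y : sphere (0 : E) 1) (r : ℝ) : μ (ball x r) = μ (ball y r) := by
  obtain ⟨e, rfl⟩ := exists_sphereIsometry_eq x y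
  rw [← (h e).measure_preimage (s := ball (sphereIsometry e x) r)
    measurableSet_ball.nullMeasurableSet, IsometryEquiv.preimage_ball, IsometryEquiv.symm_apply_apply]

/-- The inverse of the orthogonal projection of a hemisphere onto the equatorial disc. -/
noncomputable def hemisphereChart (e : E) (z : (ℝ ∙ e)ᗮ) : E :=
  (z : E) + Real.sqrt (1 - ‖z‖ ^ 2) • e

/-- The orthogonal projection to a hyperplane is 1-Lipschitz, and its image of the sphere contains
the unit disc, which has positive measure. -/
theorem euclideanHausdorffMeasure_sphere_ne_zero [Nontrivial E] :
    (μHE[Module.finrank ℝ E - 1] : Measure E) (sphere (0 : E) 1) ≠ 0 := by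
  obtain ⟨e, he⟩ := exists_norm_eq E (zero_le_one' ℝ)
  have he0 : e ≠ 0 := by rintro rfl; simp at he
  have hdim : Module.finrank ℝ ((ℝ ∙ e)ᗮ : Submodule ℝ E) = Module.finrank ℝ E - 1 := by
    have := Submodule.finrank_add_finrank_orthogonal (ℝ ∙ e)
    rw [finrank_span_singleton he0] at this
    omega
  intro h0
  have hsub : ball (0 : (ℝ ∙ e)ᗮ) 1 ⊆ (ℝ ∙ e)ᗮ.orthogonalProjectionOnto '' sphere (0 : E) 1 := by
    intro z hz
    rw [mem_ball_zero_iff] at hz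
    refine ⟨hemisphereChart e z, ?_, ?_⟩
    · have hperp : ⟪(z : E), Real.sqrt (1 - ‖z‖ ^ 2) • e⟫_ℝ = 0 := by
        rw [inner_smul_right, real_inner_comm,
          Submodule.inner_right_of_mem_orthogonal (Submodule.mem_span_singleton_self e) z.2, mul_zero]
      have h1 : ‖hemisphereChart e z‖ ^ 2 = 1 := by
        have h2 := norm_add_sq_real (z : E) (Real.sqrt (1 - ‖z‖ ^ 2) • e)
        have h3 : 0 ≤ 1 - ‖z‖ ^ 2 := by nlinarith [norm_nonneg z]
        rw [hperp, norm_smul, he, mul_one, Real.norm_eq_abs, sq_abs, Real.sq_sqrt h3] at h2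
        rw [hemisphereChart, h2, Submodule.coe_norm]; ring
      rw [mem_sphere_zero_iff_norm]
      nlinarith [norm_nonneg (hemisphereChart e z)]
    · rw [hemisphereChart, map_add, map_smul,
        Submodule.orthogonalProjectionOnto_orthogonal_apply_eq_zero
          (Submodule.mem_span_singleton_self e)]
      simp
  have h1 := euclideanHausdorffMeasure_image_le_of_dist_le (d := Module.finrank ℝ E - 1) (K := 1)
    (f := (ℝ ∙ e)ᗮ.orthogonalProjectionOnto) (g := id) (s := sphere (0 : E) 1)
    (fun x _ y _ => by
      simpa [dist_eq_norm, ← map_sub] using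
        (ℝ ∙ e)ᗮ.norm_orthogonalProjectionOnto_apply_le (x - y))
  rw [image_id, h0, mul_zero, ← hdim, InnerProductSpace.euclideanHausdorffMeasure_eq_volume] at h1
  exact (measure_ball_pos volume (0 : (ℝ ∙ e)ᗮ) one_pos).ne'
    (le_antisymm ((measure_mono hsub).trans h1) bot_le)

/-- By compactness it suffices to bound the measure near one point e. The hemisphere chart with pole
e is C¹ near 0, hence Lipschitz there; it is not Lipschitz up to the equator, so the bound has to be
local. -/
theorem euclideanHausdorffMeasure_sphere_lt_top :
    (μHE[Module.finrank ℝ E - 1] : Measure E) (sphere (0 : E) 1) < ∞ := by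
  refine (isCompact_sphere (0 : E) 1).measure_lt_top_of_nhdsWithin fun e he => ?_
  rw [mem_sphere_zero_iff_norm] at he
  have he0 : e ≠ 0 := by rintro rfl; simp at he
  have hdim : Module.finrank ℝ ((ℝ ∙ e)ᗮ : Submodule ℝ E) = Module.finrank ℝ E - 1 := by
    have := Submodule.finrank_add_finrank_orthogonal (ℝ ∙ e)
    rw [finrank_span_singleton he0] at this
    omega
  have hcd : ContDiffAt ℝ 1 (hemisphereChart e) 0 := by
    unfold hemisphereChart
    refine ContDiffAt.add (Submodule.subtypeL (ℝ ∙ e)ᗮ).contDiff.contDiffAt ?_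
    refine ContDiffAt.smul ?_ contDiffAt_const
    refine ContDiffAt.sqrt ?_ (by simp)
    exact contDiffAt_const.sub (contDiff_norm_sq ℝ).contDiffAt
  obtain ⟨K, N, hN, hK⟩ := hcd.exists_lipschitzOnWith
  set P := (ℝ ∙ e)ᗮ.orthogonalProjectionOnto with hP
  have hPe : P e = 0 := Submodule.orthogonalProjectionOnto_orthogonal_apply_eq_zero
    (Submodule.mem_span_singleton_self e)
  set W : Set E := {x | P x ∈ N ∩ ball 0 1} ∩ {x | 0 < ⟪e, x⟫_ℝ} with hW
  have hWn : W ∈ 𝓝 e := by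
    refine inter_mem ?_ ?_
    · refine P.continuous.continuousAt.preimage_mem_nhds ?_
      rw [hPe]
      exact inter_mem hN (ball_mem_nhds _ one_pos)
    · exact (isOpen_lt continuous_const (by fun_prop)).mem_nhds (by
        show 0 < ⟪e, e⟫_ℝ
        rw [real_inner_self_eq_norm_sq, he]; norm_num)
  refine ⟨W ∩ sphere 0 1, by
    rw [inter_comm]; exact inter_mem_nhdsWithin _ hWn, ?_⟩
  have hsub : W ∩ sphere 0 1 ⊆ hemisphereChart e '' (N ∩ ball 0 1) := by
    rintro x ⟨⟨hx1, hx2⟩, hx3⟩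
    refine ⟨P x, hx1, ?_⟩
    rw [mem_sphere_zero_iff_norm] at hx3
    have hdec : x = (P x : E) + ⟪e, x⟫_ℝ • e := by
      have h1 := (ℝ ∙ e).starProjection_add_starProjection_orthogonal x
      rw [Submodule.starProjection_unit_singleton ℝ he] at h1
      nth_rewrite 1 [← h1]
      rw [add_comm]; rfl
    have hperp : ⟪(P x : E), ⟪e, x⟫_ℝ • e⟫_ℝ = 0 := by
      rw [inner_smul_right, real_inner_comm e (P x : E),
        Submodule.inner_right_of_mem_orthogonal (Submodule.mem_span_singleton_self e) (P x).2, mul_zero]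
    have hn := norm_add_sq_real (P x : E) (⟪e, x⟫_ℝ • e)
    rw [hperp, ← hdec, hx3, norm_smul, he, mul_one, Real.norm_eq_abs, sq_abs] at hn
    have hs : 1 - ‖P x‖ ^ 2 = ⟪e, x⟫_ℝ ^ 2 := by
      have : ‖(P x : E)‖ = ‖P x‖ := rfl
      rw [this] at hn; linarith
    rw [hemisphereChart, hs, Real.sqrt_sq hx2.le, ← hdec]
  have h1 := euclideanHausdorffMeasure_image_le_of_dist_le (d := Module.finrank ℝ E - 1) (K := K)
    (f := hemisphereChart e) (g := id) (s := N ∩ ball 0 1)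
    (fun x hx y hy => hK.dist_le_mul x hx.1 y hy.1)
  refine lt_of_le_of_lt ((measure_mono hsub).trans h1) ?_
  rw [image_id, ← hdim, InnerProductSpace.euclideanHausdorffMeasure_eq_volume]
  refine ENNReal.mul_lt_top (by simp) ?_
  exact lt_of_le_of_lt (measure_mono inter_subset_right) measure_ball_lt_top

/-- On the unit sphere, the Hausdorff measure is a positive multiple of the cone measure. -/
theorem exists_euclideanHausdorffMeasure_sphere_eq_smul [Nontrivial E] :
    ∃ c : ℝ≥0, 0 < c ∧ (μHE[Module.finrank ℝ E - 1] : Measure (sphere (0 : E) 1)) =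
      c • (volume : Measure E).toSphere := by
  set d := Module.finrank ℝ E - 1
  have huniv : (μHE[d] : Measure (sphere (0 : E) 1)) univ = (μHE[d] : Measure E) (sphere (0 : E) 1) := by
    rw [← (isometry_subtype_coe (s := sphere (0 : E) 1)).euclideanHausdorffMeasure_image, image_univ,
      Subtype.range_coe]
  have hfin : IsFiniteMeasure (μHE[d] : Measure (sphere (0 : E) 1)) :=
    ⟨by rw [huniv]; exact euclideanHausdorffMeasure_sphere_lt_top⟩
  have h := eq_smul_of_measure_ball_eq (μHE[d] : Measure (sphere (0 : E) 1))
    (volume : Measure E).toSphere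
    (measure_ball_eq_of_invariant fun e =>
      (sphereIsometry e).measurePreserving_euclideanHausdorffMeasure d)
    (measure_ball_eq_of_invariant measurePreserving_sphereIsometry)
  have h1 : (volume : Measure E).toSphere univ ≠ 0 :=
    (Measure.measure_univ_ne_zero).2 (Measure.toSphere_ne_zero _)
  have h2 : (μHE[d] : Measure (sphere (0 : E) 1)) univ ≠ 0 := by
    rw [huniv]; exact euclideanHausdorffMeasure_sphere_ne_zero
  have h3 : (μHE[d] : Measure (sphere (0 : E) 1)) univ / (volume : Measure E).toSphere univ ≠ ∞ :=
    ENNReal.div_ne_top (measure_ne_top _ _) h1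
  refine ⟨((μHE[d] : Measure (sphere (0 : E) 1)) univ / (volume : Measure E).toSphere univ).toNNReal,
    ENNReal.toNNReal_pos ?_ h3, ?_⟩
  · exact ENNReal.div_ne_zero.2 ⟨h2, measure_ne_top _ _⟩
  · nth_rewrite 1 [h, ← ENNReal.coe_toNNReal h3]
    rfl

end SphereMeasure

/-! ### Rotation fields and integration by parts on the sphere -/

section SphereIntegral

open Filter Topology Metric

variable {n : ℕ}

/-- The Euclidean space `ℝ^n`, a model of the hyperplane. -/
abbrev Eu (n : ℕ) : Type := EuclideanSpace ℝ (Fin n)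

/-- The integral over the unit sphere of `ℝ^n`. -/
noncomputable def sphInt (f : Eu n → ℝ) : ℝ :=
  ∫ ω : sphere (0 : Eu n) 1, f ω ∂(volume : Measure (Eu n)).toSphere

/-- The area of the unit sphere of `ℝ^n`. -/
noncomputable def sphArea (n : ℕ) : ℝ := (volume : Measure (Eu n)).toSphere.real univ

theorem sphArea_pos [Nontrivial (Eu n)] : 0 < sphArea n := by
  rw [sphArea, measureReal_def]
  exact ENNReal.toReal_pos (Measure.measure_univ_ne_zero.2 (Measure.toSphere_ne_zero _))
    (measure_ne_top _ _)

theorem sphere_integrable {f : Eu n → ℝ} (hf : ContinuousOn f (sphere 0 1)) :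
    Integrable (fun ω : sphere (0 : Eu n) 1 => f ω) (volume : Measure (Eu n)).toSphere := by
  have hc : Continuous (fun ω : sphere (0 : Eu n) 1 => f ω) := hf.domRestrict
  obtain ⟨B, hB⟩ := (isCompact_univ (X := sphere (0 : Eu n) 1)).exists_bound_of_continuousOn
    hc.continuousOn
  exact Integrable.of_bound hc.aestronglyMeasurable B (Eventually.of_forall fun p => hB _ trivial)

theorem sphInt_add {f g : Eu n → ℝ} (hf : ContinuousOn f (sphere 0 1))
    (hg : ContinuousOn g (sphere 0 1)) :
    sphInt (fun x => f x + g x) = sphInt f + sphInt g :=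
  integral_add (sphere_integrable hf) (sphere_integrable hg)

theorem sphInt_sub {f g : Eu n → ℝ} (hf : ContinuousOn f (sphere 0 1))
    (hg : ContinuousOn g (sphere 0 1)) :
    sphInt (fun x => f x - g x) = sphInt f - sphInt g :=
  integral_sub (sphere_integrable hf) (sphere_integrable hg)

theorem sphInt_const_mul (c : ℝ) (f : Eu n → ℝ) :
    sphInt (fun x => c * f x) = c * sphInt f :=
  integral_const_mul _ _

theorem sphInt_const (c : ℝ) : sphInt (fun _ : Eu n => c) = c * sphArea n := by
  simp [sphInt, sphArea, mul_comm]

theorem sphInt_sum {ι : Type*} (s : Finset ι) {f : ι → Eu n → ℝ}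
    (hf : ∀ i ∈ s, ContinuousOn (f i) (sphere 0 1)) :
    sphInt (fun x => ∑ i ∈ s, f i x) = ∑ i ∈ s, sphInt (f i) :=
  integral_finsetSum _ fun i hi => sphere_integrable (hf i hi)

theorem sphInt_congr {f g : Eu n → ℝ} (h : EqOn f g (sphere 0 1)) : sphInt f = sphInt g :=
  integral_congr_ae (Eventually.of_forall fun ω => h ω.2)

theorem sphInt_mono {f g : Eu n → ℝ} (hf : ContinuousOn f (sphere 0 1))
    (hg : ContinuousOn g (sphere 0 1)) (h : ∀ x ∈ sphere (0 : Eu n) 1, f x ≤ g x) :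
    sphInt f ≤ sphInt g :=
  integral_mono (sphere_integrable hf) (sphere_integrable hg) fun ω => h ω ω.2

theorem sphInt_nonneg {f : Eu n → ℝ} (h : ∀ x ∈ sphere (0 : Eu n) 1, 0 ≤ f x) : 0 ≤ sphInt f :=
  integral_nonneg fun ω => h ω ω.2

theorem sphInt_comp_isometry (e : Eu n ≃ₗᵢ[ℝ] Eu n) (f : Eu n → ℝ) :
    sphInt (fun x => f (e x)) = sphInt f :=
  (measurePreserving_sphereIsometry e).integral_comp
    (sphereIsometry e).toHomeomorph.measurableEmbedding (fun ω => f ω)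

/-- The infinitesimal rotation `x ↦ x_i e_j - x_j e_i`. -/
noncomputable def rotField (i j : Fin n) : Eu n →L[ℝ] Eu n :=
  (EuclideanSpace.proj i).smulRight (EuclideanSpace.single j (1 : ℝ)) -
    (EuclideanSpace.proj j).smulRight (EuclideanSpace.single i (1 : ℝ))

theorem rotField_apply (i j : Fin n) (x : Eu n) :
    rotField i j x = x i • EuclideanSpace.single j (1 : ℝ) - x j • EuclideanSpace.single i (1 : ℝ) :=
  rfl

/-- The derivative along an infinitesimal rotation. -/
noncomputable def rotDeriv (i j : Fin n) (f : Eu n → ℝ) (x : Eu n) : ℝ :=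
  fderiv ℝ f x (rotField i j x)

/-- The component in the coordinate plane `(i, j)`. -/
noncomputable def planeProj (i j : Fin n) : Eu n →L[ℝ] Eu n :=
  (EuclideanSpace.proj i).smulRight (EuclideanSpace.single i (1 : ℝ)) +
    (EuclideanSpace.proj j).smulRight (EuclideanSpace.single j (1 : ℝ))

theorem planeProj_apply (i j : Fin n) (x : Eu n) :
    planeProj i j x = x i • EuclideanSpace.single i (1 : ℝ) + x j • EuclideanSpace.single j (1 : ℝ) :=
  rfl

/-- The rotation of angle `θ` in the coordinate plane `(i, j)`. -/
noncomputable def rotation (i j : Fin n) (θ : ℝ) : Eu n →L[ℝ] Eu n :=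
  ContinuousLinearMap.id ℝ _ + (Real.cos θ - 1) • planeProj i j + Real.sin θ • rotField i j

theorem norm_rotation {i j : Fin n} (hij : i ≠ j) (θ : ℝ) (x : Eu n) :
    ‖rotation i j θ x‖ = ‖x‖ := by
  have h : ‖rotation i j θ x‖ ^ 2 = ‖x‖ ^ 2 := by
    have hx : rotation i j θ x = x + ((Real.cos θ - 1) * x i - Real.sin θ * x j) •
        EuclideanSpace.single i (1 : ℝ) + ((Real.cos θ - 1) * x j + Real.sin θ * x i) •
        EuclideanSpace.single j (1 : ℝ) := by
      simp only [rotation, _root_.add_apply, _root_.smul_apply,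
        ContinuousLinearMap.id_apply, planeProj_apply, rotField_apply]
      module
    rw [hx, ← real_inner_self_eq_norm_sq, ← real_inner_self_eq_norm_sq]
    have h1 : ⟪(EuclideanSpace.single i (1 : ℝ) : Eu n), EuclideanSpace.single j (1 : ℝ)⟫_ℝ = 0 := by
      rw [EuclideanSpace.inner_single_left]; simp [hij]
    have h2 : ⟪(EuclideanSpace.single j (1 : ℝ) : Eu n), EuclideanSpace.single i (1 : ℝ)⟫_ℝ = 0 := by
      rw [EuclideanSpace.inner_single_left]; simp [hij.symm]
    have h3 : ∀ k : Fin n,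
        ⟪(EuclideanSpace.single k (1 : ℝ) : Eu n), EuclideanSpace.single k (1 : ℝ)⟫_ℝ = 1 := fun k => by
      rw [EuclideanSpace.inner_single_left]; simp
    have h4 : ∀ k : Fin n, ⟪x, EuclideanSpace.single k (1 : ℝ)⟫_ℝ = x k := by
      simp [EuclideanSpace.inner_single_right]
    have h5 : ∀ k : Fin n, ⟪EuclideanSpace.single k (1 : ℝ), x⟫_ℝ = x k := by
      simp [EuclideanSpace.inner_single_left]
    simp only [inner_add_left, inner_add_right, inner_smul_left, inner_smul_right, h1, h2, h3, h4,
      h5, RCLike.conj_to_real]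
    linear_combination (x i ^ 2 + x j ^ 2) * Real.sin_sq_add_cos_sq θ
  exact (sq_eq_sq₀ (norm_nonneg _) (norm_nonneg _)).1 h

theorem sphInt_comp_rotation {i j : Fin n} (hij : i ≠ j) (θ : ℝ) (f : Eu n → ℝ) :
    sphInt (fun x => f (rotation i j θ x)) = sphInt f := by
  let l : Eu n →ₗᵢ[ℝ] Eu n := ⟨(rotation i j θ : Eu n →ₗ[ℝ] Eu n), norm_rotation hij θ⟩
  exact sphInt_comp_isometry (l.toLinearIsometryEquiv rfl) f

/-- Integrals over the sphere of derivatives along rotations vanish. -/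
theorem sphInt_rotDeriv {O : Set (Eu n)} (hO : IsOpen O) (hS : sphere 0 1 ⊆ O) {f : Eu n → ℝ}
    (hf : ContDiffOn ℝ 1 f O) (i j : Fin n) : sphInt (rotDeriv i j f) = 0 := by
  rcases eq_or_ne i j with rfl | hij
  · have : rotDeriv i i f = fun _ => 0 := by
      funext x; simp [rotDeriv, rotField_apply]
    rw [this, sphInt_const, zero_mul]
  set R' : ℝ → Eu n →L[ℝ] Eu n := fun θ => (-Real.sin θ) • planeProj i j + Real.cos θ • rotField i j
    with hR'
  have hRd : ∀ θ, HasDerivAt (fun θ => rotation i j θ) (R' θ) θ := fun θ => by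
    unfold rotation
    have h1 := ((Real.hasDerivAt_cos θ).sub_const 1).smul_const (planeProj i j)
    have h2 := (Real.hasDerivAt_sin θ).smul_const (rotField i j)
    exact (h1.const_add (ContinuousLinearMap.id ℝ (Eu n))).add h2
  have hRS : ∀ θ, ∀ x ∈ sphere (0 : Eu n) 1, rotation i j θ x ∈ sphere (0 : Eu n) 1 :=
    fun θ x hx => by rw [mem_sphere_zero_iff_norm, norm_rotation hij] at *; exact hx
  have hfd : ContinuousOn (fderiv ℝ f) O := hf.continuousOn_fderiv_of_isOpen hO le_rfl
  obtain ⟨B, hB⟩ := (isCompact_sphere (0 : Eu n) 1).exists_bound_of_continuousOn (hfd.mono hS)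
  have hder : ∀ (ω : sphere (0 : Eu n) 1) (θ : ℝ), HasDerivAt (fun θ => f (rotation i j θ ω))
      (fderiv ℝ f (rotation i j θ ω) (R' θ ω)) θ := fun ω θ => by
    have h1 : HasFDerivAt f (fderiv ℝ f (rotation i j θ ω)) (rotation i j θ ω) :=
      ((hf.differentiableOn one_ne_zero).differentiableAt
        (hO.mem_nhds (hS (hRS θ ω ω.2)))).hasFDerivAt
    have h2 : HasDerivAt (fun θ => rotation i j θ (ω : Eu n)) (R' θ ω) θ :=
      (hRd θ).clm_apply (hasDerivAt_const θ (ω : Eu n)) |>.congr_deriv (by simp)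
    exact h1.comp_hasDerivAt θ h2
  have hbound : ∀ (ω : sphere (0 : Eu n) 1) (θ : ℝ),
      ‖fderiv ℝ f (rotation i j θ ω) (R' θ ω)‖ ≤ B * (‖planeProj i j‖ + ‖rotField i j‖) :=
    fun ω θ => by
      have hω : ‖(ω : Eu n)‖ = 1 := by simp
      have h1 : ‖R' θ ω‖ ≤ ‖planeProj i j‖ + ‖rotField i j‖ := by
        calc ‖R' θ ω‖ ≤ ‖R' θ‖ * ‖(ω : Eu n)‖ := (R' θ).le_opNorm _
          _ = ‖R' θ‖ := by rw [hω, mul_one]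
          _ ≤ ‖(-Real.sin θ) • planeProj i j‖ + ‖Real.cos θ • rotField i j‖ := norm_add_le _ _
          _ ≤ 1 * ‖planeProj i j‖ + 1 * ‖rotField i j‖ := by
            rw [norm_smul, norm_smul, norm_neg]
            gcongr
            · exact Real.abs_sin_le_one θ
            · exact Real.abs_cos_le_one θ
          _ = _ := by ring
      have h2 := hB _ (hRS θ ω ω.2)
      have hB0 : 0 ≤ B := (norm_nonneg _).trans h2
      exact ((fderiv ℝ f (rotation i j θ ω)).le_opNorm _).trans (by gcongr)
  have hcomp : ∀ θ, ContinuousOn (fun x => f (rotation i j θ x)) (sphere 0 1) := fun θ =>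
    (hf.continuousOn.mono hS).comp (rotation i j θ).continuous.continuousOn (hRS θ)
  have h0 : rotation i j 0 = ContinuousLinearMap.id ℝ (Eu n) := ContinuousLinearMap.ext fun x => by
    simp [rotation]
  have hR'0 : R' 0 = rotField i j := ContinuousLinearMap.ext fun x => by simp [hR']
  have hF'm : ContinuousOn (fun x => fderiv ℝ f (rotation i j 0 x) (R' 0 x)) (sphere 0 1) := by
    rw [h0, hR'0]
    exact (hfd.mono hS).clm_apply (rotField i j).continuous.continuousOn
  have hmain := hasDerivAt_integral_of_dominated_loc_of_deriv_le
    (μ := (volume : Measure (Eu n)).toSphere) (s := univ) (x₀ := (0 : ℝ))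
    (F := fun θ (ω : sphere (0 : Eu n) 1) => f (rotation i j θ ω))
    (F' := fun θ (ω : sphere (0 : Eu n) 1) => fderiv ℝ f (rotation i j θ ω) (R' θ ω))
    (bound := fun _ => B * (‖planeProj i j‖ + ‖rotField i j‖)) univ_mem
    (Eventually.of_forall fun θ => (sphere_integrable (hcomp θ)).aestronglyMeasurable)
    (sphere_integrable (hcomp 0)) (sphere_integrable hF'm).aestronglyMeasurable
    (Eventually.of_forall fun ω θ _ => hbound ω θ) (integrable_const _)
    (Eventually.of_forall fun ω θ _ => hder ω θ)
  -- By invariance of the measure the integral of the rotated function is constant in θ; its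
  -- derivative at θ = 0 is the integral of the rotational derivative.
  have hconst : (fun θ => ∫ ω : sphere (0 : Eu n) 1, f (rotation i j θ ω)
      ∂(volume : Measure (Eu n)).toSphere) = fun _ => sphInt f := by
    funext θ; exact sphInt_comp_rotation hij θ f
  rw [hconst] at hmain
  have := hmain.2.unique (hasDerivAt_const (0 : ℝ) (sphInt f))
  rw [← this, sphInt]
  simp [rotDeriv, h0, hR'0]

theorem continuousOn_rotDeriv {O : Set (Eu n)} (hO : IsOpen O) (hS : sphere 0 1 ⊆ O) {f : Eu n → ℝ}
    (hf : ContDiffOn ℝ 1 f O) (i j : Fin n) : ContinuousOn (rotDeriv i j f) (sphere 0 1) :=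
  ((hf.continuousOn_fderiv_of_isOpen hO le_rfl).mono hS).clm_apply
    (rotField i j).continuous.continuousOn

theorem sphInt_rotDeriv_mul {O : Set (Eu n)} (hO : IsOpen O) (hS : sphere 0 1 ⊆ O)
    {f g : Eu n → ℝ} (hf : ContDiffOn ℝ 1 f O) (hg : ContDiffOn ℝ 1 g O) (i j : Fin n) :
    sphInt (fun x => rotDeriv i j f x * g x) = -sphInt (fun x => f x * rotDeriv i j g x) := by
  have h := sphInt_rotDeriv hO hS (hf.mul hg) i j
  have h1 : EqOn (rotDeriv i j fun x => f x * g x)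
      (fun x => rotDeriv i j f x * g x + f x * rotDeriv i j g x) (sphere 0 1) := fun x hx => by
    have hfx := (hf.differentiableOn one_ne_zero).differentiableAt (hO.mem_nhds (hS hx))
    have hgx := (hg.differentiableOn one_ne_zero).differentiableAt (hO.mem_nhds (hS hx))
    simp only [rotDeriv, fderiv_fun_mul hfx hgx, _root_.add_apply,
      _root_.smul_apply, smul_eq_mul]
    ring
  have h2 : sphInt (rotDeriv i j fun x => f x * g x) = 0 := h
  rw [sphInt_congr h1, sphInt_add (f := fun x => rotDeriv i j f x * g x)
    (g := fun x => f x * rotDeriv i j g x) ((continuousOn_rotDeriv hO hS hf i j).mul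
    (hg.continuousOn.mono hS)) ((hf.continuousOn.mono hS).mul
    (continuousOn_rotDeriv hO hS hg i j))] at h2
  linarith

/-- The Dirichlet form of the sphere, written with rotation fields. -/
noncomputable def dirichlet (f g : Eu n → ℝ) : ℝ :=
  sphInt fun x => 1 / 2 * ∑ i, ∑ j, rotDeriv i j f x * rotDeriv i j g x

/-- The Laplacian of the sphere, written with rotation fields. -/
noncomputable def casimir (f : Eu n → ℝ) (x : Eu n) : ℝ :=
  1 / 2 * ∑ i, ∑ j, rotDeriv i j (rotDeriv i j f) x

theorem contDiff_rotDeriv {k : ℕ∞} {f : Eu n → ℝ} (hf : ContDiff ℝ (k + 1) f) (i j : Fin n) :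
    ContDiff ℝ k (rotDeriv i j f) :=
  (hf.fderiv_right le_rfl).clm_apply (rotField i j).contDiff

/-- Integration by parts that puts both derivatives on `g`. The function `f` is merely C¹, as the
slices of a C¹ graph are. -/
theorem dirichlet_eq_neg_sphInt_mul_casimir {O : Set (Eu n)} (hO : IsOpen O) (hS : sphere 0 1 ⊆ O)
    {f g : Eu n → ℝ} (hf : ContDiffOn ℝ 1 f O) (hg : ContDiff ℝ 2 g) :
    dirichlet f g = -sphInt (fun x => f x * casimir g x) := by
  have hg1 : ∀ i j, ContDiff ℝ 1 (rotDeriv i j g) := fun i j =>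
    contDiff_rotDeriv (k := 1) hg i j
  have hg2 : ∀ i j, Continuous (rotDeriv i j (rotDeriv i j g)) := fun i j =>
    (contDiff_rotDeriv (k := 0) (by simpa using hg1 i j) i j).continuous
  have hfc := hf.continuousOn.mono hS
  have h1 : ∀ i j, sphInt (fun x => rotDeriv i j f x * rotDeriv i j g x) =
      -sphInt (fun x => f x * rotDeriv i j (rotDeriv i j g) x) := fun i j =>
    sphInt_rotDeriv_mul hO hS hf (hg1 i j).contDiffOn i j
  have hc : ∀ i j, ContinuousOn (fun x => rotDeriv i j f x * rotDeriv i j g x) (sphere 0 1) :=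
    fun i j => (continuousOn_rotDeriv hO hS hf i j).mul (hg1 i j).continuous.continuousOn
  have hc' : ∀ i j, ContinuousOn (fun x => f x * rotDeriv i j (rotDeriv i j g) x) (sphere 0 1) :=
    fun i j => hfc.mul (hg2 i j).continuousOn
  rw [dirichlet, sphInt_const_mul, sphInt_sum _ fun i _ => continuousOn_finsetSum _ fun j _ => hc i j]
  have h2 : (fun x => f x * casimir g x) =
      fun x => 1 / 2 * ∑ i, ∑ j, f x * rotDeriv i j (rotDeriv i j g) x := by
    funext x
    simp only [casimir, ← Finset.mul_sum]
    ring
  rw [h2, sphInt_const_mul, sphInt_sum _ fun i _ => continuousOn_finsetSum _ fun j _ => hc' i j,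
    ← mul_neg, ← Finset.sum_neg_distrib]
  congr 1
  refine Finset.sum_congr rfl fun i _ => ?_
  rw [sphInt_sum _ fun j _ => hc i j, sphInt_sum _ fun j _ => hc' i j, ← Finset.sum_neg_distrib]
  exact Finset.sum_congr rfl fun j _ => h1 i j

theorem fderiv_rotField (f : Eu n → ℝ) (x : Eu n) (i j : Fin n) :
    rotDeriv i j f x = x i * fderiv ℝ f x (EuclideanSpace.single j 1) -
      x j * fderiv ℝ f x (EuclideanSpace.single i 1) := by
  simp [rotDeriv, rotField_apply]

theorem sum_sum_sub_sq (a b : Fin n → ℝ) :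
    ∑ i, ∑ j, (a i * b j - a j * b i) ^ 2 =
      2 * ((∑ i, a i ^ 2) * (∑ i, b i ^ 2) - (∑ i, a i * b i) ^ 2) := by
  have h : ∀ i j, (a i * b j - a j * b i) ^ 2 =
      a i ^ 2 * b j ^ 2 + b i ^ 2 * a j ^ 2 - 2 * ((a i * b i) * (a j * b j)) := fun i j => by ring
  simp only [h, Finset.sum_sub_distrib, Finset.sum_add_distrib, ← Finset.mul_sum, ← Finset.sum_mul]
  ring

/-- The Lagrange identity for the tangential gradient. -/
theorem half_sum_rotDeriv_sq (f : Eu n → ℝ) (x : Eu n) :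
    1 / 2 * ∑ i, ∑ j, rotDeriv i j f x * rotDeriv i j f x =
      ‖x‖ ^ 2 * ‖fderiv ℝ f x‖ ^ 2 - (fderiv ℝ f x x) ^ 2 := by
  set g := (InnerProductSpace.toDual ℝ (Eu n)).symm (fderiv ℝ f x) with hg
  have h1 : ∀ v, fderiv ℝ f x v = ⟪g, v⟫_ℝ := fun v => by
    rw [hg, InnerProductSpace.toDual_symm_apply]
  have h2 : ‖fderiv ℝ f x‖ = ‖g‖ := by rw [hg, LinearIsometryEquiv.norm_map]
  have h3 : ∀ i, fderiv ℝ f x (EuclideanSpace.single i 1) = g i := fun i => by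
    rw [h1, EuclideanSpace.inner_single_right]; simp
  have h4 : fderiv ℝ f x x = ∑ i, x i * g i := by
    rw [h1, PiLp.inner_apply]
    simp
  simp only [fderiv_rotField, h3, ← sq]
  rw [sum_sum_sub_sq, h4, h2, EuclideanSpace.real_norm_sq_eq, EuclideanSpace.real_norm_sq_eq]
  ring

end SphereIntegral

/-! ### Polynomials as approximate eigenfunctions of the spherical Laplacian -/

section SpectralGap

open Filter Topology Metric

variable {n : ℕ}

/-- The power `x ↦ ⟪a, x⟫ ^ k` of a linear form. -/
noncomputable def linPow (a : Eu n) (k : ℕ) (x : Eu n) : ℝ := ⟪a, x⟫_ℝ ^ k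

theorem contDiff_linPow (a : Eu n) (k : ℕ) {m : WithTop ℕ∞} : ContDiff ℝ m (linPow a k) :=
  (contDiff_const.inner ℝ contDiff_id).pow k

theorem rotDeriv_linPow (a : Eu n) (k : ℕ) (i j : Fin n) :
    rotDeriv i j (linPow a k) = fun x => k * ⟪a, x⟫_ℝ ^ (k - 1) * ⟪a, rotField i j x⟫_ℝ := by
  funext x
  have h : HasFDerivAt (linPow a k) ((k * ⟪a, x⟫_ℝ ^ (k - 1)) • innerSL ℝ a) x := by
    have h1 : HasFDerivAt (fun x => ⟪a, x⟫_ℝ) (innerSL ℝ a) x := (innerSL ℝ a).hasFDerivAt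
    exact (h1.pow k).congr_fderiv (by ext v; simp [nsmul_eq_mul, mul_smul])
  rw [rotDeriv, h.fderiv]
  simp [_root_.smul_apply]

theorem rotField_rotField (i j : Fin n) (x : Eu n) :
    rotField i j (rotField i j x) = if i = j then 0 else -planeProj i j x := by
  split_ifs with h
  · subst h; simp [rotField_apply]
  · have h' : j ≠ i := fun h' => h h'.symm
    simp [rotField_apply, planeProj_apply, h, h']
    module

/-- The squares of the first order terms add up by Lagrange's identity. For i ≠ j the square of a
rotation field is minus the projection to its coordinate plane, and each coordinate belongs to n - 1
such planes; this gives the factor n - 1. Where a truncated exponent occurs, its coefficient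
vanishes. -/
theorem casimir_linPow (a : Eu n) (k : ℕ) (x : Eu n) :
    casimir (linPow a k) x =
      k * (k - 1 : ℕ) * ⟪a, x⟫_ℝ ^ (k - 1 - 1) * (‖x‖ ^ 2 * ‖a‖ ^ 2 - ⟪a, x⟫_ℝ ^ 2) -
        k * ⟪a, x⟫_ℝ ^ (k - 1) * ((n - 1 : ℝ) * ⟪a, x⟫_ℝ) := by
  have h1 : ∀ i j, rotDeriv i j (rotDeriv i j (linPow a k)) x =
      k * (k - 1 : ℕ) * ⟪a, x⟫_ℝ ^ (k - 1 - 1) * ⟪a, rotField i j x⟫_ℝ ^ 2 +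
        k * ⟪a, x⟫_ℝ ^ (k - 1) * ⟪a, rotField i j (rotField i j x)⟫_ℝ := fun i j => by
    have h2 : HasFDerivAt (fun x => k * ⟪a, x⟫_ℝ ^ (k - 1) * ⟪a, rotField i j x⟫_ℝ)
        ((k * ⟪a, x⟫_ℝ ^ (k - 1)) • ((innerSL ℝ a).comp (rotField i j)) + ⟪a, rotField i j x⟫_ℝ •
          ((k : ℝ) • (((k - 1 : ℕ) * ⟪a, x⟫_ℝ ^ (k - 1 - 1)) • innerSL ℝ a))) x := by
      have h3 : HasFDerivAt (fun x => ⟪a, x⟫_ℝ) (innerSL ℝ a) x := (innerSL ℝ a).hasFDerivAt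
      have h4 : HasFDerivAt (fun x => ⟪a, rotField i j x⟫_ℝ) ((innerSL ℝ a).comp (rotField i j)) x :=
        ((innerSL ℝ a).comp (rotField i j)).hasFDerivAt
      have h5 := (h3.pow (k - 1)).const_mul (k : ℝ)
      exact (h5.mul h4).congr_fderiv (by ext v; simp [nsmul_eq_mul, mul_smul])
    rw [rotDeriv_linPow, rotDeriv, h2.fderiv]
    simp [_root_.smul_apply, _root_.add_apply]
    ring
  have ha : ∀ i : Fin n, ⟪a, EuclideanSpace.single i (1 : ℝ)⟫_ℝ = a i := fun i => by
    rw [EuclideanSpace.inner_single_right]; simp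
  have h2 : ∀ i j, ⟪a, rotField i j x⟫_ℝ = x i * a j - x j * a i := fun i j => by
    rw [rotField_apply, inner_sub_right, inner_smul_right, inner_smul_right, ha, ha]
  have hax : ∑ i, x i * a i = ⟪a, x⟫_ℝ := by rw [PiLp.inner_apply]; simp
  have h3 : ∑ i, ∑ j, ⟪a, rotField i j x⟫_ℝ ^ 2 = 2 * (‖x‖ ^ 2 * ‖a‖ ^ 2 - ⟪a, x⟫_ℝ ^ 2) := by
    simp only [h2]
    rw [sum_sum_sub_sq, EuclideanSpace.real_norm_sq_eq, EuclideanSpace.real_norm_sq_eq, hax]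
  have h4 : ∑ i, ∑ j, ⟪a, rotField i j (rotField i j x)⟫_ℝ = -2 * ((n - 1 : ℝ) * ⟪a, x⟫_ℝ) := by
    have h5 : ∀ i j, ⟪a, rotField i j (rotField i j x)⟫_ℝ =
        (if i = j then 2 * (x i * a i) else 0) - x i * a i - x j * a j := fun i j => by
      rw [rotField_rotField]
      split_ifs with h
      · subst h; rw [inner_zero_right]; ring
      · rw [inner_neg_right, planeProj_apply, inner_add_right, inner_smul_right, inner_smul_right,
          ha, ha]; ring
    simp only [h5, Finset.sum_sub_distrib, Finset.sum_ite_eq, Finset.mem_univ, if_true,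
      Finset.sum_const, Finset.card_univ, Fintype.card_fin, nsmul_eq_mul, ← Finset.mul_sum, hax]
    ring
  simp only [casimir, h1, Finset.sum_add_distrib, ← Finset.mul_sum]
  rw [h3, h4]
  ring

/-- The span of the powers of linear forms of degree less than `k`. -/
noncomputable def polySpace (n k : ℕ) : Submodule ℝ (Eu n → ℝ) :=
  Submodule.span ℝ {f | ∃ j < k, ∃ a : Eu n, f = linPow a j}

theorem polySpace_mono {k l : ℕ} (h : k ≤ l) : polySpace n k ≤ polySpace n l :=
  Submodule.span_mono fun _ ⟨j, hj, a, hf⟩ => ⟨j, hj.trans_le h, a, hf⟩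

theorem linPow_mem_polySpace (a : Eu n) {j k : ℕ} (h : j < k) : linPow a j ∈ polySpace n k :=
  Submodule.subset_span ⟨j, h, a, rfl⟩

/-- Induction on the degree: ⟪a, x⟫^(j+1) is the combination with coefficients a_i of the products
x_i ⟪a, x⟫^j, so the span lies in n images of the previous one. -/
theorem finiteDimensional_span_linPow (n j : ℕ) :
    FiniteDimensional ℝ (Submodule.span ℝ (range fun a : Eu n => linPow a j)) := by
  induction j with
  | zero =>
    have : range (fun a : Eu n => linPow a 0) ⊆ {fun _ => 1} := by
      rintro _ ⟨a, rfl⟩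
      exact mem_singleton_iff.2 (funext fun x => by simp [linPow])
    exact FiniteDimensional.span_of_finite ℝ ((finite_singleton _).subset this)
  | succ j ih =>
    set X := Submodule.span ℝ (range fun a : Eu n => linPow a j)
    let T : Fin n → (Eu n → ℝ) →ₗ[ℝ] (Eu n → ℝ) := fun i =>
      LinearMap.mulLeft ℝ (fun x : Eu n => x i)
    have hle : Submodule.span ℝ (range fun a : Eu n => linPow a (j + 1)) ≤ ⨆ i, X.map (T i) := by
      refine Submodule.span_le.2 ?_
      rintro _ ⟨a, rfl⟩
      have h1 : linPow a (j + 1) = ∑ i, a i • T i (linPow a j) := by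
        funext x
        have hax : ⟪a, x⟫_ℝ = ∑ i, a i * x i := by
          rw [PiLp.inner_apply]; simp [mul_comm]
        simp only [linPow, T, pow_succ', Finset.sum_apply, Pi.smul_apply, LinearMap.mulLeft_apply,
          Pi.mul_apply, smul_eq_mul, ← mul_assoc, ← Finset.sum_mul]
        rw [hax]
      show linPow a (j + 1) ∈ ⨆ i, X.map (T i)
      rw [h1]
      refine Submodule.sum_mem _ fun i _ => Submodule.smul_mem _ _ ?_
      exact Submodule.mem_iSup_of_mem i (Submodule.mem_map_of_mem (Submodule.subset_span ⟨a, rfl⟩))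
    exact Submodule.finiteDimensional_of_le hle

instance finiteDimensional_polySpace (n k : ℕ) : FiniteDimensional ℝ (polySpace n k) := by
  have := finiteDimensional_span_linPow n
  have hle : polySpace n k ≤ ⨆ j : Fin k, Submodule.span ℝ (range fun a : Eu n => linPow a j) := by
    refine Submodule.span_le.2 ?_
    rintro _ ⟨j, hj, a, rfl⟩
    exact Submodule.mem_iSup_of_mem (⟨j, hj⟩ : Fin k) (Submodule.subset_span ⟨a, rfl⟩)
  exact Submodule.finiteDimensional_of_le hle

theorem contDiff_of_mem_polySpace {k : ℕ} {f : Eu n → ℝ} (hf : f ∈ polySpace n k)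
    {m : WithTop ℕ∞} : ContDiff ℝ m f := by
  induction hf using Submodule.span_induction with
  | mem f h => obtain ⟨j, -, a, rfl⟩ := h; exact contDiff_linPow a j
  | zero => exact contDiff_const
  | add f g _ _ hf hg => exact hf.add hg
  | smul c f _ hf => exact contDiff_const.smul hf

theorem rotDeriv_add {f g : Eu n → ℝ} (hf : Differentiable ℝ f) (hg : Differentiable ℝ g)
    (i j : Fin n) : rotDeriv i j (f + g) = rotDeriv i j f + rotDeriv i j g := by
  funext x
  simp [rotDeriv, fderiv_add (hf x) (hg x), _root_.add_apply]

theorem rotDeriv_smul {f : Eu n → ℝ} (hf : Differentiable ℝ f) (c : ℝ) (i j : Fin n) :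
    rotDeriv i j (c • f) = c • rotDeriv i j f := by
  funext x
  simp [rotDeriv, fderiv_const_smul (hf x), _root_.smul_apply]

theorem casimir_add {f g : Eu n → ℝ} (hf : ContDiff ℝ 2 f) (hg : ContDiff ℝ 2 g) :
    casimir (f + g) = casimir f + casimir g := by
  funext x
  have hd : ∀ {f : Eu n → ℝ}, ContDiff ℝ 2 f → ∀ i j, Differentiable ℝ (rotDeriv i j f) :=
    fun hf i j => (contDiff_rotDeriv (k := 1) hf i j).differentiable one_ne_zero
  simp only [casimir, Pi.add_apply, rotDeriv_add (hf.differentiable two_ne_zero)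
    (hg.differentiable two_ne_zero), rotDeriv_add (hd hf _ _) (hd hg _ _), Finset.sum_add_distrib]
  ring

theorem casimir_smul {f : Eu n → ℝ} (hf : ContDiff ℝ 2 f) (c : ℝ) :
    casimir (c • f) = c • casimir f := by
  funext x
  have hd : ∀ i j, Differentiable ℝ (rotDeriv i j f) :=
    fun i j => (contDiff_rotDeriv (k := 1) hf i j).differentiable one_ne_zero
  simp only [casimir, rotDeriv_smul (hf.differentiable two_ne_zero), rotDeriv_smul (hd _ _),
    Pi.smul_apply, smul_eq_mul, ← Finset.mul_sum]
  ring

/-- Modulo lower degrees, the spherical Laplacian acts on polynomials of degree `k` as the scalar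
`-k (k + n - 2)`. -/
theorem casimir_of_mem_polySpace {k : ℕ} {f : Eu n → ℝ} (hf : f ∈ polySpace n (k + 1)) :
    ∃ g ∈ polySpace n k, EqOn (casimir f)
      (fun x => -((k : ℝ) * (k + n - 2)) * f x + g x) (sphere 0 1) := by
  induction hf using Submodule.span_induction with
  | mem f h =>
    obtain ⟨j, hj, a, rfl⟩ := h
    -- The term of degree j - 2 has coefficient zero for j = 0 and j = 1, so truncated subtraction
    -- does no harm.
    have hcas : ∀ x ∈ sphere (0 : Eu n) 1, casimir (linPow a j) x =
        -((j : ℝ) * (j + n - 2)) * linPow a j x + (j * (j - 1 : ℕ) * ‖a‖ ^ 2) * linPow a (j - 2) x := by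
      intro x hx
      rw [mem_sphere_zero_iff_norm] at hx
      rw [casimir_linPow, hx]
      simp only [linPow]
      rcases j with _ | _ | j
      · simp
      · simp; ring
      · simp only [Nat.add_sub_cancel, Nat.reduceSubDiff]
        push_cast
        ring
    -- A power of degree j < k already counts as lower order, so the difference of the two scalars
    -- is moved into the remainder `g`.
    rcases Nat.lt_succ_iff_lt_or_eq.1 hj with hj | rfl
    · refine ⟨((k : ℝ) * (k + n - 2) - (j : ℝ) * (j + n - 2)) • linPow a j +
        (j * (j - 1 : ℕ) * ‖a‖ ^ 2) • linPow a (j - 2), Submodule.add_mem _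
          (Submodule.smul_mem _ _ (linPow_mem_polySpace a hj))
          (Submodule.smul_mem _ _ (linPow_mem_polySpace a (by omega))), fun x hx => ?_⟩
      simp only [hcas x hx, Pi.add_apply, Pi.smul_apply, smul_eq_mul]
      ring
    · refine ⟨(j * (j - 1 : ℕ) * ‖a‖ ^ 2) • linPow a (j - 2), ?_, fun x hx => ?_⟩
      · rcases j with _ | j
        · simp
        · exact Submodule.smul_mem _ _ (linPow_mem_polySpace a (by omega))
      · simp only [hcas x hx, Pi.smul_apply, smul_eq_mul]
  | zero =>
    refine ⟨0, Submodule.zero_mem _, fun x _ => ?_⟩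
    have h0 : ∀ i j : Fin n, rotDeriv i j (0 : Eu n → ℝ) = 0 := fun i j => by
      funext x; simp [rotDeriv]
    simp [casimir, h0]
  | add f g hf hg ihf ihg =>
    obtain ⟨p, hp, hpe⟩ := ihf
    obtain ⟨q, hq, hqe⟩ := ihg
    refine ⟨p + q, Submodule.add_mem _ hp hq, fun x hx => ?_⟩
    rw [casimir_add (contDiff_of_mem_polySpace hf) (contDiff_of_mem_polySpace hg), Pi.add_apply,
      hpe hx, hqe hx]
    simp only [Pi.add_apply]
    ring
  | smul c f hf ihf =>
    obtain ⟨p, hp, hpe⟩ := ihf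
    refine ⟨c • p, Submodule.smul_mem _ _ hp, fun x hx => ?_⟩
    rw [casimir_smul (contDiff_of_mem_polySpace hf), Pi.smul_apply, hpe hx]
    simp only [Pi.smul_apply, smul_eq_mul]
    ring

/-- The orthogonal projection onto a space of polynomials restricted to the sphere. -/
theorem exists_polySpace_projection (k : ℕ) {v : Eu n → ℝ} (hv : ContinuousOn v (sphere 0 1)) :
    ∃ f ∈ polySpace n k, ∀ h ∈ polySpace n k, sphInt (fun x => (v x - f x) * h x) = 0 := by
  set μ := (volume : Measure (Eu n)).toSphere
  have hL : ∀ {f : Eu n → ℝ}, ContinuousOn f (sphere 0 1) →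
      MemLp (fun ω : sphere (0 : Eu n) 1 => f ω) 2 μ := fun {f} hf => by
    have hc : Continuous (fun ω : sphere (0 : Eu n) 1 => f ω) := hf.domRestrict
    obtain ⟨B, hB⟩ := (isCompact_univ (X := sphere (0 : Eu n) 1)).exists_bound_of_continuousOn
      hc.continuousOn
    exact MemLp.of_bound hc.aestronglyMeasurable B (Eventually.of_forall fun p => hB _ trivial)
  have hW : ∀ f : polySpace n k, ContinuousOn (f : Eu n → ℝ) (sphere 0 1) := fun f =>
    (contDiff_of_mem_polySpace (m := 0) f.2).continuous.continuousOn
  -- Different polynomials can agree on the sphere, so `T` need not be injective. The projection is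
  -- taken onto its range and then lifted to some preimage.
  let T : polySpace n k →ₗ[ℝ] Lp ℝ 2 μ :=
    { toFun := fun f => (hL (hW f)).toLp
      map_add' := fun f g => rfl
      map_smul' := fun c f => rfl }
  set Y := LinearMap.range T
  set w : Lp ℝ 2 μ := (hL hv).toLp with hw
  obtain ⟨f, hf⟩ : Y.starProjection w ∈ Y := Submodule.starProjection_apply_mem _ _
  refine ⟨f, f.2, fun h hh => ?_⟩
  have h1 : ⟪T ⟨h, hh⟩, w - T f⟫_ℝ = 0 := by
    rw [hf]
    exact Submodule.inner_right_of_mem_orthogonal (LinearMap.mem_range_self T ⟨h, hh⟩)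
      (Submodule.sub_starProjection_mem_orthogonal w)
  rw [L2.inner_def] at h1
  rw [sphInt, ← h1]
  refine integral_congr_ae ?_
  filter_upwards [Lp.coeFn_sub w (T f), (hL (hW ⟨h, hh⟩)).coeFn_toLp, (hL hv).coeFn_toLp,
    (hL (hW f)).coeFn_toLp] with ω h2 h3 h4 h5
  have h3' : (T ⟨h, hh⟩ : sphere (0 : Eu n) 1 → ℝ) ω = h ω := h3
  have h5' : (T f : sphere (0 : Eu n) 1 → ℝ) ω = (f : Eu n → ℝ) ω := h5
  rw [h2, Pi.sub_apply, h3', h5', hw, h4]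
  simp [mul_comm]

/-- Polynomials are dense in the continuous functions on the sphere. -/
theorem exists_polySpace_near {v : Eu n → ℝ} (hv : ContinuousOn v (sphere 0 1)) {ε : ℝ}
    (hε : 0 < ε) : ∃ k, ∃ f ∈ polySpace n k, ∀ x ∈ sphere (0 : Eu n) 1, |v x - f x| ≤ ε := by
  set X := sphere (0 : Eu n) 1
  let F : Eu n → C(X, ℝ) := fun a => ⟨fun ω => ⟪a, (ω : Eu n)⟫_ℝ, by fun_prop⟩
  -- The exponentials exp ⟪a, x⟫ lie in the closed span of the powers of linear forms. They are
  -- closed under multiplication, so their span is an algebra to which Stone-Weierstrass applies.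
  let W : Submodule ℝ C(X, ℝ) := Submodule.span ℝ {g | ∃ a j, g = F a ^ j}
  have hexp : ∀ a, NormedSpace.exp (F a) ∈ W.topologicalClosure := fun a => by
    have hs := NormedSpace.exp_series_hasSum_exp' (𝕂 := ℝ) (F a)
    refine W.isClosed_topologicalClosure.mem_of_tendsto hs (Eventually.of_forall fun s => ?_)
    exact W.le_topologicalClosure (Submodule.sum_mem _ fun j _ => Submodule.smul_mem _ _
      (Submodule.subset_span ⟨a, j, rfl⟩))
  let M : Submonoid C(X, ℝ) :=
    { carrier := range fun a => NormedSpace.exp (F a)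
      one_mem' := ⟨0, by
        have : F 0 = 0 := by ext ω; simp [F]
        simp [this]⟩
      mul_mem' := by
        rintro _ _ ⟨a, rfl⟩ ⟨b, rfl⟩
        refine ⟨a + b, ?_⟩
        have : F (a + b) = F a + F b := by ext ω; simp [F, inner_add_left]
        simp only [this]
        exact NormedSpace.exp_add }
  let A : Subalgebra ℝ C(X, ℝ) := Algebra.adjoin ℝ (M : Set C(X, ℝ))
  -- The exponential with a = x - y distinguishes x from y, since ⟪x - y, x⟫ = ⟪x - y, y⟫ would
  -- force x = y.
  have hsep : A.SeparatesPoints := by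
    intro x y hxy
    have hxy' : (x : Eu n) - y ≠ 0 := fun h => hxy (Subtype.ext (sub_eq_zero.1 h))
    refine ⟨_, ⟨NormedSpace.exp (F ((x : Eu n) - y)), Algebra.subset_adjoin ⟨_, rfl⟩, rfl⟩, ?_⟩
    have hev : ∀ z : X, NormedSpace.exp (F ((x : Eu n) - y)) z =
        Real.exp (F ((x : Eu n) - y) z) := fun z => by
      have := NormedSpace.map_exp (ContinuousMap.evalAlgHom ℝ ℝ z)
        (continuous_eval_const z) (F ((x : Eu n) - y))
      rw [Real.exp_eq_exp_ℝ]
      exact this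
    intro h
    have h1 := Real.exp_injective (((hev x).symm.trans h).trans (hev y))
    have h2 : ⟪(x : Eu n) - y, (x : Eu n) - y⟫_ℝ = 0 := by
      rw [inner_sub_right]
      exact sub_eq_zero.2 h1
    exact hxy' (inner_self_eq_zero.1 h2)
  have hAW : ∀ g ∈ A, g ∈ W.topologicalClosure := fun g hg => by
    have h1 : g ∈ Subalgebra.toSubmodule A := hg
    rw [Algebra.adjoin_eq_span, Submonoid.closure_eq] at h1
    refine Submodule.span_le.2 ?_ h1
    rintro _ ⟨a, rfl⟩
    exact hexp a
  obtain ⟨g, hg⟩ := ContinuousMap.exists_mem_subalgebra_near_continuous_of_separatesPoints A hsep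
    (fun ω : X => v ω) hv.domRestrict (ε / 2) (half_pos hε)
  obtain ⟨p, hpW, hp⟩ := Metric.mem_closure_iff.1 (hAW g g.2) (ε / 2) (half_pos hε)
  have hlift : ∀ p ∈ W, ∃ k, ∃ f ∈ polySpace n k, ∀ ω : X, p ω = f ω := fun p hp => by
    induction hp using Submodule.span_induction with
    | mem p h =>
      obtain ⟨a, j, rfl⟩ := h
      exact ⟨j + 1, linPow a j, linPow_mem_polySpace a (Nat.lt_succ_self j), fun ω => rfl⟩
    | zero => exact ⟨0, 0, Submodule.zero_mem _, fun ω => rfl⟩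
    | add p q _ _ ihp ihq =>
      obtain ⟨k, f, hf, hpf⟩ := ihp
      obtain ⟨l, g, hg, hqg⟩ := ihq
      exact ⟨max k l, f + g, Submodule.add_mem _ (polySpace_mono (le_max_left _ _) hf)
        (polySpace_mono (le_max_right _ _) hg), fun ω => by
          rw [ContinuousMap.add_apply, hpf, hqg]; rfl⟩
    | smul c p _ ihp =>
      obtain ⟨k, f, hf, hpf⟩ := ihp
      exact ⟨k, c • f, Submodule.smul_mem _ _ hf, fun ω => by
        rw [ContinuousMap.smul_apply, hpf]; rfl⟩
  obtain ⟨k, f, hf, hpf⟩ := hlift p hpW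
  refine ⟨k, f, hf, fun x hx => ?_⟩
  have h1 := hg ⟨x, hx⟩
  have h2 := (ContinuousMap.dist_apply_le_dist (f := (g : C(X, ℝ))) (g := p) ⟨x, hx⟩).trans_lt hp
  rw [Real.dist_eq, hpf] at h2
  rw [Real.norm_eq_abs] at h1
  have := abs_sub_le (v x) ((g : C(X, ℝ)) ⟨x, hx⟩) (f x)
  rw [abs_sub_comm] at h1
  simp only at h1 h2
  linarith

end SpectralGap

/-! ### The spectral gap for C¹ functions on the sphere -/

section SpectralGap

open Filter Topology Metric

variable {n : ℕ}

theorem dirichlet_self_nonneg (f : Eu n → ℝ) : 0 ≤ dirichlet f f :=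
  sphInt_nonneg fun x _ => mul_nonneg (by norm_num) (Finset.sum_nonneg fun i _ =>
    Finset.sum_nonneg fun j _ => mul_self_nonneg _)

theorem dirichlet_sub_self {O : Set (Eu n)} (hO : IsOpen O) (hS : sphere 0 1 ⊆ O)
    {f g : Eu n → ℝ} (hf : ContDiffOn ℝ 1 f O) (hg : ContDiffOn ℝ 1 g O) :
    dirichlet (fun x => f x - g x) (fun x => f x - g x) =
      dirichlet f f - 2 * dirichlet f g + dirichlet g g := by
  have hc : ∀ {f g : Eu n → ℝ}, ContDiffOn ℝ 1 f O → ContDiffOn ℝ 1 g O → ContinuousOn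
      (fun x => 1 / 2 * ∑ i, ∑ j, rotDeriv i j f x * rotDeriv i j g x) (sphere 0 1) :=
    fun hf hg => continuousOn_const.mul (continuousOn_finsetSum _ fun i _ =>
      continuousOn_finsetSum _ fun j _ => (continuousOn_rotDeriv hO hS hf i j).mul
        (continuousOn_rotDeriv hO hS hg i j))
  have h1 : EqOn (fun x => 1 / 2 * ∑ i, ∑ j, rotDeriv i j (fun x => f x - g x) x *
      rotDeriv i j (fun x => f x - g x) x)
      (fun x => ((1 / 2 * ∑ i, ∑ j, rotDeriv i j f x * rotDeriv i j f x) -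
        2 * (1 / 2 * ∑ i, ∑ j, rotDeriv i j f x * rotDeriv i j g x)) +
        1 / 2 * ∑ i, ∑ j, rotDeriv i j g x * rotDeriv i j g x) (sphere 0 1) := fun x hx => by
    have hfx := (hf.differentiableOn one_ne_zero).differentiableAt (hO.mem_nhds (hS hx))
    have hgx := (hg.differentiableOn one_ne_zero).differentiableAt (hO.mem_nhds (hS hx))
    have h2 : ∀ i j, rotDeriv i j (fun x => f x - g x) x = rotDeriv i j f x - rotDeriv i j g x :=
      fun i j => by rw [rotDeriv, fderiv_fun_sub hfx hgx]; rfl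
    have h3 : ∀ i j, rotDeriv i j (fun x => f x - g x) x * rotDeriv i j (fun x => f x - g x) x =
        rotDeriv i j f x * rotDeriv i j f x - 2 * (rotDeriv i j f x * rotDeriv i j g x) +
          rotDeriv i j g x * rotDeriv i j g x := fun i j => by rw [h2]; ring
    simp only [h3, Finset.sum_add_distrib, Finset.sum_sub_distrib, ← Finset.mul_sum]
    ring
  have hff := hc hf hf
  have hfg := hc hf hg
  have hgg := hc hg hg
  rw [dirichlet, sphInt_congr h1, sphInt_add, sphInt_sub, sphInt_const_mul 2]
  · rfl
  · exact hff
  · exact continuousOn_const.mul hfg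
  · exact hff.sub (continuousOn_const.mul hfg)
  · exact hgg

theorem contDiffOn_of_mem_polySpace {k : ℕ} {f : Eu n → ℝ} (hf : f ∈ polySpace n k)
    {m : WithTop ℕ∞} (O : Set (Eu n)) : ContDiffOn ℝ m f O :=
  (contDiff_of_mem_polySpace hf).contDiffOn

theorem continuousOn_of_mem_polySpace {k : ℕ} {f : Eu n → ℝ} (hf : f ∈ polySpace n k)
    (O : Set (Eu n)) : ContinuousOn f O :=
  (contDiff_of_mem_polySpace (m := 0) hf).continuous.continuousOn

/-- A function orthogonal to polynomials of degree at most `k` is orthogonal in the Dirichlet form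
to them as well. -/
theorem dirichlet_eq_of_orthogonal {O : Set (Eu n)} (hO : IsOpen O) (hS : sphere 0 1 ⊆ O)
    {k : ℕ} {v : Eu n → ℝ} (hv : ContDiffOn ℝ 1 v O)
    (h : ∀ p ∈ polySpace n k, sphInt (fun x => v x * p x) = 0) {f : Eu n → ℝ}
    (hf : f ∈ polySpace n (k + 1)) :
    dirichlet v f = (k : ℝ) * (k + n - 2) * sphInt (fun x => v x * f x) := by
  obtain ⟨g, hg, hcas⟩ := casimir_of_mem_polySpace hf
  have hvc := hv.continuousOn.mono hS
  rw [dirichlet_eq_neg_sphInt_mul_casimir hO hS hv (contDiff_of_mem_polySpace hf)]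
  have h1 : EqOn (fun x => v x * casimir f x)
      (fun x => -((k : ℝ) * (k + n - 2)) * (v x * f x) + v x * g x) (sphere 0 1) := fun x hx => by
    simp only [hcas hx]; ring
  have hfc := continuousOn_of_mem_polySpace hf (sphere 0 1)
  have hgc := continuousOn_of_mem_polySpace hg (sphere 0 1)
  rw [sphInt_congr h1, sphInt_add, sphInt_const_mul, h g hg]
  · ring
  all_goals fun_prop

theorem dirichlet_eq_zero_of_orthogonal {O : Set (Eu n)} (hO : IsOpen O) (hS : sphere 0 1 ⊆ O)
    {k : ℕ} {v : Eu n → ℝ} (hv : ContDiffOn ℝ 1 v O)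
    (h : ∀ p ∈ polySpace n k, sphInt (fun x => v x * p x) = 0) {f : Eu n → ℝ}
    (hf : f ∈ polySpace n k) : dirichlet v f = 0 := by
  rw [dirichlet_eq_of_orthogonal hO hS hv h (polySpace_mono (Nat.le_succ k) hf), h f hf, mul_zero]

theorem sphInt_sub_mul {f g h : Eu n → ℝ} (hf : ContinuousOn f (sphere 0 1))
    (hg : ContinuousOn g (sphere 0 1)) (hh : ContinuousOn h (sphere 0 1)) :
    sphInt (fun x => (f x - g x) * h x) =
      sphInt (fun x => f x * h x) - sphInt (fun x => g x * h x) := by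
  simp only [sub_mul]
  rw [sphInt_sub] <;> fun_prop

theorem sphInt_sub_sq {f g : Eu n → ℝ} (hf : ContinuousOn f (sphere 0 1))
    (hg : ContinuousOn g (sphere 0 1)) (h : sphInt (fun x => (f x - g x) * g x) = 0) :
    sphInt (fun x => (f x - g x) ^ 2) = sphInt (fun x => f x ^ 2) - sphInt (fun x => g x ^ 2) := by
  have h1 : (fun x => (f x - g x) ^ 2) =
      fun x => (f x ^ 2 - g x ^ 2) - 2 * ((f x - g x) * g x) := by funext x; ring
  rw [h1, sphInt_sub, sphInt_sub, sphInt_const_mul, h]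
  · ring
  all_goals fun_prop

/-- The spectral gap for polynomials. -/
theorem dirichlet_ge_of_mem_polySpace (k : ℕ) {f : Eu n → ℝ} (hf : f ∈ polySpace n (k + 2))
    (h : ∀ p ∈ polySpace n 2, sphInt (fun x => f x * p x) = 0) :
    2 * n * sphInt (fun x => f x ^ 2) ≤ dirichlet f f := by
  induction k generalizing f with
  | zero =>
    -- In the base case f is orthogonal to itself.
    have := h f hf
    simp only [← sq] at this
    rw [this, mul_zero]
    exact dirichlet_self_nonneg f
  | succ k ih =>
    have hU : IsOpen (univ : Set (Eu n)) := isOpen_univ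
    have hSU : sphere (0 : Eu n) 1 ⊆ univ := subset_univ _
    have hfc := continuousOn_of_mem_polySpace hf (sphere 0 1)
    -- Splitting off the part of degree below k + 2. The remainder f - q is orthogonal to all lower
    -- degrees, so the error term in the action of the Laplacian disappears and the scalar (k + 2)(k
    -- + n) ≥ 2n acts exactly; q is covered by induction.
    obtain ⟨q, hq, hort⟩ := exists_polySpace_projection (k + 2) hfc
    have hqc := continuousOn_of_mem_polySpace hq (sphere 0 1)
    have hr : (fun x => f x - q x) ∈ polySpace n (k + 1 + 2) :=
      Submodule.sub_mem _ hf (polySpace_mono (by omega) hq)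
    have hrd := contDiffOn_of_mem_polySpace (m := 1) hr univ
    have hq2 : ∀ p ∈ polySpace n 2, sphInt (fun x => q x * p x) = 0 := fun p hp => by
      have h1 := hort p (polySpace_mono (by omega) hp)
      rw [sphInt_sub_mul hfc hqc (continuousOn_of_mem_polySpace hp _), h p hp] at h1
      linarith
    have hDr := dirichlet_eq_of_orthogonal hU hSU hrd hort hr
    have hDq := dirichlet_eq_zero_of_orthogonal hU hSU hrd hort hq
    have hfd := contDiffOn_of_mem_polySpace (m := 1) hf univ
    have hqd := contDiffOn_of_mem_polySpace (m := 1) hq univ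
    have hexp := dirichlet_sub_self hU hSU hrd ((contDiffOn_const (c := (0 : ℝ))).sub hqd)
    have hff : (fun x => (f x - q x) - (0 - q x)) = f := by funext x; ring
    have hD2 : dirichlet (fun x => f x - q x) (fun x => 0 - q x) = 0 := by
      have : (fun x => 0 - q x) ∈ polySpace n (k + 2) :=
        Submodule.sub_mem _ (Submodule.zero_mem _) hq
      exact dirichlet_eq_zero_of_orthogonal hU hSU hrd hort this
    have hD3 : dirichlet (fun x => 0 - q x) (fun x => 0 - q x) = dirichlet q q := by
      have : ∀ i j x, rotDeriv i j (fun x => 0 - q x) x = -rotDeriv i j q x := fun i j x => by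
        simp only [zero_sub, rotDeriv]
        rw [fderiv_fun_neg]; rfl
      simp only [dirichlet, this, neg_mul_neg]
    rw [hff, hD2, hD3, hDr] at hexp
    have hsq := sphInt_sub_sq hfc hqc (hort q hq)
    have hih := ih hq hq2
    have hnn : 0 ≤ sphInt (fun x => (f x - q x) ^ 2) := sphInt_nonneg fun x _ => sq_nonneg _
    have hlam : (2 * n : ℝ) ≤ ((k + 2 : ℕ) : ℝ) * ((k + 2 : ℕ) + n - 2) := by
      push_cast
      have : (0 : ℝ) ≤ k := Nat.cast_nonneg k
      have : (0 : ℝ) ≤ n := Nat.cast_nonneg n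
      nlinarith
    simp only [← sq] at hexp
    rw [hexp]
    have := mul_le_mul_of_nonneg_right hlam hnn
    nlinarith

/-- The spectral gap for `C^1` functions orthogonal to the polynomials of degree at most one. -/
theorem dirichlet_ge_of_orthogonal {O : Set (Eu n)} (hO : IsOpen O) (hS : sphere 0 1 ⊆ O)
    {v : Eu n → ℝ} (hv : ContDiffOn ℝ 1 v O)
    (h : ∀ p ∈ polySpace n 2, sphInt (fun x => v x * p x) = 0) :
    2 * n * sphInt (fun x => v x ^ 2) ≤ dirichlet v v := by
  have hvc := hv.continuousOn.mono hS
  -- No convergence of gradients is needed. If f is the L² projection of v to polynomials, then v -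
  -- f and f are orthogonal in the Dirichlet form, so the form of v dominates that of f; and f is at
  -- least as close to v in L² as any uniformly approximating polynomial g.
  have key : ∀ ε : ℝ, 0 < ε →
      2 * n * sphInt (fun x => v x ^ 2) ≤ dirichlet v v + 2 * n * (sphArea n * ε ^ 2) := by
    intro ε hε
    obtain ⟨k, g, hg, hvg⟩ := exists_polySpace_near hvc hε
    have hg' : g ∈ polySpace n (k + 2) := polySpace_mono (by omega) hg
    obtain ⟨f, hf, hort⟩ := exists_polySpace_projection (k + 2) hvc
    have hfc := continuousOn_of_mem_polySpace hf (sphere 0 1)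
    have hgc := continuousOn_of_mem_polySpace hg' (sphere 0 1)
    have hfd := contDiffOn_of_mem_polySpace (m := 1) hf O
    have hf2 : ∀ p ∈ polySpace n 2, sphInt (fun x => f x * p x) = 0 := fun p hp => by
      have h1 := hort p (polySpace_mono (by omega) hp)
      rw [sphInt_sub_mul hvc hfc (continuousOn_of_mem_polySpace hp _), h p hp] at h1
      linarith
    have h1 := dirichlet_ge_of_mem_polySpace k hf hf2
    have h2 := dirichlet_eq_zero_of_orthogonal hO hS (hv.sub hfd) hort hf
    have h3 := dirichlet_sub_self hO hS (hv.sub hfd) ((contDiffOn_const (c := (0 : ℝ))).sub hfd)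
    have hff : (fun x => (v x - f x) - (0 - f x)) = v := by funext x; ring
    have hneg : (fun x => 0 - f x) ∈ polySpace n (k + 2) :=
      Submodule.sub_mem _ (Submodule.zero_mem _) hf
    have hD2 : dirichlet (fun x => v x - f x) (fun x => 0 - f x) = 0 :=
      dirichlet_eq_zero_of_orthogonal hO hS (hv.sub hfd) hort hneg
    have hD3 : dirichlet (fun x => 0 - f x) (fun x => 0 - f x) = dirichlet f f := by
      have : ∀ i j x, rotDeriv i j (fun x => 0 - f x) x = -rotDeriv i j f x := fun i j x => by
        simp only [zero_sub, rotDeriv]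
        rw [fderiv_fun_neg]; rfl
      simp only [dirichlet, this, neg_mul_neg]
    have h3' : dirichlet v v = dirichlet (fun x => v x - f x) (fun x => v x - f x) -
        2 * 0 + dirichlet f f := by
      rw [← hD2, ← hD3]
      nth_rewrite 1 [← hff]
      nth_rewrite 2 [← hff]
      exact h3
    have h4 := dirichlet_self_nonneg (fun x => v x - f x)
    have h5 := sphInt_sub_sq hvc hfc (hort f hf)
    have h6 : sphInt (fun x => (v x - f x) ^ 2) ≤ sphArea n * ε ^ 2 := by
      have hfg : (fun x => f x - g x) ∈ polySpace n (k + 2) := Submodule.sub_mem _ hf hg'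
      have h7 : sphInt (fun x => (v x - g x) ^ 2) =
          sphInt (fun x => (v x - f x) ^ 2) + sphInt (fun x => (f x - g x) ^ 2) := by
        have h8 : (fun x => (v x - g x) ^ 2) = fun x => ((v x - f x) ^ 2 + (f x - g x) ^ 2) +
            2 * ((v x - f x) * (f x - g x)) := by funext x; ring
        rw [h8, sphInt_add, sphInt_add, sphInt_const_mul, hort _ hfg]
        · ring
        all_goals fun_prop
      have h8 : sphInt (fun x => (v x - g x) ^ 2) ≤ sphInt (fun _ : Eu n => ε ^ 2) := by
        refine sphInt_mono ((hvc.sub hgc).pow 2) continuousOn_const fun x hx => ?_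
        have := hvg x hx
        rw [← sq_abs]
        gcongr
      rw [sphInt_const] at h8
      have h9 : 0 ≤ sphInt (fun x => (f x - g x) ^ 2) := sphInt_nonneg fun x _ => sq_nonneg _
      linarith
    have hn : (0 : ℝ) ≤ n := Nat.cast_nonneg n
    nlinarith
  refine le_of_forall_pos_le_add fun δ hδ => ?_
  have hA : 0 ≤ sphArea n := measureReal_nonneg
  have hn : (0 : ℝ) ≤ n := Nat.cast_nonneg n
  have hB : 0 < 2 * n * sphArea n + 1 := by positivity
  have h1 := key (Real.sqrt (δ / (2 * n * sphArea n + 1))) (Real.sqrt_pos.2 (by positivity))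
  rw [Real.sq_sqrt (by positivity)] at h1
  have h2 : 2 * n * (sphArea n * (δ / (2 * n * sphArea n + 1))) ≤ δ := by
    rw [show 2 * n * (sphArea n * (δ / (2 * n * sphArea n + 1))) =
      (2 * n * sphArea n) * δ / (2 * n * sphArea n + 1) by ring, div_le_iff₀ hB]
    nlinarith
  linarith

/-- All unit vectors are related by isometries, so the quadratic form is a multiple of the squared
norm. -/
theorem exists_sphInt_linear_sq (n : ℕ) [Nontrivial (Eu n)] :
    ∃ κ : ℝ, 0 < κ ∧ ∀ a : Eu n, sphInt (fun x => ⟪a, x⟫_ℝ ^ 2) = κ * ‖a‖ ^ 2 := by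
  obtain ⟨e, he⟩ := exists_norm_eq (Eu n) (zero_le_one' ℝ)
  refine ⟨sphInt (fun x => ⟪e, x⟫_ℝ ^ 2), ?_, fun a => ?_⟩
  · have hc : Continuous fun ω : sphere (0 : Eu n) 1 => ⟪e, (ω : Eu n)⟫_ℝ ^ 2 := by fun_prop
    refine (integral_pos_iff_support_of_nonneg (fun ω => sq_nonneg _) (sphere_integrable
      (f := fun x => ⟪e, x⟫_ℝ ^ 2) (by fun_prop))).2 ?_
    refine (hc.isOpen_support).measure_pos _ ⟨⟨e, by simpa using he⟩, ?_⟩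
    simp [he]
  · rcases eq_or_ne a 0 with rfl | ha
    · simp [sphInt]
    · have hn : ‖a‖ ≠ 0 := norm_ne_zero_iff.2 ha
      obtain ⟨l, hl⟩ := exists_sphereIsometry_eq (E := Eu n)
        ⟨‖a‖⁻¹ • a, by simp [norm_smul, hn]⟩ ⟨e, by simpa using he⟩
      have hl' : l (‖a‖⁻¹ • a) = e := congrArg Subtype.val hl
      have ha' : a = ‖a‖ • l.symm e := by
        rw [← hl', LinearIsometryEquiv.symm_apply_apply, smul_smul, mul_inv_cancel₀ hn, one_smul]
      have h1 : (fun x => ⟪a, x⟫_ℝ ^ 2) = fun x => ‖a‖ ^ 2 * (fun y => ⟪e, y⟫_ℝ ^ 2) (l x) := by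
        funext x
        nth_rewrite 1 [ha']
        rw [inner_smul_left, RCLike.conj_to_real, mul_pow, ← LinearIsometryEquiv.inner_map_map l,
          LinearIsometryEquiv.apply_symm_apply]
      rw [h1, sphInt_const_mul, sphInt_comp_isometry l (fun y => ⟪e, y⟫_ℝ ^ 2)]
      ring

theorem sphInt_linear (a : Eu n) : sphInt (fun x => ⟪a, x⟫_ℝ) = 0 := by
  have h := sphInt_comp_isometry (LinearIsometryEquiv.neg ℝ) (fun x : Eu n => ⟪a, x⟫_ℝ)
  have h1 : (fun x : Eu n => ⟪a, LinearIsometryEquiv.neg ℝ x⟫_ℝ) = fun x => (-1) * ⟪a, x⟫_ℝ := by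
    funext x; simp
  rw [h1, sphInt_const_mul] at h
  linarith

theorem mem_polySpace_two {f : Eu n → ℝ} (hf : f ∈ polySpace n 2) :
    ∃ (c : ℝ) (a : Eu n), ∀ x, f x = c + ⟪a, x⟫_ℝ := by
  induction hf using Submodule.span_induction with
  | mem f h =>
    obtain ⟨j, hj, a, rfl⟩ := h
    interval_cases j
    · exact ⟨1, 0, fun x => by simp [linPow]⟩
    · exact ⟨0, a, fun x => by simp [linPow]⟩
  | zero => exact ⟨0, 0, fun x => by simp⟩
  | add f g _ _ hf hg =>
    obtain ⟨c, a, h⟩ := hf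
    obtain ⟨d, b, h'⟩ := hg
    exact ⟨c + d, a + b, fun x => by rw [Pi.add_apply, h, h', inner_add_left]; ring⟩
  | smul t f _ hf =>
    obtain ⟨c, a, h⟩ := hf
    exact ⟨t * c, t • a, fun x => by
      rw [Pi.smul_apply, h, inner_smul_left, smul_eq_mul, RCLike.conj_to_real]; ring⟩

/-- The Poincaré inequality on the sphere, at the level of the second nonzero eigenvalue. -/
theorem exists_spectral_gap (n : ℕ) [Nontrivial (Eu n)] :
    ∃ K : ℝ, 0 < K ∧ ∀ (O : Set (Eu n)) (v : Eu n → ℝ), IsOpen O → sphere 0 1 ⊆ O →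
      ContDiffOn ℝ 1 v O →
      2 * n * (sphInt (fun x => v x ^ 2) - sphInt v ^ 2 / sphArea n) -
          K * ∑ i, sphInt (fun x => v x * x i) ^ 2 ≤
        sphInt (fun x => ‖fderiv ℝ v x‖ ^ 2 - (fderiv ℝ v x x) ^ 2) := by
  obtain ⟨κ, hκ, hlin⟩ := exists_sphInt_linear_sq n
  have hA : 0 < sphArea n := sphArea_pos
  have hn : (0 : ℝ) ≤ n := Nat.cast_nonneg n
  -- The part 2n / κ is what the degree one component of v costs; the summand 1 only makes
  -- positivity immediate.
  refine ⟨2 * n / κ + 1, by positivity, fun O v hO hS hv => ?_⟩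
  have hvc := hv.continuousOn.mono hS
  obtain ⟨f, hf, hort⟩ := exists_polySpace_projection 2 hvc
  have hfc := continuousOn_of_mem_polySpace hf (sphere 0 1)
  have hfd := contDiffOn_of_mem_polySpace (m := 1) hf O
  obtain ⟨c, a, hca⟩ := mem_polySpace_two hf
  set Z := ∑ i, sphInt (fun x => v x * x i) ^ 2 with hZ
  have hZ0 : 0 ≤ Z := Finset.sum_nonneg fun i _ => sq_nonneg _
  have hlc : ContinuousOn (fun x : Eu n => ⟪a, x⟫_ℝ) (sphere 0 1) := by fun_prop
  have hc : sphInt v = c * sphArea n := by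
    have h1 := hort (linPow 0 0) (linPow_mem_polySpace _ (by norm_num))
    have h2 : (fun x => (v x - f x) * linPow 0 0 x) = fun x => v x - f x := by
      funext x; simp [linPow]
    have h3 : f = fun x => c + ⟪a, x⟫_ℝ := funext hca
    rw [h2, sphInt_sub hvc hfc, h3, sphInt_add continuousOn_const hlc, sphInt_const,
      sphInt_linear] at h1
    linarith
  have hva : sphInt (fun x => v x * ⟪a, x⟫_ℝ) = κ * ‖a‖ ^ 2 := by
    have h1 := hort (linPow a 1) (linPow_mem_polySpace _ (by norm_num))
    have h2 : (fun x => (v x - f x) * linPow a 1 x) =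
        fun x => v x * ⟪a, x⟫_ℝ - (c * ⟪a, x⟫_ℝ + ⟪a, x⟫_ℝ ^ 2) := by
      funext x; simp only [linPow, hca]; ring
    rw [h2, sphInt_sub, sphInt_add, sphInt_const_mul, sphInt_linear, hlin] at h1
    · linarith
    all_goals fun_prop
  have hf2 : sphInt (fun x => f x ^ 2) = c ^ 2 * sphArea n + κ * ‖a‖ ^ 2 := by
    have h1 : (fun x => f x ^ 2) = fun x => (c ^ 2 + 2 * c * ⟪a, x⟫_ℝ) + ⟪a, x⟫_ℝ ^ 2 := by
      funext x; rw [hca]; ring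
    rw [h1, sphInt_add, sphInt_add, sphInt_const, sphInt_const_mul, sphInt_linear, hlin]
    · ring
    all_goals fun_prop
  -- Cauchy-Schwarz in the coefficients: κ ‖a‖² is the sum of a_i times the i-th first mode of v. It
  -- follows that the squared norm κ ‖a‖² of the linear part is at most `Z` / κ.
  have hcs : (κ * ‖a‖ ^ 2) ^ 2 ≤ ‖a‖ ^ 2 * Z := by
    rw [← hva]
    have h1 : (fun x => v x * ⟪a, x⟫_ℝ) = fun x => ∑ i, a i * (v x * x i) := by
      funext x
      rw [PiLp.inner_apply, Finset.mul_sum]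
      exact Finset.sum_congr rfl fun i _ => by simp; ring
    have hvi : ∀ i : Fin n, ContinuousOn (fun x : Eu n => v x * x i) (sphere 0 1) := fun i =>
      hvc.mul (by fun_prop)
    rw [h1, sphInt_sum]
    · simp only [sphInt_const_mul]
      rw [EuclideanSpace.real_norm_sq_eq, hZ]
      exact Finset.sum_mul_sq_le_sq_mul_sq _ _ _
    · exact fun i _ => continuousOn_const.mul (hvi i)
  have hka : κ * ‖a‖ ^ 2 ≤ Z / κ := by
    rw [le_div_iff₀ hκ]
    rcases eq_or_lt_of_le (sq_nonneg ‖a‖) with h0 | h0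
    · rw [← h0]; simpa using hZ0
    · have h1 : ‖a‖ ^ 2 * (κ ^ 2 * ‖a‖ ^ 2) ≤ ‖a‖ ^ 2 * Z := by nlinarith
      have := le_of_mul_le_mul_left h1 h0
      linarith
  have hgap := dirichlet_ge_of_orthogonal hO hS (hv.sub hfd) hort
  have hexp := dirichlet_sub_self hO hS (hv.sub hfd) ((contDiffOn_const (c := (0 : ℝ))).sub hfd)
  have hff : (fun x => (v x - f x) - (0 - f x)) = v := by funext x; ring
  have hneg : (fun x => 0 - f x) ∈ polySpace n 2 :=
    Submodule.sub_mem _ (Submodule.zero_mem _) hf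
  have hD2 : dirichlet (fun x => v x - f x) (fun x => 0 - f x) = 0 :=
    dirichlet_eq_zero_of_orthogonal hO hS (hv.sub hfd) hort hneg
  have hD3 := dirichlet_self_nonneg (fun x => 0 - f x)
  have hvv : dirichlet v v = sphInt (fun x => ‖fderiv ℝ v x‖ ^ 2 - (fderiv ℝ v x x) ^ 2) := by
    refine sphInt_congr fun x hx => ?_
    rw [mem_sphere_zero_iff_norm] at hx
    simp only [half_sum_rotDeriv_sq, hx, one_pow, one_mul]
  rw [hD2] at hexp
  have hexp' : dirichlet v v = dirichlet (fun x => v x - f x) (fun x => v x - f x) - 2 * 0 +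
      dirichlet (fun x => 0 - f x) (fun x => 0 - f x) := by
    rw [← hexp]
    exact congrArg₂ dirichlet hff.symm hff.symm
  rw [← hvv, hexp']
  have hsq := sphInt_sub_sq hvc hfc (hort f hf)
  have hg2 : 2 * n * sphInt (fun x => (v x - f x) ^ 2) ≤
    dirichlet (fun x => v x - f x) (fun x => v x - f x) := hgap
  rw [hsq, hf2] at hg2
  have hM : sphInt v ^ 2 / sphArea n = c ^ 2 * sphArea n := by
    rw [hc]; field_simp
  rw [hM]
  have h1 : 2 * n * (κ * ‖a‖ ^ 2) ≤ 2 * n * (Z / κ) := by gcongr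
  have h2 : (2 * n / κ + 1) * Z = 2 * n * (Z / κ) + Z := by ring
  rw [h2]
  linarith

end SpectralGap

/-! ### Parametrization of the spherical graph by a flat annulus -/

section GraphGeometry

open Filter Topology

variable {n : ℕ}

/-- The open annulus in the model hyperplane. -/
def eann (n : ℕ) (a b : ℝ) : Set (Eu n) := {y | a < ‖y‖ ∧ ‖y‖ < b}

theorem isOpen_eann (a b : ℝ) : IsOpen (eann n a b) :=
  (isOpen_lt continuous_const continuous_norm).inter (isOpen_lt continuous_norm continuous_const)

theorem ne_zero_of_mem_eann {a b : ℝ} (ha : 0 ≤ a) {y : Eu n} (hy : y ∈ eann n a b) : y ≠ 0 := by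
  rintro rfl
  have := hy.1
  rw [norm_zero] at this
  linarith

/-- The function `y ↦ |y| V(y)`, the height over the hyperplane. -/
noncomputable def height (V : Eu n → ℝ) (y : Eu n) : ℝ := ‖y‖ * V y

/-- The map `y ↦ √(1 - V²) ι y + |y| V ν`, whose image is a spherical graph. -/
noncomputable def graphMap (ι : Eu n →ₗᵢ[ℝ] Amb n) (ν : Amb n) (V : Eu n → ℝ) (y : Eu n) : Amb n :=
  Real.sqrt (1 - V y ^ 2) • ι y + height V y • ν

/-- The quantity `V² + |y|²|DV|²` that controls the deviation from the flat metric. -/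
noncomputable def energyDensity (V : Eu n → ℝ) (y : Eu n) : ℝ := V y ^ 2 + ‖y‖ ^ 2 * ‖fderiv ℝ V y‖ ^ 2

theorem energyDensity_nonneg (V : Eu n → ℝ) (y : Eu n) : 0 ≤ energyDensity V y := by
  unfold energyDensity; positivity

theorem hasFDerivAt_norm {y : Eu n} (hy : y ≠ 0) :
    HasFDerivAt (fun y : Eu n => ‖y‖) (‖y‖⁻¹ • innerSL ℝ y) y := by
  have h1 : HasFDerivAt (fun y : Eu n => ‖y‖ ^ 2) (2 • innerSL ℝ y) y :=
    (hasStrictFDerivAt_norm_sq y).hasFDerivAt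
  have hn : ‖y‖ ≠ 0 := norm_ne_zero_iff.2 hy
  have h2 := h1.sqrt (by positivity)
  have h3 : (fun y : Eu n => √(‖y‖ ^ 2)) = fun y => ‖y‖ := funext fun y => Real.sqrt_sq (norm_nonneg _)
  rw [h3] at h2
  refine h2.congr_fderiv ?_
  rw [Real.sqrt_sq (norm_nonneg _)]
  ext v
  simp [_root_.smul_apply]
  field_simp

theorem hasFDerivAt_height {V : Eu n → ℝ} {y : Eu n} (hV : DifferentiableAt ℝ V y) (hy : y ≠ 0) :
    HasFDerivAt (height V) (‖y‖ • fderiv ℝ V y + V y • (‖y‖⁻¹ • innerSL ℝ y)) y :=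
  (hasFDerivAt_norm hy).mul hV.hasFDerivAt

theorem fderiv_height_apply {V : Eu n → ℝ} {y : Eu n} (hV : DifferentiableAt ℝ V y) (hy : y ≠ 0)
    (v : Eu n) : fderiv ℝ (height V) y v = ‖y‖ * fderiv ℝ V y v + V y * (‖y‖⁻¹ * ⟪y, v⟫_ℝ) := by
  rw [(hasFDerivAt_height hV hy).fderiv]
  simp [_root_.smul_apply, _root_.add_apply]

theorem norm_fderiv_height_le {V : Eu n → ℝ} {y : Eu n} (hV : DifferentiableAt ℝ V y) (hy : y ≠ 0) :
    ‖fderiv ℝ (height V) y‖ ≤ |V y| + ‖y‖ * ‖fderiv ℝ V y‖ := by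
  have hn : ‖y‖ ≠ 0 := norm_ne_zero_iff.2 hy
  rw [(hasFDerivAt_height hV hy).fderiv]
  refine (norm_add_le _ _).trans ?_
  rw [norm_smul, norm_smul, norm_smul, innerSL_apply_norm, norm_inv, norm_norm,
    inv_mul_cancel₀ hn, Real.norm_eq_abs]
  linarith

variable {ι : Eu n →ₗᵢ[ℝ] Amb n} {ν : Amb n}

theorem hasFDerivAt_graphMap {V : Eu n → ℝ} {y : Eu n} (hV : DifferentiableAt ℝ V y) (hy : y ≠ 0)
    (h1 : |V y| < 1) : ∃ L : Eu n →L[ℝ] Amb n, HasFDerivAt (graphMap ι ν V) L y ∧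
      ∀ v, L v = Real.sqrt (1 - V y ^ 2) • ι v +
        (-(V y / Real.sqrt (1 - V y ^ 2)) * fderiv ℝ V y v) • ι y +
        fderiv ℝ (height V) y v • ν := by
  have h0 : 0 < 1 - V y ^ 2 := by
    have := abs_lt.1 h1
    nlinarith
  have hs : HasFDerivAt (fun y => Real.sqrt (1 - V y ^ 2))
      ((1 / (2 * Real.sqrt (1 - V y ^ 2))) • -((2 * V y) • fderiv ℝ V y)) y := by
    have := ((hV.hasFDerivAt.pow 2).const_sub 1).sqrt h0.ne'
    refine this.congr_fderiv ?_
    ext v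
    simp [_root_.smul_apply]
  have hι : HasFDerivAt (fun y => ι y) ι.toContinuousLinearMap y :=
    ι.toContinuousLinearMap.hasFDerivAt
  have hw := (hasFDerivAt_height hV hy)
  refine ⟨_, (hs.smul hι).add (hw.smul_const ν), fun v => ?_⟩
  rw [← hw.fderiv]
  simp [_root_.smul_apply, _root_.add_apply]
  have hsq := (Real.sqrt_pos.2 h0).ne'
  match_scalars; field_simp

/-- This identity is the reason for the parametrization: radial cutoffs in the ambient space pull
back to radial cutoffs on the flat annulus, and annuli correspond to annuli. -/
theorem norm_graphMap (hν : ‖ν‖ = 1) (hι : ∀ y, ⟪ι y, ν⟫_ℝ = 0) {V : Eu n → ℝ} {y : Eu n}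
    (h1 : |V y| < 1) : ‖graphMap ι ν V y‖ = ‖y‖ := by
  have h0 : 0 < 1 - V y ^ 2 := by
    have := abs_lt.1 h1
    nlinarith
  have h : ‖graphMap ι ν V y‖ ^ 2 = ‖y‖ ^ 2 := by
    rw [graphMap, norm_add_sq_real, inner_smul_left, inner_smul_right, hι, norm_smul, norm_smul,
      hν, ι.norm_map, height]
    simp only [Real.norm_eq_abs, mul_pow, sq_abs, mul_zero, mul_one, add_zero]
    rw [Real.sq_sqrt h0.le]
    ring
  exact (sq_eq_sq₀ (norm_nonneg _) (norm_nonneg _)).1 h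

theorem inner_graphMap (hν : ‖ν‖ = 1) (hι : ∀ y, ⟪ι y, ν⟫_ℝ = 0) (V : Eu n → ℝ) (y : Eu n) :
    ⟪graphMap ι ν V y, ν⟫_ℝ = height V y := by
  rw [graphMap, inner_add_left, inner_smul_left, inner_smul_left, hι, real_inner_self_eq_norm_sq, hν]
  simp

/-- The left inverse `x ↦ |x| ιᵀx / |ιᵀx|` of `graphMap`. -/
noncomputable def graphInv (ι : Eu n →ₗᵢ[ℝ] Amb n) (x : Amb n) : Eu n :=
  (‖x‖ * ‖ContinuousLinearMap.adjoint ι.toContinuousLinearMap x‖⁻¹) •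
    ContinuousLinearMap.adjoint ι.toContinuousLinearMap x

theorem adjoint_graphMap (hι : ∀ y, ⟪ι y, ν⟫_ℝ = 0) (V : Eu n → ℝ) (y : Eu n) :
    ContinuousLinearMap.adjoint ι.toContinuousLinearMap (graphMap ι ν V y) =
      Real.sqrt (1 - V y ^ 2) • y := by
  refine ext_inner_left ℝ fun v => ?_
  rw [ContinuousLinearMap.adjoint_inner_right, graphMap, inner_add_right, inner_smul_right,
    inner_smul_right, inner_smul_right]
  show √(1 - V y ^ 2) * ⟪ι v, ι y⟫_ℝ + height V y * ⟪ι v, ν⟫_ℝ = _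
  rw [hι, ι.inner_map_map, mul_zero, add_zero]

theorem graphInv_graphMap (hν : ‖ν‖ = 1) (hι : ∀ y, ⟪ι y, ν⟫_ℝ = 0) {V : Eu n → ℝ} {y : Eu n}
    (h1 : |V y| < 1) (hy : y ≠ 0) : graphInv ι (graphMap ι ν V y) = y := by
  have h0 : 0 < 1 - V y ^ 2 := by
    have := abs_lt.1 h1
    nlinarith
  have hs := Real.sqrt_pos.2 h0
  have hn : ‖y‖ ≠ 0 := norm_ne_zero_iff.2 hy
  rw [graphInv, adjoint_graphMap hι, norm_graphMap hν hι h1, norm_smul, Real.norm_eq_abs,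
    abs_of_pos hs, smul_smul]
  have : ‖y‖ * (√(1 - V y ^ 2) * ‖y‖)⁻¹ * √(1 - V y ^ 2) = 1 := by
    have := hs.ne'
    field_simp
  rw [this, one_smul]

theorem differentiableAt_graphInv {x : Amb n}
    (hx : ContinuousLinearMap.adjoint ι.toContinuousLinearMap x ≠ 0) :
    DifferentiableAt ℝ (graphInv ι) x := by
  have hx0 : x ≠ 0 := by rintro rfl; simp at hx
  have h1 : DifferentiableAt ℝ (fun x => ContinuousLinearMap.adjoint ι.toContinuousLinearMap x) x :=
    (ContinuousLinearMap.adjoint ι.toContinuousLinearMap).differentiableAt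
  have h2 : DifferentiableAt ℝ (fun x : Amb n => ‖x‖) x := differentiableAt_id.norm ℝ hx0
  exact (h2.mul ((h1.norm ℝ hx).inv (norm_ne_zero_iff.2 hx))).smul h1

/-- The tangent space of the image of `graphMap`. -/
theorem tangentSpaceAt_graphMap (hν : ‖ν‖ = 1) (hι : ∀ y, ⟪ι y, ν⟫_ℝ = 0) {V : Eu n → ℝ}
    {D : Set (Eu n)} (hD : IsOpen D) (hV : ∀ y ∈ D, |V y| < 1) (hD0 : ∀ y ∈ D, y ≠ 0) {y : Eu n}
    (hy : y ∈ D) {L : Eu n →L[ℝ] Amb n} (hL : HasFDerivAt (graphMap ι ν V) L y) :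
    tangentSpaceAt (graphMap ι ν V '' D) (graphMap ι ν V y) = LinearMap.range L.toLinearMap := by
  set Φ := graphMap ι ν V
  have h0 : 0 < 1 - V y ^ 2 := by
    have := abs_lt.1 (hV y hy)
    nlinarith
  refine le_antisymm ?_ ?_
  · refine Submodule.span_le.2 fun v hv => ?_
    -- On the image, Φ ∘ `graphInv` is the identity, and `graphInv` is differentiable in a full
    -- ambient neighbourhood. Derivatives within a set are unique on its tangent cone, so a tangent
    -- vector v equals L applied to the derivative of `graphInv` in the direction v.
    have hx : ContinuousLinearMap.adjoint ι.toContinuousLinearMap (Φ y) ≠ 0 := by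
      rw [adjoint_graphMap hι]
      exact smul_ne_zero (Real.sqrt_pos.2 h0).ne' (hD0 y hy)
    have hI := (differentiableAt_graphInv hx).hasFDerivAt
    have hinv : graphInv ι (Φ y) = y := graphInv_graphMap hν hι (hV y hy) (hD0 y hy)
    have hL' : HasFDerivAt Φ L (graphInv ι (Φ y)) := by rw [hinv]; exact hL
    have hcomp := (hL'.comp (Φ y) hI).hasFDerivWithinAt (s := Φ '' D)
    have hid : HasFDerivWithinAt (Φ ∘ graphInv ι) (ContinuousLinearMap.id ℝ (Amb n)) (Φ '' D) (Φ y) := by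
      refine (hasFDerivWithinAt_id (Φ y) (Φ '' D)).congr ?_ ?_
      · rintro _ ⟨z, hz, rfl⟩
        simp only [Function.comp_apply, id]
        rw [graphInv_graphMap hν hι (hV z hz) (hD0 z hz)]
      · simp only [Function.comp_apply, id, hinv]
    have := hcomp.unique_on hid hv
    exact ⟨_, this⟩
  · rintro _ ⟨v, rfl⟩
    refine Submodule.subset_span ?_
    have h1 := hL.hasFDerivWithinAt (s := D)
    refine h1.mapsTo_tangent_cone ?_
    have : tangentConeAt ℝ D y = univ := tangentConeAt_of_mem_nhds (hD.mem_nhds hy)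
    rw [this]; trivial

/-- Every term of the metric error is quadratic in the sine t, its derivatives d, d' and the
derivatives w, w' of the height. The linear terms cancel because ν is orthogonal to the image of ι.
-/
theorem inner_sub_inner_eq (hν : ‖ν‖ = 1) (hι : ∀ y, ⟪ι y, ν⟫_ℝ = 0) {y v v' : Eu n}
    {s t d d' w w' : ℝ} (hs : s ≠ 0) (hst : s ^ 2 = 1 - t ^ 2) :
    ⟪s • ι v + (-(t / s) * d) • ι y + w • ν, s • ι v' + (-(t / s) * d') • ι y + w' • ν⟫_ℝ -
      ⟪v, v'⟫_ℝ = -t ^ 2 * ⟪v, v'⟫_ℝ - t * d' * ⟪v, y⟫_ℝ - t * d * ⟪y, v'⟫_ℝ +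
        t ^ 2 / s ^ 2 * (d * d') * ‖y‖ ^ 2 + w * w' := by
  have hι' : ∀ y, ⟪ν, ι y⟫_ℝ = 0 := fun y => by rw [real_inner_comm, hι]
  simp only [inner_add_left, inner_add_right, inner_smul_left, inner_smul_right, hι, hι',
    ι.inner_map_map, RCLike.conj_to_real, real_inner_self_eq_norm_sq, hν, one_pow, mul_zero,
    add_zero, zero_add, mul_one]
  rw [show t ^ 2 = 1 - s ^ 2 by linarith]
  generalize ⟪v, v'⟫_ℝ = A
  generalize ⟪v, y⟫_ℝ = B
  generalize ⟪y, v'⟫_ℝ = C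
  field_simp
  rw [hst]
  ring

/-- Here p stands for |V|, q for |y| |DV|, and a, b for the lengths of the two vectors; each of the
five terms is at most a quadratic form in (p, q) times a b. -/
theorem abs_metric_error_le {p q a b A B C D D' W W' T N S : ℝ} (hp0 : 0 ≤ p) (hq0 : 0 ≤ q)
    (ha : 0 ≤ a) (hb : 0 ≤ b) (e1 : |T ^ 2 * A| ≤ p ^ 2 * (a * b))
    (e2 : |T * D' * B| ≤ p * q * (a * b)) (e3 : |T * D * C| ≤ p * q * (a * b))
    (e4 : |T ^ 2 / S ^ 2 * (D * D') * N ^ 2| ≤ 1 / 3 * q ^ 2 * (a * b))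
    (hWv : |W| ≤ (p + q) * a) (hWv' : |W'| ≤ (p + q) * b) :
    |-T ^ 2 * A - T * D' * B - T * D * C + T ^ 2 / S ^ 2 * (D * D') * N ^ 2 + W * W'| ≤
      5 * (p ^ 2 + q ^ 2) * (a * b) := by
  have e5 : |W * W'| ≤ (p + q) ^ 2 * (a * b) := by
    rw [abs_mul]
    calc |W| * |W'| ≤ ((p + q) * a) * ((p + q) * b) := by gcongr
      _ = _ := by ring
  have hab : 0 ≤ a * b := by positivity
  generalize a * b = z at *
  have hpq : 2 * (p * q) ≤ p ^ 2 + q ^ 2 := by nlinarith [sq_nonneg (p - q)]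
  have hfin : (p ^ 2 + p * q + p * q + 1 / 3 * q ^ 2 + (p + q) ^ 2) * z ≤
      5 * (p ^ 2 + q ^ 2) * z := by
    refine mul_le_mul_of_nonneg_right ?_ hab
    nlinarith [sq_nonneg p, sq_nonneg q]
  refine le_trans ?_ hfin
  rw [abs_le] at *
  constructor <;> linarith [e1.1, e1.2, e2.1, e2.2, e3.1, e3.2, e4.1, e4.2, e5.1, e5.2]

/-- The induced metric is close to the flat one. -/
theorem abs_inner_sub_inner_le (hν : ‖ν‖ = 1) (hι : ∀ y, ⟪ι y, ν⟫_ℝ = 0) {V : Eu n → ℝ} {y : Eu n}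
    (hV : DifferentiableAt ℝ V y) (hy : y ≠ 0) (h1 : |V y| ≤ 1 / 2)
    {L : Eu n →L[ℝ] Amb n}
    (hL : ∀ v, L v = Real.sqrt (1 - V y ^ 2) • ι v +
        (-(V y / Real.sqrt (1 - V y ^ 2)) * fderiv ℝ V y v) • ι y +
        fderiv ℝ (height V) y v • ν) (v v' : Eu n) :
    |⟪L v, L v'⟫_ℝ - ⟪v, v'⟫_ℝ| ≤ 5 * energyDensity V y * (‖v‖ * ‖v'‖) := by
  have hVsq : V y ^ 2 ≤ 1 / 4 := by
    rw [← sq_abs]; nlinarith [abs_nonneg (V y)]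
  have h0 : 0 < 1 - V y ^ 2 := by linarith
  have hssq : Real.sqrt (1 - V y ^ 2) ^ 2 = 1 - V y ^ 2 := Real.sq_sqrt h0.le
  have hκ : energyDensity V y = |V y| ^ 2 + (‖y‖ * ‖fderiv ℝ V y‖) ^ 2 := by
    rw [energyDensity, sq_abs, mul_pow]
  have hDv : ∀ v, |fderiv ℝ V y v| ≤ ‖fderiv ℝ V y‖ * ‖v‖ := fun v => (fderiv ℝ V y).le_opNorm v
  have hW : ∀ v, |fderiv ℝ (height V) y v| ≤ (|V y| + ‖y‖ * ‖fderiv ℝ V y‖) * ‖v‖ := fun v =>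
    ((fderiv ℝ (height V) y).le_opNorm v).trans (by gcongr; exact norm_fderiv_height_le hV hy)
  rw [hL, hL, inner_sub_inner_eq hν hι (Real.sqrt_pos.2 h0).ne' hssq, hκ]
  refine abs_metric_error_le (abs_nonneg _) (by positivity) (norm_nonneg _) (norm_nonneg _)
    ?_ ?_ ?_ ?_ (hW v) (hW v')
  · rw [abs_mul, abs_of_nonneg (sq_nonneg (V y)), ← sq_abs]
    gcongr
    exact abs_real_inner_le_norm v v'
  · rw [abs_mul, abs_mul]
    calc |V y| * |fderiv ℝ V y v'| * |⟪v, y⟫_ℝ| ≤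
        |V y| * (‖fderiv ℝ V y‖ * ‖v'‖) * (‖v‖ * ‖y‖) := by
          gcongr
          exacts [hDv v', abs_real_inner_le_norm v y]
      _ = _ := by ring
  · rw [abs_mul, abs_mul]
    calc |V y| * |fderiv ℝ V y v| * |⟪y, v'⟫_ℝ| ≤
        |V y| * (‖fderiv ℝ V y‖ * ‖v‖) * (‖y‖ * ‖v'‖) := by
          gcongr
          exacts [hDv v, abs_real_inner_le_norm y v']
      _ = _ := by ring
  · rw [abs_mul, abs_mul, abs_mul, abs_of_nonneg (sq_nonneg ‖y‖), abs_of_nonneg (by positivity)]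
    have h3 : V y ^ 2 / Real.sqrt (1 - V y ^ 2) ^ 2 ≤ 1 / 3 := by
      rw [hssq, div_le_iff₀ h0]; linarith
    calc V y ^ 2 / Real.sqrt (1 - V y ^ 2) ^ 2 * (|fderiv ℝ V y v| * |fderiv ℝ V y v'|) * ‖y‖ ^ 2 ≤
        1 / 3 * ((‖fderiv ℝ V y‖ * ‖v‖) * (‖fderiv ℝ V y‖ * ‖v'‖)) * ‖y‖ ^ 2 := by
          gcongr
          exacts [hDv v, hDv v']
      _ = _ := by ring

theorem one_add_pow_le {s : ℝ} (h0 : 0 ≤ s) (h1 : s ≤ 1) (m : ℕ) : (1 + s) ^ m ≤ 1 + 2 ^ m * s := by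
  -- The chord bound on [0, 1], with 2 ^ m - 1 in place of 2 ^ m, is the form that is stable under
  -- induction.
  suffices h : (1 + s) ^ m ≤ 1 + (2 ^ m - 1) * s by linarith
  induction m with
  | zero => simp
  | succ m ih =>
    have h2 : (0 : ℝ) ≤ 2 ^ m - 1 := sub_nonneg.2 (one_le_pow₀ (by norm_num))
    calc (1 + s) ^ (m + 1) = (1 + s) ^ m * (1 + s) := pow_succ _ _
      _ ≤ (1 + (2 ^ m - 1) * s) * (1 + s) := by gcongr
      _ ≤ 1 + (2 ^ (m + 1) - 1) * s := by
        rw [pow_succ]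
        have : (2 ^ m - 1) * s * s ≤ (2 ^ m - 1) * s * 1 := by gcongr
        nlinarith

/-- A relative error s of the metric gives ‖L v‖ ≤ (1 + s) ‖v‖ and ‖v‖ ≤ (1 + 2 s) ‖L v‖, the latter
because (1 + 2s)² (1 - s) ≥ 1 for s ≤ 1/2. The volume comparisons turn both into bounds for the
Jacobian. -/
theorem abs_jac_sub_one_le {F : Type*} [NormedAddCommGroup F] [InnerProductSpace ℝ F]
    [FiniteDimensional ℝ F] [MeasurableSpace F] [BorelSpace F] {L : Eu n →L[ℝ] F} {s : ℝ}
    (hs0 : 0 ≤ s) (hs : s ≤ 1 / 2) (h : ∀ v, |⟪L v, L v⟫_ℝ - ⟪v, v⟫_ℝ| ≤ s * (‖v‖ * ‖v‖)) :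
    |jac L - 1| ≤ 2 * 2 ^ n * s := by
  have hfr : Module.finrank ℝ (Eu n) = n := by simp
  have hb : ∀ v, ‖L v‖ ^ 2 ≤ (1 + s) * ‖v‖ ^ 2 ∧ (1 - s) * ‖v‖ ^ 2 ≤ ‖L v‖ ^ 2 := fun v => by
    have h1 := abs_le.1 (h v)
    rw [real_inner_self_eq_norm_sq, real_inner_self_eq_norm_sq] at h1
    constructor <;> nlinarith [h1.1, h1.2]
  have hup : jac L ≤ (1 + s) ^ n := by
    have h1 := jac_le_pow (L := L) (c := ⟨1 + s, by linarith⟩) (fun v => by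
      show ‖L v‖ ≤ (1 + s) * ‖v‖
      refine le_of_sq_le_sq ?_ (by positivity)
      have := (hb v).1
      have h2 : (1 + s) * ‖v‖ ^ 2 ≤ ((1 + s) * ‖v‖) ^ 2 := by
        rw [mul_pow]; gcongr; nlinarith
      linarith)
    rwa [hfr] at h1
  have hlow : 1 ≤ (1 + 2 * s) ^ n * jac L := by
    have h1 := one_le_pow_mul_jac (L := L) (c := ⟨1 + 2 * s, by linarith⟩) (fun v => by
      show ‖v‖ ≤ (1 + 2 * s) * ‖L v‖
      refine le_of_sq_le_sq ?_ (by positivity)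
      have h2 := (hb v).2
      rw [mul_pow]
      have h3 : 1 ≤ (1 + 2 * s) ^ 2 * (1 - s) := by nlinarith [mul_nonneg hs0 (sub_nonneg.2 hs), mul_nonneg hs0 (mul_nonneg hs0 (sub_nonneg.2 hs))]
      have h4 : (1 + 2 * s) ^ 2 * ((1 - s) * ‖v‖ ^ 2) ≤ (1 + 2 * s) ^ 2 * ‖L v‖ ^ 2 := by gcongr
      nlinarith [sq_nonneg ‖v‖])
    rwa [hfr] at h1
  have h1 := one_add_pow_le hs0 (by linarith) n
  have h2 := one_add_pow_le (s := 2 * s) (by linarith) (by linarith) n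
  have hJ := jac_nonneg L
  have h3 : (0 : ℝ) < 2 ^ n := by positivity
  have h4 : 0 ≤ 2 ^ n * s := by positivity
  refine abs_le.2 ⟨?_, by linarith⟩
  have h5 : 1 ≤ (1 + 2 ^ n * (2 * s)) * jac L := hlow.trans (by gcongr)
  nlinarith

end GraphGeometry

/-! ### Area deviation and the first variation as a weak Laplace equation -/

section WeakForm

open Filter Topology

variable {n : ℕ}

theorem volume_eann_lt_top (a b : ℝ) : volume (eann n a b) < ⊤ := by
  refine (measure_mono (t := Metric.ball (0 : Eu n) b) fun y hy => ?_).trans_lt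
    measure_ball_lt_top
  simpa using hy.2

theorem integrableOn_eann_of_bound {a b C : ℝ} {f : Eu n → ℝ} (hc : ContinuousOn f (eann n a b))
    (hb : ∀ y ∈ eann n a b, |f y| ≤ C) : IntegrableOn f (eann n a b) := by
  refine IntegrableOn.of_bound (volume_eann_lt_top a b)
    (hc.aestronglyMeasurable (isOpen_eann a b).measurableSet) C ?_
  exact (ae_restrict_iff' (isOpen_eann a b).measurableSet).2 (Eventually.of_forall hb)

/-- `V` is a `C¹` function on the annulus, small in the scale invariant `C¹` norm. -/
structure SmallOn (V : Eu n → ℝ) (σ r₁ r₂ : ℝ) : Prop where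
  pos : 0 < r₁
  nonneg : 0 ≤ σ
  le : σ ≤ 1 / 8
  contDiffOn : ContDiffOn ℝ 1 V (eann n r₁ r₂)
  abs_le : ∀ y ∈ eann n r₁ r₂, |V y| ≤ σ
  fderiv_le : ∀ y ∈ eann n r₁ r₂, ‖y‖ * ‖fderiv ℝ V y‖ ≤ 2 * σ

variable {ι : Eu n →ₗᵢ[ℝ] Amb n} {ν : Amb n} {V : Eu n → ℝ} {σ r₁ r₂ : ℝ}

namespace SmallOn

theorem ne_zero (h : SmallOn V σ r₁ r₂) {y : Eu n} (hy : y ∈ eann n r₁ r₂) : y ≠ 0 :=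
  ne_zero_of_mem_eann h.pos.le hy

theorem abs_lt_one (h : SmallOn V σ r₁ r₂) {y : Eu n} (hy : y ∈ eann n r₁ r₂) : |V y| < 1 := by
  linarith [h.abs_le y hy, h.le]

theorem differentiableAt (h : SmallOn V σ r₁ r₂) {y : Eu n} (hy : y ∈ eann n r₁ r₂) :
    DifferentiableAt ℝ V y :=
  (h.contDiffOn.differentiableOn (by norm_num)).differentiableAt ((isOpen_eann _ _).mem_nhds hy)

theorem energyDensity_le (h : SmallOn V σ r₁ r₂) {y : Eu n} (hy : y ∈ eann n r₁ r₂) :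
    energyDensity V y ≤ 5 * σ ^ 2 := by
  have h1 := h.abs_le y hy
  have h2 := h.fderiv_le y hy
  have h3 : |V y| ^ 2 ≤ σ ^ 2 := by gcongr
  have h4 : (‖y‖ * ‖fderiv ℝ V y‖) ^ 2 ≤ (2 * σ) ^ 2 := by gcongr
  rw [energyDensity, ← mul_pow, ← sq_abs]
  nlinarith

theorem contDiffOn_height (h : SmallOn V σ r₁ r₂) : ContDiffOn ℝ 1 (height V) (eann n r₁ r₂) := by
  refine ContDiffOn.mul (fun y hy => ?_) h.contDiffOn
  exact (contDiffAt_norm ℝ (h.ne_zero hy)).contDiffWithinAt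

theorem contDiffOn_graphMap (h : SmallOn V σ r₁ r₂) :
    ContDiffOn ℝ 1 (graphMap ι ν V) (eann n r₁ r₂) := by
  have h1 : ContDiffOn ℝ 1 (fun y => Real.sqrt (1 - V y ^ 2)) (eann n r₁ r₂) := ?_
  · exact (h1.smul ι.contDiff.contDiffOn).add (h.contDiffOn_height.smul contDiffOn_const)
  refine (contDiffOn_const.sub (h.contDiffOn.pow 2)).sqrt fun y hy => ?_
  have := abs_lt.1 (h.abs_lt_one hy)
  nlinarith

theorem injOn_graphMap (h : SmallOn V σ r₁ r₂) (hν : ‖ν‖ = 1) (hι : ∀ y, ⟪ι y, ν⟫_ℝ = 0) :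
    InjOn (graphMap ι ν V) (eann n r₁ r₂) := fun x hx y hy hxy => by
  rw [← graphInv_graphMap hν hι (h.abs_lt_one hx) (h.ne_zero hx), hxy,
    graphInv_graphMap hν hι (h.abs_lt_one hy) (h.ne_zero hy)]

theorem hasFDerivAt_graphMap (h : SmallOn V σ r₁ r₂) {y : Eu n} (hy : y ∈ eann n r₁ r₂) :
    HasFDerivAt (graphMap ι ν V) (fderiv ℝ (graphMap ι ν V) y) y :=
  ((h.contDiffOn_graphMap.differentiableOn (by norm_num)).differentiableAt
    ((isOpen_eann _ _).mem_nhds hy)).hasFDerivAt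

theorem abs_inner_fderiv_sub_le (h : SmallOn V σ r₁ r₂) (hν : ‖ν‖ = 1) (hι : ∀ y, ⟪ι y, ν⟫_ℝ = 0)
    {y : Eu n} (hy : y ∈ eann n r₁ r₂) (v v' : Eu n) :
    |⟪fderiv ℝ (graphMap ι ν V) y v, fderiv ℝ (graphMap ι ν V) y v'⟫_ℝ - ⟪v, v'⟫_ℝ| ≤
      5 * energyDensity V y * (‖v‖ * ‖v'‖) := by
  obtain ⟨L, hL, hLv⟩ := SphericalGraph.hasFDerivAt_graphMap (ι := ι) (ν := ν)
    (h.differentiableAt hy) (h.ne_zero hy) (h.abs_lt_one hy)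
  rw [hL.fderiv]
  exact abs_inner_sub_inner_le hν hι (h.differentiableAt hy) (h.ne_zero hy)
    (by linarith [h.abs_le y hy, h.le]) hLv v v'

/-- The threshold σ ≤ 1/8 gives 25 σ² ≤ 25/64 < 1/2. At this size of metric error the Gram operator
is invertible and the Jacobian comparison applies. -/
theorem five_mul_energyDensity_le (h : SmallOn V σ r₁ r₂) {y : Eu n} (hy : y ∈ eann n r₁ r₂) :
    5 * energyDensity V y ≤ 1 / 2 := by
  have := h.energyDensity_le hy
  have h1 : σ ^ 2 ≤ (1 / 8) ^ 2 := pow_le_pow_left₀ h.nonneg h.le 2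
  linarith

theorem norm_sq_le (h : SmallOn V σ r₁ r₂) (hν : ‖ν‖ = 1) (hι : ∀ y, ⟪ι y, ν⟫_ℝ = 0)
    {y : Eu n} (hy : y ∈ eann n r₁ r₂) (v : Eu n) :
    ‖v‖ ^ 2 ≤ 2 * ‖fderiv ℝ (graphMap ι ν V) y v‖ ^ 2 := by
  have h1 := h.abs_inner_fderiv_sub_le hν hι hy v v
  have h2 := h.five_mul_energyDensity_le hy
  rw [real_inner_self_eq_norm_sq, real_inner_self_eq_norm_sq] at h1
  have h3 := (_root_.abs_le.1 h1).1
  nlinarith [mul_nonneg (norm_nonneg v) (norm_nonneg v)]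

theorem injective_fderiv_graphMap (h : SmallOn V σ r₁ r₂) (hν : ‖ν‖ = 1)
    (hι : ∀ y, ⟪ι y, ν⟫_ℝ = 0) {y : Eu n} (hy : y ∈ eann n r₁ r₂) :
    Function.Injective (fderiv ℝ (graphMap ι ν V) y) := by
  refine (injective_iff_map_eq_zero _).2 fun v hv => ?_
  have := h.norm_sq_le hν hι hy v
  rw [hv] at this
  have h2 : ‖v‖ ^ 2 = 0 := le_antisymm (by simpa using this) (sq_nonneg _)
  simpa using h2

theorem abs_jac_sub_one_le (h : SmallOn V σ r₁ r₂) (hν : ‖ν‖ = 1) (hι : ∀ y, ⟪ι y, ν⟫_ℝ = 0)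
    {y : Eu n} (hy : y ∈ eann n r₁ r₂) :
    |jac (fderiv ℝ (graphMap ι ν V) y) - 1| ≤ 2 * 2 ^ n * (5 * energyDensity V y) :=
  SphericalGraph.abs_jac_sub_one_le (by linarith [energyDensity_nonneg V y])
    (h.five_mul_energyDensity_le hy) fun v => h.abs_inner_fderiv_sub_le hν hι hy v v

theorem jac_le (h : SmallOn V σ r₁ r₂) (hν : ‖ν‖ = 1) (hι : ∀ y, ⟪ι y, ν⟫_ℝ = 0)
    {y : Eu n} (hy : y ∈ eann n r₁ r₂) : jac (fderiv ℝ (graphMap ι ν V) y) ≤ 1 + 2 ^ n := by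
  have h1 := (_root_.abs_le.1 (h.abs_jac_sub_one_le hν hι hy)).2
  have h2 := mul_le_mul_of_nonneg_left (h.five_mul_energyDensity_le hy)
    (by positivity : (0 : ℝ) ≤ 2 * 2 ^ n)
  linarith

theorem continuousOn_fderiv_graphMap (h : SmallOn V σ r₁ r₂) :
    ContinuousOn (fderiv ℝ (graphMap ι ν V)) (eann n r₁ r₂) :=
  h.contDiffOn_graphMap.continuousOn_fderiv_of_isOpen (isOpen_eann _ _) le_rfl

theorem continuousOn_fderiv (h : SmallOn V σ r₁ r₂) : ContinuousOn (fderiv ℝ V) (eann n r₁ r₂) :=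
  h.contDiffOn.continuousOn_fderiv_of_isOpen (isOpen_eann _ _) le_rfl

theorem continuousOn_energyDensity (h : SmallOn V σ r₁ r₂) :
    ContinuousOn (energyDensity V) (eann n r₁ r₂) :=
  (h.contDiffOn.continuousOn.pow 2).add
    ((continuous_norm.continuousOn.pow 2).mul (h.continuousOn_fderiv.norm.pow 2))

theorem integrableOn_energyDensity (h : SmallOn V σ r₁ r₂) :
    IntegrableOn (energyDensity V) (eann n r₁ r₂) :=
  integrableOn_eann_of_bound (C := 5 * σ ^ 2) h.continuousOn_energyDensity fun y hy => by
    rw [abs_of_nonneg (energyDensity_nonneg V y)]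
    exact h.energyDensity_le hy

theorem mono (h : SmallOn V σ r₁ r₂) {r₃ r₄ : ℝ} (h3 : r₁ ≤ r₃) (h4 : r₄ ≤ r₂) :
    SmallOn V σ r₃ r₄ := by
  have hs : eann n r₃ r₄ ⊆ eann n r₁ r₂ := fun y hy => ⟨h3.trans_lt hy.1, hy.2.trans_le h4⟩
  exact ⟨h.pos.trans_le h3, h.nonneg, h.le, h.contDiffOn.mono hs, fun y hy => h.abs_le y (hs hy),
    fun y hy => h.fderiv_le y (hs hy)⟩

/-- The area of the graph differs from the area of the flat annulus by the energy. -/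
theorem abs_area_sub_le (h : SmallOn V σ r₁ r₂) (hν : ‖ν‖ = 1) (hι : ∀ y, ⟪ι y, ν⟫_ℝ = 0) :
    |area (graphMap ι ν V '' eann n r₁ r₂) - (volume (eann n r₁ r₂)).toReal| ≤
      10 * 2 ^ n * ∫ y in eann n r₁ r₂, energyDensity V y := by
  have hD := isOpen_eann (n := n) r₁ r₂
  have hfr : Module.finrank ℝ (Eu n) = n := by simp
  have hA := measure_image_eq_setLIntegral_jac hD h.contDiffOn_graphMap (h.injOn_graphMap hν hι)
    fun y hy => h.injective_fderiv_graphMap hν hι hy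
  rw [hfr] at hA
  have hjc : ContinuousOn (fun y => jac (fderiv ℝ (graphMap ι ν V) y)) (eann n r₁ r₂) :=
    continuous_jac.comp_continuousOn h.continuousOn_fderiv_graphMap
  have hji : IntegrableOn (fun y => jac (fderiv ℝ (graphMap ι ν V) y)) (eann n r₁ r₂) :=
    integrableOn_eann_of_bound hjc fun y hy => by
      rw [abs_of_nonneg (jac_nonneg _)]; exact h.jac_le hν hι hy
  have hA' : area (graphMap ι ν V '' eann n r₁ r₂) =
      ∫ y in eann n r₁ r₂, jac (fderiv ℝ (graphMap ι ν V) y) := by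
    rw [area, hA, integral_eq_lintegral_of_nonneg_ae (Eventually.of_forall fun y => jac_nonneg _)
      hji.aestronglyMeasurable]
  have hvol : (volume (eann n r₁ r₂)).toReal = ∫ y in eann n r₁ r₂, (1 : ℝ) := by
    simp [Measure.real]
  have h1i : IntegrableOn (fun _ : Eu n => (1 : ℝ)) (eann n r₁ r₂) :=
    integrableOn_const (volume_eann_lt_top _ _).ne
  rw [hA', hvol, ← integral_sub hji h1i, ← integral_const_mul, ← Real.norm_eq_abs]
  refine norm_integral_le_of_norm_le (h.integrableOn_energyDensity.const_mul _) ?_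
  refine (ae_restrict_iff' hD.measurableSet).2 (Eventually.of_forall fun y hy => ?_)
  rw [Real.norm_eq_abs]
  exact (h.abs_jac_sub_one_le hν hι hy).trans_eq (by ring)

/-- The coordinates of the tangential part of `ν`. -/
noncomputable def _root_.SphericalGraph.normalCoord (ι : Eu n →ₗᵢ[ℝ] Amb n) (ν : Amb n) (V : Eu n → ℝ)
    (y : Eu n) : Eu n :=
  Ring.inverse (ContinuousLinearMap.adjoint (fderiv ℝ (graphMap ι ν V) y) ∘L
    fderiv ℝ (graphMap ι ν V) y) (ContinuousLinearMap.adjoint (fderiv ℝ (graphMap ι ν V) y) ν)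

/-- The bound for the bilinear form is tested on the pair v, e, where e is the image of v under 1 -
L†L; this gives ‖e‖² ≤ 5 e(V) ‖v‖ ‖e‖ with e(V) the energy density. -/
theorem norm_gram_sub_one_le (h : SmallOn V σ r₁ r₂) (hν : ‖ν‖ = 1) (hι : ∀ y, ⟪ι y, ν⟫_ℝ = 0)
    {y : Eu n} (hy : y ∈ eann n r₁ r₂) :
    ‖1 - ContinuousLinearMap.adjoint (fderiv ℝ (graphMap ι ν V) y) ∘L
      fderiv ℝ (graphMap ι ν V) y‖ ≤ 5 * energyDensity V y := by
  set L := fderiv ℝ (graphMap ι ν V) y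
  have hκ : 0 ≤ 5 * energyDensity V y := by linarith [energyDensity_nonneg V y]
  refine ContinuousLinearMap.opNorm_le_bound _ hκ fun v => ?_
  set e := (1 - ContinuousLinearMap.adjoint L ∘L L) v
  have h1 := h.abs_inner_fderiv_sub_le hν hι hy v e
  have h2 : ⟪e, e⟫_ℝ = -(⟪L v, L e⟫_ℝ - ⟪v, e⟫_ℝ) := by
    have h4 : ⟪e, e⟫_ℝ = ⟪v - ContinuousLinearMap.adjoint L (L v), e⟫_ℝ := rfl
    rw [h4, inner_sub_left, ContinuousLinearMap.adjoint_inner_left]; ring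
  have h3 : ‖e‖ ^ 2 ≤ 5 * energyDensity V y * (‖v‖ * ‖e‖) := by
    rw [← real_inner_self_eq_norm_sq, h2]
    exact (neg_le_abs _).trans h1
  rcases eq_or_ne ‖e‖ 0 with h0 | h0
  · rw [h0]; positivity
  · have : 0 < ‖e‖ := lt_of_le_of_ne (norm_nonneg _) h0.symm
    refine le_of_mul_le_mul_right ?_ this
    nlinarith

theorem isUnit_gram (h : SmallOn V σ r₁ r₂) (hν : ‖ν‖ = 1) (hι : ∀ y, ⟪ι y, ν⟫_ℝ = 0)
    {y : Eu n} (hy : y ∈ eann n r₁ r₂) :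
    IsUnit (ContinuousLinearMap.adjoint (fderiv ℝ (graphMap ι ν V) y) ∘L
      fderiv ℝ (graphMap ι ν V) y) := by
  have h1 := isUnit_one_sub_of_norm_lt_one (x := 1 -
    ContinuousLinearMap.adjoint (fderiv ℝ (graphMap ι ν V) y) ∘L fderiv ℝ (graphMap ι ν V) y)
    (by linarith [h.norm_gram_sub_one_le hν hι hy, h.five_mul_energyDensity_le hy])
  rwa [sub_sub_cancel] at h1

theorem gram_normalCoord (h : SmallOn V σ r₁ r₂) (hν : ‖ν‖ = 1) (hι : ∀ y, ⟪ι y, ν⟫_ℝ = 0)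
    {y : Eu n} (hy : y ∈ eann n r₁ r₂) :
    ContinuousLinearMap.adjoint (fderiv ℝ (graphMap ι ν V) y)
      (fderiv ℝ (graphMap ι ν V) y (normalCoord ι ν V y)) =
      ContinuousLinearMap.adjoint (fderiv ℝ (graphMap ι ν V) y) ν := by
  have h1 := Ring.mul_inverse_cancel _ (h.isUnit_gram hν hι hy)
  exact DFunLike.congr_fun h1 (ContinuousLinearMap.adjoint (fderiv ℝ (graphMap ι ν V) y) ν)

theorem inner_fderiv_normal (h : SmallOn V σ r₁ r₂) (hν : ‖ν‖ = 1) (hι : ∀ y, ⟪ι y, ν⟫_ℝ = 0)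
    {y : Eu n} (hy : y ∈ eann n r₁ r₂) (v : Eu n) :
    ⟪fderiv ℝ (graphMap ι ν V) y v, ν⟫_ℝ = fderiv ℝ (height V) y v := by
  have h1 := (h.hasFDerivAt_graphMap (ι := ι) (ν := ν) hy).inner ℝ (hasFDerivAt_const ν y)
  have h2 : (fun y => ⟪graphMap ι ν V y, ν⟫_ℝ) = height V := funext (inner_graphMap hν hι V)
  rw [h2] at h1
  rw [h1.fderiv]
  simp

theorem adjoint_fderiv_normal (h : SmallOn V σ r₁ r₂) (hν : ‖ν‖ = 1) (hι : ∀ y, ⟪ι y, ν⟫_ℝ = 0)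
    {y : Eu n} (hy : y ∈ eann n r₁ r₂) :
    ContinuousLinearMap.adjoint (fderiv ℝ (graphMap ι ν V) y) ν = gradient (height V) y := by
  refine ext_inner_left ℝ fun v => ?_
  rw [ContinuousLinearMap.adjoint_inner_right, h.inner_fderiv_normal hν hι hy,
    real_inner_comm, inner_gradient_left]

theorem continuousOn_normalCoord (h : SmallOn V σ r₁ r₂) (hν : ‖ν‖ = 1)
    (hι : ∀ y, ⟪ι y, ν⟫_ℝ = 0) : ContinuousOn (normalCoord ι ν V) (eann n r₁ r₂) := by
  have hL := h.continuousOn_fderiv_graphMap (ι := ι) (ν := ν)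
  have hA : ContinuousOn (fun y => ContinuousLinearMap.adjoint (fderiv ℝ (graphMap ι ν V) y))
      (eann n r₁ r₂) := ContinuousLinearMap.adjoint.continuous.comp_continuousOn hL
  have hG := hA.clm_comp hL
  refine ContinuousOn.clm_apply (fun y hy => ?_) (hA.clm_apply continuousOn_const)
  obtain ⟨x, hx⟩ := h.isUnit_gram hν hι hy
  have hc := NormedRing.inverse_continuousAt x
  rw [hx] at hc
  exact ContinuousAt.comp_continuousWithinAt (g := Ring.inverse)
    (f := fun y => ContinuousLinearMap.adjoint (fderiv ℝ (graphMap ι ν V) y) ∘L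
      fderiv ℝ (graphMap ι ν V) y) hc (hG y hy)

/-- Since L†L z equals the gradient g of the height, z - g = (1 - L†L) z is small relative to z, and
z is comparable to g. The factor J - 1 is of the same order σ². -/
theorem norm_jac_smul_normalCoord_sub_le (h : SmallOn V σ r₁ r₂) (hν : ‖ν‖ = 1)
    (hι : ∀ y, ⟪ι y, ν⟫_ℝ = 0) {y : Eu n} (hy : y ∈ eann n r₁ r₂) :
    ‖normalCoord ι ν V y‖ ≤ 2 * ‖gradient (height V) y‖ ∧
    ‖jac (fderiv ℝ (graphMap ι ν V) y) • normalCoord ι ν V y - gradient (height V) y‖ ≤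
      (100 * 2 ^ n + 50) * σ ^ 2 * ‖gradient (height V) y‖ := by
  have hG := h.gram_normalCoord hν hι hy
  rw [h.adjoint_fderiv_normal hν hι hy] at hG
  set L := fderiv ℝ (graphMap ι ν V) y
  set z := normalCoord ι ν V y
  set g := gradient (height V) y
  have hs := h.norm_gram_sub_one_le hν hι hy
  have hs2 := h.five_mul_energyDensity_le hy
  have hκ := energyDensity_nonneg V y
  have hj := h.abs_jac_sub_one_le hν hι hy
  have hκσ := h.energyDensity_le hy
  have h1 : ‖z - g‖ ≤ 5 * energyDensity V y * ‖z‖ := by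
    rw [← hG]
    exact ((1 - ContinuousLinearMap.adjoint L ∘L L).le_opNorm z).trans (by gcongr)
  have h2 : ‖z‖ ≤ 2 * ‖g‖ := by
    have h3 : ‖z‖ ≤ ‖z - g‖ + ‖g‖ := by simpa using norm_add_le (z - g) g
    have h4 : 5 * energyDensity V y * ‖z‖ ≤ 1 / 2 * ‖z‖ := by gcongr
    linarith
  refine ⟨h2, ?_⟩
  have h5 : jac L • z - g = (jac L - 1) • z + (z - g) := by rw [sub_smul, one_smul]; abel
  rw [h5]
  calc ‖(jac L - 1) • z + (z - g)‖ ≤ |jac L - 1| * ‖z‖ + ‖z - g‖ := by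
        refine (norm_add_le _ _).trans ?_
        rw [norm_smul, Real.norm_eq_abs]
    _ ≤ 2 * 2 ^ n * (5 * energyDensity V y) * (2 * ‖g‖) + 5 * energyDensity V y * (2 * ‖g‖) := by
        gcongr
        exact h1.trans (by gcongr)
    _ = (20 * 2 ^ n + 10) * energyDensity V y * ‖g‖ := by ring
    _ ≤ (20 * 2 ^ n + 10) * (5 * σ ^ 2) * ‖g‖ := by gcongr
    _ = _ := by ring

/-- The normal equations L†L z = L†ν say that ν - L z is orthogonal to the range of L, which is the
tangent space. -/
theorem starProjection_normal (h : SmallOn V σ r₁ r₂) (hν : ‖ν‖ = 1) (hι : ∀ y, ⟪ι y, ν⟫_ℝ = 0)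
    {y : Eu n} (hy : y ∈ eann n r₁ r₂) :
    (tangentSpaceAt (graphMap ι ν V '' eann n r₁ r₂) (graphMap ι ν V y)).starProjection ν =
      fderiv ℝ (graphMap ι ν V) y (normalCoord ι ν V y) := by
  have hT := tangentSpaceAt_graphMap hν hι (isOpen_eann r₁ r₂) (fun z hz => h.abs_lt_one hz)
    (fun z hz => h.ne_zero hz) hy (h.hasFDerivAt_graphMap hy)
  refine Submodule.eq_starProjection_of_mem_orthogonal
    (K := tangentSpaceAt (graphMap ι ν V '' eann n r₁ r₂) (graphMap ι ν V y)) ?_ ?_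
  · rw [hT]; exact ⟨_, rfl⟩
  · rw [hT]
    rintro _ ⟨v, rfl⟩
    have hG := h.gram_normalCoord hν hι hy
    show ⟪fderiv ℝ (graphMap ι ν V) y v, _⟫_ℝ = 0
    rw [← ContinuousLinearMap.adjoint_inner_right, map_sub, hG, sub_self, inner_zero_right]

/-- The derivative of f ν has rank one, so the trace of its composition with the tangential
projection P is Df applied to P ν. Only the coordinates of P ν are needed, and no second derivatives
of the graph. -/
theorem tangentialDiv_graphMap (h : SmallOn V σ r₁ r₂) (hν : ‖ν‖ = 1) (hι : ∀ y, ⟪ι y, ν⟫_ℝ = 0)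
    {f : Amb n → ℝ} (hf : Differentiable ℝ f) {y : Eu n} (hy : y ∈ eann n r₁ r₂) :
    tangentialDiv (graphMap ι ν V '' eann n r₁ r₂) (fun x => f x • ν) (graphMap ι ν V y) =
      fderiv ℝ (fun y => f (graphMap ι ν V y)) y (normalCoord ι ν V y) := by
  have h1 : fderiv ℝ (fun x => f x • ν) (graphMap ι ν V y) =
      (fderiv ℝ f (graphMap ι ν V y)).smulRight ν :=
    ((hf _).hasFDerivAt.smul_const ν).fderiv
  have h2 : fderiv ℝ (fun y => f (graphMap ι ν V y)) y =
      (fderiv ℝ f (graphMap ι ν V y)).comp (fderiv ℝ (graphMap ι ν V) y) :=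
    ((hf _).hasFDerivAt.comp y (h.hasFDerivAt_graphMap hy)).fderiv
  rw [tangentialDiv, h1, h2]
  set P := (tangentSpaceAt (graphMap ι ν V '' eann n r₁ r₂) (graphMap ι ν V y)).starProjection
    with hP
  have h3 : (P ∘L (fderiv ℝ f (graphMap ι ν V y)).smulRight ν).toLinearMap =
      LinearMap.smulRight (fderiv ℝ f (graphMap ι ν V y)).toLinearMap (P ν) := by
    ext v
    simp
  rw [h3, LinearMap.trace_smulRight, hP, h.starProjection_normal hν hι hy]
  rfl

theorem norm_gradient (f : Eu n → ℝ) (y : Eu n) : ‖gradient f y‖ = ‖fderiv ℝ f y‖ := by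
  rw [gradient, LinearIsometryEquiv.norm_map]

theorem norm_fderiv_height_le (h : SmallOn V σ r₁ r₂) {y : Eu n} (hy : y ∈ eann n r₁ r₂) :
    ‖fderiv ℝ (height V) y‖ ≤ 3 * σ := by
  linarith [SphericalGraph.norm_fderiv_height_le (h.differentiableAt hy) (h.ne_zero hy),
    h.abs_le y hy, h.fderiv_le y hy]

theorem norm_fderiv_graphMap_le (h : SmallOn V σ r₁ r₂) (hν : ‖ν‖ = 1) (hι : ∀ y, ⟪ι y, ν⟫_ℝ = 0)
    {y : Eu n} (hy : y ∈ eann n r₁ r₂) : ‖fderiv ℝ (graphMap ι ν V) y‖ ≤ 2 := by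
  refine ContinuousLinearMap.opNorm_le_bound _ (by norm_num) fun v => ?_
  have h1 := (_root_.abs_le.1 (h.abs_inner_fderiv_sub_le hν hι hy v v)).2
  have h2 := h.five_mul_energyDensity_le hy
  rw [real_inner_self_eq_norm_sq, real_inner_self_eq_norm_sq] at h1
  refine le_of_sq_le_sq ?_ (by positivity)
  nlinarith [mul_nonneg (norm_nonneg v) (norm_nonneg v)]

/-- The first variation identity for the graph, tested with `f ν`, as a perturbation of the weak
Laplace equation for the height function. -/
theorem abs_integral_fderiv_gradient_le (h : SmallOn V σ r₁ r₂) (hν : ‖ν‖ = 1)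
    (hι : ∀ y, ⟪ι y, ν⟫_ℝ = 0) {Λ : ℝ}
    (hM : HasMeanCurvatureBoundedBy (graphMap ι ν V '' eann n r₁ r₂) (annulus n r₁ r₂) Λ)
    {f : Amb n → ℝ} (hf : ContDiff ℝ 1 f) (hfc : HasCompactSupport f)
    (hfs : tsupport f ⊆ annulus n r₁ r₂) {F : Eu n → ℝ}
    (hF : ∀ y ∈ eann n r₁ r₂, F y = f (graphMap ι ν V y)) :
    |∫ y in eann n r₁ r₂, fderiv ℝ F y (gradient (height V) y)| ≤
      (100 * 2 ^ n + 50) * σ ^ 2 *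
          (∫ y in eann n r₁ r₂, ‖fderiv ℝ (height V) y‖ * ‖fderiv ℝ F y‖) +
        (1 + 2 ^ n) * Λ * ∫ y in eann n r₁ r₂, |F y| := by
  have hD := isOpen_eann (n := n) r₁ r₂
  have hfr : Module.finrank ℝ (Eu n) = n := by simp
  have hFd : ∀ y ∈ eann n r₁ r₂, fderiv ℝ F y = fderiv ℝ (fun y => f (graphMap ι ν V y)) y :=
    fun y hy => Filter.EventuallyEq.fderiv_eq (by
      filter_upwards [hD.mem_nhds hy] with z hz using hF z hz)
  obtain ⟨H, hHm, hHb, hH⟩ := hM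
  have hX := hH (fun x => f x • ν) (hf.smul contDiff_const) hfc.smul_right
    ((closure_mono (Function.support_smul_subset_left _ _)).trans hfs)
  have hsub := setIntegral_image_eq_setIntegral_jac hD h.contDiffOn_graphMap
    (h.injOn_graphMap hν hι) fun y hy => h.injective_fderiv_graphMap hν hι hy
  rw [hfr] at hsub
  -- The area formula brings both sides of the first variation identity to the flat annulus.
  rw [hsub, hsub] at hX
  have hFC : ContDiffOn ℝ 1 F (eann n r₁ r₂) :=
    (hf.comp_contDiffOn h.contDiffOn_graphMap).congr hF
  have hFc := hFC.continuousOn_fderiv_of_isOpen hD le_rfl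
  obtain ⟨B, hB⟩ := (hf.continuous_fderiv (by norm_num)).bounded_above_of_compact_support
    (hfc.fderiv (𝕜 := ℝ))
  have hB0 : 0 ≤ B := (norm_nonneg _).trans (hB 0)
  obtain ⟨B', hB'⟩ := hf.continuous.bounded_above_of_compact_support hfc
  have hFB : ∀ y ∈ eann n r₁ r₂, ‖fderiv ℝ F y‖ ≤ B * 2 := fun y hy => by
    have h2 : fderiv ℝ (fun y => f (graphMap ι ν V y)) y =
        (fderiv ℝ f (graphMap ι ν V y)).comp (fderiv ℝ (graphMap ι ν V) y) :=
      (((hf.differentiable (by norm_num)) _).hasFDerivAt.comp y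
        (h.hasFDerivAt_graphMap hy)).fderiv
    rw [hFd y hy, h2]
    refine (ContinuousLinearMap.opNorm_comp_le _ _).trans ?_
    gcongr
    exacts [hB _, h.norm_fderiv_graphMap_le hν hι hy]
  have hdiv : ∫ y in eann n r₁ r₂, jac (fderiv ℝ (graphMap ι ν V) y) *
        tangentialDiv (graphMap ι ν V '' eann n r₁ r₂) (fun x => f x • ν) (graphMap ι ν V y) =
      ∫ y in eann n r₁ r₂, fderiv ℝ F y
        (jac (fderiv ℝ (graphMap ι ν V) y) • normalCoord ι ν V y) := by
    refine setIntegral_congr_fun hD.measurableSet fun y hy => ?_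
    rw [h.tangentialDiv_graphMap hν hι (hf.differentiable (by norm_num)) hy, ← hFd y hy, map_smul,
      smul_eq_mul]
  rw [hdiv] at hX
  have hgc : ContinuousOn (fun y => gradient (height V) y) (eann n r₁ r₂) :=
    (InnerProductSpace.toDual ℝ (Eu n)).symm.continuous.comp_continuousOn
      (h.contDiffOn_height.continuousOn_fderiv_of_isOpen hD le_rfl)
  have hgb : ∀ y ∈ eann n r₁ r₂, ‖gradient (height V) y‖ ≤ 3 * σ := fun y hy => by
    rw [norm_gradient]; exact h.norm_fderiv_height_le hy
  have hjc : ContinuousOn (fun y => jac (fderiv ℝ (graphMap ι ν V) y)) (eann n r₁ r₂) :=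
    continuous_jac.comp_continuousOn h.continuousOn_fderiv_graphMap
  have hi1 : IntegrableOn (fun y => fderiv ℝ F y (gradient (height V) y)) (eann n r₁ r₂) := by
    refine integrableOn_eann_of_bound (C := B * 2 * (3 * σ)) (hFc.clm_apply hgc) fun y hy => ?_
    rw [← Real.norm_eq_abs]
    exact ((fderiv ℝ F y).le_opNorm _).trans (by gcongr; exacts [hFB y hy, hgb y hy])
  have hσ := h.nonneg
  have hi2 : IntegrableOn (fun y => fderiv ℝ F y
      (jac (fderiv ℝ (graphMap ι ν V) y) • normalCoord ι ν V y)) (eann n r₁ r₂) := by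
    refine integrableOn_eann_of_bound (C := B * 2 * ((1 + 2 ^ n) * (2 * (3 * σ))))
      (hFc.clm_apply (hjc.smul (h.continuousOn_normalCoord hν hι))) fun y hy => ?_
    rw [← Real.norm_eq_abs]
    refine ((fderiv ℝ F y).le_opNorm _).trans ?_
    rw [norm_smul, Real.norm_eq_abs, abs_of_nonneg (jac_nonneg _)]
    gcongr
    exacts [mul_nonneg (jac_nonneg _) (norm_nonneg _), hFB y hy, h.jac_le hν hι hy, (h.norm_jac_smul_normalCoord_sub_le hν hι hy).1.trans
      (by gcongr; exact hgb y hy)]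
  have hi3 : IntegrableOn (fun y => ‖fderiv ℝ (height V) y‖ * ‖fderiv ℝ F y‖) (eann n r₁ r₂) := by
    refine integrableOn_eann_of_bound (C := 3 * σ * (B * 2))
      ((h.contDiffOn_height.continuousOn_fderiv_of_isOpen hD le_rfl).norm.mul hFc.norm)
      fun y hy => ?_
    rw [abs_of_nonneg (by positivity)]
    gcongr
    exacts [h.norm_fderiv_height_le hy, hFB y hy]
  have hi4 : IntegrableOn (fun y => |F y|) (eann n r₁ r₂) := by
    refine integrableOn_eann_of_bound (C := B') hFC.continuousOn.abs fun y hy => ?_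
    rw [abs_abs, hF y hy]
    exact hB' _
  -- Replacing J z by the gradient of the height costs a relative error O(σ²).
  have e1 : |(∫ y in eann n r₁ r₂, fderiv ℝ F y
      (jac (fderiv ℝ (graphMap ι ν V) y) • normalCoord ι ν V y)) -
      ∫ y in eann n r₁ r₂, fderiv ℝ F y (gradient (height V) y)| ≤
      (100 * 2 ^ n + 50) * σ ^ 2 *
          (∫ y in eann n r₁ r₂, ‖fderiv ℝ (height V) y‖ * ‖fderiv ℝ F y‖) := by
    rw [← integral_sub hi2 hi1, ← integral_const_mul, ← Real.norm_eq_abs]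
    refine norm_integral_le_of_norm_le (hi3.const_mul _) ?_
    refine (ae_restrict_iff' hD.measurableSet).2 (Eventually.of_forall fun y hy => ?_)
    rw [← map_sub]
    refine ((fderiv ℝ F y).le_opNorm _).trans ?_
    rw [← norm_gradient (height V)]
    calc _ ≤ ‖fderiv ℝ F y‖ * ((100 * 2 ^ n + 50) * σ ^ 2 * ‖gradient (height V) y‖) := by
          gcongr
          exact (h.norm_jac_smul_normalCoord_sub_le hν hι hy).2
      _ = _ := by ring
  -- The left side equals the curvature term, in which the Jacobian is at most 1 + 2ⁿ and |⟪ν, h⟫| ≤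
  -- Λ.
  have e2 : |∫ y in eann n r₁ r₂, fderiv ℝ F y
      (jac (fderiv ℝ (graphMap ι ν V) y) • normalCoord ι ν V y)| ≤
      (1 + 2 ^ n) * Λ * ∫ y in eann n r₁ r₂, |F y| := by
    rw [hX, ← integral_const_mul, ← Real.norm_eq_abs]
    refine norm_integral_le_of_norm_le (hi4.const_mul _) ?_
    refine (ae_restrict_iff' hD.measurableSet).2 (Eventually.of_forall fun y hy => ?_)
    rw [norm_mul, Real.norm_eq_abs, abs_of_nonneg (jac_nonneg _), inner_smul_left, hF y hy]
    simp only [RCLike.conj_to_real, norm_mul, Real.norm_eq_abs]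
    have h5 : |⟪ν, H (graphMap ι ν V y)⟫_ℝ| ≤ Λ :=
      (abs_real_inner_le_norm _ _).trans (by rw [hν, one_mul]; exact hHb _)
    calc _ ≤ (1 + 2 ^ n) * (|f (graphMap ι ν V y)| * Λ) := by
          gcongr
          exact h.jac_le hν hι hy
      _ = _ := by ring
  have := abs_sub_abs_le_abs_sub (∫ y in eann n r₁ r₂, fderiv ℝ F y (gradient (height V) y))
    (∫ y in eann n r₁ r₂, fderiv ℝ F y (jac (fderiv ℝ (graphMap ι ν V) y) • normalCoord ι ν V y))
  rw [abs_sub_comm] at this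
  linarith

end SmallOn

end WeakForm

/-! ### Polar coordinates and integrals over spheres -/

section Slices

open Filter Topology Metric

variable {n : ℕ}

/-- The integral of `f` over the sphere of radius `r`, scaled to the unit sphere. -/
noncomputable def slice (f : Eu n → ℝ) (r : ℝ) : ℝ := sphInt fun ω => f (r • ω)

theorem norm_smul_sphere {r : ℝ} (hr : 0 ≤ r) {ω : Eu n} (hω : ω ∈ sphere (0 : Eu n) 1) :
    ‖r • ω‖ = r := by
  rw [norm_smul, mem_sphere_zero_iff_norm.1 hω, mul_one, Real.norm_of_nonneg hr]

theorem smul_mem_eann {a b r : ℝ} (ha : 0 ≤ a) (hr : r ∈ Ioo a b) {ω : Eu n}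
    (hω : ω ∈ sphere (0 : Eu n) 1) : r • ω ∈ eann n a b := by
  have h := norm_smul_sphere (ha.trans hr.1.le) hω
  exact ⟨by rw [h]; exact hr.1, by rw [h]; exact hr.2⟩

/-- Off the origin Lebesgue measure is the product of the cone measure and r^(n-1) dr. Extending f
by zero outside the annulus allows the use of this product on the whole punctured space. -/
theorem integral_eann_eq [Nontrivial (Eu n)] {a b : ℝ} (ha : 0 ≤ a) {f : Eu n → ℝ}
    (hf : IntegrableOn f (eann n a b)) :
    IntegrableOn (fun r => r ^ (n - 1) * slice f r) (Ioo a b) ∧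
    ∫ y in eann n a b, f y = ∫ r in Ioo a b, r ^ (n - 1) * slice f r := by
  have hD := (isOpen_eann (n := n) a b).measurableSet
  set g := (eann n a b).indicator f
  have hg : Integrable g := (integrable_indicator_iff hD).2 hf
  have hfr : Module.finrank ℝ (Eu n) = n := by simp
  have hmp := (volume : Measure (Eu n)).measurePreserving_homeomorphUnitSphereProd
  have hme := (homeomorphUnitSphereProd (Eu n)).measurableEmbedding
  rw [hfr] at hmp
  set G : sphere (0 : Eu n) 1 × Ioi (0 : ℝ) → ℝ := fun p => g (p.2.1 • p.1.1)
  have hGg : (fun x : ({0}ᶜ : Set (Eu n)) => G (homeomorphUnitSphereProd (Eu n) x)) =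
      fun x : ({0}ᶜ : Set (Eu n)) => g x := by
    funext x
    have : ‖(x : Eu n)‖ ≠ 0 := norm_ne_zero_iff.2 x.2
    simp [G, smul_smul, mul_inv_cancel₀ this]
  have hGi : Integrable G ((volume : Measure (Eu n)).toSphere.prod
      (Measure.volumeIoiPow (n - 1))) := by
    rw [← hmp.integrable_comp_emb hme]
    show Integrable (fun x : ({0}ᶜ : Set (Eu n)) => G (homeomorphUnitSphereProd (Eu n) x)) _
    rw [hGg]
    exact (integrableOn_iff_comap_subtypeVal (measurableSet_singleton _).compl).1 hg.integrableOn
  have hint : ∫ y, g y = ∫ p, G p ∂((volume : Measure (Eu n)).toSphere.prod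
      (Measure.volumeIoiPow (n - 1))) := by
    rw [← hmp.integral_comp hme, hGg,
      integral_subtype_comap (measurableSet_singleton _).compl (fun x => g x),
      restrict_compl_singleton]
  have hsl : ∀ r : ℝ, 0 < r → sphInt (fun ω => g (r • ω)) = (Ioo a b).indicator (slice f) r := by
    intro r hr
    by_cases hrI : r ∈ Ioo a b
    · rw [indicator_of_mem hrI, slice]
      exact sphInt_congr fun ω hω => indicator_of_mem (smul_mem_eann ha hrI hω) _
    · rw [indicator_of_notMem hrI]
      have : sphInt (fun _ : Eu n => (0 : ℝ)) = 0 := by rw [sphInt_const, zero_mul]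
      rw [← this]
      refine sphInt_congr fun ω hω => indicator_of_notMem (fun hm => hrI ?_) _
      rw [← norm_smul_sphere hr.le hω]; exact hm
  have hIoi : Ioo a b ⊆ Ioi (0 : ℝ) := fun r hr => ha.trans_lt hr.1
  have hind : ∀ r : Ioi (0 : ℝ), Real.toNNReal (r.1 ^ (n - 1)) •
      (∫ ω : sphere (0 : Eu n) 1, G (ω, r) ∂(volume : Measure (Eu n)).toSphere) =
      (Ioo a b).indicator (fun r => r ^ (n - 1) * slice f r) r := by
    intro r
    have h1 : (∫ ω : sphere (0 : Eu n) 1, G (ω, r) ∂(volume : Measure (Eu n)).toSphere) =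
      (Ioo a b).indicator (slice f) r := hsl r r.2
    have h2 : (0 : ℝ) ≤ r.1 ^ (n - 1) := pow_nonneg (le_of_lt r.2) _
    rw [h1, NNReal.smul_def, Real.coe_toNNReal _ h2, smul_eq_mul]
    by_cases hr : r.1 ∈ Ioo a b
    · rw [indicator_of_mem hr, indicator_of_mem hr]
    · rw [indicator_of_notMem hr, indicator_of_notMem hr, mul_zero]
  have hmeas : Measurable fun r : Ioi (0 : ℝ) => Real.toNNReal (r.1 ^ (n - 1)) :=
    (measurable_subtype_coe.pow_const _).real_toNNReal
  constructor
  · have h1 := hGi.integral_prod_right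
    rw [Measure.volumeIoiPow] at h1
    have h2 := (integrable_withDensity_iff_integrable_smul (μ := Measure.comap Subtype.val volume)
      hmeas).1 h1
    rw [integrable_congr (Eventually.of_forall hind)] at h2
    have h3 := (integrableOn_iff_comap_subtypeVal (s := Ioi (0 : ℝ))
      (f := (Ioo a b).indicator (fun r => r ^ (n - 1) * slice f r)) measurableSet_Ioi).2 h2
    rw [IntegrableOn, integrable_indicator_iff measurableSet_Ioo, IntegrableOn,
      Measure.restrict_restrict measurableSet_Ioo, inter_eq_left.2 hIoi] at h3
    exact h3
  · rw [← integral_indicator hD, hint, integral_prod_symm _ hGi, Measure.volumeIoiPow]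
    have h4 := integral_withDensity_eq_integral_smul (μ := Measure.comap Subtype.val volume) hmeas
      (fun r : Ioi (0 : ℝ) => ∫ ω : sphere (0 : Eu n) 1, G (ω, r)
        ∂(volume : Measure (Eu n)).toSphere)
    refine h4.trans ?_
    rw [integral_congr_ae (Eventually.of_forall hind),
      integral_subtype_comap measurableSet_Ioi
        (fun r => (Ioo a b).indicator (fun r => r ^ (n - 1) * slice f r) r),
      setIntegral_indicator measurableSet_Ioo, inter_eq_right.2 hIoi]

variable {a b : ℝ} {f g : Eu n → ℝ}

theorem continuousOn_comp_smul (ha : 0 ≤ a) (hf : ContinuousOn f (eann n a b)) {r : ℝ}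
    (hr : r ∈ Ioo a b) : ContinuousOn (fun ω => f (r • ω)) (sphere 0 1) :=
  hf.comp (continuous_const_smul r).continuousOn fun _ hω => smul_mem_eann ha hr hω

theorem slice_congr (ha : 0 ≤ a) {r : ℝ} (hr : r ∈ Ioo a b) (h : EqOn f g (eann n a b)) :
    slice f r = slice g r :=
  sphInt_congr fun _ hω => h (smul_mem_eann ha hr hω)

theorem slice_add (ha : 0 ≤ a) {r : ℝ} (hr : r ∈ Ioo a b) (hf : ContinuousOn f (eann n a b))
    (hg : ContinuousOn g (eann n a b)) :
    slice (fun y => f y + g y) r = slice f r + slice g r :=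
  sphInt_add (continuousOn_comp_smul ha hf hr) (continuousOn_comp_smul ha hg hr)

theorem slice_sub (ha : 0 ≤ a) {r : ℝ} (hr : r ∈ Ioo a b) (hf : ContinuousOn f (eann n a b))
    (hg : ContinuousOn g (eann n a b)) :
    slice (fun y => f y - g y) r = slice f r - slice g r :=
  sphInt_sub (continuousOn_comp_smul ha hf hr) (continuousOn_comp_smul ha hg hr)

theorem slice_radial_mul (c : ℝ → ℝ) (f : Eu n → ℝ) {r : ℝ} (hr : 0 ≤ r) :
    slice (fun y => c ‖y‖ * f y) r = c r * slice f r := by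
  rw [slice, slice, ← sphInt_const_mul]
  exact sphInt_congr fun ω hω => by simp only [norm_smul_sphere hr hω]

theorem slice_const_mul (c : ℝ) (f : Eu n → ℝ) (r : ℝ) :
    slice (fun y => c * f y) r = c * slice f r := sphInt_const_mul _ _

theorem slice_mono (ha : 0 ≤ a) {r : ℝ} (hr : r ∈ Ioo a b) (hf : ContinuousOn f (eann n a b))
    (hg : ContinuousOn g (eann n a b)) (h : ∀ y ∈ eann n a b, f y ≤ g y) : slice f r ≤ slice g r :=
  sphInt_mono (continuousOn_comp_smul ha hf hr) (continuousOn_comp_smul ha hg hr) fun _ hω =>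
    h _ (smul_mem_eann ha hr hω)

theorem slice_nonneg (ha : 0 ≤ a) {r : ℝ} (hr : r ∈ Ioo a b) (h : ∀ y ∈ eann n a b, 0 ≤ f y) :
    0 ≤ slice f r :=
  sphInt_nonneg fun _ hω => h _ (smul_mem_eann ha hr hω)

theorem abs_slice_le (ha : 0 ≤ a) {r C : ℝ} (hr : r ∈ Ioo a b) (hf : ContinuousOn f (eann n a b))
    (h : ∀ y ∈ eann n a b, |f y| ≤ C) : |slice f r| ≤ C * sphArea n := by
  rw [abs_le, ← neg_mul, ← sphInt_const, ← sphInt_const]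
  exact ⟨sphInt_mono continuousOn_const (continuousOn_comp_smul ha hf hr) fun _ hω =>
      (abs_le.1 (h _ (smul_mem_eann ha hr hω))).1,
    sphInt_mono (continuousOn_comp_smul ha hf hr) continuousOn_const fun _ hω =>
      (abs_le.1 (h _ (smul_mem_eann ha hr hω))).2⟩

/-- The Cauchy-Schwarz inequality on spheres. -/
theorem sphInt_mul_sq_le {f g : Eu n → ℝ} (hf : ContinuousOn f (sphere 0 1))
    (hg : ContinuousOn g (sphere 0 1)) :
    sphInt (fun x => f x * g x) ^ 2 ≤ sphInt (fun x => f x ^ 2) * sphInt (fun x => g x ^ 2) := by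
  have key : ∀ t : ℝ, 0 ≤ sphInt (fun x => g x ^ 2) * (t * t) +
      (2 * sphInt (fun x => f x * g x)) * t + sphInt (fun x => f x ^ 2) := fun t => by
    have h : sphInt (fun x => (t * g x + f x) ^ 2) = sphInt (fun x => g x ^ 2) * (t * t) +
      (2 * sphInt (fun x => f x * g x)) * t + sphInt (fun x => f x ^ 2) := by
      have h1 : (fun x => (t * g x + f x) ^ 2) =
        fun x => (t * t) * g x ^ 2 + (2 * t) * (f x * g x) + f x ^ 2 := by funext x; ring
      rw [h1, sphInt_add, sphInt_add, sphInt_const_mul, sphInt_const_mul]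
      · ring
      all_goals fun_prop
    rw [← h]
    exact sphInt_nonneg fun x _ => sq_nonneg _
  have := discrim_le_zero key
  rw [discrim] at this
  nlinarith

theorem continuousOn_slice (ha : 0 ≤ a) {C : ℝ} (hf : ContinuousOn f (eann n a b))
    (h : ∀ y ∈ eann n a b, |f y| ≤ C) : ContinuousOn (slice f) (Ioo a b) := by
  intro r hr
  refine ContinuousAt.continuousWithinAt ?_
  refine tendsto_integral_filter_of_dominated_convergence (fun _ => C) ?_ ?_
    (integrable_const C) ?_
  · filter_upwards [isOpen_Ioo.mem_nhds hr] with s hs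
    exact (sphere_integrable (continuousOn_comp_smul ha hf hs)).aestronglyMeasurable
  · filter_upwards [isOpen_Ioo.mem_nhds hr] with s hs
    exact Eventually.of_forall fun ω => h _ (smul_mem_eann ha hs ω.2)
  · refine Eventually.of_forall fun ω => ?_
    have h1 : ContinuousAt f (r • ω.1) :=
      hf.continuousAt ((isOpen_eann a b).mem_nhds (smul_mem_eann ha hr ω.2))
    exact ContinuousAt.comp (f := fun s : ℝ => s • ω.1) h1
      ((continuous_id.smul continuous_const).continuousAt)

theorem hasDerivAt_comp_smul (ha : 0 ≤ a) (hf : ContDiffOn ℝ 1 f (eann n a b)) {r : ℝ}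
    (hr : r ∈ Ioo a b) {ω : Eu n} (hω : ω ∈ sphere (0 : Eu n) 1) :
    HasDerivAt (fun s : ℝ => f (s • ω)) (r⁻¹ * fderiv ℝ f (r • ω) (r • ω)) r := by
  have h1 : HasFDerivAt f (fderiv ℝ f (r • ω)) (r • ω) :=
    ((hf.differentiableOn one_ne_zero).differentiableAt
      ((isOpen_eann a b).mem_nhds (smul_mem_eann ha hr hω))).hasFDerivAt
  have h2 : HasDerivAt (fun s : ℝ => s • ω) ω r := by
    simpa using (hasDerivAt_id r).smul_const ω
  have h3 := h1.comp_hasDerivAt r h2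
  have hr0 : r ≠ 0 := (ha.trans_lt hr.1).ne'
  rw [map_smul, smul_eq_mul, inv_mul_cancel_left₀ hr0]
  exact h3

theorem continuousOn_radial (hf : ContDiffOn ℝ 1 f (eann n a b)) :
    ContinuousOn (fun y => fderiv ℝ f y y) (eann n a b) :=
  (hf.continuousOn_fderiv_of_isOpen (isOpen_eann a b) le_rfl).clm_apply continuousOn_id

theorem hasDerivAt_slice (ha : 0 < a) {C : ℝ} (hf : ContDiffOn ℝ 1 f (eann n a b))
    (h : ∀ y ∈ eann n a b, |fderiv ℝ f y y| ≤ C) {r : ℝ} (hr : r ∈ Ioo a b) :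
    HasDerivAt (slice f) (r⁻¹ * slice (fun y => fderiv ℝ f y y) r) r := by
  have h1 : r⁻¹ * slice (fun y => fderiv ℝ f y y) r =
      ∫ ω : sphere (0 : Eu n) 1, r⁻¹ * fderiv ℝ f (r • (ω : Eu n)) (r • (ω : Eu n))
        ∂(volume : Measure (Eu n)).toSphere := (integral_const_mul _ _).symm
  rw [h1]
  have hrc := continuousOn_radial hf
  refine (hasDerivAt_integral_of_dominated_loc_of_deriv_le
    (F := fun (s : ℝ) (ω : sphere (0 : Eu n) 1) => f (s • (ω : Eu n)))
    (F' := fun (s : ℝ) (ω : sphere (0 : Eu n) 1) =>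
      s⁻¹ * fderiv ℝ f (s • (ω : Eu n)) (s • (ω : Eu n)))
    (bound := fun _ => a⁻¹ * C) (isOpen_Ioo.mem_nhds hr) ?_ ?_ ?_ ?_ (integrable_const _) ?_).2
  · filter_upwards [isOpen_Ioo.mem_nhds hr] with s hs
    exact (sphere_integrable (continuousOn_comp_smul ha.le hf.continuousOn hs)).aestronglyMeasurable
  · exact sphere_integrable (continuousOn_comp_smul ha.le hf.continuousOn hr)
  · exact ((sphere_integrable (continuousOn_comp_smul ha.le hrc hr)).const_mul
      r⁻¹).aestronglyMeasurable
  · refine Eventually.of_forall fun ω s hs => ?_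
    rw [norm_mul, norm_inv, Real.norm_eq_abs, Real.norm_eq_abs, abs_of_pos (ha.trans hs.1)]
    exact mul_le_mul (inv_anti₀ ha hs.1.le) (h _ (smul_mem_eann ha.le hs ω.2)) (abs_nonneg _)
      (by positivity)
  · exact Eventually.of_forall fun ω s hs => hasDerivAt_comp_smul ha.le hf hs ω.2

/-- Two slices differ by the radial energy. -/
theorem slice_sub_sq_le (ha : 0 < a) {C : ℝ} (hf : ContDiffOn ℝ 1 f (eann n a b))
    (h : ∀ y ∈ eann n a b, |fderiv ℝ f y y| ≤ C) {r s : ℝ} (hr : r ∈ Ioo a b) (hs : s ∈ Ioo a b) :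
    sphInt (fun ω => (f (r • ω) - f (s • ω)) ^ 2) ≤
      (b - a) * ∫ t in Ioo a b, (t ^ 2)⁻¹ * slice (fun y => fderiv ℝ f y y ^ 2) t := by
  wlog hrs : s ≤ r generalizing r s
  · have := this hs hr (not_le.1 hrs).le
    convert this using 3
    ring
  set G : Eu n → ℝ → ℝ := fun ω t => (t⁻¹ * fderiv ℝ f (t • ω) (t • ω)) ^ 2
  have hrc := continuousOn_radial hf
  have hsub : Icc s r ⊆ Ioo a b := fun t ht => ⟨hs.1.trans_le ht.1, ht.2.trans_lt hr.2⟩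
  have hGc : ContinuousOn (fun p : Eu n × ℝ => G p.1 p.2) (sphere 0 1 ×ˢ Ioo a b) := by
    have h1 : ContinuousOn (fun p : Eu n × ℝ => p.2 • p.1) (sphere 0 1 ×ˢ Ioo a b) := by fun_prop
    have h2 := hrc.comp h1 (fun p hp => smul_mem_eann ha.le hp.2 hp.1)
    have h3 : ContinuousOn (fun p : Eu n × ℝ => p.2⁻¹) (sphere 0 1 ×ˢ Ioo a b) :=
      continuousOn_snd.inv₀ fun p hp => (ha.trans hp.2.1).ne'
    exact (h3.mul h2).pow 2
  have hGb : ∀ ω ∈ sphere (0 : Eu n) 1, ∀ t ∈ Ioo a b, |G ω t| ≤ (a⁻¹ * C) ^ 2 := by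
    intro ω hω t ht
    have h0 : |G ω t| = (t⁻¹ * |fderiv ℝ f (t • ω) (t • ω)|) ^ 2 := by
      rw [abs_of_nonneg (sq_nonneg _), mul_pow, sq_abs, ← mul_pow]
    rw [h0]
    have := inv_anti₀ ha ht.1.le
    have := h _ (smul_mem_eann ha.le ht hω)
    have := ha.trans ht.1
    gcongr
  have hray : ∀ ω ∈ sphere (0 : Eu n) 1, ContinuousOn (G ω) (Ioo a b) := fun ω hω =>
    hGc.comp (f := fun t : ℝ => (ω, t)) (by fun_prop) fun t ht => ⟨hω, ht⟩
  have hrayi : ∀ ω ∈ sphere (0 : Eu n) 1, IntegrableOn (G ω) (Ioo a b) := fun ω hω =>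
    IntegrableOn.of_bound (by simp) ((hray ω hω).aestronglyMeasurable measurableSet_Ioo) _
      ((ae_restrict_iff' measurableSet_Ioo).2 (Eventually.of_forall fun t ht => hGb ω hω t ht))
  -- Along each ray: the fundamental theorem of calculus and Cauchy-Schwarz. Integration over ω and
  -- Fubini then give the claim.
  have hpt : ∀ ω ∈ sphere (0 : Eu n) 1, (f (r • ω) - f (s • ω)) ^ 2 ≤
      (b - a) * ∫ t in Ioo a b, G ω t := by
    intro ω hω
    rcases hrs.eq_or_lt with rfl | hlt
    · rw [sub_self]
      have : 0 ≤ ∫ t in Ioo a b, G ω t := integral_nonneg fun t => sq_nonneg _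
      have h2 : 0 ≤ b - a := by linarith [hr.1, hr.2]
      nlinarith [mul_nonneg h2 this]
    set g : ℝ → ℝ := fun t => t⁻¹ * fderiv ℝ f (t • ω) (t • ω)
    have hgc : ContinuousOn g (uIcc s r) := by
      rw [uIcc_of_le hrs]
      refine ContinuousOn.mul (continuousOn_id.inv₀ fun t ht => (ha.trans (hsub ht).1).ne') ?_
      exact hrc.comp (f := fun t : ℝ => t • ω) (by fun_prop)
        fun t ht => smul_mem_eann ha.le (hsub ht) hω
    have hftc : ∫ t in s..r, g t = f (r • ω) - f (s • ω) :=
      intervalIntegral.integral_eq_sub_of_hasDerivAt (fun t ht => hasDerivAt_comp_smul ha.le hf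
        (hsub (by rwa [uIcc_of_le hrs] at ht)) hω) hgc.intervalIntegrable
    set c := f (r • ω) - f (s • ω)
    have hl : 0 < r - s := sub_pos.2 hlt
    -- Cauchy-Schwarz in the form that the variance of g on [s, r] is nonnegative; c / (r - s) is
    -- its mean.
    have h1 : 0 ≤ ∫ t in s..r, (g t - c / (r - s)) ^ 2 :=
      intervalIntegral.integral_nonneg hrs fun t _ => sq_nonneg _
    have h2 : ∫ t in s..r, (g t - c / (r - s)) ^ 2 =
        (∫ t in s..r, g t ^ 2) - c ^ 2 / (r - s) := by
      have h3 : ∀ t, (g t - c / (r - s)) ^ 2 =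
          g t ^ 2 - (2 * (c / (r - s))) * g t + (c / (r - s)) ^ 2 := fun t => by ring
      simp only [h3]
      have hg2 : IntervalIntegrable (fun t => g t ^ 2) volume s r :=
        (hgc.pow 2).intervalIntegrable
      have hg1 : IntervalIntegrable (fun t => (2 * (c / (r - s))) * g t) volume s r :=
        (continuousOn_const.mul hgc).intervalIntegrable
      rw [intervalIntegral.integral_add (hg2.sub hg1) (by simp),
        intervalIntegral.integral_sub hg2 hg1, intervalIntegral.integral_const_mul, hftc,
        intervalIntegral.integral_const, smul_eq_mul]
      field_simp
      ring
    have h4 : ∫ t in s..r, g t ^ 2 ≤ ∫ t in Ioo a b, G ω t := by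
      rw [intervalIntegral.integral_of_le hrs]
      refine setIntegral_mono_set (hrayi ω hω) (Eventually.of_forall fun t => sq_nonneg _) ?_
      exact (Ioc_subset_Icc_self.trans hsub).eventuallyLE
    rw [h2, sub_nonneg, div_le_iff₀ hl] at h1
    have h5 : 0 ≤ ∫ t in Ioo a b, G ω t := integral_nonneg fun t => sq_nonneg _
    calc c ^ 2 ≤ (∫ t in s..r, g t ^ 2) * (r - s) := h1
      _ ≤ (∫ t in Ioo a b, G ω t) * (b - a) := by
        gcongr
        · exact hr.2.le
        · exact hs.1.le
      _ = _ := mul_comm _ _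
  have hcm : ContinuousOn (fun p : sphere (0 : Eu n) 1 × ℝ => G p.1 p.2) (univ ×ˢ Ioo a b) :=
    hGc.comp (f := fun p : sphere (0 : Eu n) 1 × ℝ => ((p.1 : Eu n), p.2)) (by fun_prop)
      fun p hp => ⟨p.1.2, hp.2⟩
  have hprod : Integrable (fun p : sphere (0 : Eu n) 1 × ℝ => G p.1 p.2)
      ((volume : Measure (Eu n)).toSphere.prod (volume.restrict (Ioo a b))) := by
    have hm : (volume : Measure (Eu n)).toSphere.prod (volume.restrict (Ioo a b)) =
        ((volume : Measure (Eu n)).toSphere.prod volume).restrict (univ ×ˢ Ioo a b) := by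
      rw [← Measure.prod_restrict, Measure.restrict_univ]
    have hfin : IsFiniteMeasure (volume.restrict (Ioo a b)) := ⟨by simp⟩
    refine Integrable.of_bound (C := (a⁻¹ * C) ^ 2) ?_ ?_
    · rw [hm]
      exact hcm.aestronglyMeasurable (MeasurableSet.univ.prod measurableSet_Ioo)
    · rw [hm, ae_restrict_iff' (MeasurableSet.univ.prod measurableSet_Ioo)]
      exact Eventually.of_forall fun p hp => hGb p.1 p.1.2 p.2 hp.2
  have hfc : ContinuousOn (fun ω => (f (r • ω) - f (s • ω)) ^ 2) (sphere 0 1) :=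
    ((continuousOn_comp_smul ha.le hf.continuousOn hr).sub
      (continuousOn_comp_smul ha.le hf.continuousOn hs)).pow 2
  calc sphInt (fun ω => (f (r • ω) - f (s • ω)) ^ 2)
      ≤ ∫ ω : sphere (0 : Eu n) 1, ((b - a) * ∫ t in Ioo a b, G ω t)
          ∂(volume : Measure (Eu n)).toSphere :=
        integral_mono (sphere_integrable hfc) (hprod.integral_prod_left.const_mul _)
          fun ω => hpt ω ω.2
    _ = _ := by
        rw [integral_const_mul, integral_integral_swap hprod]
        congr 1
        refine integral_congr_ae (Eventually.of_forall fun t => ?_)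
        show sphInt (fun ω => G ω t) = (t ^ 2)⁻¹ * sphInt (fun ω => fderiv ℝ f (t • ω) (t • ω) ^ 2)
        rw [ ← sphInt_const_mul]
        congr 1
        funext ω
        simp only [G, mul_pow, inv_pow]

end Slices

/-! ### Radial test functions and the Caccioppoli inequality -/

section RadialTest

open Filter Topology Metric

variable {n : ℕ} {r₁ r₂ r₃ r₄ : ℝ}

/-- The norm is not differentiable at the origin only, and there the composition vanishes nearby
because the support of α stays above r₁ > 0. -/
theorem contDiff_comp_norm {E : Type*} [NormedAddCommGroup E] [InnerProductSpace ℝ E]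
    {α : ℝ → ℝ} (h0 : 0 < r₁) (hα : ContDiff ℝ 1 α) (hs : tsupport α ⊆ Ioo r₁ r₂) :
    ContDiff ℝ 1 (fun x : E => α ‖x‖) := by
  refine contDiff_iff_contDiffAt.2 fun x => ?_
  by_cases hx : x = 0
  · have h1 : ‖x‖ ∉ tsupport α := fun h => by
      have := (hs h).1
      rw [hx, norm_zero] at this
      linarith
    have h2 : ∀ᶠ y in 𝓝 x, ‖y‖ ∈ (tsupport α)ᶜ :=
      continuous_norm.continuousAt.eventually ((isClosed_tsupport α).isOpen_compl.mem_nhds h1)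
    refine (contDiffAt_const (c := (0 : ℝ))).congr_of_eventuallyEq ?_
    filter_upwards [h2] with y hy using image_eq_zero_of_notMem_tsupport hy
  · exact hα.contDiffAt.comp x (contDiffAt_norm ℝ hx)

/-- The test function `α(|y|) |y| V + β(|y|)`. -/
noncomputable def radialTest (V : Eu n → ℝ) (α β : ℝ → ℝ) (y : Eu n) : ℝ :=
  α ‖y‖ * height V y + β ‖y‖

theorem fderiv_radialTest {V : Eu n → ℝ} {α β : ℝ → ℝ} {y : Eu n} (hV : DifferentiableAt ℝ V y)
    (hy : y ≠ 0) (hα : DifferentiableAt ℝ α ‖y‖) (hβ : DifferentiableAt ℝ β ‖y‖) :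
    fderiv ℝ (radialTest V α β) y = α ‖y‖ • fderiv ℝ (height V) y +
      ((deriv α ‖y‖ * height V y + deriv β ‖y‖) * ‖y‖⁻¹) • innerSL ℝ y := by
  have h1 := hasFDerivAt_norm hy
  have h2 : HasFDerivAt (fun y : Eu n => α ‖y‖) _ y := hα.hasDerivAt.comp_hasFDerivAt y h1
  have h3 : HasFDerivAt (fun y : Eu n => β ‖y‖) _ y := hβ.hasDerivAt.comp_hasFDerivAt y h1
  have h4 := (hasFDerivAt_height hV hy).differentiableAt.hasFDerivAt
  have h5 : HasFDerivAt (radialTest V α β) _ y := (h2.mul h4).add h3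
  rw [h5.fderiv]
  ext v
  simp [_root_.smul_apply, _root_.add_apply]
  ring

namespace SmallOn

variable {ι : Eu n →ₗᵢ[ℝ] Amb n} {ν : Amb n} {V : Eu n → ℝ} {σ Λ : ℝ}

/-- The ambient function α(|x|) ⟪x, ν⟫ + β(|x|) is admissible in the first variation and pulls back
exactly to `radialTest`, because Φ preserves norms and ⟪Φ(y), ν⟫ is the height. -/
theorem abs_integral_radialTest_le (h : SmallOn V σ r₁ r₂) (hν : ‖ν‖ = 1)
    (hι : ∀ y, ⟪ι y, ν⟫_ℝ = 0)
    (hM : HasMeanCurvatureBoundedBy (graphMap ι ν V '' eann n r₁ r₂) (annulus n r₁ r₂) Λ)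
    {α β : ℝ → ℝ} (hα : ContDiff ℝ 1 α) (hβ : ContDiff ℝ 1 β) (hsα : tsupport α ⊆ Ioo r₁ r₂)
    (hsβ : tsupport β ⊆ Ioo r₁ r₂) :
    |∫ y in eann n r₁ r₂, fderiv ℝ (radialTest V α β) y (gradient (height V) y)| ≤
      (100 * 2 ^ n + 50) * σ ^ 2 *
          (∫ y in eann n r₁ r₂, ‖fderiv ℝ (height V) y‖ * ‖fderiv ℝ (radialTest V α β) y‖) +
        (1 + 2 ^ n) * Λ * ∫ y in eann n r₁ r₂, |radialTest V α β y| := by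
  set f : Amb n → ℝ := fun x => α ‖x‖ * ⟪x, ν⟫_ℝ + β ‖x‖
  set K : Set (Amb n) := {x | ‖x‖ ∈ tsupport α ∪ tsupport β}
  have hKc : IsClosed K :=
    ((isClosed_tsupport α).union (isClosed_tsupport β)).preimage continuous_norm
  have hKs : K ⊆ annulus n r₁ r₂ := fun x hx => union_subset hsα hsβ hx
  have hKk : IsCompact K := isCompact_of_isClosed_isBounded hKc
    ((isBounded_ball (x := (0 : Amb n)) (r := r₂)).subset fun x hx => by
      simpa using (hKs hx).2)
  have hfK : Function.support f ⊆ K := fun x hx => by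
    by_contra hxK
    have h1 : ‖x‖ ∉ tsupport α := fun h1 => hxK (Or.inl h1)
    have h2 : ‖x‖ ∉ tsupport β := fun h1 => hxK (Or.inr h1)
    exact hx (by simp [f, image_eq_zero_of_notMem_tsupport h1, image_eq_zero_of_notMem_tsupport h2])
  have hf : ContDiff ℝ 1 f := ((contDiff_comp_norm h.pos hα hsα).mul
    (contDiff_id.inner ℝ contDiff_const)).add (contDiff_comp_norm h.pos hβ hsβ)
  refine h.abs_integral_fderiv_gradient_le hν hι hM hf
    (HasCompactSupport.of_support_subset_isCompact hKk hfK)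
    ((closure_minimal hfK hKc).trans hKs) fun y hy => ?_
  simp only [f, radialTest, norm_graphMap hν hι (h.abs_lt_one hy), inner_graphMap hν hι]

end SmallOn

/-- A cutoff function between two annuli, with scale invariant bounds. -/
structure IsCutoff (ζ : ℝ → ℝ) (c r₁ r₂ r₃ r₄ : ℝ) : Prop where
  contDiff : ContDiff ℝ 1 ζ
  nonneg : ∀ r, 0 ≤ ζ r
  le_one : ∀ r, ζ r ≤ 1
  eq_one : ∀ r ∈ Ioo r₃ r₄, ζ r = 1
  tsupport_subset : tsupport ζ ⊆ Ioo r₁ r₂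
  abs_deriv_le : ∀ r ∈ Ioo r₁ r₂, |r * deriv ζ r| ≤ c

/-- One fixed bump is rescaled by r₀. The quantity r ζ'(r) is invariant under scaling, so c depends
on η and η₀ alone. -/
theorem exists_isCutoff {η η₀ : ℝ} (hη : 0 < η) (hη₀ : η < η₀) : ∃ c : ℝ, 0 ≤ c ∧ ∀ r₀ > 0,
    ∃ ζ, IsCutoff ζ c (r₀ * (1 - η₀)) (r₀ * (1 + η₀)) (r₀ * (1 - η)) (r₀ * (1 + η)) := by
  -- The outer radius lies strictly between η and η₀, which keeps the closed support inside the open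
  -- interval.
  let χ : ContDiffBump (0 : ℝ) := ⟨η, (η + η₀) / 2, hη, by linarith⟩
  have hχ : ContDiff ℝ 1 χ := χ.contDiff
  obtain ⟨B, hB⟩ := (hχ.continuous_deriv le_rfl).bounded_above_of_compact_support
    χ.hasCompactSupport.deriv
  have hB0 : 0 ≤ B := (norm_nonneg _).trans (hB 0)
  refine ⟨(1 + η₀) * B, by have := hη.trans hη₀; positivity, fun r₀ hr₀ => ?_⟩
  have hd : ∀ r, HasDerivAt (fun r => χ ((r - r₀) / r₀)) (deriv χ ((r - r₀) / r₀) * (1 / r₀)) r :=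
    fun r => ((hχ.differentiable one_ne_zero) _).hasDerivAt.comp r
      (((hasDerivAt_id r).sub_const r₀).div_const r₀)
  refine ⟨fun r => χ ((r - r₀) / r₀), ?_, fun r => χ.nonneg, fun r => χ.le_one, ?_, ?_, ?_⟩
  · exact hχ.comp ((contDiff_id.sub contDiff_const).div_const r₀)
  · intro r hr
    refine χ.one_of_mem_closedBall ?_
    rw [mem_closedBall_zero_iff, Real.norm_eq_abs, abs_div, abs_of_pos hr₀, div_le_iff₀ hr₀, abs_le]
    constructor <;> linarith [hr.1, hr.2]
  · have hK : Function.support (fun r => χ ((r - r₀) / r₀)) ⊆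
        Icc (r₀ * (1 - (η + η₀) / 2)) (r₀ * (1 + (η + η₀) / 2)) := by
      intro r hr
      have h1 : (r - r₀) / r₀ ∈ ball (0 : ℝ) ((η + η₀) / 2) := by
        rw [← show Function.support χ = ball (0 : ℝ) ((η + η₀) / 2) from χ.support_eq]
        exact hr
      rw [mem_ball_zero_iff, Real.norm_eq_abs, abs_div, abs_of_pos hr₀, div_lt_iff₀ hr₀, abs_lt] at h1
      constructor <;> linarith [h1.1, h1.2]
    refine (closure_minimal hK isClosed_Icc).trans fun r hr => ⟨?_, ?_⟩
    · refine lt_of_lt_of_le ?_ hr.1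
      gcongr; linarith
    · refine lt_of_le_of_lt hr.2 ?_
      gcongr; linarith
  · intro r hr
    rw [(hd r).deriv, abs_mul, abs_mul, abs_of_pos (by positivity : 0 < 1 / r₀)]
    have h1 : |r| ≤ r₀ * (1 + η₀) := by
      rw [abs_le]
      constructor <;> nlinarith [hr.1, hr.2]
    calc |r| * (|deriv χ ((r - r₀) / r₀)| * (1 / r₀)) ≤ (r₀ * (1 + η₀)) * (B * (1 / r₀)) := by
          gcongr
          · have := hη.trans hη₀; positivity
          · exact hB _
      _ = (1 + η₀) * B := by field_simp

namespace IsCutoff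

variable {ζ : ℝ → ℝ} {c : ℝ}

theorem contDiff_sq (hζ : IsCutoff ζ c r₁ r₂ r₃ r₄) : ContDiff ℝ 1 (fun r => ζ r ^ 2) :=
  hζ.contDiff.pow 2

theorem hasDerivAt (hζ : IsCutoff ζ c r₁ r₂ r₃ r₄) (r : ℝ) : HasDerivAt ζ (deriv ζ r) r :=
  (hζ.contDiff.differentiable one_ne_zero r).hasDerivAt

theorem deriv_sq (hζ : IsCutoff ζ c r₁ r₂ r₃ r₄) (r : ℝ) :
    deriv (fun r => ζ r ^ 2) r = 2 * ζ r * deriv ζ r := by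
  have h : HasDerivAt (fun r => ζ r ^ 2) _ r := (hζ.hasDerivAt r).pow 2
  rw [h.deriv]
  simp

theorem tsupport_sq_subset (hζ : IsCutoff ζ c r₁ r₂ r₃ r₄) :
    tsupport (fun r => ζ r ^ 2) ⊆ Ioo r₁ r₂ := by
  refine (closure_mono fun r hr => ?_).trans hζ.tsupport_subset
  simpa using hr

theorem continuous (hζ : IsCutoff ζ c r₁ r₂ r₃ r₄) : Continuous ζ := hζ.contDiff.continuous

end IsCutoff

namespace SmallOn

variable {ι : Eu n →ₗᵢ[ℝ] Amb n} {ν : Amb n} {V : Eu n → ℝ} {σ Λ : ℝ}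

/-- From |y| DV = Dw - V ⟪y, ·⟫ / |y|, where w = |y| V. -/
theorem norm_mul_norm_fderiv_sq_le (h : SmallOn V σ r₁ r₂) {y : Eu n} (hy : y ∈ eann n r₁ r₂) :
    energyDensity V y ≤ 2 * ‖fderiv ℝ (height V) y‖ ^ 2 + 3 * V y ^ 2 := by
  have hn : ‖y‖ ≠ 0 := norm_ne_zero_iff.2 (h.ne_zero hy)
  have h1 : ‖y‖ • fderiv ℝ V y = fderiv ℝ (height V) y - V y • (‖y‖⁻¹ • innerSL ℝ y) := by
    rw [(hasFDerivAt_height (h.differentiableAt hy) (h.ne_zero hy)).fderiv, add_sub_cancel_right]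
  have h2 : ‖y‖ * ‖fderiv ℝ V y‖ ≤ ‖fderiv ℝ (height V) y‖ + |V y| := by
    have := norm_sub_le (fderiv ℝ (height V) y) (V y • (‖y‖⁻¹ • innerSL ℝ y))
    rwa [← h1, norm_smul, norm_norm, norm_smul, norm_smul, innerSL_apply_norm, norm_inv, norm_norm,
      inv_mul_cancel₀ hn, mul_one, Real.norm_eq_abs] at this
  have h3 : (‖y‖ * ‖fderiv ℝ V y‖) ^ 2 ≤ (‖fderiv ℝ (height V) y‖ + |V y|) ^ 2 := by gcongr
  rw [energyDensity, ← mul_pow, ← sq_abs (V y)]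
  nlinarith [sq_nonneg (‖fderiv ℝ (height V) y‖ - |V y|)]

theorem norm_le (h : SmallOn V σ r₁ r₂) {y : Eu n} (hy : y ∈ eann n r₁ r₂) : ‖y‖ ≤ r₂ :=
  have := h.pos
  hy.2.le

/-- The Caccioppoli inequality. -/
theorem integral_energyDensity_le (h : SmallOn V σ r₁ r₂) (hν : ‖ν‖ = 1)
    (hι : ∀ y, ⟪ι y, ν⟫_ℝ = 0) (hΛ : 0 ≤ Λ)
    (hM : HasMeanCurvatureBoundedBy (graphMap ι ν V '' eann n r₁ r₂) (annulus n r₁ r₂) Λ)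
    {ζ : ℝ → ℝ} {c : ℝ} (hc : 0 ≤ c) (hζ : IsCutoff ζ c r₁ r₂ r₃ r₄) (h13 : r₁ ≤ r₃) (h42 : r₄ ≤ r₂)
    (hσ : (100 * 2 ^ n + 50) * σ ^ 2 ≤ 1 / 8) :
    ∫ y in eann n r₃ r₄, energyDensity V y ≤ (20 * c ^ 2 + 4 * (1 + 2 ^ n)) *
      ∫ y in eann n r₁ r₂, (V y ^ 2 + Λ * (‖y‖ * |V y|)) := by
  have hD := (isOpen_eann (n := n) r₁ r₂).measurableSet
  have hsub : eann n r₃ r₄ ⊆ eann n r₁ r₂ := fun y hy =>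
    ⟨h13.trans_lt hy.1, hy.2.trans_le h42⟩
  -- The test function is ζ² w, without radial correction.
  have hW := h.abs_integral_radialTest_le hν hι hM hζ.contDiff_sq contDiff_const (β := fun _ => 0)
    hζ.tsupport_sq_subset (by simp [tsupport])
  set F := radialTest V (fun r => ζ r ^ 2) (fun _ => 0)
  set A := (100 * 2 ^ n + 50) * σ ^ 2
  have hA : 0 ≤ A := by positivity
  have hFd : ∀ y ∈ eann n r₁ r₂, fderiv ℝ F y = ζ ‖y‖ ^ 2 • fderiv ℝ (height V) y +
      (2 * ζ ‖y‖ * deriv ζ ‖y‖ * V y) • innerSL ℝ y := fun y hy => by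
    have hn : ‖y‖ ≠ 0 := norm_ne_zero_iff.2 (h.ne_zero hy)
    rw [fderiv_radialTest (h.differentiableAt hy) (h.ne_zero hy)
      (hζ.contDiff_sq.differentiable one_ne_zero _) (differentiableAt_const _), hζ.deriv_sq,
      deriv_const, height]
    congr 2
    field_simp
    ring
  have hzr : ∀ y ∈ eann n r₁ r₂, ‖(2 * ζ ‖y‖ * deriv ζ ‖y‖ * V y) • innerSL ℝ y‖ ≤
      2 * ζ ‖y‖ * c * |V y| := fun y hy => by
    rw [norm_smul, innerSL_apply_norm, Real.norm_eq_abs, abs_mul, abs_mul, abs_mul, abs_two,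
      abs_of_nonneg (hζ.nonneg _)]
    have h1 := hζ.abs_deriv_le ‖y‖ hy
    rw [abs_mul, abs_norm] at h1
    calc _ = 2 * ζ ‖y‖ * (‖y‖ * |deriv ζ ‖y‖|) * |V y| := by ring
      _ ≤ _ := by
        have := hζ.nonneg ‖y‖
        gcongr
  have hVc := h.contDiffOn.continuousOn
  have hwc : ContinuousOn (fderiv ℝ (height V)) (eann n r₁ r₂) :=
    h.contDiffOn_height.continuousOn_fderiv_of_isOpen (isOpen_eann _ _) le_rfl
  have hzc : ContinuousOn (fun y : Eu n => ζ ‖y‖) (eann n r₁ r₂) :=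
    (hζ.continuous.comp continuous_norm).continuousOn
  have hσ0 := h.nonneg
  have hIi : IntegrableOn (fun y => ζ ‖y‖ ^ 2 * ‖fderiv ℝ (height V) y‖ ^ 2) (eann n r₁ r₂) :=
    integrableOn_eann_of_bound (C := 1 ^ 2 * (3 * σ) ^ 2) ((hzc.pow 2).mul (hwc.norm.pow 2))
      fun y hy => by
        have := hζ.nonneg ‖y‖
        rw [abs_of_nonneg (by positivity)]
        gcongr
        exacts [hζ.le_one _, h.norm_fderiv_height_le hy]
  have hVi : IntegrableOn (fun y => V y ^ 2) (eann n r₁ r₂) :=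
    integrableOn_eann_of_bound (C := σ ^ 2) (hVc.pow 2) fun y hy => by
      rw [abs_of_nonneg (by positivity), ← sq_abs]
      gcongr
      exact h.abs_le y hy
  have hLi : IntegrableOn (fun y => ‖y‖ * |V y|) (eann n r₁ r₂) :=
    integrableOn_eann_of_bound (C := r₂ * σ) (continuous_norm.continuousOn.mul hVc.abs)
      fun y hy => by
        rw [abs_of_nonneg (by positivity)]
        exact mul_le_mul (h.norm_le hy) (h.abs_le y hy) (abs_nonneg _)
          ((norm_nonneg _).trans (h.norm_le hy))
  set I := ∫ y in eann n r₁ r₂, ζ ‖y‖ ^ 2 * ‖fderiv ℝ (height V) y‖ ^ 2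
  set J := ∫ y in eann n r₁ r₂, V y ^ 2
  set Q := ∫ y in eann n r₁ r₂, ‖y‖ * |V y|
  have hI0 : 0 ≤ I := integral_nonneg fun y => by positivity
  have hJ0 : 0 ≤ J := integral_nonneg fun y => by positivity
  have hQ0 : 0 ≤ Q := integral_nonneg fun y => by positivity
  have hFn : ∀ y ∈ eann n r₁ r₂, ‖fderiv ℝ F y‖ ≤
      ζ ‖y‖ ^ 2 * ‖fderiv ℝ (height V) y‖ + 2 * ζ ‖y‖ * c * |V y| := fun y hy => by
    rw [hFd y hy]
    refine (norm_add_le _ _).trans ?_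
    rw [norm_smul, Real.norm_of_nonneg (sq_nonneg _)]
    gcongr
    exact hzr y hy
  have hFC : ContinuousOn (fderiv ℝ F) (eann n r₁ r₂) := by
    have h1 : ContDiffOn ℝ 1 F (eann n r₁ r₂) := by
      refine ContDiffOn.add (ContDiffOn.mul ?_ h.contDiffOn_height) contDiffOn_const
      exact (contDiff_comp_norm h.pos hζ.contDiff_sq hζ.tsupport_sq_subset).contDiffOn
    exact h1.continuousOn_fderiv_of_isOpen (isOpen_eann _ _) le_rfl
  have hgc : ContinuousOn (fun y => gradient (height V) y) (eann n r₁ r₂) :=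
    (InnerProductSpace.toDual ℝ (Eu n)).symm.continuous.comp_continuousOn hwc
  -- The cross term 2 c ζ |V| |Dw| is split so that a quarter of the good term pays for its gradient
  -- part.
  have hpt : ∀ y ∈ eann n r₁ r₂, |fderiv ℝ F y (gradient (height V) y) -
      ζ ‖y‖ ^ 2 * ‖fderiv ℝ (height V) y‖ ^ 2| ≤
      1 / 4 * (ζ ‖y‖ ^ 2 * ‖fderiv ℝ (height V) y‖ ^ 2) + 4 * c ^ 2 * V y ^ 2 := fun y hy => by
    have h1 : fderiv ℝ (height V) y (gradient (height V) y) = ‖fderiv ℝ (height V) y‖ ^ 2 := by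
      rw [← inner_gradient_left, real_inner_self_eq_norm_sq, norm_gradient]
    have h2 : fderiv ℝ F y (gradient (height V) y) - ζ ‖y‖ ^ 2 * ‖fderiv ℝ (height V) y‖ ^ 2 =
        ((2 * ζ ‖y‖ * deriv ζ ‖y‖ * V y) • innerSL ℝ y) (gradient (height V) y) := by
      rw [hFd y hy, _root_.add_apply, _root_.smul_apply, h1, smul_eq_mul, add_sub_cancel_left]
    rw [h2, ← Real.norm_eq_abs]
    refine (ContinuousLinearMap.le_opNorm _ _).trans ?_
    rw [norm_gradient]
    refine (mul_le_mul_of_nonneg_right (hzr y hy) (norm_nonneg _)).trans ?_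
    rw [← sq_abs (V y)]
    nlinarith [sq_nonneg (ζ ‖y‖ * ‖fderiv ℝ (height V) y‖ - 4 * (c * |V y|))]
  have e1 : 3 / 4 * I - 4 * c ^ 2 * J ≤
      ∫ y in eann n r₁ r₂, fderiv ℝ F y (gradient (height V) y) := by
    rw [← integral_const_mul, ← integral_const_mul,
      ← integral_sub (hIi.const_mul _) (hVi.const_mul _)]
    refine setIntegral_mono_on ((hIi.const_mul _).sub (hVi.const_mul _)) ?_ hD fun y hy => ?_
    · refine integrableOn_eann_of_bound (C := (1 ^ 2 * (3 * σ) + 2 * 1 * c * σ) * (3 * σ))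
        (hFC.clm_apply hgc) fun y hy => ?_
      rw [← Real.norm_eq_abs]
      refine ((fderiv ℝ F y).le_opNorm _).trans ?_
      rw [norm_gradient]
      have := hζ.nonneg ‖y‖
      have := hζ.le_one ‖y‖
      gcongr
      · refine (hFn y hy).trans ?_
        gcongr
        exacts [h.norm_fderiv_height_le hy, h.abs_le y hy]
      · exact h.norm_fderiv_height_le hy
    · have := (_root_.abs_le.1 (hpt y hy)).1
      linarith
  have e2 : ∫ y in eann n r₁ r₂, ‖fderiv ℝ (height V) y‖ * ‖fderiv ℝ F y‖ ≤ 2 * I + c ^ 2 * J := by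
    rw [← integral_const_mul, ← integral_const_mul,
      ← integral_add (hIi.const_mul _) (hVi.const_mul _)]
    refine integral_mono_of_nonneg (Eventually.of_forall fun y => by positivity)
      ((hIi.const_mul _).add (hVi.const_mul _)) ?_
    refine (ae_restrict_iff' hD).2 (Eventually.of_forall fun y hy => ?_)
    refine (mul_le_mul_of_nonneg_left (hFn y hy) (norm_nonneg _)).trans ?_
    beta_reduce
    rw [← sq_abs (V y)]
    nlinarith [sq_nonneg (ζ ‖y‖ * ‖fderiv ℝ (height V) y‖ - c * |V y|)]
  have e3 : ∫ y in eann n r₁ r₂, |F y| ≤ Q := by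
    refine integral_mono_of_nonneg (Eventually.of_forall fun y => abs_nonneg _) hLi ?_
    refine (ae_restrict_iff' hD).2 (Eventually.of_forall fun y hy => ?_)
    have h1 : F y = ζ ‖y‖ ^ 2 * (‖y‖ * V y) := by simp [F, radialTest, height]
    have h2 : ζ ‖y‖ ^ 2 ≤ 1 := pow_le_one₀ (hζ.nonneg _) (hζ.le_one _)
    beta_reduce
    rw [h1, abs_mul, abs_mul, abs_norm, abs_of_nonneg (sq_nonneg _)]
    exact mul_le_of_le_one_left (by positivity) h2
  -- Of 3/4 `I`, the perturbation with A ≤ 1/8 consumes 1/4; the remaining half is doubled.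
  have hfin : I ≤ 10 * c ^ 2 * J + 2 * (1 + 2 ^ n) * Λ * Q := by
    have h1 := (le_abs_self _).trans hW
    have h2 : A * (∫ y in eann n r₁ r₂, ‖fderiv ℝ (height V) y‖ * ‖fderiv ℝ F y‖) ≤
        1 / 8 * (2 * I + c ^ 2 * J) :=
      (mul_le_mul_of_nonneg_left e2 hA).trans (by gcongr)
    have h3 : (1 + 2 ^ n) * Λ * ∫ y in eann n r₁ r₂, |F y| ≤ (1 + 2 ^ n) * Λ * Q := by gcongr
    have h4 : 0 ≤ c ^ 2 * J := by positivity
    linarith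
  have hκ : ∫ y in eann n r₃ r₄, energyDensity V y ≤ 2 * I + 3 * J := by
    have hi : IntegrableOn (fun y => 2 * (ζ ‖y‖ ^ 2 * ‖fderiv ℝ (height V) y‖ ^ 2) + 3 * V y ^ 2)
        (eann n r₁ r₂) := (hIi.const_mul 2).add (hVi.const_mul 3)
    calc ∫ y in eann n r₃ r₄, energyDensity V y ≤
        ∫ y in eann n r₃ r₄,
          (2 * (ζ ‖y‖ ^ 2 * ‖fderiv ℝ (height V) y‖ ^ 2) + 3 * V y ^ 2) := by
          refine setIntegral_mono_on (h.integrableOn_energyDensity.mono_set hsub)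
            (hi.mono_set hsub) (isOpen_eann _ _).measurableSet fun y hy => ?_
          rw [hζ.eq_one ‖y‖ hy, one_pow, one_mul]
          exact h.norm_mul_norm_fderiv_sq_le (hsub hy)
      _ ≤ ∫ y in eann n r₁ r₂,
          (2 * (ζ ‖y‖ ^ 2 * ‖fderiv ℝ (height V) y‖ ^ 2) + 3 * V y ^ 2) :=
          setIntegral_mono_set hi (Eventually.of_forall fun y => by positivity) hsub.eventuallyLE
      _ = 2 * I + 3 * J := by
          rw [integral_add (hIi.const_mul _) (hVi.const_mul _), integral_const_mul,
            integral_const_mul]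
  rw [integral_add hVi (hLi.const_mul _), integral_const_mul]
  have h5 : (1 : ℝ) ≤ 2 ^ n := one_le_pow₀ (by norm_num)
  have h6 : 0 ≤ c ^ 2 * (Λ * Q) := by positivity
  have h7 : 0 ≤ (2 ^ n - 1) * J := mul_nonneg (by linarith) hJ0
  nlinarith

end SmallOn

end RadialTest

/-! ### Bounded continuous functions and weighted radial integrals -/

section BoundedContinuous

open Filter Topology Metric

/-- Bounded continuous functions on a set. -/
def BddContOn {X : Type*} [TopologicalSpace X] (f : X → ℝ) (s : Set X) : Prop :=
  ContinuousOn f s ∧ ∃ C, ∀ x ∈ s, |f x| ≤ C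

namespace BddContOn

variable {X : Type*} [TopologicalSpace X] {f g : X → ℝ} {s : Set X}

theorem const (c : ℝ) : BddContOn (fun _ : X => c) s := ⟨continuousOn_const, |c|, fun _ _ => le_rfl⟩

theorem add (hf : BddContOn f s) (hg : BddContOn g s) : BddContOn (fun x => f x + g x) s := by
  obtain ⟨hf, C, hC⟩ := hf
  obtain ⟨hg, C', hC'⟩ := hg
  exact ⟨hf.add hg, C + C', fun x hx => (abs_add_le _ _).trans (add_le_add (hC x hx) (hC' x hx))⟩

theorem mul (hf : BddContOn f s) (hg : BddContOn g s) : BddContOn (fun x => f x * g x) s := by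
  obtain ⟨hf, C, hC⟩ := hf
  obtain ⟨hg, C', hC'⟩ := hg
  refine ⟨hf.mul hg, C * C', fun x hx => ?_⟩
  rw [abs_mul]
  exact mul_le_mul (hC x hx) (hC' x hx) (abs_nonneg _) ((abs_nonneg _).trans (hC x hx))

theorem const_mul (c : ℝ) (hf : BddContOn f s) : BddContOn (fun x => c * f x) s := (const c).mul hf

theorem sub (hf : BddContOn f s) (hg : BddContOn g s) : BddContOn (fun x => f x - g x) s := by
  simpa [sub_eq_add_neg] using hf.add (hg.const_mul (-1))

theorem sq (hf : BddContOn f s) : BddContOn (fun x => f x ^ 2) s := by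
  simpa only [pow_two] using hf.mul hf

theorem sum {ι : Type*} (t : Finset ι) {f : ι → X → ℝ} (hf : ∀ i ∈ t, BddContOn (f i) s) :
    BddContOn (fun x => ∑ i ∈ t, f i x) s := by
  classical
  induction t using Finset.induction_on with
  | empty => simpa using const 0
  | insert i t hi ih =>
    simp only [Finset.sum_insert hi]
    exact (hf i (Finset.mem_insert_self _ _)).add
      (ih fun j hj => hf j (Finset.mem_insert_of_mem hj))

theorem abs (hf : BddContOn f s) : BddContOn (fun x => |f x|) s := by
  obtain ⟨hf, C, hC⟩ := hf
  exact ⟨hf.abs, C, fun x hx => by rw [abs_abs]; exact hC x hx⟩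

theorem congr (hf : BddContOn f s) (h : ∀ x ∈ s, g x = f x) : BddContOn g s := by
  obtain ⟨hf, C, hC⟩ := hf
  exact ⟨hf.congr h, C, fun x hx => by rw [h x hx]; exact hC x hx⟩

theorem of_continuous_of_isCompact {t : Set X} (hf : Continuous f) (ht : IsCompact t) (hs : s ⊆ t) :
    BddContOn f s := by
  obtain ⟨C, hC⟩ := ht.exists_bound_of_continuousOn hf.continuousOn
  exact ⟨hf.continuousOn, C, fun x hx => hC x (hs hx)⟩

theorem of_continuous_Ioo {f : ℝ → ℝ} {a b : ℝ} (hf : Continuous f) : BddContOn f (Ioo a b) :=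
  of_continuous_of_isCompact hf isCompact_Icc Ioo_subset_Icc_self

theorem integrableOn_Ioo {f : ℝ → ℝ} {a b : ℝ} (hf : BddContOn f (Ioo a b)) :
    IntegrableOn f (Ioo a b) := by
  obtain ⟨hc, C, hC⟩ := hf
  exact IntegrableOn.of_bound (by simp) (hc.aestronglyMeasurable measurableSet_Ioo) C
    ((ae_restrict_iff' measurableSet_Ioo).2 (Eventually.of_forall hC))

theorem integrableOn_eann {n : ℕ} {f : Eu n → ℝ} {a b : ℝ} (hf : BddContOn f (eann n a b)) :
    IntegrableOn f (eann n a b) := by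
  obtain ⟨hc, C, hC⟩ := hf
  exact integrableOn_eann_of_bound hc hC

theorem slice {n : ℕ} {f : Eu n → ℝ} {a b : ℝ} (ha : 0 ≤ a) (hf : BddContOn f (eann n a b)) :
    BddContOn (slice f) (Ioo a b) := by
  obtain ⟨hc, C, hC⟩ := hf
  exact ⟨continuousOn_slice ha hc hC, C * sphArea n, fun r hr => abs_slice_le ha hr hc hC⟩

theorem comp_norm {n : ℕ} {f : ℝ → ℝ} {a b : ℝ} (hf : BddContOn f (Ioo a b)) :
    BddContOn (fun y : Eu n => f ‖y‖) (eann n a b) := by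
  obtain ⟨hc, C, hC⟩ := hf
  exact ⟨hc.comp continuous_norm.continuousOn fun y hy => hy, C, fun y hy => hC _ hy⟩

end BddContOn

/-- The integral over an interval with the weight `r^(n-1)`. -/
noncomputable def wint (n : ℕ) (a b : ℝ) (f : ℝ → ℝ) : ℝ := ∫ r in Ioo a b, r ^ (n - 1) * f r

variable {n : ℕ} {a b : ℝ} {f g : ℝ → ℝ}

theorem BddContOn.weight (hf : BddContOn f (Ioo a b)) :
    IntegrableOn (fun r => r ^ (n - 1) * f r) (Ioo a b) :=
  ((BddContOn.of_continuous_Ioo (by fun_prop)).mul hf).integrableOn_Ioo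

theorem wint_add (hf : BddContOn f (Ioo a b)) (hg : BddContOn g (Ioo a b)) :
    wint n a b (fun r => f r + g r) = wint n a b f + wint n a b g := by
  rw [wint, wint, wint, ← integral_add hf.weight hg.weight]
  simp only [mul_add]

theorem wint_const_mul (c : ℝ) : wint n a b (fun r => c * f r) = c * wint n a b f := by
  rw [wint, wint, ← integral_const_mul]
  congr 1
  funext r; ring

theorem wint_sub (hf : BddContOn f (Ioo a b)) (hg : BddContOn g (Ioo a b)) :
    wint n a b (fun r => f r - g r) = wint n a b f - wint n a b g := by
  rw [wint, wint, wint, ← integral_sub hf.weight hg.weight]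
  simp only [mul_sub]

theorem wint_mono (ha : 0 ≤ a) (hf : BddContOn f (Ioo a b)) (hg : BddContOn g (Ioo a b))
    (h : ∀ r ∈ Ioo a b, f r ≤ g r) : wint n a b f ≤ wint n a b g :=
  setIntegral_mono_on hf.weight hg.weight measurableSet_Ioo fun r hr =>
    mul_le_mul_of_nonneg_left (h r hr) (pow_nonneg (ha.trans hr.1.le) _)

theorem wint_nonneg (ha : 0 ≤ a) (h : ∀ r ∈ Ioo a b, 0 ≤ f r) : 0 ≤ wint n a b f :=
  setIntegral_nonneg measurableSet_Ioo fun r hr =>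
    mul_nonneg (pow_nonneg (ha.trans hr.1.le) _) (h r hr)

theorem wint_congr (h : ∀ r ∈ Ioo a b, f r = g r) : wint n a b f = wint n a b g :=
  setIntegral_congr_fun measurableSet_Ioo fun r hr => by simp only [h r hr]

theorem integral_eann_eq_wint [Nontrivial (Eu n)] (ha : 0 ≤ a) {f : Eu n → ℝ}
    (hf : BddContOn f (eann n a b)) : ∫ y in eann n a b, f y = wint n a b (slice f) :=
  (integral_eann_eq ha hf.integrableOn_eann).2

theorem contDiffOn_slice (ha : 0 < a) {C : ℝ} {f : Eu n → ℝ} (hf : ContDiffOn ℝ 1 f (eann n a b))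
    (h : ∀ y ∈ eann n a b, |fderiv ℝ f y y| ≤ C) : ContDiffOn ℝ 1 (slice f) (Ioo a b) := by
  have hd := fun r (hr : r ∈ Ioo a b) => hasDerivAt_slice ha hf h hr
  have h1 : ContDiffOn ℝ (0 + 1) (slice f) (Ioo a b) := by
    rw [contDiffOn_succ_iff_deriv_of_isOpen isOpen_Ioo]
    refine ⟨fun r hr => (hd r hr).differentiableAt.differentiableWithinAt, by simp, ?_⟩
    rw [contDiffOn_zero]
    refine ContinuousOn.congr (f := fun r => r⁻¹ * slice (fun y => fderiv ℝ f y y) r) ?_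
      fun r hr => (hd r hr).deriv
    exact (continuousOn_id.inv₀ fun r hr => (ha.trans hr.1).ne').mul
      (continuousOn_slice ha.le (continuousOn_radial hf) h)
  simpa using h1

/-- Differentiability of g is needed only on the interval, since outside the support of α the
product vanishes locally. -/
theorem contDiff_mul_of_tsupport_subset {α g : ℝ → ℝ} (hα : ContDiff ℝ 1 α)
    (hs : tsupport α ⊆ Ioo a b) (hg : ContDiffOn ℝ 1 g (Ioo a b)) :
    ContDiff ℝ 1 (fun r => α r * g r) := by
  refine contDiff_iff_contDiffAt.2 fun r => ?_
  by_cases hr : r ∈ Ioo a b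
  · exact hα.contDiffAt.mul (hg.contDiffAt (isOpen_Ioo.mem_nhds hr))
  · have h1 : r ∉ tsupport α := fun h => hr (hs h)
    refine (contDiffAt_const (c := (0 : ℝ))).congr_of_eventuallyEq ?_
    filter_upwards [(isClosed_tsupport α).isOpen_compl.mem_nhds h1] with y hy
    rw [image_eq_zero_of_notMem_tsupport hy, zero_mul]

theorem tsupport_mul_subset_of_left {α g : ℝ → ℝ} {s : Set ℝ} (hs : tsupport α ⊆ s) :
    tsupport (fun r => α r * g r) ⊆ s := by
  refine (closure_mono fun r hr => ?_).trans hs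
  exact left_ne_zero_of_mul hr

theorem integral_deriv_eq_zero_of_tsupport_subset {Ψ : ℝ → ℝ} (hΨ : ContDiff ℝ 1 Ψ)
    (hs : tsupport Ψ ⊆ Ioo a b) : ∫ r in Ioo a b, deriv Ψ r = 0 := by
  have hc : HasCompactSupport Ψ :=
    IsCompact.of_isClosed_subset isCompact_Icc (isClosed_tsupport _) (hs.trans Ioo_subset_Icc_self)
  have h1 : ∫ r, deriv Ψ r = 0 :=
    integral_eq_zero_of_hasDerivAt_of_integrable
      (fun r => (hΨ.differentiable one_ne_zero r).hasDerivAt)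
      ((hΨ.continuous_deriv le_rfl).integrable_of_hasCompactSupport hc.deriv)
      (hΨ.continuous.integrable_of_hasCompactSupport hc)
  rw [← h1]
  refine setIntegral_eq_integral_of_forall_compl_eq_zero fun r hr => ?_
  by_contra hne
  exact hr (hs (support_deriv_subset hne))

end BoundedContinuous

/-! ### The flat Dirichlet form on the slices -/

section Slices

open Filter Topology Metric

variable {n : ℕ}

/-- The radial derivative `r ∂_r V`. -/
noncomputable def radial (V : Eu n → ℝ) (y : Eu n) : ℝ := fderiv ℝ V y y

/-- The squared norm of the gradient, multiplied by `|y|²`. -/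
noncomputable def gradSq (V : Eu n → ℝ) (y : Eu n) : ℝ := ‖y‖ ^ 2 * ‖fderiv ℝ V y‖ ^ 2

/-- The mean value over the sphere of radius `r`. -/
noncomputable def sphMean (V : Eu n → ℝ) (r : ℝ) : ℝ := slice V r / sphArea n

theorem BddContOn.sphMean {f : Eu n → ℝ} {a b : ℝ} (ha : 0 ≤ a) (hf : BddContOn f (eann n a b)) :
    BddContOn (sphMean f) (Ioo a b) :=
  ((hf.slice ha).const_mul _).congr fun _ _ => div_eq_inv_mul _ _

namespace SmallOn

variable {V : Eu n → ℝ} {σ r₁ r₂ : ℝ}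

theorem bddContOn (h : SmallOn V σ r₁ r₂) : BddContOn V (eann n r₁ r₂) :=
  ⟨h.contDiffOn.continuousOn, σ, h.abs_le⟩

theorem abs_radial_le (h : SmallOn V σ r₁ r₂) {y : Eu n} (hy : y ∈ eann n r₁ r₂) :
    |radial V y| ≤ 2 * σ := by
  refine ((fderiv ℝ V y).le_opNorm y).trans ?_
  rw [mul_comm]
  exact h.fderiv_le y hy

theorem bddContOn_radial (h : SmallOn V σ r₁ r₂) : BddContOn (radial V) (eann n r₁ r₂) :=
  ⟨continuousOn_radial h.contDiffOn, 2 * σ, fun _ hy => h.abs_radial_le hy⟩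

theorem bddContOn_gradSq (h : SmallOn V σ r₁ r₂) : BddContOn (gradSq V) (eann n r₁ r₂) := by
  refine ⟨(continuous_norm.continuousOn.pow 2).mul (h.continuousOn_fderiv.norm.pow 2),
    (2 * σ) ^ 2, fun y hy => ?_⟩
  rw [gradSq, ← mul_pow, abs_of_nonneg (by positivity)]
  have := h.fderiv_le y hy
  gcongr

theorem hasDerivAt_slice_self (h : SmallOn V σ r₁ r₂) {r : ℝ} (hr : r ∈ Ioo r₁ r₂) :
    HasDerivAt (slice V) (r⁻¹ * slice (radial V) r) r :=
  hasDerivAt_slice h.pos h.contDiffOn (fun _ hy => h.abs_radial_le hy) hr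

theorem fderiv_sq (h : SmallOn V σ r₁ r₂) {y : Eu n} (hy : y ∈ eann n r₁ r₂) :
    fderiv ℝ (fun y => V y ^ 2) y y = 2 * (V y * radial V y) := by
  have h1 : HasFDerivAt (fun y => V y ^ 2) _ y := (h.differentiableAt hy).hasFDerivAt.pow 2
  rw [h1.fderiv]
  simp [radial, _root_.smul_apply]
  ring

theorem abs_fderiv_sq_le (h : SmallOn V σ r₁ r₂) {y : Eu n} (hy : y ∈ eann n r₁ r₂) :
    |fderiv ℝ (fun y => V y ^ 2) y y| ≤ 2 * (σ * (2 * σ)) := by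
  rw [h.fderiv_sq hy, abs_mul, abs_mul, abs_two]
  have := h.nonneg
  gcongr
  exacts [h.abs_le y hy, h.abs_radial_le hy]

theorem hasDerivAt_slice_sq (h : SmallOn V σ r₁ r₂) {r : ℝ} (hr : r ∈ Ioo r₁ r₂) :
    HasDerivAt (slice fun y => V y ^ 2) (r⁻¹ * (2 * slice (fun y => V y * radial V y) r)) r := by
  have h1 := hasDerivAt_slice h.pos (h.contDiffOn.pow 2) (fun _ hy => h.abs_fderiv_sq_le hy) hr
  rw [slice_congr h.pos.le hr (fun y hy => h.fderiv_sq hy), slice_const_mul] at h1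
  exact h1

theorem contDiffOn_sphMean (h : SmallOn V σ r₁ r₂) : ContDiffOn ℝ 1 (sphMean V) (Ioo r₁ r₂) :=
  (contDiffOn_slice h.pos h.contDiffOn fun _ hy => h.abs_radial_le hy).div_const _

theorem contDiffOn_slice_sq (h : SmallOn V σ r₁ r₂) :
    ContDiffOn ℝ 1 (slice fun y => V y ^ 2) (Ioo r₁ r₂) :=
  contDiffOn_slice h.pos (h.contDiffOn.pow 2) fun _ hy => h.abs_fderiv_sq_le hy

/-- Both identities follow from the decomposition of the gradient of w as |y| ∇V + V y / |y|. -/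
theorem radial_height (h : SmallOn V σ r₁ r₂) {y : Eu n} (hy : y ∈ eann n r₁ r₂) :
    ⟪y, gradient (height V) y⟫_ℝ = ‖y‖ * (radial V y + V y) ∧
      ‖fderiv ℝ (height V) y‖ ^ 2 = gradSq V y + 2 * (V y * radial V y) + V y ^ 2 := by
  have hn : ‖y‖ ≠ 0 := norm_ne_zero_iff.2 (h.ne_zero hy)
  have hg : gradient (height V) y = ‖y‖ • gradient V y + (V y * ‖y‖⁻¹) • y := by
    refine ext_inner_right ℝ fun v => ?_
    rw [inner_gradient_left, inner_add_left, inner_smul_left, inner_smul_left, inner_gradient_left,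
      fderiv_height_apply (h.differentiableAt hy) (h.ne_zero hy)]
    simp only [RCLike.conj_to_real]
    ring
  have hyg : ⟪y, gradient V y⟫_ℝ = radial V y := by
    rw [real_inner_comm, inner_gradient_left, radial]
  refine ⟨?_, ?_⟩
  · rw [hg, inner_add_right, inner_smul_right, inner_smul_right, hyg, real_inner_self_eq_norm_sq]
    field_simp
  · rw [← norm_gradient, hg, norm_add_sq_real, norm_smul, norm_smul, inner_smul_left,
      inner_smul_right, real_inner_comm, hyg, norm_gradient, gradSq]
    simp only [RCLike.conj_to_real, norm_mul, norm_inv, Real.norm_eq_abs, mul_pow,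
      sq_abs, inv_pow]
    field_simp

/-! ### The test function with the reflected mean -/

section Test

variable [Nontrivial (Eu n)] {α : ℝ → ℝ}

/-- The radial part of the test function. -/
noncomputable def _root_.SphericalGraph.meanTest (V : Eu n → ℝ) (α : ℝ → ℝ) (r : ℝ) : ℝ :=
  α r * (-2 * (r * sphMean V r))

theorem contDiff_meanTest (h : SmallOn V σ r₁ r₂) (hα : ContDiff ℝ 1 α)
    (hs : tsupport α ⊆ Ioo r₁ r₂) : ContDiff ℝ 1 (meanTest V α) :=
  contDiff_mul_of_tsupport_subset hα hs
    (contDiffOn_const.mul (contDiffOn_id.mul h.contDiffOn_sphMean))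

theorem hasDerivAt_sphMean (h : SmallOn V σ r₁ r₂) {r : ℝ} (hr : r ∈ Ioo r₁ r₂) :
    HasDerivAt (sphMean V) (r⁻¹ * sphMean (radial V) r) r := by
  have h1 := (h.hasDerivAt_slice_self hr).div_const (sphArea n)
  rwa [mul_div_assoc] at h1

theorem deriv_meanTest (h : SmallOn V σ r₁ r₂) (hα : ContDiff ℝ 1 α) {r : ℝ} (hr : r ∈ Ioo r₁ r₂) :
    deriv (meanTest V α) r = -2 * (r * deriv α r * sphMean V r + α r * (sphMean V r +
      sphMean (radial V) r)) := by
  have hr0 : r ≠ 0 := (h.pos.trans hr.1).ne'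
  have h1 : HasDerivAt (meanTest V α) _ r := (hα.differentiable one_ne_zero r).hasDerivAt.mul
    (((hasDerivAt_id r).mul (h.hasDerivAt_sphMean hr)).const_mul (-2))
  rw [h1.deriv]
  simp only [id]
  field_simp
  ring

theorem fderiv_radialTest_gradient (h : SmallOn V σ r₁ r₂) (hα : ContDiff ℝ 1 α)
    (hs : tsupport α ⊆ Ioo r₁ r₂) {y : Eu n} (hy : y ∈ eann n r₁ r₂) :
    fderiv ℝ (radialTest V α (meanTest V α)) y (gradient (height V) y) =
      α ‖y‖ * (gradSq V y + 2 * (V y * radial V y) + V y ^ 2) +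
        (‖y‖ * deriv α ‖y‖) * (V y * radial V y + V y ^ 2) +
        deriv (meanTest V α) ‖y‖ * (radial V y + V y) := by
  have hn : ‖y‖ ≠ 0 := norm_ne_zero_iff.2 (h.ne_zero hy)
  have h1 : fderiv ℝ (height V) y (gradient (height V) y) = ‖fderiv ℝ (height V) y‖ ^ 2 := by
    rw [← inner_gradient_left, real_inner_self_eq_norm_sq, norm_gradient]
  rw [fderiv_radialTest (h.differentiableAt hy) (h.ne_zero hy) (hα.differentiable one_ne_zero _)
    ((h.contDiff_meanTest hα hs).differentiable one_ne_zero _), _root_.add_apply,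
    _root_.smul_apply, _root_.smul_apply, h1, innerSL_apply_apply, (h.radial_height hy).1,
    (h.radial_height hy).2, height, smul_eq_mul, smul_eq_mul]
  field_simp
  ring

theorem slice_fderiv_radialTest (h : SmallOn V σ r₁ r₂) (hα : ContDiff ℝ 1 α)
    (hs : tsupport α ⊆ Ioo r₁ r₂) {r : ℝ} (hr : r ∈ Ioo r₁ r₂) :
    slice (fun y => fderiv ℝ (radialTest V α (meanTest V α)) y (gradient (height V) y)) r =
      α r * (slice (gradSq V) r + 2 * slice (fun y => V y * radial V y) r +
          slice (fun y => V y ^ 2) r) +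
        (r * deriv α r) * (slice (fun y => V y * radial V y) r + slice (fun y => V y ^ 2) r) +
        deriv (meanTest V α) r * (sphArea n * (sphMean (radial V) r + sphMean V r)) := by
  have h0 := h.pos.le
  have hr0 : 0 ≤ r := h0.trans hr.1.le
  have hS : sphArea n ≠ 0 := sphArea_pos.ne'
  rw [slice_congr h0 hr (fun y hy => h.fderiv_radialTest_gradient hα hs hy)]
  have hαc : Continuous α := hα.continuous
  have hα' : Continuous (deriv α) := hα.continuous_deriv le_rfl
  have hβ' : Continuous (deriv (meanTest V α)) := (h.contDiff_meanTest hα hs).continuous_deriv le_rfl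
  have c1 := h.bddContOn.1
  have c2 := h.bddContOn_radial.1
  have c3 := h.bddContOn_gradSq.1
  have hn : ContinuousOn (fun y : Eu n => ‖y‖) (eann n r₁ r₂) := continuous_norm.continuousOn
  have d1 : ContinuousOn (fun y : Eu n => α ‖y‖) (eann n r₁ r₂) :=
    (hαc.comp continuous_norm).continuousOn
  have d2 : ContinuousOn (fun y : Eu n => deriv α ‖y‖) (eann n r₁ r₂) :=
    (hα'.comp continuous_norm).continuousOn
  have d3 : ContinuousOn (fun y : Eu n => deriv (meanTest V α) ‖y‖) (eann n r₁ r₂) :=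
    (hβ'.comp continuous_norm).continuousOn
  rw [slice_add h0 hr, slice_add h0 hr, slice_radial_mul _ _ hr0,
    slice_radial_mul (fun r => r * deriv α r) _ hr0, slice_radial_mul _ _ hr0,
    slice_add h0 hr, slice_add h0 hr, slice_add h0 hr, slice_add h0 hr, slice_const_mul]
  · simp only [sphMean]
    field_simp
  all_goals fun_prop

/-- The Dirichlet form against the test function, up to a total derivative. -/
theorem integral_fderiv_radialTest (h : SmallOn V σ r₁ r₂) (hn : 1 ≤ n) (hα : ContDiff ℝ 1 α)
    (hs : tsupport α ⊆ Ioo r₁ r₂)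
    (hbdd : BddContOn (fun y => fderiv ℝ (radialTest V α (meanTest V α)) y (gradient (height V) y))
      (eann n r₁ r₂)) :
    ∫ y in eann n r₁ r₂, fderiv ℝ (radialTest V α (meanTest V α)) y (gradient (height V) y) =
      wint n r₁ r₂ fun r =>
        α r * (slice (gradSq V) r - 2 * sphArea n * sphMean (radial V) r ^ 2 -
          (n - 1) * (slice (fun y => V y ^ 2) r - 2 * sphArea n * sphMean V r ^ 2)) +
        (r * deriv α r) * (slice (fun y => V y * radial V y) r -
          2 * sphArea n * (sphMean V r * sphMean (radial V) r)) := by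
  -- The derivative of Ψ removes every term in which α' multiplies V² or the squared mean.
  -- Afterwards α' multiplies only products of V with its radial derivative, and the zero order term
  -- takes the form -(n - 1)(A - 2 S m²), where A is the slice of V², S the area of the sphere and m
  -- the mean: the mean enters with reversed sign.
  set Ψ : ℝ → ℝ := fun r => α r * (r ^ n * (slice (fun y => V y ^ 2) r -
    2 * sphArea n * sphMean V r ^ 2)) with hΨ
  have hg : ContDiffOn ℝ 1 (fun r => r ^ n * (slice (fun y => V y ^ 2) r -
      2 * sphArea n * sphMean V r ^ 2)) (Ioo r₁ r₂) :=
    (contDiffOn_id.pow n).mul (h.contDiffOn_slice_sq.sub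
      (contDiffOn_const.mul (h.contDiffOn_sphMean.pow 2)))
  have hΨc : ContDiff ℝ 1 Ψ := contDiff_mul_of_tsupport_subset hα hs hg
  have hΨ0 := integral_deriv_eq_zero_of_tsupport_subset hΨc (tsupport_mul_subset_of_left hs)
  have hΨi : IntegrableOn (deriv Ψ) (Ioo r₁ r₂) :=
    (BddContOn.of_continuous_Ioo (hΨc.continuous_deriv le_rfl)).integrableOn_Ioo
  have hΨd : ∀ r ∈ Ioo r₁ r₂, deriv Ψ r = deriv α r * (r ^ n * (slice (fun y => V y ^ 2) r -
      2 * sphArea n * sphMean V r ^ 2)) + α r * (n * r ^ (n - 1) * (slice (fun y => V y ^ 2) r -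
      2 * sphArea n * sphMean V r ^ 2) + r ^ n * (r⁻¹ * (2 * slice (fun y => V y * radial V y) r) -
      2 * sphArea n * (2 * sphMean V r * (r⁻¹ * sphMean (radial V) r)))) := fun r hr => by
    have h1 : HasDerivAt (fun r => sphMean V r ^ 2) _ r := (h.hasDerivAt_sphMean hr).pow 2
    have h2 : HasDerivAt (fun r : ℝ => r ^ n) _ r := hasDerivAt_pow n r
    have h3 : HasDerivAt Ψ _ r := (hα.differentiable one_ne_zero r).hasDerivAt.mul
      (h2.mul ((h.hasDerivAt_slice_sq hr).sub (h1.const_mul (2 * sphArea n))))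
    rw [h3.deriv]
    simp
  rw [integral_eann_eq_wint h.pos.le hbdd, ← sub_eq_zero, ← hΨ0, wint, wint]
  rw [← integral_sub]
  · refine setIntegral_congr_fun measurableSet_Ioo fun r hr => ?_
    have hr0 : r ≠ 0 := (h.pos.trans hr.1).ne'
    beta_reduce
    rw [hΨd r hr, h.slice_fderiv_radialTest hα hs hr, h.deriv_meanTest hα hr]
    obtain ⟨k, rfl⟩ : ∃ k, n = k + 1 := ⟨n - 1, by omega⟩
    simp only [Nat.add_sub_cancel, pow_succ]
    push_cast
    field_simp
    ring
  · exact (hbdd.slice h.pos.le).weight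
  · have b0 := h.pos.le
    have b1 : BddContOn α (Ioo r₁ r₂) := .of_continuous_Ioo hα.continuous
    have b2 : BddContOn (fun r => r * deriv α r) (Ioo r₁ r₂) :=
      .of_continuous_Ioo (continuous_id.mul (hα.continuous_deriv le_rfl))
    have b3 := h.bddContOn.sphMean b0
    have b4 := h.bddContOn_radial.sphMean b0
    exact ((b1.mul (((h.bddContOn_gradSq.slice b0).sub (b4.sq.const_mul _)).sub
      (((h.bddContOn.sq.slice b0).sub (b3.sq.const_mul _)).const_mul _))).add
      (b2.mul (((h.bddContOn.mul h.bddContOn_radial).slice b0).sub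
        ((b3.mul b4).const_mul _)))).weight

end Test

end SmallOn

end Slices

/-! ### Inequalities on slices and transport between radii -/

section SliceInequalities

open Filter Topology Metric

variable {n : ℕ} [Nontrivial (Eu n)] {V : Eu n → ℝ} {σ r₁ r₂ r₃ r₄ : ℝ}

theorem sphArea_mul_sphMean_sq_le {f : Eu n → ℝ} {a b r : ℝ} (ha : 0 ≤ a) (hr : r ∈ Ioo a b)
    (hf : ContinuousOn f (eann n a b)) :
    sphArea n * sphMean f r ^ 2 ≤ slice (fun y => f y ^ 2) r := by
  have h := sphInt_mul_sq_le (continuousOn_comp_smul ha hf hr) (continuousOn_const (c := (1 : ℝ)))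
  simp only [mul_one, one_pow, sphInt_const, one_mul] at h
  have hS : 0 < sphArea n := sphArea_pos
  rw [sphMean, div_pow, mul_div_assoc', div_le_iff₀ (by positivity)]
  calc sphArea n * slice f r ^ 2 ≤ sphArea n * (slice (fun y => f y ^ 2) r * sphArea n) := by
        gcongr
        exact h
    _ = _ := by ring

/-- The sum of the squared first Fourier coefficients. -/
noncomputable def firstModes (V : Eu n → ℝ) (r : ℝ) : ℝ :=
  ∑ i, slice (fun y => V y * (‖y‖⁻¹ * y i)) r ^ 2

theorem slice_mul_coord (V : Eu n → ℝ) {r : ℝ} (hr : 0 < r) (i : Fin n) :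
    slice (fun y => V y * (‖y‖⁻¹ * y i)) r = sphInt fun x => V (r • x) * x i := by
  refine sphInt_congr fun x hx => ?_
  simp only [norm_smul_sphere hr.le hx, PiLp.smul_apply, smul_eq_mul]
  rw [inv_mul_cancel_left₀ hr.ne']

theorem abs_coord_le_one {x : Eu n} (hx : x ∈ sphere (0 : Eu n) 1) (i : Fin n) : |x i| ≤ 1 := by
  have := PiLp.norm_apply_le x i
  rwa [mem_sphere_zero_iff_norm.1 hx] at this

theorem sphInt_mul_coord_sq_le {f : Eu n → ℝ} (hf : ContinuousOn f (sphere 0 1)) (i : Fin n) :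
    sphInt (fun x => f x * x i) ^ 2 ≤ sphArea n * sphInt fun x => f x ^ 2 := by
  refine (sphInt_mul_sq_le hf (by fun_prop)).trans ?_
  rw [mul_comm]
  refine mul_le_mul_of_nonneg_right ?_ (sphInt_nonneg fun x _ => sq_nonneg _)
  rw [← one_mul (sphArea n), ← sphInt_const]
  refine sphInt_mono (by fun_prop) (by fun_prop) fun x hx => ?_
  rw [← sq_abs]
  exact pow_le_one₀ (abs_nonneg _) (abs_coord_le_one hx i)

/-- The function v - 2 m, with m the mean of v, is the reflection of v in the functions of mean zero
and has the same L² norm. The left side is the square of its product with ρ, so Cauchy-Schwarz loses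
nothing from the correction. -/
theorem sphInt_mul_sub_mean_sq_le {v ρ : Eu n → ℝ} (hv : ContinuousOn v (sphere 0 1))
    (hρ : ContinuousOn ρ (sphere 0 1)) :
    (sphInt (fun x => v x * ρ x) -
        2 * sphArea n * (sphInt v / sphArea n * (sphInt ρ / sphArea n))) ^ 2 ≤
      sphInt (fun x => v x ^ 2) * sphInt (fun x => ρ x ^ 2) := by
  have hS : sphArea n ≠ 0 := sphArea_pos.ne'
  set m := sphInt v / sphArea n with hm
  have h0 : sphInt v = m * sphArea n := by rw [hm]; field_simp
  have h1 : sphInt (fun x => (v x - 2 * m) * ρ x) = sphInt (fun x => v x * ρ x) -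
      2 * sphArea n * (m * (sphInt ρ / sphArea n)) := by
    have e : (fun x => (v x - 2 * m) * ρ x) = fun x => v x * ρ x - 2 * m * ρ x := by
      funext x; ring
    rw [e, sphInt_sub, sphInt_const_mul]
    · field_simp
    all_goals fun_prop
  have h2 : sphInt (fun x => (v x - 2 * m) ^ 2) = sphInt (fun x => v x ^ 2) := by
    have e : (fun x => (v x - 2 * m) ^ 2) = fun x => v x ^ 2 - 4 * m * v x + 4 * m ^ 2 := by
      funext x; ring
    rw [e, sphInt_add, sphInt_sub, sphInt_const_mul, sphInt_const, h0]
    · ring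
    all_goals fun_prop
  have := sphInt_mul_sq_le (f := fun x => v x - 2 * m) (by fun_prop) hρ
  rwa [h1, h2] at this

theorem sphInt_sq_le {v w : Eu n → ℝ} (hv : ContinuousOn v (sphere 0 1))
    (hw : ContinuousOn w (sphere 0 1)) : sphInt (fun x => v x ^ 2) ≤
      2 * sphInt (fun x => w x ^ 2) + 2 * sphInt (fun x => (v x - w x) ^ 2) := by
  rw [← sphInt_const_mul, ← sphInt_const_mul, ← sphInt_add (by fun_prop) (by fun_prop)]
  refine sphInt_mono (by fun_prop) (by fun_prop) fun x _ => ?_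
  nlinarith [sq_nonneg (v x - 2 * w x)]

/-- The i-th mode of v is that of w plus that of v - w, and coordinates are at most 1 on the sphere.
-/
theorem sphInt_mul_coord_sq_le_add {v w : Eu n → ℝ} (hv : ContinuousOn v (sphere 0 1))
    (hw : ContinuousOn w (sphere 0 1)) (i : Fin n) : sphInt (fun x => v x * x i) ^ 2 ≤
      2 * sphInt (fun x => w x * x i) ^ 2 +
        2 * (sphArea n * sphInt (fun x => (v x - w x) ^ 2)) := by
  have h3 := sphInt_mul_coord_sq_le (f := fun x => v x - w x) (by fun_prop) i
  have h4 : sphInt (fun x => (v x - w x) * x i) =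
      sphInt (fun x => v x * x i) - sphInt (fun x => w x * x i) := by
    simp only [sub_mul]
    exact sphInt_sub (by fun_prop) (by fun_prop)
  rw [h4] at h3
  nlinarith [sq_nonneg (sphInt (fun x => v x * x i) - 2 * sphInt (fun x => w x * x i))]

namespace SmallOn

theorem slice_sq_sub_mean (h : SmallOn V σ r₁ r₂) {r : ℝ} (hr : r ∈ Ioo r₁ r₂) :
    (slice (fun y => V y * radial V y) r - 2 * sphArea n * (sphMean V r * sphMean (radial V) r)) ^ 2
      ≤ slice (fun y => V y ^ 2) r * slice (fun y => radial V y ^ 2) r :=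
  sphInt_mul_sub_mean_sq_le (continuousOn_comp_smul h.pos.le h.bddContOn.1 hr)
    (continuousOn_comp_smul h.pos.le h.bddContOn_radial.1 hr)

theorem bddContOn_firstModes (h : SmallOn V σ r₁ r₂) :
    BddContOn (firstModes V) (Ioo r₁ r₂) := by
  refine BddContOn.sum _ fun i _ => ((h.bddContOn.mul ⟨?_, 1, fun y hy => ?_⟩).slice h.pos.le).sq
  · exact (continuous_norm.continuousOn.inv₀ fun y hy => norm_ne_zero_iff.2 (h.ne_zero hy)).mul
      (by fun_prop)
  · rw [abs_mul, abs_inv, abs_norm, inv_mul_le_iff₀ (norm_pos_iff.2 (h.ne_zero hy)), mul_one]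
    exact PiLp.norm_apply_le y i

/-- The spectral gap on the slices. -/
theorem spectral_gap_slice (h : SmallOn V σ r₁ r₂) {K : ℝ}
    (hK : ∀ (O : Set (Eu n)) (v : Eu n → ℝ), IsOpen O → sphere 0 1 ⊆ O →
      ContDiffOn ℝ 1 v O →
      2 * n * (sphInt (fun x => v x ^ 2) - sphInt v ^ 2 / sphArea n) -
          K * ∑ i, sphInt (fun x => v x * x i) ^ 2 ≤
        sphInt (fun x => ‖fderiv ℝ v x‖ ^ 2 - (fderiv ℝ v x x) ^ 2))
    {r : ℝ} (hr : r ∈ Ioo r₁ r₂) :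
    2 * n * (slice (fun y => V y ^ 2) r - sphArea n * sphMean V r ^ 2) - K * firstModes V r ≤
      slice (gradSq V) r - slice (fun y => radial V y ^ 2) r := by
  have hr0 : 0 < r := h.pos.trans hr.1
  have hS : sphArea n ≠ 0 := sphArea_pos.ne'
  have h1 := hK ((fun x => r • x) ⁻¹' eann n r₁ r₂) (fun x => V (r • x))
    ((isOpen_eann _ _).preimage (continuous_const_smul r))
    (fun x hx => smul_mem_eann h.pos.le hr hx)
    (h.contDiffOn.comp (contDiff_const_smul r).contDiffOn fun x hx => hx)
  have h2 : sphInt (fun x => ‖fderiv ℝ (fun x => V (r • x)) x‖ ^ 2 -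
      (fderiv ℝ (fun x => V (r • x)) x x) ^ 2) =
      slice (gradSq V) r - slice (fun y => radial V y ^ 2) r := by
    rw [← slice_sub h.pos.le hr h.bddContOn_gradSq.1 h.bddContOn_radial.sq.1]
    refine sphInt_congr fun x hx => ?_
    have hd : fderiv ℝ (fun x => V (r • x)) x = r • fderiv ℝ V (r • x) := by
      have h3 : HasFDerivAt (fun x : Eu n => r • x) (r • ContinuousLinearMap.id ℝ (Eu n)) x :=
        (hasFDerivAt_id x).const_smul r
      have h4 := ((h.differentiableAt (smul_mem_eann h.pos.le hr hx)).hasFDerivAt.comp x h3).fderiv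
      refine h4.trans ?_
      ext v
      simp
    simp only [hd, norm_smul, gradSq, radial, norm_smul_sphere hr0.le hx, map_smul,
      _root_.smul_apply, Real.norm_eq_abs, mul_pow, sq_abs]
  rw [h2] at h1
  have h5 : firstModes V r = ∑ i, sphInt (fun x => V (r • x) * x i) ^ 2 :=
    Finset.sum_congr rfl fun i _ => by rw [slice_mul_coord V hr0]
  have h6 : sphArea n * sphMean V r ^ 2 = sphInt (fun x => V (r • x)) ^ 2 / sphArea n := by
    rw [sphMean, slice]
    field_simp
  rw [h5, h6]
  exact h1

/-- The radial energy. -/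
noncomputable def _root_.SphericalGraph.radialEnergy (V : Eu n → ℝ) (r₁ r₂ : ℝ) : ℝ :=
  wint n r₁ r₂ (slice fun y => radial V y ^ 2)

/-- For t > r₁ the weight satisfies t⁻² ≤ r₁^(-(n+1)) t^(n-1), which converts the integral over
radii into the weighted radial energy. -/
theorem sphInt_sub_sq_le (h : SmallOn V σ r₁ r₂) {r s : ℝ} (hr : r ∈ Ioo r₁ r₂)
    (hs : s ∈ Ioo r₁ r₂) (hn : 1 ≤ n) :
    sphInt (fun ω => (V (r • ω) - V (s • ω)) ^ 2) ≤
      (r₂ - r₁) * (radialEnergy V r₁ r₂ / r₁ ^ (n + 1)) := by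
  refine (slice_sub_sq_le h.pos h.contDiffOn (fun y hy => h.abs_radial_le hy) hr hs).trans ?_
  have h12 : 0 ≤ r₂ - r₁ := by linarith [hr.1, hr.2]
  refine mul_le_mul_of_nonneg_left ?_ h12
  have hb := h.bddContOn_radial.sq.slice h.pos.le
  have hp := h.pos
  rw [radialEnergy, div_eq_inv_mul, wint, ← integral_const_mul]
  refine setIntegral_mono_on (g := fun r => (r₁ ^ (n + 1))⁻¹ *
    (r ^ (n - 1) * slice (fun y => radial V y ^ 2) r)) ?_ (hb.weight.const_mul _)
    measurableSet_Ioo fun t ht => ?_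
  · refine (BddContOn.mul ⟨?_, (r₁ ^ 2)⁻¹, fun t ht => ?_⟩ hb).integrableOn_Ioo
    · exact (continuousOn_id.pow 2).inv₀ fun t ht => pow_ne_zero _ (hp.trans ht.1).ne'
    · rw [abs_of_nonneg (by positivity)]
      have := ht.1
      gcongr
  · have ht0 := hp.trans ht.1
    have hsl : 0 ≤ slice (fun y => radial V y ^ 2) t := slice_nonneg hp.le ht fun y _ => sq_nonneg _
    rw [← mul_assoc]
    refine mul_le_mul_of_nonneg_right ?_ hsl
    rw [inv_mul_eq_div, le_div_iff₀ (by positivity), inv_mul_le_iff₀ (by positivity), ← pow_add]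
    have h3 : 2 + (n - 1) = n + 1 := by omega
    rw [h3]
    exact pow_le_pow_left₀ hp.le ht.1.le _

theorem slice_sq_le (h : SmallOn V σ r₁ r₂) {r s : ℝ} (hr : r ∈ Ioo r₁ r₂) (hs : s ∈ Ioo r₁ r₂) :
    slice (fun y => V y ^ 2) r ≤ 2 * slice (fun y => V y ^ 2) s +
      2 * sphInt (fun ω => (V (r • ω) - V (s • ω)) ^ 2) :=
  sphInt_sq_le (continuousOn_comp_smul h.pos.le h.bddContOn.1 hr)
    (continuousOn_comp_smul h.pos.le h.bddContOn.1 hs)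

/-- Near orthogonality to linear functions at one radius s is carried to any other radius r. Both
the modes and the L² norm at s are compared with those at r up to the difference of the slices,
which the radial energy controls. -/
theorem firstModes_le (h : SmallOn V σ r₁ r₂) {r s : ℝ} (hr : r ∈ Ioo r₁ r₂) (hs : s ∈ Ioo r₁ r₂)
    (hZ : firstModes V s ≤ n * sphArea n * σ ^ 4 * slice (fun y => V y ^ 2) s) :
    firstModes V r ≤ n * sphArea n * (4 * σ ^ 4 * slice (fun y => V y ^ 2) r +
      6 * sphInt (fun ω => (V (r • ω) - V (s • ω)) ^ 2)) := by
  set δ := sphInt (fun ω => (V (r • ω) - V (s • ω)) ^ 2)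
  have hδ : 0 ≤ δ := sphInt_nonneg fun _ _ => sq_nonneg _
  have c1 := continuousOn_comp_smul h.pos.le h.bddContOn.1 hr
  have c2 := continuousOn_comp_smul h.pos.le h.bddContOn.1 hs
  have hS : 0 < sphArea n := sphArea_pos
  have h1 : firstModes V r ≤ 2 * firstModes V s + 2 * (n * (sphArea n * δ)) := by
    have h2 : ∀ i : Fin n, slice (fun y => V y * (‖y‖⁻¹ * y i)) r ^ 2 ≤
        2 * slice (fun y => V y * (‖y‖⁻¹ * y i)) s ^ 2 + 2 * (sphArea n * δ) := fun i => by
      rw [slice_mul_coord V (h.pos.trans hr.1), slice_mul_coord V (h.pos.trans hs.1)]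
      exact sphInt_mul_coord_sq_le_add c1 c2 i
    calc firstModes V r ≤ ∑ i : Fin n, (2 * slice (fun y => V y * (‖y‖⁻¹ * y i)) s ^ 2 +
          2 * (sphArea n * δ)) := Finset.sum_le_sum fun i _ => h2 i
      _ = _ := by
        rw [Finset.sum_add_distrib, ← Finset.mul_sum, firstModes, Finset.sum_const,
          Finset.card_univ, Fintype.card_fin, nsmul_eq_mul]
        ring
  have h5 := h.slice_sq_le hs hr
  have h6 : sphInt (fun ω => (V (s • ω) - V (r • ω)) ^ 2) = δ := by
    congr 1; funext ω; ring
  rw [h6] at h5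
  have h7 : σ ^ 4 ≤ 1 := pow_le_one₀ h.nonneg (h.le.trans (by norm_num))
  have h8 : 0 ≤ σ ^ 4 := pow_nonneg h.nonneg 4
  calc firstModes V r ≤ 2 * (n * sphArea n * σ ^ 4 * (2 * slice (fun y => V y ^ 2) r + 2 * δ)) +
        2 * (n * (sphArea n * δ)) := by
        refine h1.trans ?_
        gcongr
        exact hZ.trans (by gcongr)
    _ = n * sphArea n * (4 * σ ^ 4 * slice (fun y => V y ^ 2) r + (4 * σ ^ 4 + 2) * δ) := by ring
    _ ≤ _ := by gcongr; linarith

end SmallOn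

theorem wint_one_le {a b : ℝ} (ha : 0 ≤ a) (hab : a ≤ b) :
    wint n a b (fun _ => 1) ≤ (b - a) * b ^ (n - 1) := by
  rw [wint]
  calc ∫ r in Ioo a b, r ^ (n - 1) * (1 : ℝ) ≤ ∫ r in Ioo a b, b ^ (n - 1) := by
        refine setIntegral_mono_on (BddContOn.const (1 : ℝ)).weight
          (BddContOn.const _).integrableOn_Ioo measurableSet_Ioo fun r hr => ?_
        rw [mul_one]
        exact pow_le_pow_left₀ (ha.trans hr.1.le) hr.2.le _
    _ = _ := by simp [Measure.real, hab]

theorem le_wint_one {a b : ℝ} (ha : 0 ≤ a) (hab : a ≤ b) :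
    (b - a) * a ^ (n - 1) ≤ wint n a b (fun _ => 1) := by
  rw [wint]
  calc (b - a) * a ^ (n - 1) = ∫ r in Ioo a b, a ^ (n - 1) := by simp [Measure.real, hab]
    _ ≤ ∫ r in Ioo a b, r ^ (n - 1) * (1 : ℝ) := by
        refine setIntegral_mono_on (BddContOn.const _).integrableOn_Ioo
          (BddContOn.const (1 : ℝ)).weight measurableSet_Ioo fun r hr => ?_
        rw [mul_one]
        exact pow_le_pow_left₀ ha hr.1.le _

namespace SmallOn

variable {ζ : ℝ → ℝ} {c q : ℝ}

/-- A count of powers: (r₂ - r₁)² r₂^(n-1) ≤ r₂^(n+1) ≤ (q r₁)^(n+1). -/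
theorem wint_one_mul_le (h : SmallOn V σ r₁ r₂) (hn : 1 ≤ n) (h12 : r₁ < r₂) (hq : r₂ ≤ q * r₁) :
    wint n r₁ r₂ (fun _ => 1) * ((r₂ - r₁) * (radialEnergy V r₁ r₂ / r₁ ^ (n + 1))) ≤
      q ^ (n + 1) * radialEnergy V r₁ r₂ := by
  have hN : 0 ≤ radialEnergy V r₁ r₂ := wint_nonneg h.pos.le fun r hr =>
    slice_nonneg h.pos.le hr fun _ _ => sq_nonneg _
  have hp := h.pos
  have h1 := wint_one_le (n := n) hp.le h12.le
  have h2 : (0 : ℝ) < r₁ ^ (n + 1) := by positivity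
  have h3 : r₂ ^ (n + 1) ≤ q ^ (n + 1) * r₁ ^ (n + 1) := by
    rw [← mul_pow]; exact pow_le_pow_left₀ (hp.trans h12).le hq _
  have h4 : (r₂ - r₁) * r₂ ^ (n - 1) * (r₂ - r₁) ≤ r₂ ^ (n + 1) := by
    obtain ⟨k, rfl⟩ : ∃ k, n = k + 1 := ⟨n - 1, by omega⟩
    have h5 : r₂ - r₁ ≤ r₂ := by linarith
    have h6 : 0 ≤ r₂ - r₁ := by linarith
    have h7 : 0 < r₂ := hp.trans h12
    simp only [Nat.add_sub_cancel]
    calc (r₂ - r₁) * r₂ ^ k * (r₂ - r₁) ≤ r₂ * r₂ ^ k * r₂ := by gcongr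
      _ = _ := by ring
  have h6 : 0 ≤ r₂ - r₁ := by linarith
  calc wint n r₁ r₂ (fun _ => 1) * ((r₂ - r₁) * (radialEnergy V r₁ r₂ / r₁ ^ (n + 1)))
      ≤ (r₂ - r₁) * r₂ ^ (n - 1) * ((r₂ - r₁) * (radialEnergy V r₁ r₂ / r₁ ^ (n + 1))) := by gcongr
    _ = ((r₂ - r₁) * r₂ ^ (n - 1) * (r₂ - r₁)) * (radialEnergy V r₁ r₂ / r₁ ^ (n + 1)) := by ring
    _ ≤ (q ^ (n + 1) * r₁ ^ (n + 1)) * (radialEnergy V r₁ r₂ / r₁ ^ (n + 1)) := by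
        exact mul_le_mul_of_nonneg_right (h4.trans h3) (by positivity)
    _ = _ := by field_simp

/-- The integral over the larger annulus is controlled by that over the smaller one and the radial
energy. -/
theorem wint_slice_sq_le (h : SmallOn V σ r₁ r₂) (hn : 1 ≤ n) (h13 : r₁ ≤ r₃) (h34 : r₃ < r₄)
    (h42 : r₄ ≤ r₂) (hq : r₂ ≤ q * r₁) (hq' : r₂ ≤ q * (r₄ - r₃)) (hζ : IsCutoff ζ c r₁ r₂ r₃ r₄) :
    wint n r₁ r₂ (slice fun y => V y ^ 2) ≤ 2 * q ^ (n + 1) * radialEnergy V r₁ r₂ +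
      2 * q ^ n * wint n r₁ r₂ fun r => ζ r ^ 2 * slice (fun y => V y ^ 2) r := by
  set N := radialEnergy V r₁ r₂
  set B := wint n r₁ r₂ fun r => ζ r ^ 2 * slice (fun y => V y ^ 2) r
  set E := (r₂ - r₁) * (N / r₁ ^ (n + 1))
  have hp := h.pos
  have h12 : r₁ < r₂ := by linarith
  have hA := h.bddContOn.sq.slice hp.le
  have hζb : BddContOn (fun r => ζ r ^ 2) (Ioo r₁ r₂) :=
    .of_continuous_Ioo (hζ.continuous.pow 2)
  have hsub : Ioo r₃ r₄ ⊆ Ioo r₁ r₂ := Ioo_subset_Ioo h13 h42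
  have hA0 : ∀ r ∈ Ioo r₁ r₂, 0 ≤ slice (fun y => V y ^ 2) r := fun r hr =>
    slice_nonneg hp.le hr fun _ _ => sq_nonneg _
  have hB0 : 0 ≤ B := wint_nonneg hp.le fun r hr => mul_nonneg (sq_nonneg _) (hA0 r hr)
  have hB : wint n r₃ r₄ (slice fun y => V y ^ 2) ≤ B := by
    calc wint n r₃ r₄ (slice fun y => V y ^ 2) =
        wint n r₃ r₄ (fun r => ζ r ^ 2 * slice (fun y => V y ^ 2) r) :=
          wint_congr fun r hr => by rw [hζ.eq_one r hr, one_pow, one_mul]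
      _ ≤ B := by
          refine setIntegral_mono_set (hζb.mul hA).weight ?_ hsub.eventuallyLE
          refine (ae_restrict_iff' measurableSet_Ioo).2 (Eventually.of_forall fun r hr => ?_)
          exact mul_nonneg (pow_nonneg (hp.trans hr.1).le _) (mul_nonneg (sq_nonneg _) (hA0 r hr))
  have hA34 : BddContOn (slice fun y => V y ^ 2) (Ioo r₃ r₄) :=
    ⟨hA.1.mono hsub, hA.2.imp fun C hC r hr => hC r (hsub hr)⟩
  set w := wint n r₃ r₄ (fun _ => 1)
  have h3 : 0 < r₃ := hp.trans_le h13
  have hq0 : 0 < q := by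
    by_contra hq0
    have : q * r₁ ≤ 0 := mul_nonpos_of_nonpos_of_nonneg (not_lt.1 hq0) hp.le
    linarith
  -- Both r₃ and r₄ - r₃ are at least r₂ / q, so the weighted length w of the inner interval is
  -- comparable to r₂ⁿ.
  have hw : (r₂ / q) ^ n ≤ w := by
    refine le_trans ?_ (le_wint_one (n := n) h3.le h34.le)
    obtain ⟨k, rfl⟩ : ∃ k, n = k + 1 := ⟨n - 1, by omega⟩
    simp only [Nat.add_sub_cancel]
    have e1 : r₂ / q ≤ r₄ - r₃ := by rw [div_le_iff₀ hq0]; linarith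
    have e2 : r₂ / q ≤ r₃ := by rw [div_le_iff₀ hq0]; nlinarith
    have e3 : 0 < r₂ / q := div_pos (hp.trans h12) hq0
    rw [pow_succ, mul_comm]
    have : 0 ≤ r₄ - r₃ := by linarith
    gcongr
  have hw0 : 0 < w := lt_of_lt_of_le (pow_pos (div_pos (hp.trans h12) hq0) n) hw
  -- The comparison of the slices at r and s is averaged over s in the inner interval, where the
  -- cutoff is 1; a second integration in r gives the claim.
  have hpt : ∀ r ∈ Ioo r₁ r₂, w * slice (fun y => V y ^ 2) r ≤ 2 * B + w * (2 * E) := by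
    intro r hr
    have e1 : wint n r₃ r₄ (fun s => slice (fun y => V y ^ 2) r * 1) ≤
        wint n r₃ r₄ (fun s => 2 * slice (fun y => V y ^ 2) s + 2 * E * 1) := by
      refine wint_mono h3.le ((BddContOn.const _).const_mul _)
        ((hA34.const_mul _).add ((BddContOn.const _).const_mul _)) fun s hs => ?_
      have e2 := h.slice_sq_le hr (hsub hs)
      have e3 := h.sphInt_sub_sq_le hr (hsub hs) hn
      linarith
    rw [wint_const_mul, wint_add (hA34.const_mul _) ((BddContOn.const _).const_mul _),
      wint_const_mul, wint_const_mul] at e1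
    linarith
  have e1 : wint n r₁ r₂ (fun r => w * slice (fun y => V y ^ 2) r) ≤
      wint n r₁ r₂ (fun r => (2 * B + w * (2 * E)) * 1) :=
    wint_mono hp.le (hA.const_mul _) ((BddContOn.const _).const_mul _) fun r hr => by
      rw [mul_one]; exact hpt r hr
  rw [wint_const_mul, wint_const_mul] at e1
  have e2 := h.wint_one_mul_le hn h12 hq
  have e3 : wint n r₁ r₂ (fun _ => 1) ≤ q ^ n * w := by
    refine (wint_one_le hp.le h12.le).trans ?_
    have e4 : (r₂ - r₁) * r₂ ^ (n - 1) ≤ r₂ ^ n := by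
      obtain ⟨k, rfl⟩ : ∃ k, n = k + 1 := ⟨n - 1, by omega⟩
      simp only [Nat.add_sub_cancel]
      rw [pow_succ, mul_comm]
      have : 0 < r₂ := hp.trans h12
      gcongr
      linarith
    calc (r₂ - r₁) * r₂ ^ (n - 1) ≤ r₂ ^ n := e4
      _ = q ^ n * (r₂ / q) ^ n := by rw [← mul_pow, mul_div_cancel₀ _ hq0.ne']
      _ ≤ _ := by gcongr
  refine le_of_mul_le_mul_left ?_ hw0
  calc w * wint n r₁ r₂ (slice fun y => V y ^ 2) ≤
        (2 * B + w * (2 * E)) * wint n r₁ r₂ (fun _ => 1) := e1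
    _ = 2 * B * wint n r₁ r₂ (fun _ => 1) + 2 * w * (wint n r₁ r₂ (fun _ => 1) * E) := by ring
    _ ≤ 2 * B * (q ^ n * w) + 2 * w * (q ^ (n + 1) * N) := by gcongr
    _ = _ := by ring

end SmallOn

end SliceInequalities

/-! ### The L² estimate by the radial energy -/

section RadialEstimate

open Filter Topology Metric

variable {n : ℕ} [Nontrivial (Eu n)] {V : Eu n → ℝ} {σ r₁ r₂ r₃ r₄ : ℝ} {ζ : ℝ → ℝ} {c q K : ℝ}

/-- The arithmetic of the coercivity estimate on a slice. -/
theorem coercivity_aux {n z S A G R Z m p a X c K : ℝ} (hn : 2 ≤ n) (hz : 0 ≤ z) (hz1 : z ≤ 1)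
    (hR : 0 ≤ R) (hA : 0 ≤ A) (hGR : R ≤ G) (hm : 0 ≤ S * m ^ 2) (hp : S * p ^ 2 ≤ R)
    (ha : |a| ≤ 2 * z * c) (hX : X ^ 2 ≤ A * R)
    (hgap : 2 * n * (A - S * m ^ 2) - K * Z ≤ G - R) :
    1 / 4 * (z ^ 2 * (G - R)) + 3 / 4 * (z ^ 2 * A) - K / 2 * (z ^ 2 * Z) - (1 + 4 * c ^ 2) * R ≤
      z ^ 2 * (G - 2 * S * p ^ 2 - (n - 1) * (A - 2 * S * m ^ 2)) + a * X := by
  -- The cutoff term: a X is at most 2 z c √(A R), split between the coercive z² A and the radial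
  -- energy.
  have h1 : |a * X| ≤ 1 / 4 * (z ^ 2 * A) + 4 * c ^ 2 * R := by
    refine abs_le_of_sq_le_sq ?_ (by positivity)
    have h2 : a ^ 2 ≤ (2 * z * c) ^ 2 := by rw [← sq_abs]; gcongr
    calc (a * X) ^ 2 = a ^ 2 * X ^ 2 := mul_pow _ _ _
      _ ≤ (2 * z * c) ^ 2 * (A * R) := by gcongr
      _ ≤ _ := by nlinarith [sq_nonneg (1 / 4 * (z ^ 2 * A) - 4 * c ^ 2 * R)]
  have h3 := neg_le_of_abs_le h1
  -- Write M = S m². Half of G - R is used in the gap inequality and yields n (A - M) - K Z / 2;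
  -- subtracting (n - 1)(A - 2 M) leaves A + (n - 2) M ≥ A. A quarter of G - R is kept to absorb
  -- errors and the last quarter is dropped.
  have h4 : 1 / 4 * (G - R) + A - K / 2 * Z - R ≤
      G - 2 * S * p ^ 2 - (n - 1) * (A - 2 * S * m ^ 2) := by
    nlinarith [mul_nonneg (sub_nonneg.2 hn) hm]
  have h5 := mul_le_mul_of_nonneg_left h4 (sq_nonneg z)
  have h6 : z ^ 2 * R ≤ R := mul_le_of_le_one_left hR (pow_le_one₀ hz hz1)
  linarith

/-- The arithmetic of the error estimate at a point. -/
theorem error_aux {z c D W p V m ρ g b : ℝ} (hW : 0 ≤ W)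
    (hg : W ^ 2 = g + 2 * (V * ρ) + V ^ 2) (hD : D ≤ z ^ 2 * W + |b|)
    (hb : |b| ≤ 2 * z * c * |V - 2 * m| + 2 * z ^ 2 * |m + p|) :
    W * D ≤ z ^ 2 * (2 * (g + ρ ^ 2 + 2 * V ^ 2) + 4 * (m ^ 2 + p ^ 2)) +
      4 * c ^ 2 * (V ^ 2 + 4 * m ^ 2) := by
  have h1 : W * D ≤ W * (z ^ 2 * W + (2 * z * c * |V - 2 * m| + 2 * z ^ 2 * |m + p|)) :=
    mul_le_mul_of_nonneg_left (hD.trans (by linarith)) hW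
  -- Both mixed products are split so that together they cost one further z² W².
  have h2 : W * (2 * z * c * |V - 2 * m|) ≤ 1 / 2 * (z ^ 2 * W ^ 2) + 2 * c ^ 2 * (V - 2 * m) ^ 2 := by
    rw [← sq_abs (V - 2 * m)]
    nlinarith [sq_nonneg (z * W - 2 * (c * |V - 2 * m|))]
  have h3 : W * (2 * z ^ 2 * |m + p|) ≤ 1 / 2 * (z ^ 2 * W ^ 2) + 2 * z ^ 2 * (m + p) ^ 2 := by
    rw [← sq_abs (m + p)]
    nlinarith [sq_nonneg (z * W - 2 * (z * |m + p|))]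
  have h4 : (V - 2 * m) ^ 2 ≤ 2 * (V ^ 2 + 4 * m ^ 2) := by nlinarith [sq_nonneg (V + 2 * m)]
  have h5 : (m + p) ^ 2 ≤ 2 * (m ^ 2 + p ^ 2) := by nlinarith [sq_nonneg (m - p)]
  have h6 : W ^ 2 ≤ g + ρ ^ 2 + 2 * V ^ 2 := by nlinarith [sq_nonneg (V - ρ)]
  have h7 := mul_le_mul_of_nonneg_left h4 (by positivity : 0 ≤ 2 * c ^ 2)
  have h8 := mul_le_mul_of_nonneg_left h5 (by positivity : 0 ≤ 2 * z ^ 2)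
  have h9 := mul_le_mul_of_nonneg_left h6 (by positivity : 0 ≤ 2 * z ^ 2)
  nlinarith

namespace SmallOn

theorem mul_deriv_sq_cutoff (hζ : IsCutoff ζ c r₁ r₂ r₃ r₄) {r : ℝ} (hr : r ∈ Ioo r₁ r₂) :
    |r * deriv (fun r => ζ r ^ 2) r| ≤ 2 * ζ r * c := by
  have h2 : r * (2 * ζ r * deriv ζ r) = 2 * ζ r * (r * deriv ζ r) := by ring
  have := hζ.nonneg r
  rw [hζ.deriv_sq, h2, abs_mul, abs_of_nonneg (by positivity : 0 ≤ 2 * ζ r)]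
  gcongr
  exact hζ.abs_deriv_le r hr

theorem sq_radial_le_gradSq (V : Eu n → ℝ) (y : Eu n) : radial V y ^ 2 ≤ gradSq V y := by
  have h : |radial V y| ≤ ‖fderiv ℝ V y‖ * ‖y‖ := (fderiv ℝ V y).le_opNorm y
  rw [gradSq, ← mul_pow, mul_comm ‖y‖, ← sq_abs]
  gcongr

theorem bddContOn_fderiv_radialTest (h : SmallOn V σ r₁ r₂) {α : ℝ → ℝ} (hα : ContDiff ℝ 1 α)
    (hs : tsupport α ⊆ Ioo r₁ r₂) :
    BddContOn (fun y => fderiv ℝ (radialTest V α (meanTest V α)) y (gradient (height V) y))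
      (eann n r₁ r₂) := by
  have b1 := h.bddContOn
  have b2 := h.bddContOn_radial
  have b3 := h.bddContOn_gradSq
  have d1 : BddContOn (fun y : Eu n => α ‖y‖) (eann n r₁ r₂) :=
    BddContOn.comp_norm (.of_continuous_Ioo hα.continuous)
  have d2 : BddContOn (fun y : Eu n => ‖y‖ * deriv α ‖y‖) (eann n r₁ r₂) :=
    BddContOn.comp_norm (f := fun r => r * deriv α r)
      (.of_continuous_Ioo (continuous_id.mul (hα.continuous_deriv le_rfl)))
  have d3 : BddContOn (fun y : Eu n => deriv (meanTest V α) ‖y‖) (eann n r₁ r₂) :=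
    BddContOn.comp_norm (.of_continuous_Ioo ((h.contDiff_meanTest hα hs).continuous_deriv le_rfl))
  exact (((d1.mul ((b3.add ((b1.mul b2).const_mul 2)).add b1.sq)).add
    (d2.mul ((b1.mul b2).add b1.sq))).add (d3.mul (b2.add b1))).congr
      fun y hy => h.fderiv_radialTest_gradient hα hs hy

/-- Coercivity of the flat form on the test function: the reflected mean gives constants the right
sign and the gap covers degrees at least two. Only the first modes and the radial energy are lost.
-/
theorem le_integral_fderiv_radialTest (h : SmallOn V σ r₁ r₂) (hn : 2 ≤ n)
    (hK : ∀ (O : Set (Eu n)) (v : Eu n → ℝ), IsOpen O → sphere 0 1 ⊆ O →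
      ContDiffOn ℝ 1 v O →
      2 * n * (sphInt (fun x => v x ^ 2) - sphInt v ^ 2 / sphArea n) -
          K * ∑ i, sphInt (fun x => v x * x i) ^ 2 ≤
        sphInt (fun x => ‖fderiv ℝ v x‖ ^ 2 - (fderiv ℝ v x x) ^ 2))
    (hζ : IsCutoff ζ c r₁ r₂ r₃ r₄) :
    1 / 4 * (wint n r₁ r₂ fun r => ζ r ^ 2 * (slice (gradSq V) r -
        slice (fun y => radial V y ^ 2) r)) +
      3 / 4 * (wint n r₁ r₂ fun r => ζ r ^ 2 * slice (fun y => V y ^ 2) r) -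
      K / 2 * (wint n r₁ r₂ fun r => ζ r ^ 2 * firstModes V r) -
      (1 + 4 * c ^ 2) * radialEnergy V r₁ r₂ ≤
    ∫ y in eann n r₁ r₂, fderiv ℝ (radialTest V (fun r => ζ r ^ 2)
      (meanTest V fun r => ζ r ^ 2)) y (gradient (height V) y) := by
  have hp := h.pos.le
  have hα := hζ.contDiff_sq
  have b1 : BddContOn (fun r => ζ r ^ 2) (Ioo r₁ r₂) := .of_continuous_Ioo hα.continuous
  have b2 : BddContOn (fun r => r * deriv (fun r => ζ r ^ 2) r) (Ioo r₁ r₂) :=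
    .of_continuous_Ioo (continuous_id.mul (hα.continuous_deriv le_rfl))
  have bA := h.bddContOn.sq.slice hp
  have bR := h.bddContOn_radial.sq.slice hp
  have bG := h.bddContOn_gradSq.slice hp
  have bW := (h.bddContOn.mul h.bddContOn_radial).slice hp
  have bm := h.bddContOn.sphMean hp
  have bp := h.bddContOn_radial.sphMean hp
  have bZ := h.bddContOn_firstModes
  rw [h.integral_fderiv_radialTest (by omega) hα hζ.tsupport_sq_subset
    (h.bddContOn_fderiv_radialTest hα hζ.tsupport_sq_subset), radialEnergy,
    ← wint_const_mul, ← wint_const_mul, ← wint_const_mul, ← wint_const_mul,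
    ← wint_add ((b1.mul (bG.sub bR)).const_mul _) ((b1.mul bA).const_mul _),
    ← wint_sub (((b1.mul (bG.sub bR)).const_mul _).add ((b1.mul bA).const_mul _))
      ((b1.mul bZ).const_mul _),
    ← wint_sub ((((b1.mul (bG.sub bR)).const_mul _).add ((b1.mul bA).const_mul _)).sub
      ((b1.mul bZ).const_mul _)) (bR.const_mul _)]
  refine wint_mono hp ((((((b1.mul (bG.sub bR)).const_mul _).add ((b1.mul bA).const_mul _)).sub
      ((b1.mul bZ).const_mul _))).sub (bR.const_mul _))
    ((b1.mul ((bG.sub (bp.sq.const_mul _)).sub ((bA.sub (bm.sq.const_mul _)).const_mul _))).add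
      (b2.mul (bW.sub ((bm.mul bp).const_mul _)))) fun r hr => ?_
  have hS : 0 < sphArea n := sphArea_pos
  exact coercivity_aux (by exact_mod_cast hn) (hζ.nonneg r) (hζ.le_one r)
    (slice_nonneg hp hr fun _ _ => sq_nonneg _) (slice_nonneg hp hr fun _ _ => sq_nonneg _)
    (slice_mono hp hr h.bddContOn_radial.sq.1 h.bddContOn_gradSq.1
      fun y _ => sq_radial_le_gradSq V y) (by positivity)
    (sphArea_mul_sphMean_sq_le hp hr h.bddContOn_radial.1) (mul_deriv_sq_cutoff hζ hr)
    (h.slice_sq_sub_mean hr) (h.spectral_gap_slice hK hr)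

theorem wint_firstModes_le (h : SmallOn V σ r₁ r₂) (hn : 1 ≤ n) (h12 : r₁ < r₂)
    (hq : r₂ ≤ q * r₁) (hζ : IsCutoff ζ c r₁ r₂ r₃ r₄) {s : ℝ} (hs : s ∈ Ioo r₁ r₂)
    (hZ : firstModes V s ≤ n * sphArea n * σ ^ 4 * slice (fun y => V y ^ 2) s) :
    (wint n r₁ r₂ fun r => ζ r ^ 2 * firstModes V r) ≤ n * sphArea n *
      (4 * σ ^ 4 * (wint n r₁ r₂ fun r => ζ r ^ 2 * slice (fun y => V y ^ 2) r) +
        6 * (q ^ (n + 1) * radialEnergy V r₁ r₂)) := by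
  have hp := h.pos.le
  have b1 : BddContOn (fun r => ζ r ^ 2) (Ioo r₁ r₂) :=
    .of_continuous_Ioo hζ.contDiff_sq.continuous
  have bA := h.bddContOn.sq.slice hp
  have hS : 0 < sphArea n := sphArea_pos
  set E := (r₂ - r₁) * (radialEnergy V r₁ r₂ / r₁ ^ (n + 1))
  have hE : 0 ≤ E := by
    have hN : 0 ≤ radialEnergy V r₁ r₂ := wint_nonneg hp fun r hr =>
      slice_nonneg hp hr fun _ _ => sq_nonneg _
    have : 0 ≤ r₂ - r₁ := by linarith
    have := h.pos
    positivity
  have h1 : (wint n r₁ r₂ fun r => ζ r ^ 2 * firstModes V r) ≤ wint n r₁ r₂ fun r =>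
      n * sphArea n * (4 * σ ^ 4 * (ζ r ^ 2 * slice (fun y => V y ^ 2) r) + 6 * E * 1) := by
    refine wint_mono hp (b1.mul h.bddContOn_firstModes)
      ((((b1.mul bA).const_mul _).add ((BddContOn.const 1).const_mul _)).const_mul _) fun r hr => ?_
    have h2 := h.firstModes_le hr hs hZ
    have h3 := h.sphInt_sub_sq_le hr hs hn
    have h4 : ζ r ^ 2 ≤ 1 := pow_le_one₀ (hζ.nonneg r) (hζ.le_one r)
    calc ζ r ^ 2 * firstModes V r ≤ ζ r ^ 2 * (n * sphArea n *
          (4 * σ ^ 4 * slice (fun y => V y ^ 2) r + 6 * E)) := by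
          refine mul_le_mul_of_nonneg_left (h2.trans ?_) (sq_nonneg _)
          gcongr
      _ = n * sphArea n * (4 * σ ^ 4 * (ζ r ^ 2 * slice (fun y => V y ^ 2) r) +
          6 * E * ζ r ^ 2) := by ring
      _ ≤ _ := by gcongr
  rw [wint_const_mul, wint_add ((b1.mul bA).const_mul _) ((BddContOn.const 1).const_mul _),
    wint_const_mul, wint_const_mul] at h1
  have h5 := h.wint_one_mul_le hn h12 hq
  refine h1.trans ?_
  gcongr ?_ * (_ + ?_)
  linarith

theorem abs_sphMean_le (h : SmallOn V σ r₁ r₂) {r : ℝ} (hr : r ∈ Ioo r₁ r₂) :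
    |sphMean V r| ≤ σ := by
  have hS : 0 < sphArea n := sphArea_pos
  rw [sphMean, abs_div, abs_of_pos hS, div_le_iff₀ hS]
  exact abs_slice_le h.pos.le hr h.bddContOn.1 h.abs_le

/-- The curvature term is estimated crudely, by the size of V rather than by its L² norm. This is
the origin of the summand in the second estimate that is linear in Λ and involves only the volume of
the annulus. -/
theorem integral_abs_radialTest_le (h : SmallOn V σ r₁ r₂) (hζ : IsCutoff ζ c r₁ r₂ r₃ r₄) :
    ∫ y in eann n r₁ r₂, |radialTest V (fun r => ζ r ^ 2) (meanTest V fun r => ζ r ^ 2) y| ≤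
      3 * r₂ * σ * (volume (eann n r₁ r₂)).toReal := by
  have hc : ∫ y in eann n r₁ r₂, (3 * r₂ * σ) = 3 * r₂ * σ * (volume (eann n r₁ r₂)).toReal := by
    simp [Measure.real, mul_comm]
  rw [← hc]
  refine integral_mono_of_nonneg (Eventually.of_forall fun y => abs_nonneg _)
    (BddContOn.const _).integrableOn_eann ?_
  refine (ae_restrict_iff' (isOpen_eann _ _).measurableSet).2 (Eventually.of_forall fun y hy => ?_)
  have h1 : radialTest V (fun r => ζ r ^ 2) (meanTest V fun r => ζ r ^ 2) y =
      ζ ‖y‖ ^ 2 * (‖y‖ * (V y - 2 * sphMean V ‖y‖)) := by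
    simp only [radialTest, meanTest, height]; ring
  have h2 : |V y - 2 * sphMean V ‖y‖| ≤ 3 * σ := by
    have e1 := _root_.abs_le.1 (h.abs_le y hy)
    have e2 := _root_.abs_le.1 (h.abs_sphMean_le (r := ‖y‖) hy)
    exact _root_.abs_le.2 ⟨by linarith, by linarith⟩
  have h3 : ζ ‖y‖ ^ 2 ≤ 1 := pow_le_one₀ (hζ.nonneg _) (hζ.le_one _)
  have hσ := h.nonneg
  have hr2 : 0 ≤ r₂ := (norm_nonneg y).trans (h.norm_le hy)
  beta_reduce
  rw [h1, abs_mul, abs_mul, abs_norm, abs_of_nonneg (sq_nonneg _)]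
  calc ζ ‖y‖ ^ 2 * (‖y‖ * |V y - 2 * sphMean V ‖y‖|) ≤ 1 * (r₂ * (3 * σ)) := by
        gcongr
        exact h.norm_le hy
    _ = _ := by ring

theorem norm_fderiv_mul_le (h : SmallOn V σ r₁ r₂) (hζ : IsCutoff ζ c r₁ r₂ r₃ r₄)
    {y : Eu n} (hy : y ∈ eann n r₁ r₂) :
    ‖fderiv ℝ (height V) y‖ * ‖fderiv ℝ (radialTest V (fun r => ζ r ^ 2)
      (meanTest V fun r => ζ r ^ 2)) y‖ ≤
      ζ ‖y‖ ^ 2 * (2 * (gradSq V y + radial V y ^ 2 + 2 * V y ^ 2) +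
        4 * (sphMean V ‖y‖ ^ 2 + sphMean (radial V) ‖y‖ ^ 2)) +
      4 * c ^ 2 * (V y ^ 2 + 4 * sphMean V ‖y‖ ^ 2) := by
  have hn : ‖y‖ ≠ 0 := norm_ne_zero_iff.2 (h.ne_zero hy)
  have hα := hζ.contDiff_sq
  set b := deriv (fun r => ζ r ^ 2) ‖y‖ * height V y + deriv (meanTest V fun r => ζ r ^ 2) ‖y‖
  refine error_aux (b := b) (p := sphMean (radial V) ‖y‖)
    (norm_nonneg _) (h.radial_height hy).2 ?_ ?_
  · rw [fderiv_radialTest (h.differentiableAt hy) (h.ne_zero hy) (hα.differentiable one_ne_zero _)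
      ((h.contDiff_meanTest hα hζ.tsupport_sq_subset).differentiable one_ne_zero _)]
    refine (norm_add_le _ _).trans (le_of_eq ?_)
    rw [norm_smul, norm_smul, innerSL_apply_norm, norm_mul, norm_inv, norm_norm, mul_assoc,
      inv_mul_cancel₀ hn, mul_one, Real.norm_of_nonneg (sq_nonneg _), Real.norm_eq_abs]
  · have e1 : b = (‖y‖ * deriv (fun r => ζ r ^ 2) ‖y‖) * (V y - 2 * sphMean V ‖y‖) +
        (-2 * ζ ‖y‖ ^ 2) * (sphMean V ‖y‖ + sphMean (radial V) ‖y‖) := by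
      simp only [b, h.deriv_meanTest hα hy, height]
      ring
    rw [e1]
    refine (abs_add_le _ _).trans ?_
    rw [abs_mul, abs_mul (-2 * ζ ‖y‖ ^ 2), abs_mul (-2), abs_neg, abs_two,
      abs_of_nonneg (sq_nonneg (ζ ‖y‖))]
    gcongr
    exact mul_deriv_sq_cutoff hζ hy

/-- Means are bounded by L² norms on each sphere. The last term has lost the cutoff and lives on the
whole larger annulus; it is harmless because this bound is later multiplied by O(σ²). -/
theorem integral_norm_fderiv_mul_le (h : SmallOn V σ r₁ r₂)
    (hζ : IsCutoff ζ c r₁ r₂ r₃ r₄) :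
    ∫ y in eann n r₁ r₂, ‖fderiv ℝ (height V) y‖ * ‖fderiv ℝ (radialTest V (fun r => ζ r ^ 2)
      (meanTest V fun r => ζ r ^ 2)) y‖ ≤
    2 * (wint n r₁ r₂ fun r => ζ r ^ 2 * (slice (gradSq V) r -
        slice (fun y => radial V y ^ 2) r)) +
      8 * (wint n r₁ r₂ fun r => ζ r ^ 2 * slice (fun y => V y ^ 2) r) +
      8 * radialEnergy V r₁ r₂ + 20 * c ^ 2 * wint n r₁ r₂ (slice fun y => V y ^ 2) := by
  have hp := h.pos.le
  have hα := hζ.contDiff_sq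
  have b1 : BddContOn (fun r => ζ r ^ 2) (Ioo r₁ r₂) := .of_continuous_Ioo hα.continuous
  have bA := h.bddContOn.sq.slice hp
  have bR := h.bddContOn_radial.sq.slice hp
  have bG := h.bddContOn_gradSq.slice hp
  have bm := (h.bddContOn.sphMean hp).sq
  have bp := (h.bddContOn_radial.sphMean hp).sq
  have d1 : BddContOn (fun y : Eu n => ζ ‖y‖ ^ 2) (eann n r₁ r₂) := b1.comp_norm
  have d2 : BddContOn (fun y => 2 * (gradSq V y + radial V y ^ 2 + 2 * V y ^ 2)) (eann n r₁ r₂) :=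
    ((h.bddContOn_gradSq.add h.bddContOn_radial.sq).add (h.bddContOn.sq.const_mul 2)).const_mul 2
  have d3 : BddContOn (fun r => 4 * (sphMean V r ^ 2 + sphMean (radial V) r ^ 2)) (Ioo r₁ r₂) :=
    (bm.add bp).const_mul 4
  have d3' : BddContOn (fun y : Eu n => 4 * (sphMean V ‖y‖ ^ 2 + sphMean (radial V) ‖y‖ ^ 2))
      (eann n r₁ r₂) := d3.comp_norm
  have d4 : BddContOn (fun y : Eu n => 4 * sphMean V ‖y‖ ^ 2) (eann n r₁ r₂) :=
    (bm.const_mul 4).comp_norm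
  have d5 := (h.bddContOn.sq.add d4).const_mul (4 * c ^ 2)
  have h1 := integral_mono_of_nonneg (Eventually.of_forall fun y => mul_nonneg (norm_nonneg _)
    (norm_nonneg _)) (((d1.mul (d2.add d3')).add d5).integrableOn_eann)
    ((ae_restrict_iff' (isOpen_eann _ _).measurableSet).2
      (Eventually.of_forall fun y hy => h.norm_fderiv_mul_le hζ hy))
  refine h1.trans ?_
  rw [integral_eann_eq_wint hp ((d1.mul (d2.add d3')).add d5)]
  have hS : 0 < sphArea n := sphArea_pos
  have hsl : ∀ r ∈ Ioo r₁ r₂, slice (fun y => ζ ‖y‖ ^ 2 * (2 * (gradSq V y + radial V y ^ 2 +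
      2 * V y ^ 2) + 4 * (sphMean V ‖y‖ ^ 2 + sphMean (radial V) ‖y‖ ^ 2)) +
      4 * c ^ 2 * (V y ^ 2 + 4 * sphMean V ‖y‖ ^ 2)) r ≤
      2 * (ζ r ^ 2 * (slice (gradSq V) r - slice (fun y => radial V y ^ 2) r)) +
      8 * (ζ r ^ 2 * slice (fun y => V y ^ 2) r) + 8 * slice (fun y => radial V y ^ 2) r +
      20 * c ^ 2 * slice (fun y => V y ^ 2) r := fun r hr => by
    have hr0 : 0 ≤ r := hp.trans hr.1.le
    have e3 : ∀ g : ℝ → ℝ, slice (fun y : Eu n => g ‖y‖) r = g r * sphArea n := fun g => by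
      have := slice_radial_mul g (fun _ : Eu n => (1 : ℝ)) hr0
      simp only [mul_one] at this
      rw [this, slice, sphInt_const, one_mul]
    have hm := sphArea_mul_sphMean_sq_le hp hr h.bddContOn.1
    have hq := sphArea_mul_sphMean_sq_le hp hr h.bddContOn_radial.1
    rw [slice_add hp hr (d1.mul (d2.add d3')).1 d5.1, slice_radial_mul (fun r => ζ r ^ 2) _ hr0,
      slice_add hp hr d2.1 d3'.1, e3 (fun r => 4 * (sphMean V r ^ 2 + sphMean (radial V) r ^ 2)),
      slice_const_mul 2, slice_const_mul (4 * c ^ 2),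
      slice_add hp hr (h.bddContOn_gradSq.add h.bddContOn_radial.sq).1
        (h.bddContOn.sq.const_mul 2).1,
      slice_add hp hr h.bddContOn_gradSq.1 h.bddContOn_radial.sq.1, slice_const_mul 2,
      slice_add hp hr h.bddContOn.sq.1 d4.1, e3 (fun r => 4 * sphMean V r ^ 2)]
    have hz : ζ r ^ 2 ≤ 1 := pow_le_one₀ (hζ.nonneg r) (hζ.le_one r)
    have hR : 0 ≤ slice (fun y => radial V y ^ 2) r := slice_nonneg hp hr fun _ _ => sq_nonneg _
    have h6 : ζ r ^ 2 * slice (fun y => radial V y ^ 2) r ≤ slice (fun y => radial V y ^ 2) r :=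
      mul_le_of_le_one_left hR hz
    have h7 := mul_le_mul_of_nonneg_left hm (sq_nonneg (ζ r))
    have h8 := mul_le_mul_of_nonneg_left hq (sq_nonneg (ζ r))
    have h9 := mul_le_mul_of_nonneg_left hm (sq_nonneg c)
    linarith
  have b2 := (b1.mul (bG.sub bR)).const_mul 2
  have b3 := (b1.mul bA).const_mul 8
  refine (wint_mono hp (((d1.mul (d2.add d3')).add d5).slice hp)
    (((b2.add b3).add (bR.const_mul 8)).add (bA.const_mul _)) hsl).trans ?_
  rw [wint_add ((b2.add b3).add (bR.const_mul 8)) (bA.const_mul _),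
    wint_add (b2.add b3) (bR.const_mul 8), wint_add b2 b3, wint_const_mul, wint_const_mul,
    wint_const_mul, wint_const_mul, radialEnergy]

variable {ι : Eu n →ₗᵢ[ℝ] Amb n} {ν : Amb n} {Λ : ℝ}

/-- The `L²` estimate in terms of the radial derivative. -/
theorem integral_sq_le (h : SmallOn V σ r₁ r₂) (hn : 2 ≤ n) (hν : ‖ν‖ = 1)
    (hι : ∀ y, ⟪ι y, ν⟫_ℝ = 0) (hΛ : 0 ≤ Λ)
    (hM : HasMeanCurvatureBoundedBy (graphMap ι ν V '' eann n r₁ r₂) (annulus n r₁ r₂) Λ)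
    (h13 : r₁ ≤ r₃) (h34 : r₃ < r₄) (h42 : r₄ ≤ r₂) (hq1 : 1 ≤ q) (hq : r₂ ≤ q * r₁)
    (hq' : r₂ ≤ q * (r₄ - r₃)) (hζ : IsCutoff ζ c r₁ r₂ r₃ r₄) (hK0 : 0 ≤ K)
    (hK : ∀ (O : Set (Eu n)) (v : Eu n → ℝ), IsOpen O → sphere 0 1 ⊆ O →
      ContDiffOn ℝ 1 v O →
      2 * n * (sphInt (fun x => v x ^ 2) - sphInt v ^ 2 / sphArea n) -
          K * ∑ i, sphInt (fun x => v x * x i) ^ 2 ≤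
        sphInt (fun x => ‖fderiv ℝ v x‖ ^ 2 - (fderiv ℝ v x x) ^ 2))
    {s : ℝ} (hs : s ∈ Ioo r₁ r₂)
    (hZ : firstModes V s ≤ n * sphArea n * σ ^ 4 * slice (fun y => V y ^ 2) s)
    (hσ : 2 * K * n * sphArea n * σ ^ 4 +
      (100 * 2 ^ n + 50) * σ ^ 2 * (8 + 40 * c ^ 2 * q ^ (n + 1)) ≤ 1 / 4) :
    ∫ y in eann n r₃ r₄, V y ^ 2 ≤
      (6 * K * n * sphArea n * q ^ (n + 1) + 8 * c ^ 2 + 3) *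
        (∫ y in eann n r₁ r₂, radial V y ^ 2) +
      6 * (1 + 2 ^ n) * Λ * r₂ * σ * (volume (eann n r₁ r₂)).toReal := by
  have hp := h.pos.le
  have h12 : r₁ < r₂ := by linarith
  have hα := hζ.contDiff_sq
  have hsα := hζ.tsupport_sq_subset
  have hW := h.abs_integral_radialTest_le hν hι hM hα (h.contDiff_meanTest hα hsα) hsα
    (tsupport_mul_subset_of_left hsα)
  have e1 := h.le_integral_fderiv_radialTest hn hK hζ
  have e2 := h.wint_firstModes_le (by omega) h12 hq hζ hs hZ
  have e3 := h.integral_abs_radialTest_le hζ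
  have e4 := h.integral_norm_fderiv_mul_le hζ
  have e5 := h.wint_slice_sq_le (by omega) h13 h34 h42 hq hq' hζ
  have hN : ∫ y in eann n r₁ r₂, radial V y ^ 2 = radialEnergy V r₁ r₂ :=
    integral_eann_eq_wint hp h.bddContOn_radial.sq
  rw [hN]
  have b1 : BddContOn (fun r => ζ r ^ 2) (Ioo r₁ r₂) := .of_continuous_Ioo hα.continuous
  have d1 : BddContOn (fun y : Eu n => ζ ‖y‖ ^ 2) (eann n r₁ r₂) := b1.comp_norm
  have hsub : eann n r₃ r₄ ⊆ eann n r₁ r₂ := fun y hy =>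
    ⟨h13.trans_lt hy.1, hy.2.trans_le h42⟩
  have hB : ∫ y in eann n r₃ r₄, V y ^ 2 ≤
      wint n r₁ r₂ fun r => ζ r ^ 2 * slice (fun y => V y ^ 2) r := by
    calc ∫ y in eann n r₃ r₄, V y ^ 2 = ∫ y in eann n r₃ r₄, ζ ‖y‖ ^ 2 * V y ^ 2 :=
          setIntegral_congr_fun (isOpen_eann _ _).measurableSet fun y hy => by
            simp only [hζ.eq_one ‖y‖ hy, one_pow, one_mul]
      _ ≤ ∫ y in eann n r₁ r₂, ζ ‖y‖ ^ 2 * V y ^ 2 :=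
          setIntegral_mono_set (d1.mul h.bddContOn.sq).integrableOn_eann
            (Eventually.of_forall fun y => by positivity) hsub.eventuallyLE
      _ = wint n r₁ r₂ (slice fun y => ζ ‖y‖ ^ 2 * V y ^ 2) :=
          integral_eann_eq_wint hp (d1.mul h.bddContOn.sq)
      _ = _ := wint_congr fun r hr => slice_radial_mul (fun r => ζ r ^ 2) _ (hp.trans hr.1.le)
  refine hB.trans ?_
  have hB0 : 0 ≤ wint n r₁ r₂ fun r => ζ r ^ 2 * slice (fun y => V y ^ 2) r :=
    wint_nonneg hp fun r hr => mul_nonneg (sq_nonneg _) (slice_nonneg hp hr fun _ _ => sq_nonneg _)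
  have hN0 : 0 ≤ radialEnergy V r₁ r₂ := wint_nonneg hp fun r hr =>
    slice_nonneg hp hr fun _ _ => sq_nonneg _
  have hT0 : 0 ≤ wint n r₁ r₂ fun r => ζ r ^ 2 * (slice (gradSq V) r -
      slice (fun y => radial V y ^ 2) r) :=
    wint_nonneg hp fun r hr => mul_nonneg (sq_nonneg _) (sub_nonneg.2
      (slice_mono hp hr h.bddContOn_radial.sq.1 h.bddContOn_gradSq.1
        fun y _ => sq_radial_le_gradSq V y))
  have hS : 0 < sphArea n := sphArea_pos
  set B := wint n r₁ r₂ fun r => ζ r ^ 2 * slice (fun y => V y ^ 2) r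
  set N := radialEnergy V r₁ r₂
  set T := wint n r₁ r₂ fun r => ζ r ^ 2 * (slice (gradSq V) r -
      slice (fun y => radial V y ^ 2) r)
  set ε := (100 * 2 ^ n + 50) * σ ^ 2
  set v := (volume (eann n r₁ r₂)).toReal
  have hε : 0 ≤ ε := by positivity
  -- Absorption. The coercive term is 3/4 `B`; the first modes cost 2 K n S σ⁴ `B` and the metric
  -- error ε (8 + 40 c² qⁿ) `B`, together at most `B` / 4 by `hσ`. The gradient term 1/4 `T`
  -- dominates 2 ε `T`. The remaining `B` / 2 is doubled, which explains the constants 6 K n S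
  -- q^(n+1) + 8 c² + 3 and 6 (1 + 2ⁿ).
  have f1 := mul_le_mul_of_nonneg_left e4 hε
  have f2 := mul_le_mul_of_nonneg_left e3 (by positivity : 0 ≤ (1 + 2 ^ n) * Λ)
  have f3 := mul_le_mul_of_nonneg_left e2 (by positivity : 0 ≤ K / 2)
  have f4 := mul_le_mul_of_nonneg_left e5 (by positivity : 0 ≤ ε * (20 * c ^ 2))
  have f5 := (le_abs_self _).trans hW
  have hqn : q ^ n ≤ q ^ (n + 1) := pow_le_pow_right₀ hq1 (by omega)
  have hQ : 0 ≤ ε * (40 * c ^ 2) * B := by positivity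
  have f6 := mul_le_mul_of_nonneg_left hqn hQ
  have hσ4 : 0 ≤ 2 * K * n * sphArea n * σ ^ 4 := by
    have := h.nonneg
    positivity
  have hx1 : 0 ≤ ε * (40 * c ^ 2 * q ^ (n + 1)) := by positivity
  have hε8 : ε * 8 ≤ 1 / 4 := by linarith
  have f7 := mul_le_mul_of_nonneg_right hσ hB0
  have hx2 : ε * (8 + 40 * c ^ 2 * q ^ (n + 1)) ≤ 1 / 4 := by linarith
  have f8 := mul_le_mul_of_nonneg_right hx2 hN0
  have f9 := mul_le_mul_of_nonneg_right hε8 hT0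
  linarith

end SmallOn

end RadialEstimate

/-! ### Jacobi fields and the measure on the equatorial sphere -/

section Jacobi

open Filter Topology Metric

variable {n : ℕ}

theorem exists_linearIsometry (H : OrientedHyperplane n) :
    ∃ ι : Eu n →ₗᵢ[ℝ] Amb n, ∀ x, x ∈ H.toSubmodule ↔ ∃ y, ι y = x := by
  have hfr : Module.finrank ℝ H.toSubmodule = n := by
    have : Fact (Module.finrank ℝ (Amb n) = n + 1) := ⟨by simp⟩
    refine Submodule.finrank_orthogonal_span_singleton fun h0 => ?_
    have := H.norm_normal
    rw [h0, norm_zero] at this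
    exact zero_ne_one this
  let e : Eu n ≃ₗᵢ[ℝ] H.toSubmodule :=
    ((stdOrthonormalBasis ℝ H.toSubmodule).reindex (finCongr hfr)).repr.symm
  refine ⟨H.toSubmodule.subtypeₗᵢ.comp e.toLinearIsometry, fun x => ⟨fun hx => ?_, ?_⟩⟩
  · exact ⟨e.symm ⟨x, hx⟩, by simp⟩
  · rintro ⟨y, rfl⟩
    exact (e y).2

variable {H : OrientedHyperplane n} {ι : Eu n →ₗᵢ[ℝ] Amb n}

theorem mem_toSubmodule_iff {x : Amb n} : x ∈ H.toSubmodule ↔ ⟪x, H.normal⟫_ℝ = 0 := by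
  rw [OrientedHyperplane.toSubmodule, Submodule.mem_orthogonal_singleton_iff_inner_left]

theorem equator_eq (hι : ∀ x, x ∈ H.toSubmodule ↔ ∃ y, ι y = x) :
    equator H = range fun ω : sphere (0 : Eu n) 1 => ι ω := by
  ext x
  constructor
  · rintro ⟨hx, hx1⟩
    obtain ⟨y, rfl⟩ := (hι x).1 hx
    exact ⟨⟨y, by rw [mem_sphere_zero_iff_norm, ← hx1, ι.norm_map]⟩, rfl⟩
  · rintro ⟨ω, rfl⟩
    exact ⟨(hι _).2 ⟨_, rfl⟩, by rw [ι.norm_map]; exact mem_sphere_zero_iff_norm.1 ω.2⟩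

theorem isometry_sphere (ι : Eu n →ₗᵢ[ℝ] Amb n) :
    Isometry fun ω : sphere (0 : Eu n) 1 => ι ω :=
  ι.isometry.comp isometry_subtype_coe

theorem measurableEmbedding_sphere (ι : Eu n →ₗᵢ[ℝ] Amb n) :
    MeasurableEmbedding fun ω : sphere (0 : Eu n) 1 => ι ω :=
  (isometry_sphere ι).isClosedEmbedding.measurableEmbedding

/-- The map ι is an isometry of the model sphere onto the equator, so one constant serves all
hyperplanes. Its value never matters, only that it is positive and depends on n alone. -/
theorem exists_sphMeasure_eq [Nontrivial (Eu n)] : ∃ c : NNReal, 0 < c ∧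
    ∀ (H : OrientedHyperplane n) (ι : Eu n →ₗᵢ[ℝ] Amb n),
      (∀ x, x ∈ H.toSubmodule ↔ ∃ y, ι y = x) → sphMeasure H =
        c • Measure.map (fun ω : sphere (0 : Eu n) 1 => ι ω) (volume : Measure (Eu n)).toSphere := by
  obtain ⟨c, hc, h⟩ := exists_euclideanHausdorffMeasure_sphere_eq_smul (E := Eu n)
  have hfr : Module.finrank ℝ (Eu n) = n := by simp
  rw [hfr] at h
  refine ⟨c, hc, fun H ι hι => ?_⟩
  rw [sphMeasure, equator_eq hι, ← (isometry_sphere ι).map_euclideanHausdorffMeasure, h,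
    Measure.map_smul]

theorem integral_sphMeasure {c : NNReal} (hc : sphMeasure H =
      c • Measure.map (fun ω : sphere (0 : Eu n) 1 => ι ω) (volume : Measure (Eu n)).toSphere)
    (f : Amb n → ℝ) : ∫ x, f x ∂(sphMeasure H) = c * sphInt fun x => f (ι x) := by
  rw [hc, integral_smul_nnreal_measure, (measurableEmbedding_sphere ι).integral_map]
  rfl

theorem hasFDerivAt_inv_norm_starProjection {x : Amb n}
    (hx : H.toSubmodule.starProjection x ≠ 0) :
    HasFDerivAt (fun x => ‖H.toSubmodule.starProjection x‖⁻¹)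
      (-(‖H.toSubmodule.starProjection x‖⁻¹ ^ 3) • innerSL ℝ (H.toSubmodule.starProjection x)) x := by
  set p := H.toSubmodule.starProjection
  have hn : ‖p x‖ ≠ 0 := norm_ne_zero_iff.2 hx
  have h1 : HasFDerivAt (fun x => ‖p x‖ ^ 2) _ x :=
    ((hasStrictFDerivAt_norm_sq (p x)).hasFDerivAt).comp x p.hasFDerivAt
  have h2 := h1.sqrt (by positivity)
  have h3 : (fun y : Amb n => √(‖p y‖ ^ 2)) = fun y => ‖p y‖ :=
    funext fun y => Real.sqrt_sq (norm_nonneg _)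
  rw [h3] at h2
  have h4 : HasFDerivAt (fun y : Amb n => ‖p y‖⁻¹) _ x := (hasDerivAt_inv hn).comp_hasFDerivAt x h2
  refine h4.congr_fderiv ?_
  rw [Real.sqrt_sq (norm_nonneg _)]
  ext v
  have h5 : ⟪p x, p v⟫_ℝ = ⟪p x, v⟫_ℝ := by
    rw [← Submodule.inner_starProjection_left_eq_right]
    congr 1
    exact Submodule.starProjection_eq_self_iff.2 (Submodule.starProjection_apply_mem _ _)
  simp [_root_.smul_apply, h5]
  field_simp

theorem equatorExt_inner {a : Amb n} (ha : a ∈ H.toSubmodule) :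
    equatorExt H (fun x => ⟪a, x⟫_ℝ) = fun x => ‖H.toSubmodule.starProjection x‖⁻¹ * ⟪a, x⟫_ℝ := by
  funext x
  rw [equatorExt, toEquator, inner_smul_right, ← Submodule.inner_starProjection_left_eq_right,
    Submodule.starProjection_eq_self_iff.2 ha]

theorem sum_inner_mul_inner {ι' : Type*} [Fintype ι'] (b : OrthonormalBasis ι' ℝ (Amb n))
    (x y : Amb n) : ∑ i, ⟪x, b i⟫_ℝ * ⟪y, b i⟫_ℝ = ⟪x, y⟫_ℝ := by
  rw [← b.sum_inner_mul_inner x y]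
  exact Finset.sum_congr rfl fun i _ => by rw [real_inner_comm y]

theorem starProjection_apply_eq (x : Amb n) :
    H.toSubmodule.starProjection x = x - ⟪H.normal, x⟫_ℝ • H.normal := by
  rw [OrientedHyperplane.toSubmodule, Submodule.starProjection_orthogonal_val,
    Submodule.starProjection_unit_singleton ℝ H.norm_normal]

/-- The restrictions of linear functions are Jacobi fields. -/
theorem isJacobiField_inner {a : Amb n} (ha : a ∈ H.toSubmodule) :
    IsJacobiField H fun x => ⟪a, x⟫_ℝ := by
  refine ⟨(contDiff_const.inner ℝ contDiff_id).contDiffOn, fun ω hω => ?_⟩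
  set p := H.toSubmodule.starProjection with hp
  set k : Amb n → ℝ := fun x => ‖p x‖⁻¹
  have hpω : p ω = ω := Submodule.starProjection_eq_self_iff.2 hω.1
  have hkω : k ω = 1 := by simp [k, hpω, hω.2]
  have hO : IsOpen {x : Amb n | p x ≠ 0} := isOpen_ne_fun p.continuous continuous_const
  have hωO : ω ∈ {x : Amb n | p x ≠ 0} := by
    show p ω ≠ 0
    rw [hpω, ← norm_ne_zero_iff, hω.2]
    exact one_ne_zero
  have hk : ∀ x, p x ≠ 0 → HasFDerivAt k (-(k x ^ 3) • innerSL ℝ (p x)) x := fun x hx =>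
    hasFDerivAt_inv_norm_starProjection hx
  set g : Amb n → ℝ := fun x => k x * ⟪a, x⟫_ℝ with hg
  have hlin : ∀ (v x : Amb n), HasFDerivAt (fun x => ⟪v, x⟫_ℝ) (innerSL ℝ v) x := fun v x =>
    (innerSL ℝ v).hasFDerivAt
  have hgd : ∀ x, p x ≠ 0 → HasFDerivAt g
      (k x • innerSL ℝ a + ⟪a, x⟫_ℝ • (-(k x ^ 3) • innerSL ℝ (p x))) x := fun x hx =>
    (hk x hx).mul (hlin a x)
  have hgC : ContDiffAt ℝ 2 g ω :=
    ((p.contDiff.contDiffAt.norm ℝ hωO).inv (norm_ne_zero_iff.2 hωO)).mul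
      (contDiffAt_const.inner ℝ contDiffAt_id)
  have hg2 : DifferentiableAt ℝ (fderiv ℝ g) ω :=
    (hgC.fderiv_right (m := 1) (by norm_num)).differentiableAt one_ne_zero
  -- Second derivative at ω of g(x) = ⟪a, x⟫ / |p x|. Its trace is (3 - n - 2) ⟪a, ω⟫ = -(n - 1) ⟪a,
  -- ω⟫, because p has trace n and ω is a unit vector.
  have hsecond : ∀ e : Amb n, fderiv ℝ (fderiv ℝ g) ω e e =
      3 * ⟪a, ω⟫_ℝ * (⟪ω, e⟫_ℝ * ⟪ω, e⟫_ℝ) - ⟪a, ω⟫_ℝ * ⟪p e, e⟫_ℝ -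
        2 * (⟪a, e⟫_ℝ * ⟪ω, e⟫_ℝ) := fun e => by
    have h1 : fderiv ℝ (fun x => fderiv ℝ g x e) ω e = fderiv ℝ (fderiv ℝ g) ω e e := by
      have h2 : HasFDerivAt (fun x => fderiv ℝ g x e) _ ω :=
        hg2.hasFDerivAt.clm_apply (hasFDerivAt_const e ω)
      rw [h2.fderiv]
      simp
    rw [← h1]
    have h3 : (fun x => fderiv ℝ g x e) =ᶠ[𝓝 ω]
        fun x => k x * ⟪a, e⟫_ℝ - ⟪a, x⟫_ℝ * (k x ^ 3 * ⟪p x, e⟫_ℝ) := by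
      filter_upwards [hO.mem_nhds hωO] with x hx
      rw [(hgd x hx).fderiv]
      simp [_root_.smul_apply, _root_.add_apply]
      ring
    rw [h3.fderiv_eq]
    have h4 := hk ω hωO
    have h5 : HasFDerivAt (fun x => ⟪p x, e⟫_ℝ) ((innerSL ℝ e).comp p) ω := by
      have := (hlin e (p ω)).comp ω p.hasFDerivAt
      simpa only [real_inner_comm, Function.comp_def] using this
    have h6 : HasFDerivAt (fun x => k x * ⟪a, e⟫_ℝ - ⟪a, x⟫_ℝ * (k x ^ 3 * ⟪p x, e⟫_ℝ)) _ ω :=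
      (h4.mul_const ⟪a, e⟫_ℝ).sub ((hlin a ω).mul ((h4.pow 3).mul h5))
    rw [h6.fderiv]
    simp [_root_.smul_apply, _root_.add_apply, _root_.sub_apply, hkω, hpω, real_inner_comm]
    ring
  have hlap : sphLaplacian H (fun x => ⟪a, x⟫_ℝ) ω = -((n : ℝ) - 1) * ⟪a, ω⟫_ℝ := by
    have hext : equatorExt H (fun x => ⟪a, x⟫_ℝ) = g := equatorExt_inner ha
    let b := EuclideanSpace.basisFun (Fin (n + 1)) ℝ
    rw [sphLaplacian, hext,
      InnerProductSpace.laplacian_eq_iteratedFDeriv_orthonormalBasis g b]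
    simp only [iteratedFDeriv_two_apply, Matrix.cons_val_zero, Matrix.cons_val_one, hsecond]
    have hpe : ∀ e : Amb n, ⟪p e, e⟫_ℝ = ⟪e, e⟫_ℝ - ⟪H.normal, e⟫_ℝ * ⟪H.normal, e⟫_ℝ := fun e => by
      rw [hp, starProjection_apply_eq, inner_sub_left, inner_smul_left]
      simp
    simp only [hpe]
    rw [Finset.sum_sub_distrib, Finset.sum_sub_distrib, ← Finset.mul_sum, ← Finset.mul_sum,
      ← Finset.mul_sum, Finset.sum_sub_distrib, sum_inner_mul_inner b, sum_inner_mul_inner b,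
      sum_inner_mul_inner b, real_inner_self_eq_norm_sq, real_inner_self_eq_norm_sq, hω.2,
      H.norm_normal]
    have h7 : ∑ i, ⟪b i, b i⟫_ℝ = (n : ℝ) + 1 := by
      simp [b.orthonormal.1]
    rw [h7]
    ring
  rw [hlap]
  ring

theorem integral_mul_eq_zero_of_jacobiProjEqZero [IsFiniteMeasure (sphMeasure H)]
    {v φ : Amb n → ℝ} (hv : JacobiProjEqZero H v) (hφ : IsJacobiField H φ)
    (hφ2 : MemLp φ 2 (sphMeasure H)) : ∫ x, v x * φ x ∂(sphMeasure H) = 0 := by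
  obtain ⟨hv2, h0⟩ := hv
  rw [jacobiProj, Submodule.starProjection_apply_eq_zero_iff] at h0
  have h1 : hφ2.toLp φ ∈ jacobiSpace H :=
    Submodule.le_topologicalClosure _ (Submodule.subset_span ⟨φ, hφ, hφ2.coeFn_toLp⟩)
  have h2 := h0 _ h1
  rw [L2.inner_def] at h2
  rw [← h2]
  refine integral_congr_ae ?_
  filter_upwards [hv2.coeFn_toLp, hφ2.coeFn_toLp] with x h3 h4
  rw [h3, h4]
  simp

/-- Only one inclusion is needed: coordinates are Jacobi fields, hence v is orthogonal to them. That
there are no other Jacobi fields plays no role. -/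
theorem sphInt_mul_coord_eq_zero {c : NNReal} (hc0 : 0 < c) (hc : sphMeasure H =
      c • Measure.map (fun ω : sphere (0 : Eu n) 1 => ι ω) (volume : Measure (Eu n)).toSphere)
    (hι : ∀ x, x ∈ H.toSubmodule ↔ ∃ y, ι y = x) {v : Amb n → ℝ} (hv : JacobiProjEqZero H v)
    (i : Fin n) : sphInt (fun x => v (ι x) * x i) = 0 := by
  have hfin : IsFiniteMeasure (sphMeasure H) := by
    rw [hc]
    infer_instance
  set a := ι (EuclideanSpace.single i 1)
  have ha : a ∈ H.toSubmodule := (hι a).2 ⟨_, rfl⟩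
  have hms : MeasurableSet (equator H) := by
    rw [equator_eq hι]
    exact (measurableEmbedding_sphere ι).measurableSet_range
  have h2 : MemLp (fun x => ⟪a, x⟫_ℝ) 2 (sphMeasure H) := by
    refine MemLp.of_bound (C := ‖a‖) (by fun_prop) ?_
    rw [sphMeasure, ae_restrict_iff' hms]
    refine Eventually.of_forall fun x hx => ?_
    have := norm_inner_le_norm (𝕜 := ℝ) a x
    rwa [hx.2, mul_one] at this
  have h3 := integral_mul_eq_zero_of_jacobiProjEqZero hv (isJacobiField_inner ha) h2
  rw [integral_sphMeasure hc] at h3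
  have h4 : (c : ℝ) ≠ 0 := by exact_mod_cast hc0.ne'
  have h5 := (mul_eq_zero.1 h3).resolve_left h4
  rw [← h5]
  congr 1
  funext x
  simp only [a, ι.inner_map_map, EuclideanSpace.inner_single_left]
  simp

end Jacobi

/-! ### Transfer from the equatorial sphere to the model annulus -/

section Transfer

open Filter Topology Metric

variable {n : ℕ} {H : OrientedHyperplane n} {ι : Eu n →ₗᵢ[ℝ] Amb n} {σ r₁ r₂ a b : ℝ}
  {u : Amb n → ℝ → ℝ}

/-- The function `u` in polar coordinates on the model hyperplane. -/
noncomputable def polar (ι : Eu n →ₗᵢ[ℝ] Amb n) (u : Amb n → ℝ → ℝ) (y : Eu n) : ℝ :=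
  u (ι (‖y‖⁻¹ • y)) ‖y‖

theorem polar_smul (u : Amb n → ℝ → ℝ) {r : ℝ} (hr : 0 < r) {ω : Eu n}
    (hω : ω ∈ sphere (0 : Eu n) 1) : polar ι u (r • ω) = u (ι ω) r := by
  rw [polar, norm_smul_sphere hr.le hω, smul_smul, inv_mul_cancel₀ hr.ne', one_smul]

theorem inv_norm_smul_mem_sphere {y : Eu n} (hy : y ≠ 0) : ‖y‖⁻¹ • y ∈ sphere (0 : Eu n) 1 := by
  rw [mem_sphere_zero_iff_norm, norm_smul, norm_inv, norm_norm,
    inv_mul_cancel₀ (norm_ne_zero_iff.2 hy)]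

theorem apply_mem_equator (hι : ∀ x, x ∈ H.toSubmodule ↔ ∃ y, ι y = x) {ω : Eu n}
    (hω : ω ∈ sphere (0 : Eu n) 1) : ι ω ∈ equator H := by
  rw [equator_eq hι]
  exact ⟨⟨ω, hω⟩, rfl⟩

theorem isCompact_equator (H : OrientedHyperplane n) : IsCompact (equator H) := by
  obtain ⟨ι, hι⟩ := exists_linearIsometry H
  rw [equator_eq hι]
  exact isCompact_range (isometry_sphere ι).continuous

theorem toEquator_mem {x : Amb n} (hx : H.toSubmodule.starProjection x ≠ 0) :
    toEquator H x ∈ equator H := by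
  refine ⟨Submodule.smul_mem _ _ (Submodule.starProjection_apply_mem _ _), ?_⟩
  rw [toEquator, norm_smul, norm_inv, norm_norm, inv_mul_cancel₀ (norm_ne_zero_iff.2 hx)]

theorem isOpen_starProjection_ne (H : OrientedHyperplane n) :
    IsOpen {x : Amb n | H.toSubmodule.starProjection x ≠ 0} :=
  isOpen_ne_fun (H.toSubmodule.starProjection).continuous continuous_const

theorem contDiffOn_toEquator (H : OrientedHyperplane n) :
    ContDiffOn ℝ 1 (toEquator H) {x | H.toSubmodule.starProjection x ≠ 0} := fun _ hx =>
  (((H.toSubmodule.starProjection.contDiff.contDiffAt.norm ℝ hx).inv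
    (norm_ne_zero_iff.2 hx)).smul H.toSubmodule.starProjection.contDiff.contDiffAt).contDiffWithinAt

theorem starProjection_apply_of_mem (hι : ∀ x, x ∈ H.toSubmodule ↔ ∃ y, ι y = x) (y : Eu n) :
    H.toSubmodule.starProjection (ι y) = ι y :=
  Submodule.starProjection_eq_self_iff.2 ((hι _).2 ⟨y, rfl⟩)

theorem toEquator_apply (hι : ∀ x, x ∈ H.toSubmodule ↔ ∃ y, ι y = x) (y : Eu n) :
    toEquator H (ι y) = ι (‖y‖⁻¹ • y) := by
  rw [toEquator, starProjection_apply_of_mem hι, ι.norm_map, map_smul]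

theorem starProjection_ne_of_mem_equator {x : Amb n} (hx : x ∈ equator H) :
    H.toSubmodule.starProjection x ≠ 0 := by
  rw [Submodule.starProjection_eq_self_iff.2 hx.1, ← norm_ne_zero_iff, hx.2]
  exact one_ne_zero

/-- A real supremum dominates the values only if the range is bounded; this comes from the
compactness of the equator and the continuity of the tangential gradient. -/
theorem le_normC1 {v : Amb n → ℝ} (hv : ContDiffOn ℝ 1 v (equator H)) {ω : Amb n}
    (hω : ω ∈ equator H) : |v ω| ≤ normC1 H v ∧ ‖sphGrad H v ω‖ ≤ normC1 H v := by
  have hext : ContDiffOn ℝ 1 (equatorExt H v) {x | H.toSubmodule.starProjection x ≠ 0} :=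
    hv.comp (contDiffOn_toEquator H) fun x hx => toEquator_mem hx
  have hg : ContinuousOn (fun x => ‖sphGrad H v x‖) (equator H) := by
    have h1 := (hext.continuousOn_fderiv_of_isOpen (isOpen_starProjection_ne H) le_rfl).mono
      fun x hx => starProjection_ne_of_mem_equator hx
    exact ((InnerProductSpace.toDual ℝ (Amb n)).symm.continuous.comp_continuousOn h1).norm
  have b1 : BddAbove (range fun ω : equator H => |v ω|) := by
    have := (isCompact_equator H).bddAbove_image hv.continuousOn.abs
    rwa [image_eq_range] at this
  have b2 : BddAbove (range fun ω : equator H => ‖sphGrad H v ω‖) := by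
    have := (isCompact_equator H).bddAbove_image hg
    rwa [image_eq_range] at this
  have h1 := le_ciSup b1 ⟨ω, hω⟩
  have h2 := le_ciSup b2 ⟨ω, hω⟩
  have h3 : 0 ≤ ⨆ ω : equator H, |v ω| := Real.iSup_nonneg fun _ => abs_nonneg _
  have h4 : 0 ≤ ⨆ ω : equator H, ‖sphGrad H v ω‖ := Real.iSup_nonneg fun _ => norm_nonneg _
  rw [normC1]
  constructor
  · exact h1.trans (by linarith)
  · exact h2.trans (by linarith)

/-- The extension is homogeneous of degree zero, so its derivative is homogeneous of degree -1. -/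
theorem fderiv_equatorExt (v : Amb n → ℝ) {t : ℝ} (ht : 0 < t) (x : Amb n) :
    fderiv ℝ (equatorExt H v) x = t • fderiv ℝ (equatorExt H v) (t • x) := by
  have h : (fun x => equatorExt H v (t • x)) = equatorExt H v := by
    funext x
    rw [equatorExt, equatorExt, toEquator, toEquator, map_smul, norm_smul, smul_smul,
      Real.norm_of_nonneg ht.le, mul_inv, mul_right_comm, inv_mul_cancel₀ ht.ne', one_mul]
  conv_lhs => rw [← h]
  exact fderiv_comp_smul t

namespace SmallC1Annulus

theorem contDiffOn_polar (hu : SmallC1Annulus H σ r₁ r₂ u) (h0 : 0 ≤ r₁)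
    (hι : ∀ x, x ∈ H.toSubmodule ↔ ∃ y, ι y = x) :
    ContDiffOn ℝ 1 (polar ι u) (eann n r₁ r₂) := by
  have h1 : ContDiffOn ℝ 1 (fun y : Eu n => (ι (‖y‖⁻¹ • y), ‖y‖)) (eann n r₁ r₂) := by
    intro y hy
    have hy0 := ne_zero_of_mem_eann h0 hy
    have h2 := contDiffAt_norm ℝ hy0 (n := 1)
    exact ((ι.contDiff.contDiffAt.comp y ((h2.inv (norm_ne_zero_iff.2 hy0)).smul
      contDiffAt_id)).prodMk h2).contDiffWithinAt
  exact hu.1.comp h1 fun y hy =>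
    ⟨apply_mem_equator hι (inv_norm_smul_mem_sphere (ne_zero_of_mem_eann h0 hy)), hy⟩

theorem abs_polar_le (hu : SmallC1Annulus H σ r₁ r₂ u) (h0 : 0 ≤ r₁)
    (hι : ∀ x, x ∈ H.toSubmodule ↔ ∃ y, ι y = x) {y : Eu n} (hy : y ∈ eann n r₁ r₂) :
    |polar ι u y| ≤ σ := by
  have h1 := hu.2.1 ‖y‖ hy
  exact (le_normC1 h1.1 (apply_mem_equator hι
    (inv_norm_smul_mem_sphere (ne_zero_of_mem_eann h0 hy)))).1.trans h1.2.le

theorem fderiv_polar_self (hu : SmallC1Annulus H σ r₁ r₂ u) (h0 : 0 ≤ r₁)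
    (hι : ∀ x, x ∈ H.toSubmodule ↔ ∃ y, ι y = x) {ω : Eu n} (hω : ω ∈ sphere (0 : Eu n) 1)
    {r : ℝ} (hr : r ∈ Ioo r₁ r₂) :
    radial (polar ι u) (r • ω) = r * radialDeriv u (ι ω) r := by
  have hr0 : 0 < r := h0.trans_lt hr.1
  have h1 := hasDerivAt_comp_smul h0 (hu.contDiffOn_polar h0 hι) hr hω
  have h2 : (fun s : ℝ => polar ι u (s • ω)) =ᶠ[𝓝 r] fun s => u (ι ω) s := by
    filter_upwards [isOpen_Ioi.mem_nhds hr0] with s hs using polar_smul u hs hω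
  rw [radialDeriv, ← h2.deriv_eq, h1.deriv, mul_inv_cancel_left₀ hr0.ne', radial]

/-- The derivative splits into a tangential part, bounded by the C¹ norm of the slice, and a radial
part, bounded by the condition on r ∂_r u. Each contributes σ / |y|. -/
theorem norm_fderiv_polar_le (hu : SmallC1Annulus H σ r₁ r₂ u) (h0 : 0 ≤ r₁)
    (hι : ∀ x, x ∈ H.toSubmodule ↔ ∃ y, ι y = x) {y : Eu n} (hy : y ∈ eann n r₁ r₂) :
    ‖y‖ * ‖fderiv ℝ (polar ι u) y‖ ≤ 2 * σ := by
  have hy0 := ne_zero_of_mem_eann h0 hy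
  have hn : 0 < ‖y‖ := norm_pos_iff.2 hy0
  have hω := inv_norm_smul_mem_sphere hy0
  set ω := ι (‖y‖⁻¹ • y) with hωdef
  have hωE : ω ∈ equator H := apply_mem_equator hι hω
  -- The set Σ × (r₁, r₂) has empty interior in the ambient product. The extension along the fibres
  -- of `toEquator` is C¹ on an open set, so full derivatives and the chain rule become available.
  set F : Amb n × ℝ → ℝ := fun p => u (toEquator H p.1) p.2
  set O : Set (Amb n × ℝ) := {x | H.toSubmodule.starProjection x ≠ 0} ×ˢ Ioo r₁ r₂
  have hO : IsOpen O := (isOpen_starProjection_ne H).prod isOpen_Ioo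
  have hyO : (ι y, ‖y‖) ∈ O := by
    refine ⟨?_, hy⟩
    show H.toSubmodule.starProjection (ι y) ≠ 0
    rw [starProjection_apply_of_mem hι, ← norm_ne_zero_iff, ι.norm_map]
    exact hn.ne'
  have hF : ContDiffOn ℝ 1 F O :=
    hu.1.comp (((contDiffOn_toEquator H).comp contDiffOn_fst fun p hp => hp.1).prodMk
      contDiffOn_snd) fun p hp => ⟨toEquator_mem hp.1, hp.2⟩
  have hFd : HasFDerivAt F (fderiv ℝ F (ι y, ‖y‖)) (ι y, ‖y‖) :=
    ((hF.differentiableOn one_ne_zero).differentiableAt (hO.mem_nhds hyO)).hasFDerivAt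
  set F' := fderiv ℝ F (ι y, ‖y‖)
  have hpolar : polar ι u = fun y => F (ι y, ‖y‖) := by
    funext y
    simp only [F, toEquator_apply hι, polar]
  have h1 : HasFDerivAt (fun y : Eu n => (ι y, ‖y‖))
      (ι.toContinuousLinearMap.prod (‖y‖⁻¹ • innerSL ℝ y)) y :=
    ι.toContinuousLinearMap.hasFDerivAt.prodMk (hasFDerivAt_norm hy0)
  have h2 : HasFDerivAt (polar ι u)
      (F'.comp (ι.toContinuousLinearMap.prod (‖y‖⁻¹ • innerSL ℝ y))) y := by
    rw [hpolar]
    exact hFd.comp y h1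
  have h3 : fderiv ℝ (equatorExt H fun x => u x ‖y‖) (ι y) =
      F'.comp (ContinuousLinearMap.inl ℝ (Amb n) ℝ) := by
    have h5 : HasFDerivAt (F ∘ fun x => (x, ‖y‖))
        (F'.comp (ContinuousLinearMap.inl ℝ (Amb n) ℝ)) (ι y) :=
      hFd.comp (ι y) (hasFDerivAt_prodMk_left (ι y) ‖y‖)
    exact h5.fderiv
  have h4 : radialDeriv u ω ‖y‖ = F' (0, 1) := by
    have h5 := (hFd.comp ‖y‖ (hasFDerivAt_prodMk_right (ι y) ‖y‖)).hasDerivAt.deriv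
    have h6 : (fun s => u ω s) = F ∘ fun s => (ι y, s) := by
      funext s
      simp only [F, Function.comp_apply, toEquator_apply hι, hωdef]
    rw [radialDeriv, h6, h5]
    simp
  have h7 : ‖fderiv ℝ (equatorExt H fun x => u x ‖y‖) (ι y)‖ ≤ ‖y‖⁻¹ * σ := by
    rw [fderiv_equatorExt _ (inv_pos.2 hn), norm_smul, norm_inv, norm_norm, ← map_smul, ← hωdef]
    have h8 := hu.2.1 ‖y‖ hy
    have h9 : ‖fderiv ℝ (equatorExt H fun x => u x ‖y‖) ω‖ =
        ‖sphGrad H (fun x => u x ‖y‖) ω‖ := by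
      rw [sphGrad, gradient, LinearIsometryEquiv.norm_map]
    rw [h9]
    gcongr
    exact (le_normC1 h8.1 hωE).2.trans h8.2.le
  have h10 : ‖y‖ * |F' (0, 1)| ≤ σ := by
    have := hu.2.2 ω hωE ‖y‖ hy
    rwa [h4, abs_mul, abs_norm] at this
  have hσ : 0 ≤ σ := (mul_nonneg hn.le (abs_nonneg _)).trans h10
  rw [h2.fderiv, ← le_div_iff₀' hn]
  refine ContinuousLinearMap.opNorm_le_bound _ (by positivity) fun v => ?_
  have h11 : (F'.comp (ι.toContinuousLinearMap.prod (‖y‖⁻¹ • innerSL ℝ y))) v =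
      F'.comp (ContinuousLinearMap.inl ℝ (Amb n) ℝ) (ι v) + (‖y‖⁻¹ * ⟪y, v⟫_ℝ) * F' (0, 1) := by
    have h12 : (ι v, ‖y‖⁻¹ * ⟪y, v⟫_ℝ) =
        (ι v, (0 : ℝ)) + (‖y‖⁻¹ * ⟪y, v⟫_ℝ) • ((0 : Amb n), (1 : ℝ)) := by simp
    show F' (ι v, ‖y‖⁻¹ * ⟪y, v⟫_ℝ) = F' (ι v, 0) + _
    rw [h12, map_add, map_smul, smul_eq_mul]
  rw [h11, ← h3]
  refine (norm_add_le _ _).trans ?_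
  have h13 : ‖fderiv ℝ (equatorExt H fun x => u x ‖y‖) (ι y) (ι v)‖ ≤ ‖y‖⁻¹ * σ * ‖v‖ := by
    refine (ContinuousLinearMap.le_opNorm _ _).trans ?_
    rw [ι.norm_map]
    gcongr
  have h14 : ‖‖y‖⁻¹ * ⟪y, v⟫_ℝ * F' (0, 1)‖ ≤ ‖y‖⁻¹ * σ * ‖v‖ := by
    rw [norm_mul, norm_mul, norm_inv, norm_norm, Real.norm_eq_abs, Real.norm_eq_abs]
    calc ‖y‖⁻¹ * |⟪y, v⟫_ℝ| * |F' (0, 1)| ≤ ‖y‖⁻¹ * (‖y‖ * ‖v‖) * |F' (0, 1)| := by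
          gcongr
          exact abs_real_inner_le_norm y v
      _ = ‖y‖⁻¹ * (‖y‖ * |F' (0, 1)|) * ‖v‖ := by ring
      _ ≤ _ := by gcongr
  calc _ ≤ ‖y‖⁻¹ * σ * ‖v‖ + ‖y‖⁻¹ * σ * ‖v‖ := add_le_add h13 h14
    _ = 2 * σ / ‖y‖ * ‖v‖ := by ring

end SmallC1Annulus

/-- The sine of the angle over the hyperplane, in terms of the slope. -/
noncomputable def slopeToSine (U : Eu n → ℝ) (y : Eu n) : ℝ := U y / Real.sqrt (1 + U y ^ 2)

theorem hasFDerivAt_slopeToSine {U : Eu n → ℝ} {y : Eu n} (hU : DifferentiableAt ℝ U y) :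
    HasFDerivAt (slopeToSine U) (((Real.sqrt (1 + U y ^ 2))⁻¹ ^ 3) • fderiv ℝ U y) y := by
  have h0 : 0 < 1 + U y ^ 2 := by positivity
  have hs := Real.sqrt_pos.2 h0
  have h1 : HasDerivAt (fun t : ℝ => t / Real.sqrt (1 + t ^ 2)) _ (U y) :=
    (hasDerivAt_id (U y)).div ((((hasDerivAt_id (U y)).pow 2).const_add 1).sqrt h0.ne') hs.ne'
  refine (h1.comp_hasFDerivAt y hU.hasFDerivAt).congr_fderiv ?_
  congr 1
  simp only [id]
  have hsq := Real.sq_sqrt h0.le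
  simp only [Pi.pow_apply, id]
  field_simp
  rw [hsq]
  ring

theorem one_le_sqrt_one_add_sq (t : ℝ) : 1 ≤ Real.sqrt (1 + t ^ 2) :=
  Real.one_le_sqrt.2 (by nlinarith [sq_nonneg t])

theorem abs_slopeToSine_le (U : Eu n → ℝ) (y : Eu n) : |slopeToSine U y| ≤ |U y| := by
  have h := one_le_sqrt_one_add_sq (U y)
  rw [slopeToSine, abs_div, abs_of_pos (by linarith : 0 < Real.sqrt (1 + U y ^ 2))]
  exact div_le_self (abs_nonneg _) h

theorem sqrt_one_sub_slopeToSine_sq (U : Eu n → ℝ) (y : Eu n) :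
    Real.sqrt (1 - slopeToSine U y ^ 2) = (Real.sqrt (1 + U y ^ 2))⁻¹ := by
  have h0 : 0 < 1 + U y ^ 2 := by positivity
  rw [slopeToSine, div_pow, Real.sq_sqrt h0.le, ← Real.sqrt_inv]
  congr 1
  field_simp
  ring

/-- With s = √(1 + U²) one has U - V = (s - 1) V and s - 1 ≤ U², so passing from slope to sine
changes the function only at third order. -/
theorem abs_sub_slopeToSine_le (U : Eu n → ℝ) (y : Eu n) :
    |U y - slopeToSine U y| ≤ U y ^ 2 * |slopeToSine U y| := by
  have h0 : 0 < 1 + U y ^ 2 := by positivity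
  have hs := one_le_sqrt_one_add_sq (U y)
  have hsq := Real.sq_sqrt h0.le
  set s := Real.sqrt (1 + U y ^ 2)
  have h1 : U y - slopeToSine U y = (s - 1) * slopeToSine U y := by
    have hV : slopeToSine U y = U y / s := rfl
    have : s ≠ 0 := by linarith
    rw [hV]
    field_simp
  rw [h1, abs_mul, abs_of_nonneg (by linarith : 0 ≤ s - 1)]
  gcongr
  nlinarith

theorem contDiffOn_slopeToSine {U : Eu n → ℝ} {s : Set (Eu n)} (hU : ContDiffOn ℝ 1 U s) :
    ContDiffOn ℝ 1 (slopeToSine U) s := by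
  refine hU.div ((contDiffOn_const.add (hU.pow 2)).sqrt fun y _ => ?_) fun y _ => ?_
  · positivity
  · exact (Real.sqrt_pos.2 (by positivity)).ne'

theorem norm_fderiv_slopeToSine_le {U : Eu n → ℝ} {y : Eu n} (hU : DifferentiableAt ℝ U y) :
    ‖fderiv ℝ (slopeToSine U) y‖ ≤ ‖fderiv ℝ U y‖ ∧
      |radial (slopeToSine U) y| ≤ |radial U y| := by
  have h := one_le_sqrt_one_add_sq (U y)
  have h1 : (Real.sqrt (1 + U y ^ 2))⁻¹ ^ 3 ≤ 1 :=
    pow_le_one₀ (by positivity) (inv_le_one_of_one_le₀ h)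
  have h2 : 0 ≤ (Real.sqrt (1 + U y ^ 2))⁻¹ ^ 3 := by positivity
  rw [radial, radial, (hasFDerivAt_slopeToSine hU).fderiv, norm_smul, Real.norm_of_nonneg h2,
    _root_.smul_apply, smul_eq_mul, abs_mul, abs_of_nonneg h2]
  exact ⟨mul_le_of_le_one_left (norm_nonneg _) h1, mul_le_of_le_one_left (abs_nonneg _) h1⟩

theorem SmallC1Annulus.smallOn (hu : SmallC1Annulus H σ r₁ r₂ u) (h0 : 0 < r₁)
    (hσ0 : 0 ≤ σ) (hσ : σ ≤ 1 / 8) (hι : ∀ x, x ∈ H.toSubmodule ↔ ∃ y, ι y = x) :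
    SmallOn (slopeToSine (polar ι u)) σ r₁ r₂ where
  pos := h0
  nonneg := hσ0
  le := hσ
  contDiffOn := contDiffOn_slopeToSine (hu.contDiffOn_polar h0.le hι)
  abs_le y hy := (abs_slopeToSine_le _ y).trans (hu.abs_polar_le h0.le hι hy)
  fderiv_le y hy := by
    refine le_trans ?_ (hu.norm_fderiv_polar_le h0.le hι hy)
    gcongr
    exact (norm_fderiv_slopeToSine_le (((hu.contDiffOn_polar h0.le hι).differentiableOn
      one_ne_zero).differentiableAt ((isOpen_eann _ _).mem_nhds hy))).1

theorem graph_eq_image (hι : ∀ x, x ∈ H.toSubmodule ↔ ∃ y, ι y = x) (u : Amb n → ℝ → ℝ)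
    (ha : 0 ≤ a) : graph H u a b =
      graphMap ι H.normal (slopeToSine (polar ι u)) '' eann n a b := by
  have key : ∀ y : Eu n, y ∈ eann n a b → graphMap ι H.normal (slopeToSine (polar ι u)) y =
      (‖y‖ / Real.sqrt (1 + u (ι (‖y‖⁻¹ • y)) ‖y‖ ^ 2)) •
        (ι (‖y‖⁻¹ • y) + u (ι (‖y‖⁻¹ • y)) ‖y‖ • H.normal) := by
    intro y hy
    have hn : ‖y‖ ≠ 0 := norm_ne_zero_iff.2 (ne_zero_of_mem_eann ha hy)
    rw [graphMap, sqrt_one_sub_slopeToSine_sq, height, slopeToSine, polar]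
    have hs : Real.sqrt (1 + u (ι (‖y‖⁻¹ • y)) ‖y‖ ^ 2) ≠ 0 := by
      have := one_le_sqrt_one_add_sq (u (ι (‖y‖⁻¹ • y)) ‖y‖)
      linarith
    generalize Real.sqrt (1 + u (ι (‖y‖⁻¹ • y)) ‖y‖ ^ 2) = s at *
    generalize u (ι (‖y‖⁻¹ • y)) ‖y‖ = t
    rw [map_smul]
    match_scalars <;> field_simp
  ext x
  constructor
  · rintro ⟨ω, hω, r, hr, rfl⟩
    rw [equator_eq hι] at hω
    obtain ⟨w, rfl⟩ := hω
    have hr0 : 0 < r := ha.trans_lt hr.1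
    refine ⟨r • (w : Eu n), smul_mem_eann ha hr w.2, ?_⟩
    rw [key _ (smul_mem_eann ha hr w.2), norm_smul_sphere hr0.le w.2, smul_smul,
      inv_mul_cancel₀ hr0.ne', one_smul]
  · rintro ⟨y, hy, rfl⟩
    exact ⟨ι (‖y‖⁻¹ • y), apply_mem_equator hι
      (inv_norm_smul_mem_sphere (ne_zero_of_mem_eann ha hy)), ‖y‖, hy, key y hy⟩

/-- The product measure is c times the polar form of Lebesgue measure on the annulus, once the
weight r^(n-1) is included. -/
theorem annulusIntegral_eq [Nontrivial (Eu n)] {c : NNReal} (hc : sphMeasure H =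
      c • Measure.map (fun ω : sphere (0 : Eu n) 1 => ι ω) (volume : Measure (Eu n)).toSphere)
    (ha : 0 ≤ a) {g : Eu n → ℝ} (hg : BddContOn g (eann n a b)) {f : Amb n → ℝ → ℝ}
    (hf : ∀ ω ∈ sphere (0 : Eu n) 1, ∀ r ∈ Ioo a b, f (ι ω) r = g (r • ω)) :
    annulusIntegral H a b (fun ω r => r ^ (n - 1) * f ω r) = c * ∫ y in eann n a b, g y := by
  have hme : MeasurableEmbedding
      (Prod.map (fun ω : sphere (0 : Eu n) 1 => ι ω) (id : ℝ → ℝ)) :=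
    (measurableEmbedding_sphere ι).prodMap MeasurableEmbedding.id
  have hm : (sphMeasure H).prod (volume.restrict (Ioo a b)) =
      c • Measure.map (Prod.map (fun ω : sphere (0 : Eu n) 1 => ι ω) (id : ℝ → ℝ))
        ((volume : Measure (Eu n)).toSphere.prod (volume.restrict (Ioo a b))) := by
    rw [hc, Measure.prod_smul_left, ← Measure.map_prod_map _ _
      (measurableEmbedding_sphere ι).measurable measurable_id, Measure.map_id]
  set G : sphere (0 : Eu n) 1 × ℝ → ℝ := fun p => p.2 ^ (n - 1) * g (p.2 • (p.1 : Eu n))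
  have hr : (volume : Measure (Eu n)).toSphere.prod (volume.restrict (Ioo a b)) =
      ((volume : Measure (Eu n)).toSphere.prod volume).restrict (univ ×ˢ Ioo a b) := by
    rw [← Measure.prod_restrict, Measure.restrict_univ]
  have hms : MeasurableSet (univ ×ˢ Ioo a b : Set (sphere (0 : Eu n) 1 × ℝ)) :=
    MeasurableSet.univ.prod measurableSet_Ioo
  have hGb : BddContOn G (univ ×ˢ Ioo a b) := by
    refine BddContOn.mul ?_ ⟨?_, hg.2.imp fun C hC p hp => hC _ (smul_mem_eann ha hp.2 p.1.2)⟩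
    · exact ⟨by fun_prop, (BddContOn.of_continuous_Ioo (a := a) (b := b)
        (continuous_pow (n - 1))).2.imp fun C hC p hp => hC _ hp.2⟩
    · exact hg.1.comp (f := fun p : sphere (0 : Eu n) 1 × ℝ => p.2 • (p.1 : Eu n)) (by fun_prop)
        fun p hp => smul_mem_eann ha hp.2 p.1.2
  have hGi : Integrable G
      ((volume : Measure (Eu n)).toSphere.prod (volume.restrict (Ioo a b))) := by
    have hfin : IsFiniteMeasure (volume.restrict (Ioo a b)) := ⟨by simp⟩
    obtain ⟨hGc, C, hC⟩ := hGb
    refine Integrable.of_bound (C := C) ?_ ?_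
    · rw [hr]
      exact hGc.aestronglyMeasurable hms
    · rw [hr, ae_restrict_iff' hms]
      exact Eventually.of_forall hC
  rw [annulusIntegral, hm, integral_smul_nnreal_measure, hme.integral_map, NNReal.smul_def,
    smul_eq_mul]
  congr 1
  rw [integral_eann_eq_wint ha hg, wint]
  have h1 : ∫ p, (Prod.map (fun ω : sphere (0 : Eu n) 1 => ι ω) (id : ℝ → ℝ) p).2 ^ (n - 1) *
      f (Prod.map (fun ω : sphere (0 : Eu n) 1 => ι ω) (id : ℝ → ℝ) p).1
        (Prod.map (fun ω : sphere (0 : Eu n) 1 => ι ω) (id : ℝ → ℝ) p).2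
        ∂((volume : Measure (Eu n)).toSphere.prod (volume.restrict (Ioo a b))) =
      ∫ p, G p ∂((volume : Measure (Eu n)).toSphere.prod (volume.restrict (Ioo a b))) := by
    refine integral_congr_ae ?_
    rw [hr]
    refine (ae_restrict_iff' hms).2 (Eventually.of_forall fun p hp => ?_)
    simp only [Prod.map_fst, Prod.map_snd, id, G]
    rw [hf p.1 p.1.2 p.2 hp.2]
  rw [h1, integral_prod_symm _ hGi]
  refine integral_congr_ae (Eventually.of_forall fun r => ?_)
  exact integral_const_mul (r ^ (n - 1)) fun ω : sphere (0 : Eu n) 1 => g (r • (ω : Eu n))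

theorem volume_eann_eq [Nontrivial (Eu n)] (hn : 1 ≤ n) (ha : 0 ≤ a) (hab : a ≤ b) :
    (volume (eann n a b)).toReal = sphArea n / n * (b ^ n - a ^ n) := by
  have h1 : (volume (eann n a b)).toReal = ∫ y in eann n a b, (1 : ℝ) := by simp [Measure.real]
  rw [h1, integral_eann_eq_wint ha (BddContOn.const 1), wint]
  have h2 : ∀ r, slice (fun _ : Eu n => (1 : ℝ)) r = sphArea n := fun r => by
    rw [slice, sphInt_const, one_mul]
  simp only [h2]
  rw [integral_mul_const, ← integral_Ioc_eq_integral_Ioo, ← intervalIntegral.integral_of_le hab,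
    integral_pow]
  obtain ⟨k, rfl⟩ : ∃ k, n = k + 1 := ⟨n - 1, by omega⟩
  simp only [Nat.add_sub_cancel]
  push_cast
  ring

end Transfer

/-! ### The two estimates for spherical graphs -/

section Estimates

open Filter Topology Metric

variable {n : ℕ} {H : OrientedHyperplane n} {ι : Eu n →ₗᵢ[ℝ] Amb n} {σ Λ c r₁ r₂ r₃ r₄ : ℝ}
  {ζ : ℝ → ℝ} {u : Amb n → ℝ → ℝ}

theorem inner_apply_normal (hι : ∀ x, x ∈ H.toSubmodule ↔ ∃ y, ι y = x) (y : Eu n) :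
    ⟪ι y, H.normal⟫_ℝ = 0 :=
  mem_toSubmodule_iff.1 ((hι _).2 ⟨y, rfl⟩)

/-- The area comparison applied to V = 0, whose energy vanishes. -/
theorem area_graph_zero (hι : ∀ x, x ∈ H.toSubmodule ↔ ∃ y, ι y = x) (h0 : 0 < r₁) :
    area (graph H (fun _ _ => 0) r₁ r₂) = (volume (eann n r₁ r₂)).toReal := by
  have hV : slopeToSine (polar ι fun _ _ => 0) = fun _ => 0 := by
    funext y
    simp [slopeToSine, polar]
  have hs : SmallOn (fun _ : Eu n => (0 : ℝ)) 0 r₁ r₂ :=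
    ⟨h0, le_rfl, by norm_num, contDiffOn_const, by simp, by simp⟩
  have h := hs.abs_area_sub_le H.norm_normal (inner_apply_normal hι)
  simp only [energyDensity, fderiv_fun_const, Pi.zero_apply, norm_zero] at h
  rw [graph_eq_image hι _ h0.le, hV, ← sub_eq_zero, ← abs_nonpos_iff]
  simpa using h

namespace SmallC1Annulus

theorem bddContOn_polar (hu : SmallC1Annulus H σ r₁ r₂ u) (h0 : 0 ≤ r₁)
    (hι : ∀ x, x ∈ H.toSubmodule ↔ ∃ y, ι y = x) : BddContOn (polar ι u) (eann n r₁ r₂) :=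
  ⟨(hu.contDiffOn_polar h0 hι).continuousOn, σ, fun _ hy => hu.abs_polar_le h0 hι hy⟩

theorem bddContOn_radial_polar (hu : SmallC1Annulus H σ r₁ r₂ u) (h0 : 0 ≤ r₁)
    (hι : ∀ x, x ∈ H.toSubmodule ↔ ∃ y, ι y = x) :
    BddContOn (radial (polar ι u)) (eann n r₁ r₂) := by
  refine ⟨continuousOn_radial (hu.contDiffOn_polar h0 hι), 2 * σ, fun y hy => ?_⟩
  refine le_trans ?_ (hu.norm_fderiv_polar_le h0 hι hy)
  rw [mul_comm]
  exact (fderiv ℝ (polar ι u) y).le_opNorm y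

theorem bddContOn_sq_add (hu : SmallC1Annulus H σ r₁ r₂ u) (h0 : 0 ≤ r₁)
    (hι : ∀ x, x ∈ H.toSubmodule ↔ ∃ y, ι y = x) (Λ : ℝ) :
    BddContOn (fun y => polar ι u y ^ 2 + Λ * ‖y‖ * |polar ι u y|) (eann n r₁ r₂) := by
  have hU := hu.bddContOn_polar h0 hι
  have hN : BddContOn (fun y : Eu n => ‖y‖) (eann n r₁ r₂) :=
    (BddContOn.of_continuous_Ioo continuous_id).comp_norm
  exact hU.sq.add ((hN.const_mul Λ).mul hU.abs)

/-- The area comparison on the inner annulus followed by the Caccioppoli inequality; passing from V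
back to u uses |V| ≤ |u|. -/
theorem abs_area_graph_sub_le (hu : SmallC1Annulus H σ r₁ r₂ u) (h0 : 0 < r₁) (hσ0 : 0 ≤ σ)
    (hσ1 : σ ≤ 1 / 8) (hι : ∀ x, x ∈ H.toSubmodule ↔ ∃ y, ι y = x) (hΛ : 0 ≤ Λ)
    (hM : HasMeanCurvatureBoundedBy (graph H u r₁ r₂) (annulus n r₁ r₂) Λ) (hc : 0 ≤ c)
    (hζ : IsCutoff ζ c r₁ r₂ r₃ r₄) (h13 : r₁ ≤ r₃) (h42 : r₄ ≤ r₂)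
    (hσ : (100 * 2 ^ n + 50) * σ ^ 2 ≤ 1 / 8) :
    |area (graph H u r₃ r₄) - area (graph H (fun _ _ => 0) r₃ r₄)| ≤
      10 * 2 ^ n * (20 * c ^ 2 + 4 * (1 + 2 ^ n)) *
        ∫ y in eann n r₁ r₂, (polar ι u y ^ 2 + Λ * ‖y‖ * |polar ι u y|) := by
  have hV := hu.smallOn h0 hσ0 hσ1 hι
  have hin := inner_apply_normal hι
  rw [graph_eq_image hι _ h0.le] at hM
  have h1 := (hV.mono h13 h42).abs_area_sub_le H.norm_normal hin
  have h2 := hV.integral_energyDensity_le H.norm_normal hin hΛ hM hc hζ h13 h42 hσ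
  rw [area_graph_zero hι (h0.trans_le h13), graph_eq_image hι _ (h0.le.trans h13), mul_assoc]
  refine h1.trans (mul_le_mul_of_nonneg_left (h2.trans ?_) (by positivity))
  refine mul_le_mul_of_nonneg_left ?_ (by positivity)
  have hN : BddContOn (fun y : Eu n => ‖y‖) (eann n r₁ r₂) :=
    (BddContOn.of_continuous_Ioo continuous_id).comp_norm
  refine setIntegral_mono_on
    (hV.bddContOn.sq.add ((hN.mul hV.bddContOn.abs).const_mul Λ)).integrableOn_eann
    (hu.bddContOn_sq_add h0.le hι Λ).integrableOn_eann (isOpen_eann _ _).measurableSet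
    fun y _ => ?_
  have h3 := abs_slopeToSine_le (polar ι u) y
  have h4 := sq_le_sq.2 h3
  rw [mul_assoc Λ]
  gcongr

/-- The first modes of u vanish at the radius s, so those of V are the modes of V - u, which is at
most σ² |V|. Squaring gives σ⁴. -/
theorem firstModes_slopeToSine_le [Nontrivial (Eu n)] (hu : SmallC1Annulus H σ r₁ r₂ u) (h0 : 0 < r₁) (hσ0 : 0 ≤ σ)
    (hσ1 : σ ≤ 1 / 8) (hι : ∀ x, x ∈ H.toSubmodule ↔ ∃ y, ι y = x) {k : NNReal} (hk0 : 0 < k)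
    (hk : sphMeasure H =
      k • Measure.map (fun ω : sphere (0 : Eu n) 1 => ι ω) (volume : Measure (Eu n)).toSphere)
    {s : ℝ} (hs : s ∈ Ioo r₁ r₂) (hZ : JacobiProjEqZero H fun ω => u ω s) :
    firstModes (slopeToSine (polar ι u)) s ≤
      n * sphArea n * σ ^ 4 * slice (fun y => slopeToSine (polar ι u) y ^ 2) s := by
  have hs0 : 0 < s := h0.trans hs.1
  have hV := hu.smallOn h0 hσ0 hσ1 hι
  set U := polar ι u
  set V := slopeToSine U
  have hUc : ContinuousOn (fun ω : Eu n => U (s • ω)) (sphere 0 1) :=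
    continuousOn_comp_smul h0.le (hu.contDiffOn_polar h0.le hι).continuousOn hs
  have hVc : ContinuousOn (fun ω : Eu n => V (s • ω)) (sphere 0 1) :=
    continuousOn_comp_smul h0.le hV.contDiffOn.continuousOn hs
  have key : ∀ i, slice (fun y => V y * (‖y‖⁻¹ * y i)) s ^ 2 ≤
      sphArea n * (σ ^ 4 * slice (fun y => V y ^ 2) s) := by
    intro i
    have h1 := sphInt_mul_coord_eq_zero hk0 hk hι hZ i
    have h2 : sphInt (fun x => U (s • x) * x i) = 0 := by
      rw [← h1]
      exact sphInt_congr fun x hx => by rw [show U (s • x) = _ from polar_smul u hs0 hx]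
    have h3 : sphInt (fun x => V (s • x) * x i) =
        sphInt (fun x => (V (s • x) - U (s • x)) * x i) := by
      rw [sphInt_sub_mul hVc hUc (by fun_prop), h2, sub_zero]
    rw [slice_mul_coord V hs0, h3]
    refine (sphInt_mul_coord_sq_le (hVc.sub hUc) i).trans ?_
    refine mul_le_mul_of_nonneg_left ?_ sphArea_pos.le
    rw [slice, ← sphInt_const_mul]
    refine sphInt_mono ((hVc.sub hUc).pow 2) (continuousOn_const.mul (hVc.pow 2)) fun x hx => ?_
    have h4 := abs_sub_slopeToSine_le U (s • x)
    have h5 : U (s • x) ^ 2 ≤ σ ^ 2 :=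
      sq_le_sq' (_root_.abs_le.1 (hu.abs_polar_le h0.le hι (smul_mem_eann h0.le hs hx))).1
        (_root_.abs_le.1 (hu.abs_polar_le h0.le hι (smul_mem_eann h0.le hs hx))).2
    rw [abs_sub_comm] at h4
    have h6 : |V (s • x) - U (s • x)| ≤ σ ^ 2 * |V (s • x)| :=
      h4.trans (mul_le_mul_of_nonneg_right h5 (abs_nonneg _))
    calc (V (s • x) - U (s • x)) ^ 2 = |V (s • x) - U (s • x)| ^ 2 := (sq_abs _).symm
      _ ≤ (σ ^ 2 * |V (s • x)|) ^ 2 := by gcongr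
      _ = σ ^ 4 * V (s • x) ^ 2 := by rw [mul_pow, sq_abs]; ring
  calc firstModes V s ≤ ∑ _i : Fin n, sphArea n * (σ ^ 4 * slice (fun y => V y ^ 2) s) :=
        Finset.sum_le_sum fun i _ => key i
    _ = _ := by
      rw [Finset.sum_const, Finset.card_univ, Fintype.card_fin, nsmul_eq_mul]
      ring

theorem integral_polar_sq_le [Nontrivial (Eu n)] {K q : ℝ} (hu : SmallC1Annulus H σ r₁ r₂ u) (hn : 2 ≤ n)
    (h0 : 0 < r₁) (hσ0 : 0 ≤ σ) (hσ1 : σ ≤ 1 / 8)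
    (hι : ∀ x, x ∈ H.toSubmodule ↔ ∃ y, ι y = x) {k : NNReal} (hk0 : 0 < k)
    (hk : sphMeasure H =
      k • Measure.map (fun ω : sphere (0 : Eu n) 1 => ι ω) (volume : Measure (Eu n)).toSphere)
    (hΛ : 0 ≤ Λ) (hM : HasMeanCurvatureBoundedBy (graph H u r₁ r₂) (annulus n r₁ r₂) Λ)
    (h13 : r₁ ≤ r₃) (h34 : r₃ < r₄) (h42 : r₄ ≤ r₂) (hq1 : 1 ≤ q) (hq : r₂ ≤ q * r₁)
    (hq' : r₂ ≤ q * (r₄ - r₃)) (hζ : IsCutoff ζ c r₁ r₂ r₃ r₄) (hK0 : 0 ≤ K)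
    (hK : ∀ (O : Set (Eu n)) (v : Eu n → ℝ), IsOpen O → sphere 0 1 ⊆ O →
      ContDiffOn ℝ 1 v O →
      2 * n * (sphInt (fun x => v x ^ 2) - sphInt v ^ 2 / sphArea n) -
          K * ∑ i, sphInt (fun x => v x * x i) ^ 2 ≤
        sphInt (fun x => ‖fderiv ℝ v x‖ ^ 2 - (fderiv ℝ v x x) ^ 2))
    {s : ℝ} (hs : s ∈ Ioo r₁ r₂) (hZ : JacobiProjEqZero H fun ω => u ω s)
    (hσ : 2 * K * n * sphArea n * σ ^ 4 +
      (100 * 2 ^ n + 50) * σ ^ 2 * (8 + 40 * c ^ 2 * q ^ (n + 1)) ≤ 1 / 4) :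
    ∫ y in eann n r₃ r₄, polar ι u y ^ 2 ≤
      4 * ((6 * K * n * sphArea n * q ^ (n + 1) + 8 * c ^ 2 + 3) *
        (∫ y in eann n r₁ r₂, radial (polar ι u) y ^ 2) +
      6 * (1 + 2 ^ n) * Λ * r₂ * σ * (volume (eann n r₁ r₂)).toReal) := by
  have hV := hu.smallOn h0 hσ0 hσ1 hι
  have hZ' := hu.firstModes_slopeToSine_le h0 hσ0 hσ1 hι hk0 hk hs hZ
  rw [graph_eq_image hι _ h0.le] at hM
  have h1 := hV.integral_sq_le hn H.norm_normal (inner_apply_normal hι) hΛ hM h13 h34 h42 hq1 hq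
    hq' hζ hK0 hK hs hZ' hσ
  have hsub : eann n r₃ r₄ ⊆ eann n r₁ r₂ := fun y hy =>
    ⟨h13.trans_lt hy.1, hy.2.trans_le h42⟩
  -- As |u| ≤ 1, u² = (1 + u²) V² ≤ 2 V²; the factor 4 is generous.
  have h2 : ∫ y in eann n r₃ r₄, polar ι u y ^ 2 ≤
      4 * ∫ y in eann n r₃ r₄, slopeToSine (polar ι u) y ^ 2 := by
    rw [← integral_const_mul]
    refine setIntegral_mono_on ((hu.bddContOn_polar h0.le hι).sq.integrableOn_eann.mono_set hsub)
      ((hV.bddContOn.sq.const_mul 4).integrableOn_eann.mono_set hsub)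
      (isOpen_eann _ _).measurableSet fun y hy => ?_
    have h3 := hu.abs_polar_le h0.le hι (hsub hy)
    have h4 : polar ι u y ^ 2 ≤ 1 := by
      rw [sq_le_one_iff_abs_le_one]
      linarith
    rw [slopeToSine, div_pow, Real.sq_sqrt (by positivity), mul_div_assoc',
      le_div_iff₀ (by positivity)]
    nlinarith [sq_nonneg (polar ι u y)]
  have h3 : ∫ y in eann n r₁ r₂, radial (slopeToSine (polar ι u)) y ^ 2 ≤
      ∫ y in eann n r₁ r₂, radial (polar ι u) y ^ 2 :=
    setIntegral_mono_on hV.bddContOn_radial.sq.integrableOn_eann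
      (hu.bddContOn_radial_polar h0.le hι).sq.integrableOn_eann (isOpen_eann _ _).measurableSet
      fun y hy => sq_le_sq.2 (norm_fderiv_slopeToSine_le
        (((hu.contDiffOn_polar h0.le hι).differentiableOn one_ne_zero).differentiableAt
          ((isOpen_eann _ _).mem_nhds hy))).2
  have hq0 : 0 ≤ q := zero_le_one.trans hq1
  have hA : 0 ≤ 6 * K * n * sphArea n * q ^ (n + 1) + 8 * c ^ 2 + 3 := by
    have := sphArea_pos (n := n)
    positivity
  have h4 := mul_le_mul_of_nonneg_left h3 hA
  linarith

end SmallC1Annulus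

theorem exists_smallness_constant {M : ℝ} (hM : 0 ≤ M) : ∃ σ₀ : ℝ, 0 < σ₀ ∧ σ₀ ≤ 1 / 8 ∧
    ∀ σ, 0 ≤ σ → σ ≤ σ₀ → M * σ ^ 2 ≤ 1 / 8 := by
  refine ⟨min (1 / 8) (1 / (8 * (M + 1))), by positivity, min_le_left _ _, fun σ h0 hσ => ?_⟩
  have h1 : σ ≤ 1 / 8 := hσ.trans (min_le_left _ _)
  have h2 : σ ≤ 1 / (8 * (M + 1)) := hσ.trans (min_le_right _ _)
  rw [le_div_iff₀ (by positivity)] at h2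
  have h3 : σ ^ 2 ≤ σ := by nlinarith
  nlinarith [mul_le_mul_of_nonneg_left h3 hM]

/-- The positivity of r₁ together with r₁ < r₂ forces r₀ > 0 and η₀ < 1, so neither has to be
assumed for related intervals. -/
theorem scale_pos_of_lt {η₀ r₀ : ℝ} (hη₀ : 0 < η₀) (h0 : 0 < r₀ * (1 - η₀))
    (h12 : r₀ * (1 - η₀) < r₀ * (1 + η₀)) : 0 < r₀ ∧ η₀ < 1 := by
  have h1 : 0 < r₀ := by
    have : 0 < r₀ * η₀ := by linarith
    exact pos_of_mul_pos_left this hη₀.le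
  exact ⟨h1, by linarith [pos_of_mul_pos_right h0 h1.le]⟩

/-- The ratio that controls `r₂ / r₁` and `r₂ / (r₄ - r₃)` for related intervals. -/
noncomputable def relatedRatio (η η₀ : ℝ) : ℝ :=
  1 + |(1 + η₀) / (1 - η₀)| + (1 + η₀) / (2 * η)

end Estimates

end SphericalGraph

/-! ### The theorem: choice of constants and conclusion -/

theorem mainTheorem8 (n : ℕ) (hn : 2 ≤ n) :
    ∃ C : ℝ, 0 < C ∧ ∀ η η₀ : ℝ, 0 < η → η < η₀ →
      ∃ σ₀ C₀ : ℝ, 0 < σ₀ ∧ 0 < C₀ ∧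
        ∀ (H : SphericalGraph.OrientedHyperplane n) (Λ σ r₁ r₂ r₃ r₄ : ℝ)
          (u : EuclideanSpace ℝ (Fin (n + 1)) → ℝ → ℝ),
          0 ≤ Λ → 0 < σ → 0 < r₁ → r₁ < r₂ →
          SphericalGraph.SmallC1Annulus H σ r₁ r₂ u →
          max 1 (Λ * r₂) * σ ≤ σ₀ →
          SphericalGraph.HasMeanCurvatureBoundedBy (SphericalGraph.graph H u r₁ r₂)
            (SphericalGraph.annulus n r₁ r₂) Λ →
          SphericalGraph.Related η η₀ r₁ r₂ r₃ r₄ →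
          |SphericalGraph.area (SphericalGraph.graph H u r₃ r₄)
              - SphericalGraph.area (SphericalGraph.graph H (fun _ _ => 0) r₃ r₄)|
            ≤ C₀ * SphericalGraph.annulusIntegral H r₁ r₂
                (fun ω r => r ^ (n - 1) * (u ω r ^ 2 + Λ * r * |u ω r|)) ∧
          ((∃ r ∈ Set.Ioo r₁ r₂, SphericalGraph.JacobiProjEqZero H (fun ω => u ω r)) →
            SphericalGraph.annulusIntegral H r₃ r₄ (fun ω r => r ^ (n - 1) * u ω r ^ 2)
              ≤ C * Λ * r₂ * (r₂ ^ n - r₁ ^ n)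
                + C₀ * SphericalGraph.annulusIntegral H r₁ r₂
                    (fun ω r => r ^ (n - 1)
                      * (r * SphericalGraph.radialDeriv u ω r) ^ 2)) := by
  have hne : Nonempty (Fin n) := ⟨⟨0, by omega⟩⟩
  have hnt : Nontrivial (SphericalGraph.Eu n) := inferInstance
  obtain ⟨K, hK0, hK⟩ := SphericalGraph.exists_spectral_gap n
  obtain ⟨k, hk0, hk⟩ := SphericalGraph.exists_sphMeasure_eq (n := n)
  have hS : 0 < SphericalGraph.sphArea n := SphericalGraph.sphArea_pos
  set S := SphericalGraph.sphArea n
  have hk0' : (0 : ℝ) < k := hk0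
  have hn0 : (0 : ℝ) < n := by exact_mod_cast (by omega : 0 < n)
  -- The constant of the curvature term in `integral_polar_sq_le`, times the volume factor S / n of
  -- the annulus and the factor k between the two sphere measures. No cutoff enters, so it depends
  -- on n only.
  refine ⟨k * (4 * (6 * (1 + 2 ^ n)) * (S / n)), by positivity, fun η η₀ hη hη₀ => ?_⟩
  have hη₀' : 0 < η₀ := hη.trans hη₀
  obtain ⟨c, hc, hζ⟩ := SphericalGraph.exists_isCutoff hη hη₀
  -- This ratio is fixed before η₀ < 1 is known; the absolute value in its definition keeps it at
  -- least 1 in every case.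
  set q := SphericalGraph.relatedRatio η η₀ with hqdef
  have hq1 : 1 ≤ q := by
    have : 0 ≤ (1 + η₀) / (2 * η) := by positivity
    rw [hqdef, SphericalGraph.relatedRatio]
    linarith [abs_nonneg ((1 + η₀) / (1 - η₀))]
  have hq0 : 0 ≤ q := zero_le_one.trans hq1
  -- The bracket collects all smallness conditions: the term with σ⁴ is bounded through σ⁴ ≤ σ², and
  -- the condition of the Caccioppoli inequality is contained in the second summand, whose last
  -- factor is at least 1.
  obtain ⟨σ₀, hσ₀, hσ₀1, hσ₀M⟩ := SphericalGraph.exists_smallness_constant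
    (M := 2 * K * n * S + (100 * 2 ^ n + 50) * (8 + 40 * c ^ 2 * q ^ (n + 1))) (by positivity)
  set A := 6 * K * n * S * q ^ (n + 1) + 8 * c ^ 2 + 3
  set B : ℝ := 10 * 2 ^ n * (20 * c ^ 2 + 4 * (1 + 2 ^ n))
  have hA : 0 < A := by positivity
  have hB : 0 < B := by positivity
  -- One constant for both estimates. In the first, the area carries no factor k while the integral
  -- does, hence the division; in the second, k occurs on both sides.
  refine ⟨σ₀, B / k + 4 * A, hσ₀, by positivity, ?_⟩
  intro H Λ σ r₁ r₂ r₃ r₄ u hΛ hσ0 h0 h12 hu hσ hM hrel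
  have hσσ : σ ≤ σ₀ := by
    refine le_trans ?_ hσ
    exact le_mul_of_one_le_left hσ0.le (le_max_left _ _)
  have hσ1 : σ ≤ 1 / 8 := hσσ.trans hσ₀1
  have hMσ := hσ₀M σ hσ0.le hσσ
  obtain ⟨r₀, rfl, rfl, rfl, rfl⟩ := hrel
  obtain ⟨hr₀, hη₁⟩ := SphericalGraph.scale_pos_of_lt hη₀' h0 h12
  have h13 : r₀ * (1 - η₀) ≤ r₀ * (1 - η) := by gcongr
  have h34 : r₀ * (1 - η) < r₀ * (1 + η) := by gcongr; linarith
  have h42 : r₀ * (1 + η) ≤ r₀ * (1 + η₀) := by gcongr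
  obtain ⟨ζ, hζ⟩ := hζ r₀ hr₀
  obtain ⟨ι, hι⟩ := SphericalGraph.exists_linearIsometry H
  have hk := hk H ι hι
  have hD := (SphericalGraph.isOpen_eann (n := n) (r₀ * (1 - η₀)) (r₀ * (1 + η₀))).measurableSet
  have hUb := hu.bddContOn_polar h0.le hι
  have hRb := (hu.bddContOn_radial_polar h0.le hι).sq
  have hI := SphericalGraph.annulusIntegral_eq hk h0.le (hu.bddContOn_sq_add h0.le hι Λ)
    (f := fun ω r => u ω r ^ 2 + Λ * r * |u ω r|) fun ω hω r hr => by
      have hr0 := h0.trans hr.1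
      rw [SphericalGraph.polar_smul u hr0 hω, SphericalGraph.norm_smul_sphere hr0.le hω]
  have hR := SphericalGraph.annulusIntegral_eq hk h0.le hRb
    (f := fun ω r => (r * SphericalGraph.radialDeriv u ω r) ^ 2) fun ω hω r hr => by
      rw [hu.fderiv_polar_self h0.le hι hω hr]
  have hU2 : SphericalGraph.BddContOn (fun y => SphericalGraph.polar ι u y ^ 2)
      (SphericalGraph.eann n (r₀ * (1 - η)) (r₀ * (1 + η))) := by
    obtain ⟨h1, C, h2⟩ := hUb.sq
    have hsub : SphericalGraph.eann n (r₀ * (1 - η)) (r₀ * (1 + η)) ⊆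
        SphericalGraph.eann n (r₀ * (1 - η₀)) (r₀ * (1 + η₀)) := fun y hy =>
      ⟨h13.trans_lt hy.1, hy.2.trans_le h42⟩
    exact ⟨h1.mono hsub, C, fun y hy => h2 y (hsub hy)⟩
  have hL := SphericalGraph.annulusIntegral_eq hk (h0.le.trans h13) hU2
    (f := fun ω r => u ω r ^ 2) fun ω hω r hr => by
      rw [SphericalGraph.polar_smul u ((h0.trans_le h13).trans hr.1) hω]
  have hP : (0 : ℝ) ≤ (100 * 2 ^ n + 50) * σ ^ 2 := by positivity
  have hQ : (0 : ℝ) ≤ 40 * c ^ 2 * q ^ (n + 1) := by positivity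
  have hKS : 0 ≤ 2 * K * n * S := by positivity
  refine ⟨?_, ?_⟩
  · rw [hI]
    have h1 := hu.abs_area_graph_sub_le h0 hσ0.le hσ1 hι hΛ hM hc hζ h13 h42 (by
      nlinarith [mul_nonneg hP hQ, mul_nonneg hKS (sq_nonneg σ)])
    refine h1.trans ?_
    have hJ : 0 ≤ ∫ y in SphericalGraph.eann n (r₀ * (1 - η₀)) (r₀ * (1 + η₀)),
        (SphericalGraph.polar ι u y ^ 2 + Λ * ‖y‖ * |SphericalGraph.polar ι u y|) :=
      MeasureTheory.setIntegral_nonneg hD fun y _ => by positivity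
    rw [← mul_assoc]
    refine mul_le_mul_of_nonneg_right ?_ hJ
    rw [add_mul, div_mul_cancel₀ _ hk0'.ne']
    exact le_add_of_nonneg_right (by positivity)
  · rintro ⟨s, hs, hZ⟩
    rw [hL, hR]
    have h1 := hu.integral_polar_sq_le hn h0 hσ0.le hσ1 hι hk0 hk hΛ hM h13 h34 h42 hq1 ?_ ?_ hζ
      hK0.le hK hs hZ ?_
    · rw [SphericalGraph.volume_eann_eq (by omega) h0.le h12.le] at h1
      have hJ : 0 ≤ ∫ y in SphericalGraph.eann n (r₀ * (1 - η₀)) (r₀ * (1 + η₀)),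
          SphericalGraph.radial (SphericalGraph.polar ι u) y ^ 2 :=
        MeasureTheory.setIntegral_nonneg hD fun y _ => by positivity
      set J := ∫ y in SphericalGraph.eann n (r₀ * (1 - η₀)) (r₀ * (1 + η₀)),
          SphericalGraph.radial (SphericalGraph.polar ι u) y ^ 2
      set d := (r₀ * (1 + η₀)) ^ n - (r₀ * (1 - η₀)) ^ n
      have hd : 0 ≤ d := sub_nonneg.2 (pow_le_pow_left₀ h0.le h12.le n)
      set r₂ := r₀ * (1 + η₀)
      have hr₂ : 0 ≤ r₂ := h0.le.trans h12.le
      -- The factor σ is bounded by 1, which leaves a constant independent of η and η₀.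
      have h2 : 6 * (1 + 2 ^ n) * Λ * r₂ * σ * (S / n * d) ≤
          6 * (1 + 2 ^ n) * Λ * r₂ * 1 * (S / n * d) := by
        gcongr
        linarith
      calc _ ≤ k * (4 * (A * J + 6 * (1 + 2 ^ n) * Λ * r₂ * σ * (S / n * d))) :=
            mul_le_mul_of_nonneg_left h1 hk0'.le
        _ ≤ k * (4 * (A * J + 6 * (1 + 2 ^ n) * Λ * r₂ * 1 * (S / n * d))) := by gcongr
        _ = k * (4 * (6 * (1 + 2 ^ n)) * (S / n)) * Λ * r₂ * d + 4 * A * (k * J) := by ring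
        _ ≤ _ := by
          gcongr
          exact le_add_of_nonneg_left (by positivity)
    · have h2 : (1 + η₀) / (1 - η₀) ≤ q := by
        have : 0 ≤ (1 + η₀) / (2 * η) := by positivity
        rw [hqdef, SphericalGraph.relatedRatio]
        linarith [le_abs_self ((1 + η₀) / (1 - η₀))]
      rw [div_le_iff₀ (by linarith)] at h2
      nlinarith [mul_le_mul_of_nonneg_left h2 hr₀.le]
    · have h2 : (1 + η₀) / (2 * η) ≤ q := by
        rw [hqdef, SphericalGraph.relatedRatio]
        linarith [abs_nonneg ((1 + η₀) / (1 - η₀))]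
      rw [div_le_iff₀ (by linarith)] at h2
      nlinarith [mul_le_mul_of_nonneg_left h2 hr₀.le]
    · have h3 : σ ^ 4 ≤ σ ^ 2 := pow_le_pow_of_le_one hσ0.le (by linarith) (by norm_num)
      have h4 := mul_le_mul_of_nonneg_left h3 hKS
      have h5 : 2 * K * n * S * σ ^ 2 +
          (100 * 2 ^ n + 50) * σ ^ 2 * (8 + 40 * c ^ 2 * q ^ (n + 1)) ≤ 1 / 8 := by
        linarith
      linarith
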